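/- Let $X$ be a Dedekind scheme, that is, a scheme with a finite affine open cover by spectra of Dedekind domains. Let $G$ be a flat affine group scheme of finite type over $X$. A tensorial construction $t$ is a finite iteration of the operations $\otimes$, $\bigwedge^i$, $\mathrm{Sym}^j$, $\oplus$ and $(\cdot)^*$. Suppose given a tensorial construction $t$, a vector bundle $V$ of finite rank on $X$, a locally split line bundle $L\subset t(V)$ (i.e. $L$ is Zariski locally a direct summand), and an identification $G=\underline{\mathrm{Aut}}(V,L)$ of group functors on $X$-schemes, where $\underline{\mathrm{Aut}}(V,L)(T)$ is the group of automorphisms $f$ of $V_T$ such that the induced automorphism of $t(V_T)=t(V)_T$ maps $L_T$ onto $L_T$. For an $X$-scheme $Y$, a $G_Y$-torsor is a faithfully flat affine $Y$-scheme $P$ with a right $G$-action such that $P\to Y$ is $G$-invariant and $P\times_X G\to P\times_Y P$, $(p,g)\mapsto(p,pg)$, is an isomorphism; morphisms are the $G$-equivariant maps of $Y$-schemes. A $G_Y$-twist of $(V,L)$ is a pair $(\mathscr E,\mathscr L)$ consisting of a vector bundle $\mathscr E$ of finite rank on $Y$ and a locally split line bundle $\mathscr L\subset t(\mathscr E)$,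 for which there are an fppf cover $Y'\to Y$ and an isomorphism $\mathscr E_{Y'}\cong V_{Y'}$ whose induced isomorphism $t(\mathscr E)_{Y'}\cong t(V)_{Y'}$ maps $\mathscr L_{Y'}$ onto $L_{Y'}$; morphisms are the isomorphisms $\mathscr E\cong\mathscr E'$ whose induced isomorphism $t(\mathscr E)\cong t(\mathscr E')$ maps $\mathscr L$ onto $\mathscr L'$. Then for every $X$-scheme $Y$ the groupoid of $G_Y$-torsors is equivalent to the groupoid of $G_Y$-twists of $(V,L)$, and these equivalences are functorial in $Y$: they are the restrictions to the fibers over $Y$ of one functor over the category of $X$-schemes, from the category of pairs ($X$-scheme $Y$, $G_Y$-torsor) to the category of pairs ($X$-scheme $Y$, $G_Y$-twist of $(V,L)$). In both categories the morphisms over $h:Y\to Y'$ are the identifications with a pullback: $G$-equivariant maps $P\to P'$ over $h$ (equivalently, isomorphisms $P\cong h^*P'$ of $G_Y$-torsors), respectively isomorphisms $(\mathscr E,\mathscr L)\cong(h^*\mathscr E',h^*\mathscr L')$. -/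

import Mathlib

open CategoryTheory AlgebraicGeometry
universe u

noncomputable section

/-- A tensorial construction: a finite iteration of the operations `⊗`, `⋀ⁱ`, `Symʲ`, `⊕` and
`(·)^*`, applied to one variable. -/
inductive TensorialConstruction where
  /-- the variable itself -/
  | id : TensorialConstruction
  | tensor (a b : TensorialConstruction) : TensorialConstruction
  | exterior (i : ℕ) (a : TensorialConstruction) : TensorialConstruction
  | sym (j : ℕ) (a : TensorialConstruction) : TensorialConstruction
  | sum (a b : TensorialConstruction) : TensorialConstruction
  | dual (a : TensorialConstruction) : TensorialConstruction

namespace TensorialConstruction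

open scoped TensorProduct

/-- The value `t(M)` of a tensorial construction on a module `M` over a commutative ring `R`. -/
def obj : TensorialConstruction → ∀ {R : Type u} [CommRing R], ModuleCat.{u} R → ModuleCat.{u} R
  | id, _, _, M => M
  | tensor a b, R, _, M => ModuleCat.of R (a.obj M ⊗[R] b.obj M)
  | exterior i a, R, _, M => ModuleCat.of R (⋀[R]^i (a.obj M))
  | sym j a, R, _, M => ModuleCat.of R (SymmetricPower R (ULift.{u} (Fin j)) (a.obj M))
  | sum a b, R, _, M => ModuleCat.of R (a.obj M × b.obj M)
  | dual a, R, _, M => ModuleCat.of R (Module.Dual R (a.obj M))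

variable {R S : Type u} [CommRing R] [CommRing S] {σ : R →+* S}
  {M N : Type u} [AddCommGroup M] [AddCommGroup N] [Module R M] [Module S N]

/-- The map `⋀ⁱ M → ⋀ⁱ N` induced by a map `M → N` which is semilinear along `R → S`. -/
def exteriorMap (i : ℕ) (f : M →ₛₗ[σ] N) : ⋀[R]^i M →ₛₗ[σ] ⋀[S]^i N :=
  letI : Module R (⋀[S]^i N) := Module.compHom _ σ
  let alt : M [⋀^Fin i]→ₗ[R] ⋀[S]^i N :=
    { toFun := fun v => exteriorPower.ιMulti S i (fun k => f (v k))
      map_update_add' := by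
        intro _ m k x y
        have h (z : M) : (fun l => f (Function.update m k z l)) =
            Function.update (fun l => f (m l)) k (f z) := by
          ext l; rcases eq_or_ne l k with rfl | hl <;> simp [*]
        simp [h]
      map_update_smul' := by
        intro _ m k c x
        have h (z : M) : (fun l => f (Function.update m k z l)) =
            Function.update (fun l => f (m l)) k (f z) := by
          ext l; rcases eq_or_ne l k with rfl | hl <;> simp [*]
        simp only [h, map_smulₛₗ, AlternatingMap.map_update_smul]
        rfl
      map_eq_zero_of_eq' := by
        intro v k l hv hkl
        exact AlternatingMap.map_eq_zero_of_eq _ _ (by simp [hv]) hkl }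
  let g := exteriorPower.alternatingMapLinearEquiv alt
  { toFun := g, map_add' := g.map_add, map_smul' := g.map_smul }

theorem exteriorMap_ιMulti (i : ℕ) (f : M →ₛₗ[σ] N) (v : Fin i → M) :
    exteriorMap i f (exteriorPower.ιMulti R i v) = exteriorPower.ιMulti S i (f ∘ v) := by
  let _ : Module R (⋀[S]^i N) := Module.compHom _ σ
  exact exteriorPower.alternatingMapLinearEquiv_apply_ιMulti _ _

/-- Auxiliary: the symmetric multilinear map `(m₁, …, mⱼ) ↦ f m₁ ⋯ f mⱼ`, over `R`. -/
def symMultilinear (j : ℕ) (f : M →ₛₗ[σ] N) :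
    letI : Module R (SymmetricPower S (ULift.{u} (Fin j)) N) := Module.compHom _ σ
    MultilinearMap R (fun _ : ULift.{u} (Fin j) => M) (SymmetricPower S (ULift.{u} (Fin j)) N) :=
  letI : Module R (SymmetricPower S (ULift.{u} (Fin j)) N) := Module.compHom _ σ
  { toFun := fun v => SymmetricPower.tprod S (fun k => f (v k))
    map_update_add' := by
      intro _ m k x y
      have h (z : M) : (fun l => f (Function.update m k z l)) =
          Function.update (fun l => f (m l)) k (f z) := by
        ext l; rcases eq_or_ne l k with rfl | hl <;> simp [*]
      simp [h]
    map_update_smul' := by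
      intro _ m k c x
      have h (z : M) : (fun l => f (Function.update m k z l)) =
          Function.update (fun l => f (m l)) k (f z) := by
        ext l; rcases eq_or_ne l k with rfl | hl <;> simp [*]
      simp only [h, map_smulₛₗ, MultilinearMap.map_update_smul]
      rfl }

/-- The map `Symʲ M → Symʲ N` induced by a map `M → N` which is semilinear along `R → S`. -/
def symMap (j : ℕ) (f : M →ₛₗ[σ] N) :
    SymmetricPower R (ULift.{u} (Fin j)) M →ₛₗ[σ] SymmetricPower S (ULift.{u} (Fin j)) N :=
  letI : Module R (SymmetricPower S (ULift.{u} (Fin j)) N) := Module.compHom _ σ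
  { toFun := AddCon.lift _ (PiTensorProduct.lift (symMultilinear j f)).toAddMonoidHom (by
      intro x y h
      induction h with
      | of x y h =>
        cases h with
        | perm e v =>
          have := SymmetricPower.tprod_equiv (R := S) e (fun k => f (v k))
          simpa [AddCon.ker_rel, symMultilinear] using this.symm
      | refl => exact AddCon.refl _ _
      | symm _ ih => exact AddCon.symm _ ih
      | trans _ _ ih ih' => exact AddCon.trans _ ih ih'
      | add _ _ ih ih' => exact AddCon.add _ ih ih')
    map_add' := map_add _
    map_smul' := fun r x => AddCon.induction_on x fun x =>
      (PiTensorProduct.lift (symMultilinear j f)).map_smul r x }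

theorem symMap_tprod (j : ℕ) (f : M →ₛₗ[σ] N) (v : ULift.{u} (Fin j) → M) :
    (symMap j f) (SymmetricPower.tprod R (ι := ULift.{u} (Fin j)) (M := M) v) =
      SymmetricPower.tprod S (ι := ULift.{u} (Fin j)) (M := N) (fun k => f (v k)) := by
  let _ : Module R (SymmetricPower S (ULift.{u} (Fin j)) N) := Module.compHom _ σ
  exact PiTensorProduct.lift.tprod (φ := symMultilinear j f) v

/-- The map `M₁ ⊕ M₂ → N₁ ⊕ N₂` induced by two semilinear maps. -/
def sumMap {M₁ M₂ N₁ N₂ : Type u} [AddCommGroup M₁] [AddCommGroup N₁] [Module R M₁] [Module S N₁]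
  [AddCommGroup M₂] [AddCommGroup N₂] [Module R M₂] [Module S N₂]
   (f : M₁ →ₛₗ[σ] N₁) (g : M₂ →ₛₗ[σ] N₂) : M₁ × M₂ →ₛₗ[σ] N₁ × N₂ where
  toFun x := (f x.1, g x.2)
  map_add' := by simp
  map_smul' := by simp

open Classical in
/-- The map `M^* → N^*` induced by a map `f : M → N` which is semilinear along `σ : R → S`: a linear
form `φ` on `M` goes to the unique linear form `ψ` on `N` with `ψ ∘ f = σ ∘ φ`. Such a `ψ` exists and
is unique whenever `f` exhibits `N` as `S ⊗[R] M`, in particular when `R = S` and `f` is an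
isomorphism (then `ψ = φ ∘ f⁻¹`), and these are the only cases in which the map is used. (If some
`φ` has no unique extension, the value is the placeholder `0`.) -/
def dualMap (f : M →ₛₗ[σ] N) : Module.Dual R M →ₛₗ[σ] Module.Dual S N :=
  if h : ∀ φ : Module.Dual R M, ∃! ψ : Module.Dual S N, ∀ x, ψ (f x) = σ (φ x) then
    { toFun := fun φ => (h φ).choose
      map_add' := fun φ φ' => ((h (φ + φ')).choose_spec.2 _ (by
        intro x; simp [(h φ).choose_spec.1 x, (h φ').choose_spec.1 x])).symm
      map_smul' := fun r φ => ((h (r • φ)).choose_spec.2 _ (by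
        intro x; simp [(h φ).choose_spec.1 x])).symm }
  else 0

theorem dualMap_apply (f : M →ₛₗ[σ] N)
    (h : ∀ φ : Module.Dual R M, ∃! ψ : Module.Dual S N, ∀ x, ψ (f x) = σ (φ x))
    (φ : Module.Dual R M) (x : M) : dualMap f φ (f x) = σ (φ x) := by
  rw [dualMap, dif_pos h]; exact (h φ).choose_spec.1 x

/-- The map `t(M) → t(N)` induced by a map `f : M → N` which is semilinear along `R → S`. It is
used when `M` is finite projective and `f` exhibits `N` as the base change `S ⊗[R] M` (and then
`t(M) → t(N)` is the canonical map exhibiting `t(N)` as `S ⊗[R] t(M)`), and when `R = S` and `f` is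
an isomorphism (and then it is the isomorphism `t(f)`). -/
def map : ∀ (t : TensorialConstruction) {R S : Type u} [CommRing R] [CommRing S] {σ : R →+* S}
    {M : ModuleCat.{u} R} {N : ModuleCat.{u} S} (_ : M →ₛₗ[σ] N), t.obj M →ₛₗ[σ] t.obj N
  | id, _, _, _, _, _, _, _, f => f
  | tensor a b, _, _, _, _, _, _, _, f => TensorProduct.map (a.map f) (b.map f)
  | exterior i a, _, _, _, _, _, _, _, f => exteriorMap i (a.map f)
  | sym j a, _, _, _, _, _, _, _, f => symMap j (a.map f)
  | sum a b, _, _, _, _, _, _, _, f => sumMap (a.map f) (b.map f)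
  | dual a, _, _, _, _, _, _, _, f => dualMap (a.map f)

theorem dualMap_of_bijective {M N : Type u} [AddCommGroup M] [AddCommGroup N] [Module R M]
    [Module R N] (f : M →ₗ[R] N) (hf : Function.Bijective f) (φ : Module.Dual R M) :
    dualMap f φ = φ ∘ₗ (LinearEquiv.ofBijective f hf).symm.toLinearMap := by
  have key : ∀ (φ : Module.Dual R M) (ψ : Module.Dual R N), (∀ x, ψ (f x) = φ x) →
      ψ = φ ∘ₗ (LinearEquiv.ofBijective f hf).symm.toLinearMap := by
    intro φ ψ h
    ext y
    obtain ⟨x, rfl⟩ := hf.2 y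
    have hx : (LinearEquiv.ofBijective f hf).symm (f x) = x :=
      (LinearEquiv.ofBijective f hf).symm_apply_apply x
    simp [h, hx]
  refine key φ _ fun x => dualMap_apply f (fun φ => ⟨φ ∘ₗ
    (LinearEquiv.ofBijective f hf).symm.toLinearMap, fun x => ?_, key φ⟩) φ x
  exact congrArg φ ((LinearEquiv.ofBijective f hf).symm_apply_apply x)

/-- `t` is a functor on the groupoid of `R`-modules and isomorphisms. -/
theorem map_functorial (t : TensorialConstruction) :
    (∀ {M : ModuleCat.{u} R}, t.map (LinearMap.id : M →ₗ[R] M) = LinearMap.id) ∧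
    (∀ {M N P : ModuleCat.{u} R} (e : M ≃ₗ[R] N) (e' : N ≃ₗ[R] P),
      t.map (e'.toLinearMap ∘ₗ e.toLinearMap) = t.map e'.toLinearMap ∘ₗ t.map e.toLinearMap) := by
  induction t with
  | id => exact ⟨rfl, fun _ _ => rfl⟩
  | tensor a b ha hb =>
    refine ⟨fun {M} => ?_, fun e e' => ?_⟩
    · change TensorProduct.map (a.map _) (b.map _) = _
      rw [ha.1, hb.1]; exact TensorProduct.map_id
    · change TensorProduct.map (a.map _) (b.map _) = TensorProduct.map _ _ ∘ₗ TensorProduct.map _ _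
      rw [ha.2, hb.2]; exact TensorProduct.map_comp _ _ _ _
  | exterior i a ha =>
    refine ⟨fun {M} => ?_, fun e e' => ?_⟩
    · change exteriorMap i (a.map _) = _
      rw [ha.1]
      refine exteriorPower.linearMap_ext ?_
      ext v
      exact congrArg _ (exteriorMap_ιMulti i _ v)
    · change exteriorMap i (a.map _) = exteriorMap i (a.map _) ∘ₗ exteriorMap i (a.map _)
      rw [ha.2]
      refine exteriorPower.linearMap_ext ?_
      ext v
      refine congrArg _ ?_
      refine (exteriorMap_ιMulti i _ v).trans ?_
      refine Eq.trans ?_ (congrArg (exteriorMap i _) (exteriorMap_ιMulti i _ v)).symm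
      exact (exteriorMap_ιMulti i (a.map e'.toLinearMap) (a.map e.toLinearMap ∘ v)).symm
  | sym j a ha =>
    have ext' {P : Type u} [AddCommGroup P] [Module R P] {M : ModuleCat.{u} R}
        (f g : SymmetricPower R (ULift.{u} (Fin j)) (a.obj M) →ₗ[R] P)
        (h : ∀ v, f (SymmetricPower.tprod R (ι := ULift.{u} (Fin j)) (M := a.obj M) v) =
          g (SymmetricPower.tprod R (ι := ULift.{u} (Fin j)) (M := a.obj M) v)) :
        f = g := by
      refine LinearMap.ext_on_range (SymmetricPower.span_tprod_eq_top R _ _) h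
    refine ⟨fun {M} => ?_, fun e e' => ?_⟩
    · change symMap j (a.map _) = _
      rw [ha.1]
      refine ext' _ _ fun v => symMap_tprod j _ v
    · change symMap j (a.map _) = symMap j (a.map _) ∘ₗ symMap j (a.map _)
      rw [ha.2]
      refine ext' _ _ fun v => ?_
      refine (symMap_tprod j _ v).trans ?_
      refine Eq.trans ?_ (congrArg (symMap j _) (symMap_tprod j _ v)).symm
      exact (symMap_tprod j (a.map e'.toLinearMap) (fun k => a.map e.toLinearMap (v k))).symm
  | sum a b ha hb =>
    refine ⟨fun {M} => ?_, fun e e' => ?_⟩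
    · change sumMap (a.map _) (b.map _) = _
      rw [ha.1, hb.1]; rfl
    · change sumMap (a.map _) (b.map _) = sumMap _ _ ∘ₗ sumMap _ _
      rw [ha.2, hb.2]; rfl
  | dual a ha =>
    have bij {M N : ModuleCat.{u} R} (e : M ≃ₗ[R] N) : Function.Bijective (a.map e.toLinearMap) := by
      have h₁ := ha.2 e e.symm
      have h₂ := ha.2 e.symm e
      simp only [LinearEquiv.symm_comp, LinearEquiv.comp_symm] at h₁ h₂
      rw [ha.1] at h₁ h₂
      exact ⟨Function.LeftInverse.injective fun x => (LinearMap.congr_fun h₁ x).symm,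
        Function.RightInverse.surjective fun x => (LinearMap.congr_fun h₂ x).symm⟩
    refine ⟨fun {M} => ?_, fun {M N P} e e' => ?_⟩
    · change dualMap (a.map _) = _
      rw [ha.1]
      refine LinearMap.ext fun φ => ?_
      rw [dualMap_of_bijective _ Function.bijective_id]
      ext x
      exact congrArg φ ((LinearEquiv.ofBijective LinearMap.id Function.bijective_id).symm_apply_apply x)
    · change dualMap (a.map _) = dualMap (a.map _) ∘ₗ dualMap (a.map _)
      have hc := ha.2 e e'
      rw [hc]
      refine LinearMap.ext fun φ => ?_
      rw [LinearMap.comp_apply, dualMap_of_bijective _ (bij e), dualMap_of_bijective _ (bij e'),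
        dualMap_of_bijective _ (by rw [← hc]; exact bij (e.trans e'))]
      ext y
      obtain ⟨y, rfl⟩ := (bij e').2 y
      obtain ⟨y, rfl⟩ := (bij e).2 y
      have h3 := (LinearEquiv.ofBijective _ (bij e')).symm_apply_apply
      have h2 := (LinearEquiv.ofBijective _ (bij e)).symm_apply_apply
      have h1 := (LinearEquiv.ofBijective (a.map e'.toLinearMap ∘ₗ a.map e.toLinearMap)
        (by rw [← hc]; exact bij (e.trans e'))).symm_apply_apply y
      simp only [LinearEquiv.ofBijective_apply, LinearMap.comp_apply] at h1 h2 h3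
      simp [h1, h2, h3]

end TensorialConstruction

namespace AlgebraicGeometry.Scheme.Modules
variable {Y Z T : Scheme.{u}}

/-- For a point `x : Spec R ⟶ Y`, the functor `M ↦ Γ(Spec R, x^* M)` from `𝒪_Y`-modules to
`R`-modules. On a vector bundle `V` it is the functor of points `R ↦ V ⊗ R`. -/
def sectionsAt {R : CommRingCat.{u}} (x : Spec R ⟶ Y) : Y.Modules ⥤ ModuleCat.{u} R :=
  pullback x ⋙ moduleSpecΓFunctor (R := R)

/-- The canonical isomorphism `Γ(Spec R, x^* g^* M) ≅ Γ(Spec R, (g ∘ x)^* M)`. -/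
def sectionsPullback {R : CommRingCat.{u}} (x : Spec R ⟶ Y) (g : Y ⟶ Z) (M : Z.Modules) :
    (sectionsAt x).obj ((pullback g).obj M) ≅ (sectionsAt (x ≫ g)).obj M :=
  (moduleSpecΓFunctor (R := R)).mapIso ((pullbackComp x g).app M)

/-- The canonical map `Γ(Spec R, x^* M) → Γ(Spec S, (x ∘ Spec σ)^* M)`, semilinear along
`σ : R → S`, for `x : Spec R ⟶ Y`. -/
def sectionsBaseChange {R S : CommRingCat.{u}} (x : Spec R ⟶ Y) (σ : R ⟶ S) (M : Y.Modules) :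
    (sectionsAt x).obj M →ₛₗ[σ.hom] (sectionsAt (Spec.map σ ≫ x)).obj M :=
  let N := (pullback x).obj M
  let u : N ⟶ (pushforward (Spec.map σ)).obj ((pullback (Spec.map σ)).obj N) :=
    (pullbackPushforwardAdjunction (Spec.map σ)).unit.app N
  let c : (sectionsAt (Spec.map σ)).obj N →ₗ[S] (sectionsAt (Spec.map σ ≫ x)).obj M :=
    (sectionsPullback (Spec.map σ) x M).hom.hom
  let v : (sectionsAt x).obj M →ₛₗ[σ.hom] (sectionsAt (Spec.map σ)).obj N :=
    { toFun := fun s => u.app ⊤ s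
      map_add' := fun s s' => map_add (u.app ⊤).hom s s'
      map_smul' := by
        intro r s
        have h : (Spec.map σ).app ⊤ ((Scheme.ΓSpecIso R).inv r) = (Scheme.ΓSpecIso S).inv (σ r) :=
          (congr($(Scheme.ΓSpecIso_inv_naturality σ) r)).symm
        have hR : ∀ (P : (Spec R).Modules) (a : Γ(P, ⊤)),
            r • a = (Scheme.ΓSpecIso R).inv r • a := by
          intro P a; rw [smul_Spec_def]; congr 1
        have hS : ∀ (P : (Spec S).Modules) (a : Γ(P, ⊤)),
            σ r • a = (Scheme.ΓSpecIso S).inv (σ r) • a := by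
          intro P a; rw [smul_Spec_def]; congr 1
        refine (congrArg (u.app ⊤) (hR N s)).trans ?_
        refine (Hom.app_smul u (U := ⊤) ((Scheme.ΓSpecIso R).inv r) s).trans ?_
        refine Eq.trans ?_ (hS _ _).symm
        exact congrArg (fun a : Γ(Spec S, ⊤) =>
          a • (show Γ((pullback (Spec.map σ)).obj N, ⊤) from u.app ⊤ s)) h }
  c ∘ₛₗ v

/-- An `𝒪_Y`-module is a vector bundle if it is locally free of finite rank. -/
def IsVectorBundle (M : Y.Modules) : Prop :=
  ∀ y : Y, ∃ U : Y.Opens, y ∈ U ∧ ∃ n : ℕ,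
    Nonempty (M.restrict U.ι ≅ SheafOfModules.free (R := (U : Scheme.{u}).ringCatSheaf) (ULift.{u} (Fin n)))

end AlgebraicGeometry.Scheme.Modules

open AlgebraicGeometry.Scheme AlgebraicGeometry.Scheme.Modules

variable {Y Z T : Scheme.{u}} (t : TensorialConstruction)

/-- A family of submodules of `t(M)`: for every point `x : Spec R ⟶ Y` an `R`-submodule of
`t(x^* M)`. For a vector bundle `M`, a locally split `𝒪_Y`-submodule `L ⊆ t(M)` is the same as such
a family `x ↦ x^* L ⊆ x^* t(M) = t(x^* M)` which is compatible with base change and locally split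
(see `LinePair`); its sections on an affine open `U` are the value at `Spec Γ(Y, U) ⟶ Y`. -/
abbrev SubFamily (M : Y.Modules) : Type (u + 1) :=
  ∀ (R : CommRingCat.{u}) (x : Spec R ⟶ Y), Submodule R (t.obj ((sectionsAt x).obj M))

namespace SubFamily
variable {t}

/-- The pullback of `K ⊆ t(M)` along `g : Y ⟶ Z`, inside `t(g^* M)`. -/
def pullback {M : Z.Modules} (K : SubFamily t M) (g : Y ⟶ Z) :
    SubFamily t ((Modules.pullback g).obj M) := fun _ x =>
  (K _ (x ≫ g)).map (t.map (sectionsPullback x g M).inv.hom)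

/-- The isomorphism `φ : M ≅ N` satisfies `t(φ)(K) = K'`. -/
def Preserves {M N : Y.Modules} (φ : M ≅ N) (K : SubFamily t M) (K' : SubFamily t N) : Prop :=
  ∀ (R : CommRingCat.{u}) (x : Spec R ⟶ Y),
    (K R x).map (t.map ((sectionsAt x).map φ.hom).hom) = K' R x

theorem map_comp_iso {R : Type u} [CommRing R] {M N P : ModuleCat.{u} R} (e : M ≅ N) (e' : N ≅ P)
    (K : Submodule R (t.obj M)) :
    (K.map (t.map e.hom.hom)).map (t.map e'.hom.hom) = K.map (t.map (e ≪≫ e').hom.hom) := by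
  rw [← Submodule.map_comp]
  exact congrArg (fun f => K.map f) ((t.map_functorial.2 e.toLinearEquiv e'.toLinearEquiv).symm)

theorem map_refl {R : Type u} [CommRing R] {M : ModuleCat.{u} R} (K : Submodule R (t.obj M)) :
    K.map (t.map (Iso.refl M).hom.hom) = K := by
  refine (congrArg (fun f => K.map f) t.map_functorial.1).trans (Submodule.map_id K)

theorem Preserves.refl {M : Y.Modules} (K : SubFamily t M) : Preserves (Iso.refl M) K K := by
  intro R x
  simpa using map_refl (K R x)

theorem Preserves.trans {M N P : Y.Modules} {φ : M ≅ N} {ψ : N ≅ P} {K : SubFamily t M}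
    {K' : SubFamily t N} {K'' : SubFamily t P} (h : Preserves φ K K') (h' : Preserves ψ K' K'') :
    Preserves (φ ≪≫ ψ) K K'' := by
  intro R x
  rw [← h' R x, ← h R x]
  refine Eq.trans ?_ (map_comp_iso ((sectionsAt x).mapIso φ) ((sectionsAt x).mapIso ψ) (K R x)).symm
  simp

theorem Preserves.symm {M N : Y.Modules} {φ : M ≅ N} {K : SubFamily t M}
    {K' : SubFamily t N} (h : Preserves φ K K') : Preserves φ.symm K' K := by
  intro R x
  rw [← h R x]
  refine (map_comp_iso ((sectionsAt x).mapIso φ) ((sectionsAt x).mapIso φ.symm) (K R x)).trans ?_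
  refine Eq.trans ?_ (map_refl (K R x))
  simp

theorem Preserves.pullback {M N : Z.Modules} {φ : M ≅ N} {K : SubFamily t M} {K' : SubFamily t N}
    (h : Preserves φ K K') (g : Y ⟶ Z) :
    Preserves ((Modules.pullback g).mapIso φ) (K.pullback g) (K'.pullback g) := by
  intro R x
  have h1 := map_comp_iso (sectionsPullback x g M).symm
    ((sectionsAt x).mapIso ((Modules.pullback g).mapIso φ)) (K R (x ≫ g))
  have h2 := map_comp_iso ((sectionsAt (x ≫ g)).mapIso φ) (sectionsPullback x g N).symm (K R (x ≫ g))
  refine h1.trans (Eq.trans ?_ (h2.symm.trans ?_))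
  · congr 4
    ext1
    exact ((moduleSpecΓFunctor (R := R)).map_comp _ _).symm.trans
      ((congrArg (moduleSpecΓFunctor (R := R)).map ((pullbackComp x g).inv.naturality φ.hom)).symm.trans
      ((moduleSpecΓFunctor (R := R)).map_comp _ _))
  · exact congrArg (Submodule.map _) (h R (x ≫ g))

/-- Transport of a family along an equality of points. -/
theorem map_eqToHom {M : Y.Modules} (K : SubFamily t M) {R : CommRingCat.{u}} {x x' : Spec R ⟶ Y}
    (h : x = x') (e : (sectionsAt x).obj M ≅ (sectionsAt x').obj M)
    (he : e.hom = eqToHom (by rw [h])) : (K R x).map (t.map e.hom.hom) = K R x' := by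
  subst h
  obtain rfl : e = Iso.refl _ := Iso.ext he
  exact map_refl _

theorem preserves_pullbackComp (f : T ⟶ Y) (g : Y ⟶ Z) {M : Z.Modules} (K : SubFamily t M) :
    Preserves ((pullbackComp f g).app M) ((K.pullback g).pullback f) (K.pullback (f ≫ g)) := by
  intro R x
  have h1 := map_comp_iso (sectionsPullback (x ≫ f) g M).symm
    (sectionsPullback x f ((Modules.pullback g).obj M)).symm (K R ((x ≫ f) ≫ g))
  have h2 := map_comp_iso ((sectionsPullback (x ≫ f) g M).symm ≪≫
    (sectionsPullback x f ((Modules.pullback g).obj M)).symm)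
    ((sectionsAt x).mapIso ((pullbackComp f g).app M)) (K R ((x ≫ f) ≫ g))
  let j := sectionsPullback x (f ≫ g) M
  let i := ((sectionsPullback (x ≫ f) g M).symm ≪≫
    (sectionsPullback x f ((Modules.pullback g).obj M)).symm) ≪≫
    ((sectionsAt x).mapIso ((pullbackComp f g).app M))
  have h3 := map_comp_iso (i ≪≫ j) j.symm (K R ((x ≫ f) ≫ g))
  have h4 := map_eqToHom K (Category.assoc x f g) (i ≪≫ j) (by
    have h := congrArg (moduleSpecΓFunctor (R := R)).map
      congr(($(pseudofunctor_associativity x f g)).app M)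
    simp only [NatTrans.comp_app, Functor.whiskerRight_app, Functor.associator_hom_app,
      Functor.whiskerLeft_app, Functor.comp_obj, Category.id_comp, eqToHom_app, eqToHom_map,
      Functor.map_comp] at h
    have h' : (i ≪≫ j).symm = eqToIso (by rw [Category.assoc]) :=
      Iso.ext (Eq.trans (by simp [i, j]; rfl) h)
    exact congrArg (fun e => e.inv) h')
  have h5 : (i ≪≫ j) ≪≫ j.symm = i := by simp [Iso.trans_assoc]
  rw [h4, h5] at h3
  refine (congrArg (Submodule.map _) h1).trans (h2.trans h3.symm)

theorem preserves_pullbackId {M : Y.Modules} (K : SubFamily t M) :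
    Preserves ((pullbackId Y).app M) (K.pullback (𝟙 Y)) K := by
  intro R x
  have h2 := map_comp_iso (sectionsPullback x (𝟙 Y) M).symm
    ((sectionsAt x).mapIso ((pullbackId Y).app M)) (K R (x ≫ 𝟙 Y))
  refine h2.trans (map_eqToHom K (Category.comp_id x) _ ?_)
  have h' := congrArg (moduleSpecΓFunctor (R := R)).map congr(($(pseudofunctor_left_unitality x)).app M)
  simp only [NatTrans.comp_app, Functor.whiskerRight_app, Functor.leftUnitor_hom_app, Functor.comp_obj, Functor.id_obj,
      Category.comp_id, eqToHom_app, eqToHom_map, Functor.map_comp] at h'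
  exact h'

end SubFamily

/-- A pair `(E, L)`: a vector bundle `E` on `Y` and a locally split line bundle `L ⊆ t(E)`. -/
structure LinePair (t : TensorialConstruction) (Y : Scheme.{u}) where
  /-- the vector bundle `E` -/
  bundle : Y.Modules
  isVectorBundle : IsVectorBundle bundle
  /-- the subbundle `L ⊆ t(E)`: a submodule of `t(x^* E)` for every `x : Spec R ⟶ Y` -/
  line : SubFamily t bundle
  /-- for `σ : R → S` the submodule over `S` is generated by the image of the one over `R` -/
  baseChange : ∀ {R S : CommRingCat.{u}} (x : Spec R ⟶ Y) (σ : R ⟶ S),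
    line S (Spec.map σ ≫ x) = Submodule.span S (t.map (sectionsBaseChange x σ bundle) '' line R x)
  /-- on the members of an affine open cover, `L` is a line bundle (an invertible module) and a
  direct summand of `t(E)` -/
  locallySplit : ∀ y : Y, ∃ U : Y.affineOpens, y ∈ U.1 ∧
    Module.Invertible Γ(Y, U) (line Γ(Y, U) U.2.fromSpec) ∧
    ∃ C : Submodule Γ(Y, U) (t.obj ((sectionsAt U.2.fromSpec).obj bundle)),
      IsCompl (line Γ(Y, U) U.2.fromSpec) C

variable {t} {X : Scheme.{u}}

theorem pullbackComp_assoc (f : T ⟶ Y) (g : Y ⟶ Z) (h : Z ⟶ X) (M : X.Modules) :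
    (pullbackComp f g).hom.app ((Modules.pullback h).obj M) ≫ (pullbackComp (f ≫ g) h).hom.app M ≫
      eqToHom (by rw [Category.assoc]) =
    (Modules.pullback f).map ((pullbackComp g h).hom.app M) ≫
      (pullbackComp f (g ≫ h)).hom.app M := by
  have h := congr(($(pseudofunctor_associativity f g h)).app M)
  simp only [NatTrans.comp_app, Functor.whiskerRight_app, Functor.associator_hom_app,
    Functor.whiskerLeft_app, Functor.comp_obj, Category.id_comp, eqToHom_app] at h
  rw [← cancel_epi ((Modules.pullback f).map ((pullbackComp g _).inv.app M)),
    ← cancel_epi ((pullbackComp f (g ≫ _)).inv.app M)]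
  rw [reassoc_of% h]
  simp [← Functor.map_comp_assoc]

theorem map_pullbackId_inv_comp (f : Y ⟶ Z) (M : Z.Modules) :
    (Modules.pullback f).map ((pullbackId Z).inv.app M) ≫ (pullbackComp f (𝟙 Z)).hom.app M ≫
      eqToHom (by rw [Category.comp_id]) = 𝟙 ((Modules.pullback f).obj M) := by
  have h := congr(($(pseudofunctor_left_unitality f)).app M)
  simp only [NatTrans.comp_app, Functor.whiskerRight_app, Functor.leftUnitor_hom_app,
    Functor.comp_obj, Functor.id_obj, Category.comp_id, eqToHom_app] at h
  rw [← h]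
  simp [← Functor.map_comp]

theorem pullbackId_inv_comp (f : Y ⟶ Z) (M : Z.Modules) :
    (pullbackId Y).inv.app ((Modules.pullback f).obj M) ≫ (pullbackComp (𝟙 Y) f).hom.app M ≫
      eqToHom (by rw [Category.id_comp]) = 𝟙 ((Modules.pullback f).obj M) := by
  have h := congr(($(pseudofunctor_right_unitality f)).app M)
  simp only [NatTrans.comp_app, Functor.whiskerLeft_app, Functor.rightUnitor_hom_app,
    Functor.comp_obj, Functor.id_obj, Category.comp_id, eqToHom_app] at h
  rw [← h]
  simp

namespace LinePair

/-- The group of `T`-points of `Aut(V, L)`: the automorphisms `φ` of `V_T` with `φ(L_T) = L_T`. -/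
def autGroup (V : LinePair t X) (T : Over X) : Subgroup (Aut ((Modules.pullback T.hom).obj V.bundle)) where
  carrier := {φ | SubFamily.Preserves φ (V.line.pullback T.hom) (V.line.pullback T.hom)}
  mul_mem' h h' := h'.trans h
  one_mem' := SubFamily.Preserves.refl _
  inv_mem' h := h.symm

/-- The pullback of an automorphism of `V_T` along `h : T' ⟶ T` to an automorphism of `V_{T'}`. -/
def pullbackAut (V : LinePair t X) {T' T : Over X} (h : T' ⟶ T)
    (φ : Aut ((Modules.pullback T.hom).obj V.bundle)) :
    Aut ((Modules.pullback T'.hom).obj V.bundle) :=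
  let α : (Modules.pullback h.left).obj ((Modules.pullback T.hom).obj V.bundle) ≅
      (Modules.pullback T'.hom).obj V.bundle :=
    (pullbackComp h.left T.hom).app V.bundle ≪≫ (pullbackCongr (Over.w h)).app V.bundle
  α.symm ≪≫ (Modules.pullback h.left).mapIso φ ≪≫ α

open scoped MonObj in
/-- An identification `G = Aut(V, L)`: an isomorphism of group functors on schemes over `X`. -/
structure AutIso (G : Over X) [GrpObj G] (V : LinePair t X) where
  equiv (T : Over X) : (T ⟶ G) ≃* V.autGroup T
  natural {T' T : Over X} (h : T' ⟶ T) (g : T ⟶ G) :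
    (equiv T' (h ≫ g) : Aut ((Modules.pullback T'.hom).obj V.bundle)) =
      V.pullbackAut h (equiv T g : Aut ((Modules.pullback T.hom).obj V.bundle))

/-- The pair `D = (E, L')` on `Y` is a `G_Y`-twist of `(V, L)`: there are an fppf cover
`g : Y' ⟶ Y` and an isomorphism `φ : E_{Y'} ≅ V_{Y'}` with `φ(L'_{Y'}) = L_{Y'}`. -/
def IsTwist (V : LinePair t X) (Y : Over X) (D : LinePair t Y.left) : Prop :=
  ∃ (Y' : Scheme.{u}) (g : Y' ⟶ Y.left), Flat g ∧ Surjective g ∧ LocallyOfFinitePresentation g ∧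
    ∃ φ : (Modules.pullback g).obj D.bundle ≅ (Modules.pullback (g ≫ Y.hom)).obj V.bundle,
      SubFamily.Preserves φ (D.line.pullback g) (V.line.pullback (g ≫ Y.hom))

end LinePair

/-- The objects of the fibered category of twists of `(V, L)`: an `X`-scheme `Y` and a twist on `Y`. -/
structure Twist (V : LinePair t X) where
  base : Over X
  pair : LinePair t base.left
  isTwist : V.IsTwist base pair

namespace Twist
variable {V : LinePair t X}

/-- A morphism from a twist `(E, L)` on `Y` to a twist `(E', L')` on `Y'`: a morphism `h : Y ⟶ Y'`
over `X` with an isomorphism of pairs `(E, L) ≅ (h^* E', h^* L')`. Over the identity of `Y` these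
are the isomorphisms of `G_Y`-twists. -/
structure Hom (D D' : Twist V) where
  base : D.base ⟶ D'.base
  iso : D.pair.bundle ≅ (Modules.pullback base.left).obj D'.pair.bundle
  preserves : SubFamily.Preserves iso D.pair.line (D'.pair.line.pullback base.left)

theorem Hom.ext' {D D' : Twist V} {f f' : Hom D D'} (h : f.base = f'.base)
    (h' : f.iso.hom ≫ eqToHom (by rw [h]) = f'.iso.hom) : f = f' := by
  obtain ⟨b, φ, _⟩ := f
  obtain ⟨b', φ', _⟩ := f'
  obtain rfl : b = b' := h
  obtain rfl : φ = φ' := Iso.ext (by simpa using h')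
  rfl

/-- The identity morphism. -/
def Hom.id (D : Twist V) : Hom D D where
  base := 𝟙 D.base
  iso := ((pullbackId D.base.left).app D.pair.bundle).symm
  preserves := (SubFamily.preserves_pullbackId D.pair.line).symm

/-- The composition of morphisms. -/
def Hom.comp {D D' D'' : Twist V} (f : Hom D D') (f' : Hom D' D'') : Hom D D'' where
  base := f.base ≫ f'.base
  iso := f.iso ≪≫ (Modules.pullback f.base.left).mapIso f'.iso ≪≫
    (pullbackComp f.base.left f'.base.left).app D''.pair.bundle
  preserves := f.preserves.trans ((f'.preserves.pullback f.base.left).trans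
    (SubFamily.preserves_pullbackComp f.base.left f'.base.left D''.pair.line))

instance : Category (Twist V) where
  Hom := Hom
  id := Hom.id
  comp := Hom.comp
  id_comp {D D'} f := by
    have hn := (pullbackId D.base.left).inv.naturality f.iso.hom
    have h := pullbackId_inv_comp f.base.left D'.pair.bundle
    have key : ((pullbackId D.base.left).inv.app D.pair.bundle ≫
        (Modules.pullback (𝟙 D.base.left)).map f.iso.hom ≫
        (pullbackComp (𝟙 D.base.left) f.base.left).hom.app D'.pair.bundle) ≫
        eqToHom (by rw [Category.id_comp]) = f.iso.hom := by
      simp only [Functor.id_obj, Functor.id_map] at hn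
      rw [Category.assoc, Category.assoc, ← reassoc_of% hn, h, Category.comp_id]
    exact Hom.ext' (Category.id_comp _) key
  comp_id {D D'} f := by
    have h := map_pullbackId_inv_comp f.base.left D'.pair.bundle
    have key : (f.iso.hom ≫
        (Modules.pullback f.base.left).map ((pullbackId D'.base.left).inv.app D'.pair.bundle) ≫
        (pullbackComp f.base.left (𝟙 D'.base.left)).hom.app D'.pair.bundle) ≫
        eqToHom (by rw [Category.comp_id]) = f.iso.hom := by
      rw [Category.assoc, Category.assoc, h, Category.comp_id]
    exact Hom.ext' (Category.comp_id _) key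
  assoc {A B C D} f g h := by
    have h1 := pullbackComp_assoc f.base.left g.base.left h.base.left D.pair.bundle
    have hn := (pullbackComp f.base.left g.base.left).hom.naturality h.iso.hom
    have key : ((f.iso.hom ≫ (Modules.pullback f.base.left).map g.iso.hom ≫
        (pullbackComp f.base.left g.base.left).hom.app C.pair.bundle) ≫
        (Modules.pullback (f.base.left ≫ g.base.left)).map h.iso.hom ≫
        (pullbackComp (f.base.left ≫ g.base.left) h.base.left).hom.app D.pair.bundle) ≫
        eqToHom (by rw [Category.assoc]) =
        f.iso.hom ≫ (Modules.pullback f.base.left).map (g.iso.hom ≫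
          (Modules.pullback g.base.left).map h.iso.hom ≫
          (pullbackComp g.base.left h.base.left).hom.app D.pair.bundle) ≫
        (pullbackComp f.base.left (g.base.left ≫ h.base.left)).hom.app D.pair.bundle := by
      simp only [Functor.map_comp, Category.assoc]
      rw [← h1, ← reassoc_of% hn]
    exact Hom.ext' (Category.assoc _ _ _) key

/-- The projection `(Y, E, L) ↦ Y`. Its fiber over `Y` is the groupoid of `G_Y`-twists of `(V, L)`. -/
def forget (V : LinePair t X) : Twist V ⥤ Over X where
  obj D := D.base
  map f := f.base

end Twist

open MonoidalCategory CartesianMonoidalCategory MonObj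

/-- The objects of the fibered category of `G`-torsors: an `X`-scheme `Y` (`base`) and a
`G_Y`-torsor `P` (`total`) on it, that is, a faithfully flat affine `P ⟶ Y` with a right action
`P × G ⟶ P` over `X` such that the square with sides `(p, g) ↦ p`, `(p, g) ↦ p g`, `P ⟶ Y`, `P ⟶ Y`
commutes (`P ⟶ Y` is invariant) and is cartesian (`P × G ⟶ P ×_Y P`, `(p, g) ↦ (p, p g)`, is an
isomorphism). -/
structure GTorsor (G : Over X) [GrpObj G] where
  base : Over X
  total : Over X
  proj : total ⟶ base
  act : total ⊗ G ⟶ total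
  act_one : total ◁ η[G] ≫ act = (ρ_ total).hom
  act_mul : (α_ total G G).hom ≫ total ◁ μ[G] ≫ act = act ▷ G ≫ act
  isPullback : IsPullback (fst total G) act proj proj
  flat : Flat proj.left
  surjective : Surjective proj.left
  affine : IsAffineHom proj.left

namespace GTorsor
variable {G : Over X} [GrpObj G]

/-- A morphism from a `G_Y`-torsor `P` to a `G_{Y'}`-torsor `P'`: a morphism `h : Y ⟶ Y'` over `X`
and a `G`-equivariant map `P ⟶ P'` over `h`. Over the identity of `Y` these are the morphisms of
`G_Y`-torsors. -/
@[ext]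
structure Hom (P P' : GTorsor G) where
  base : P.base ⟶ P'.base
  map : P.total ⟶ P'.total
  w : map ≫ P'.proj = P.proj ≫ base
  equivariant : P.act ≫ map = map ▷ G ≫ P'.act

instance : Category (GTorsor G) where
  Hom := Hom
  id P := ⟨𝟙 _, 𝟙 _, by simp, by simp⟩
  comp f g := ⟨f.base ≫ g.base, f.map ≫ g.map, by
    rw [Category.assoc, g.w, ← Category.assoc, f.w, Category.assoc], by
    rw [← Category.assoc, f.equivariant, Category.assoc, g.equivariant, comp_whiskerRight,
      Category.assoc]⟩
  id_comp f := Hom.ext (Category.id_comp _) (Category.id_comp _)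
  comp_id f := Hom.ext (Category.comp_id _) (Category.comp_id _)
  assoc f g h := Hom.ext (Category.assoc _ _ _) (Category.assoc _ _ _)

/-- The projection `(Y, P) ↦ Y`. Its fiber over `Y` is the groupoid of `G_Y`-torsors. -/
def forget (G : Over X) [GrpObj G] : GTorsor G ⥤ Over X where
  obj P := P.base
  map f := f.base

end GTorsor

/-- The functor induced on the fibers over `S` by a functor of categories over `𝒮`. -/
def CategoryTheory.BasedFunctor.onFiber {𝒮 : Type*} [Category* 𝒮] {𝒳 𝒴 : BasedCategory 𝒮}
    (F : BasedFunctor 𝒳 𝒴) (S : 𝒮) : 𝒳.p.Fiber S ⥤ 𝒴.p.Fiber S where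
  obj a := ⟨F.obj a.1, (F.w_obj a.1).trans a.2⟩
  map f := ⟨F.map f.1, have := f.2; inferInstance⟩
  map_id a := Subtype.ext (F.map_id a.1)
  map_comp f g := Subtype.ext (F.map_comp f.1 g.1)

/-- A Dedekind scheme: a scheme with a finite affine open cover by spectra of Dedekind domains. -/
def IsDedekindScheme (X : Scheme.{u}) : Prop :=
  ∃ S : Set X.affineOpens, S.Finite ∧ (∀ U ∈ S, IsDedekindDomain Γ(X, U)) ∧ ∀ x : X, ∃ U ∈ S, x ∈ U.1

end

noncomputable section

/-! ### Semilinear maps exhibiting a base change -/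

section IsExt

variable {R S T : Type u} [CommRing R] [CommRing S] [CommRing T] {σ : R →+* S} {τ : S →+* T}
  {ρ : R →+* T} {M N P : Type u} [AddCommGroup M] [AddCommGroup N] [AddCommGroup P] [Module R M]
  [Module S N] [Module T P]

/-- The semilinear map `f : M → N` exhibits `N` as the base change of `M`. -/
def IsExt (f : M →ₛₗ[σ] N) : Prop :=
  ∀ (Q : Type u) [AddCommGroup Q] [Module S Q] (g : M →ₛₗ[σ] Q), ∃! h : N →ₗ[S] Q, ∀ m, h (f m) = g m

namespace IsExt

variable {Q : Type u} [AddCommGroup Q] [Module S Q]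

def lift {f : M →ₛₗ[σ] N} (hf : IsExt f) (g : M →ₛₗ[σ] Q) : N →ₗ[S] Q := (hf Q g).choose

theorem lift_apply {f : M →ₛₗ[σ] N} (hf : IsExt f) (g : M →ₛₗ[σ] Q) (m : M) :
    hf.lift g (f m) = g m := (hf Q g).choose_spec.1 m

theorem ext {f : M →ₛₗ[σ] N} (hf : IsExt f) {h h' : N →ₗ[S] Q} (H : ∀ m, h (f m) = h' (f m)) :
    h = h' :=
  (hf Q (h'.comp f)).unique H fun _ => rfl

theorem span_range {f : M →ₛₗ[σ] N} (hf : IsExt f) : Submodule.span S (Set.range f) = ⊤ := by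
  have h : (Submodule.span S (Set.range f)).mkQ = 0 := hf.ext fun m => by
    simpa using Submodule.subset_span (Set.mem_range_self m)
  rw [← Submodule.ker_mkQ (Submodule.span S (Set.range f)), h, LinearMap.ker_zero]

theorem induction {f : M →ₛₗ[σ] N} (hf : IsExt f) {p : N → Prop} (n : N) (h0 : p 0)
    (hadd : ∀ x y, p x → p y → p (x + y)) (hsmul : ∀ (s : S) m, p (s • f m)) : p n := by
  have hn : n ∈ Submodule.span S (Set.range f) := hf.span_range ▸ trivial
  induction hn using Submodule.closure_induction with
  | zero => exact h0
  | add x y _ _ hx hy => exact hadd x y hx hy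
  | smul_mem r x hx => obtain ⟨m, rfl⟩ := hx; exact hsmul r m

/-- Composition of base changes. -/
theorem comp {f : M →ₛₗ[σ] N} (hf : IsExt f) {g : N →ₛₗ[τ] P} (hg : IsExt g) (k : M →ₛₗ[ρ] P)
    (hρ : ∀ r, ρ r = τ (σ r)) (hk : ∀ m, k m = g (f m)) : IsExt k := by
  intro Q _ _ q
  letI : Module S Q := Module.compHom Q τ
  have smul_def (s : S) (x : Q) : s • x = τ s • x := rfl
  let q' : M →ₛₗ[σ] Q := { toFun := q
                           map_add' := by simp
                           map_smul' := fun r m => by rw [map_smulₛₗ, smul_def, hρ] }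
  let q'' : N →ₛₗ[τ] Q := { hf.lift q' with map_smul' := fun s n => (hf.lift q').map_smul s n }
  refine ⟨hg.lift q'', fun m => ?_, fun h' hh' => hg.ext fun n => ?_⟩
  · change hg.lift q'' (k m) = q m
    rw [hk, lift_apply]; exact hf.lift_apply q' m
  · rw [lift_apply]
    let l : N →ₗ[S] Q := { toFun := fun n => h' (g n)
                           map_add' := by simp
                           map_smul' := fun s n => by simp [smul_def] }
    have : l = hf.lift q' := hf.ext fun m => by
      rw [lift_apply]; change h' (g (f m)) = q m; rw [← hk]; exact hh' m
    exact LinearMap.congr_fun this n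

theorem of_comp {f : M →ₛₗ[σ] N} (hf : IsExt f) (g : N →ₛₗ[τ] P) {k : M →ₛₗ[ρ] P} (hk' : IsExt k)
    (hρ : ∀ r, ρ r = τ (σ r)) (hk : ∀ m, k m = g (f m)) : IsExt g := by
  intro Q _ _ q
  letI : Module S Q := Module.compHom Q τ
  have smul_def (s : S) (x : Q) : s • x = τ s • x := rfl
  let q' : M →ₛₗ[ρ] Q := { toFun := fun m => q (f m)
                           map_add' := by simp
                           map_smul' := by simp [hρ] }
  refine ⟨hk'.lift q', fun n => ?_, fun h' hh' => hk'.ext fun m => ?_⟩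
  · let l : N →ₗ[S] Q := { toFun := fun n => hk'.lift q' (g n)
                           map_add' := by simp
                           map_smul' := fun s n => by simp [smul_def] }
    let l' : N →ₗ[S] Q := { toFun := q
                            map_add' := by simp
                            map_smul' := fun s n => by simp [smul_def] }
    have : l = l' := hf.ext fun m => by
      change hk'.lift q' (g (f m)) = q (f m)
      rw [← hk, lift_apply]; rfl
    exact LinearMap.congr_fun this n
  · rw [lift_apply, hk]; exact hh' _

theorem of_linearEquiv {M' : Type u} [AddCommGroup M'] [Module R M'] (e : M ≃ₗ[R] M') :
    IsExt e.toLinearMap := fun Q _ _ g =>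
  ⟨g ∘ₗ e.symm.toLinearMap, fun m => by simp, fun h hh => LinearMap.ext fun m => by
    simpa using hh (e.symm m)⟩

theorem of_bijective {M' : Type u} [AddCommGroup M'] [Module R M'] (f : M →ₗ[R] M')
    (hf : Function.Bijective f) : IsExt f := of_linearEquiv (LinearEquiv.ofBijective f hf)

/-- A base change along a bijective ring homomorphism is bijective. -/
theorem bijective {f : M →ₛₗ[σ] N} (hf : IsExt f) (hσ : Function.Bijective σ) :
    Function.Bijective f := by
  let e := RingEquiv.ofBijective σ hσ
  letI : Module S M := Module.compHom M e.symm.toRingHom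
  have smul_def (s : S) (x : M) : s • x = e.symm s • x := rfl
  let i : M →ₛₗ[σ] M := { toFun := _root_.id
                          map_add' := by simp
                          map_smul' := fun r m => by
                            simp only [_root_.id, smul_def]
                            congr 1; exact (e.symm_apply_apply r).symm }
  have h1 (m) : hf.lift i (f m) = m := hf.lift_apply i m
  let f' : M →ₗ[S] N := { toFun := f
                          map_add' := by simp
                          map_smul' := fun s m => by
                            simp only [smul_def, map_smulₛₗ, RingHom.id_apply]
                            congr 1; exact e.apply_symm_apply s }
  have h2 : f' ∘ₗ hf.lift i = LinearMap.id := hf.ext fun m => by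
    change f (hf.lift i (f m)) = f m
    rw [h1]
  exact ⟨Function.LeftInverse.injective h1, Function.RightInverse.surjective fun n => LinearMap.congr_fun h2 n⟩

/-- Two base changes of the same module are isomorphic. -/
def equiv {N' : Type u} [AddCommGroup N'] [Module S N'] {f : M →ₛₗ[σ] N} (hf : IsExt f)
    {f' : M →ₛₗ[σ] N'} (hf' : IsExt f') : N ≃ₗ[S] N' :=
  LinearEquiv.ofLinear (hf.lift f') (hf'.lift f)
    (hf'.ext fun m => by simp [lift_apply]) (hf.ext fun m => by simp [lift_apply])

theorem equiv_apply {N' : Type u} [AddCommGroup N'] [Module S N'] {f : M →ₛₗ[σ] N} (hf : IsExt f)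
    {f' : M →ₛₗ[σ] N'} (hf' : IsExt f') (m : M) : hf.equiv hf' (f m) = f' m := hf.lift_apply f' m

theorem comp_linearEquiv {N' : Type u} [AddCommGroup N'] [Module S N'] {f : M →ₛₗ[σ] N} (hf : IsExt f)
    (e : N ≃ₗ[S] N') (k : M →ₛₗ[σ] N') (hk : ∀ m, k m = e (f m)) : IsExt k :=
  hf.comp (of_linearEquiv e) k (fun _ => rfl) hk

end IsExt

theorem IsExt.of_isBaseChange [Algebra R S] [Module R N] [IsScalarTower R S N]
    (f : M →ₗ[R] N) (f' : M →ₛₗ[algebraMap R S] N) (h : ∀ m, f' m = f m) (hf : IsBaseChange S f) :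
    IsExt f' := by
  intro Q _ _ g
  letI : Module R Q := Module.compHom Q (algebraMap R S)
  haveI : IsScalarTower R S Q := IsScalarTower.of_algebraMap_smul fun _ _ => rfl
  let g' : M →ₗ[R] Q := { g with map_smul' := fun r m => g.map_smulₛₗ r m }
  refine ⟨hf.lift g', fun m => ?_, fun l hl => hf.algHom_ext _ _ fun m => ?_⟩
  · rw [h]; exact hf.lift_eq g' m
  · rw [hf.lift_eq, ← h]; exact hl m

/-- The canonical map to the tensor product is a base change. -/
def tensorUnit (σ : R →+* S) (M : Type u) [AddCommGroup M] [Module R M] :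
    letI := σ.toAlgebra
    M →ₛₗ[σ] TensorProduct R S M :=
  letI := σ.toAlgebra
  { toFun := fun m => 1 ⊗ₜ[R] m
    map_add' := fun _ _ => TensorProduct.tmul_add _ _ _
    map_smul' := fun r m => by
      rw [TensorProduct.tmul_smul]
      exact (algebraMap_smul S r (1 ⊗ₜ[R] m : TensorProduct R S M)).symm }

theorem tensorUnit_isExt (σ : R →+* S) : IsExt (tensorUnit σ M) := by
  letI := σ.toAlgebra
  exact IsExt.of_isBaseChange (TensorProduct.mk R S M 1) (tensorUnit σ M) (fun _ => rfl)
    (TensorProduct.isBaseChange R M S)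

namespace IsExt

theorem isBaseChange [Algebra R S] [Module R N] [IsScalarTower R S N]
    (f : M →ₗ[R] N) (f' : M →ₛₗ[algebraMap R S] N) (h : ∀ m, f' m = f m) (hf : IsExt f') :
    IsBaseChange S f := by
  have h1 : IsExt (σ := algebraMap R S) (N := TensorProduct R S M)
      { toFun := fun m => 1 ⊗ₜ[R] m
        map_add' := fun _ _ => TensorProduct.tmul_add _ _ _
        map_smul' := fun r m => by
          rw [TensorProduct.tmul_smul]
          exact (algebraMap_smul S r (1 ⊗ₜ[R] m : TensorProduct R S M)).symm } :=
    IsExt.of_isBaseChange (TensorProduct.mk R S M 1) _ (fun _ => rfl)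
      (TensorProduct.isBaseChange R M S)
  exact IsBaseChange.of_equiv (h1.equiv hf) fun m => (h1.equiv_apply hf m).trans (h m)

theorem finite {f : M →ₛₗ[σ] N} (hf : IsExt f) [Module.Finite R M] : Module.Finite S N := by
  letI := σ.toAlgebra
  exact Module.Finite.equiv ((tensorUnit_isExt σ (M := M)).equiv hf)

theorem projective {f : M →ₛₗ[σ] N} (hf : IsExt f) [Module.Projective R M] :
    Module.Projective S N := by
  letI := σ.toAlgebra
  exact Module.Projective.of_equiv ((tensorUnit_isExt σ (M := M)).equiv hf)

end IsExt

/-! ### Multilinear maps and base change -/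

section Multilinear

variable {Q : Type u} [AddCommGroup Q] [Module S Q]

theorem IsExt.multilinear_ext {f : M →ₛₗ[σ] N} (hf : IsExt f) {ι : Type*} [Finite ι]
    {G G' : MultilinearMap S (fun _ : ι => N) Q} (h : ∀ v : ι → M, G (fun i => f (v i)) = G' (fun i => f (v i))) :
    G = G' := by
  classical
  letI := Fintype.ofFinite ι
  ext w
  have key (s : Finset ι) : ∀ w : ι → N, (∀ i ∉ s, ∃ m, w i = f m) → G w = G' w := by
    induction s using Finset.induction with
    | empty =>
      intro w hw
      choose v hv using fun i => hw i (by simp)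
      obtain rfl : w = fun i => f (v i) := funext hv
      exact h v
    | insert k s hk ih =>
      intro w hw
      have : ∀ x : N, G (Function.update w k x) = G' (Function.update w k x) := by
        intro x
        have e : G.toLinearMap w k = G'.toLinearMap w k := hf.ext fun m => by
          refine ih _ fun i hi => ?_
          rcases eq_or_ne i k with rfl | hik
          · exact ⟨m, by simp⟩
          · obtain ⟨m', hm'⟩ := hw i (by simp [hi, hik])
            exact ⟨m', by simp [hik, hm']⟩
        exact LinearMap.congr_fun e x
      simpa using this (w k)
  exact key Finset.univ w (by simp)

theorem IsExt.exists_multilinear {f : M →ₛₗ[σ] N} (hf : IsExt f) :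
    letI : Module R Q := Module.compHom Q σ
    ∀ (n : ℕ) (g : MultilinearMap R (fun _ : Fin n => M) Q),
      ∃ G : MultilinearMap S (fun _ : Fin n => N) Q, ∀ v, G (fun i => f (v i)) = g v := by
  letI : Module R Q := Module.compHom Q σ
  intro n
  induction n with
  | zero =>
    intro g
    exact ⟨MultilinearMap.constOfIsEmpty S _ (g 0), fun v => congrArg g (Subsingleton.elim _ _)⟩
  | succ n ih =>
    intro g
    choose G hG using ih
    let c : M →ₛₗ[σ] MultilinearMap S (fun _ : Fin n => N) Q :=
      { toFun := fun m => G (g.curryLeft m)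
        map_add' := fun m m' => hf.multilinear_ext fun v => by simp [hG]
        map_smul' := fun r m => hf.multilinear_ext fun v => by
          rw [MultilinearMap.smul_apply, hG, hG, map_smul]; rfl }
    refine ⟨LinearMap.uncurryLeft (hf.lift c), fun v => ?_⟩
    rw [LinearMap.uncurryLeft_apply, lift_apply]
    change G (g.curryLeft (v 0)) (fun i => f (v i.succ)) = g v
    rw [hG]
    simp only [MultilinearMap.curryLeft_apply]
    exact congrArg g (Fin.cons_self_tail v)

/-- A multilinear map over `S` which is alternating on the image of `M` is alternating. -/
theorem IsExt.alternating {f : M →ₛₗ[σ] N} (hf : IsExt f) {n : ℕ}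
    (G : MultilinearMap S (fun _ : Fin n => N) Q)
    (h : ∀ (v : Fin n → M) k l, v k = v l → k ≠ l → G (fun i => f (v i)) = 0)
    (w : Fin n → N) (k l : Fin n) (hw : w k = w l) (hkl : k ≠ l) : G w = 0 := by
  classical
  let e := Equiv.swap k l
  let d (w : Fin n → N) (x y : N) : Fin n → N := Function.update (Function.update w k x) l y
  have dcomm (w x y) : d w x y = Function.update (Function.update w l y) k x :=
    Function.update_comm hkl x y w
  have addd (w x x' y) : G (d w (x + x') y) = G (d w x y) + G (d w x' y) := by
    simp only [dcomm, MultilinearMap.map_update_add]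
  have addd' (w x y y') : G (d w x (y + y')) = G (d w x y) + G (d w x y') := by
    simp only [d, MultilinearMap.map_update_add]
  have smuld (w) (s : S) (x y) : G (d w (s • x) y) = s • G (d w x y) := by
    simp only [dcomm, MultilinearMap.map_update_smul]
  have smuld' (w) (s : S) (x y) : G (d w x (s • y)) = s • G (d w x y) := by
    simp only [d, MultilinearMap.map_update_smul]
  have dself (w) : d w (w k) (w l) = w := by simp [d]
  have dswap (w x y) : (fun i => d w x y (e i)) = d w y x := by
    ext i
    by_cases h1 : i = l
    · subst h1; simp [d, e, hkl]
    · by_cases h2 : i = k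
      · subst h2; simp [d, e, h1]
      · simp [h1, h2, d, e, Equiv.swap_apply_of_ne_of_ne h2 h1]
  have anti : ∀ w, G w + G (fun i => w (e i)) = 0 := by
    have : G + G.domDomCongr e = 0 := hf.multilinear_ext fun v => by
      let w : Fin n → N := fun i => f (v i)
      have key (a : M) : G (d w (f a) (f a)) = 0 := by
        refine Eq.trans ?_ (h (Function.update (Function.update v k a) l a) k l (by simp [hkl]) hkl)
        congr 1; ext i
        by_cases h1 : i = l
        · subst h1; simp [d]
        · by_cases h2 : i = k
          · subst h2; simp [d, h1]
          · simp [d, h1, h2, w]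
      have h1 := key (v k + v l)
      rw [map_add, addd, addd', addd', key, key, zero_add, add_zero] at h1
      change G w + G (fun i => w (e i)) = 0
      rw [← dself w, dswap, dself]
      exact (congrArg (· + _) (congrArg G (dself w).symm)).trans h1
    exact fun w => congr($this w)
  have hd (x y : N) : G (d w x y) + G (d w y x) = 0 := by rw [← anti (d w x y), dswap]
  rw [← dself w, ← hw]
  induction w k using hf.induction with
  | h0 => simpa using smuld w 0 0 0
  | hadd x y hx hy => rw [addd, addd', addd', hx, hy, zero_add, add_zero, hd]
  | hsmul s m =>
    rw [smuld, smuld']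
    suffices G (d w (f m) (f m)) = 0 by rw [this]; simp
    let P : Fin n → Prop := fun i => i ≠ k ∧ i ≠ l
    have : G.domDomRestrict P (fun _ => f m) = 0 := hf.multilinear_ext fun v => by
      refine (MultilinearMap.domDomRestrict_apply _ _ _ _).trans ?_
      refine Eq.trans ?_ (h (fun i => if hi : P i then v ⟨i, hi⟩ else m) k l (by simp [P]) hkl)
      congr 1; ext i; split_ifs <;> rfl
    have := congr($this (fun i => w i))
    refine Eq.trans ?_ ((MultilinearMap.domDomRestrict_apply _ _ _ _).symm.trans this)
    congr 1; ext i
    by_cases h1 : i = l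
    · subst h1; simp [d, P]
    · by_cases h2 : i = k
      · subst h2; simp [h1, d, P]
      · simp [h1, h2, d, P]

end Multilinear

end IsExt

end

noncomputable section

namespace TensorialConstruction

open scoped TensorProduct

variable {R S T : Type u} [CommRing R] [CommRing S] [CommRing T] {σ : R →+* S} {τ : S →+* T}
  {ρ : R →+* T} {M N P : Type u} [AddCommGroup M] [AddCommGroup N] [AddCommGroup P] [Module R M]
  [Module S N] [Module T P]

/-! ### Functoriality in semilinear maps -/

theorem tensorMap_comp {M' N' P' : Type u} [AddCommGroup M'] [AddCommGroup N'] [AddCommGroup P']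
    [Module R M'] [Module S N'] [Module T P'] (f : M →ₛₗ[σ] N) (g : N →ₛₗ[τ] P) (k : M →ₛₗ[ρ] P)
    (f' : M' →ₛₗ[σ] N') (g' : N' →ₛₗ[τ] P') (k' : M' →ₛₗ[ρ] P')
    (hk : ∀ m, k m = g (f m)) (hk' : ∀ m, k' m = g' (f' m)) (x : M ⊗[R] M') :
    TensorProduct.map k k' x = TensorProduct.map g g' (TensorProduct.map f f' x) := by
  induction x with
  | zero => simp
  | tmul m m' => simp [hk, hk']
  | add x y hx hy => simp [hx, hy]

theorem exteriorMap_comp (i : ℕ) (f : M →ₛₗ[σ] N) (g : N →ₛₗ[τ] P) (k : M →ₛₗ[ρ] P)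
    (hρ : ∀ r, ρ r = τ (σ r)) (hk : ∀ m, k m = g (f m)) (x : ⋀[R]^i M) :
    exteriorMap i k x = exteriorMap i g (exteriorMap i f x) := by
  have hx : x ∈ Submodule.span R (Set.range (exteriorPower.ιMulti R i (M := M))) :=
    exteriorPower.ιMulti_span R i M ▸ trivial
  induction hx using Submodule.span_induction with
  | mem x hx =>
    obtain ⟨v, rfl⟩ := hx
    rw [exteriorMap_ιMulti, exteriorMap_ιMulti, exteriorMap_ιMulti]
    congr 1; ext j; exact hk _
  | zero => simp
  | add x y _ _ hx hy => simp [hx, hy]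
  | smul r x _ hx => simp [hx, hρ]

theorem sym_induction {j : ℕ} {p : SymmetricPower R (ULift.{u} (Fin j)) M → Prop}
    (x : SymmetricPower R (ULift.{u} (Fin j)) M) (h : ∀ v, p (SymmetricPower.tprod R v)) (h0 : p 0)
    (hadd : ∀ x y, p x → p y → p (x + y)) (hsmul : ∀ (r : R) x, p x → p (r • x)) : p x := by
  have hx : x ∈ Submodule.span R (Set.range (SymmetricPower.tprod R (ι := ULift.{u} (Fin j)) (M := M))) :=
    SymmetricPower.span_tprod_eq_top R _ M ▸ trivial
  induction hx using Submodule.span_induction with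
  | mem x hx => obtain ⟨v, rfl⟩ := hx; exact h v
  | zero => exact h0
  | add x y _ _ hx hy => exact hadd x y hx hy
  | smul r x _ hx => exact hsmul r x hx

theorem symMap_comp (j : ℕ) (f : M →ₛₗ[σ] N) (g : N →ₛₗ[τ] P) (k : M →ₛₗ[ρ] P)
    (hρ : ∀ r, ρ r = τ (σ r)) (hk : ∀ m, k m = g (f m)) (x : SymmetricPower R (ULift.{u} (Fin j)) M) :
    symMap j k x = symMap j g (symMap j f x) := by
  induction x using sym_induction with
  | h v => rw [symMap_tprod, symMap_tprod, symMap_tprod]; congr 1; ext j; exact hk _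
  | h0 => simp
  | hadd x y hx hy => simp only [map_add, hx, hy]
  | hsmul r x hx => simp only [map_smulₛₗ, hx, hρ]

theorem dual_existsUnique {f : M →ₛₗ[σ] N} (hf : IsExt f) (φ : Module.Dual R M) :
    ∃! ψ : Module.Dual S N, ∀ x, ψ (f x) = σ (φ x) :=
  hf S { toFun := fun m => σ (φ m), map_add' := by simp, map_smul' := by simp }

theorem dualMap_comp {f : M →ₛₗ[σ] N} (hf : IsExt f) {g : N →ₛₗ[τ] P} (hg : IsExt g) (k : M →ₛₗ[ρ] P)
    (hρ : ∀ r, ρ r = τ (σ r)) (hk : ∀ m, k m = g (f m)) (φ : Module.Dual R M) :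
    dualMap k φ = dualMap g (dualMap f φ) := by
  have hk' := hf.comp hg k hρ hk
  refine hk'.ext fun m => ?_
  rw [dualMap_apply _ (dual_existsUnique hk'), hk, dualMap_apply _ (dual_existsUnique hg),
    dualMap_apply _ (dual_existsUnique hf), hρ]

/-! ### Base change -/

theorem tensorMap_isExt {M' N' : Type u} [AddCommGroup M'] [AddCommGroup N'] [Module R M']
    [Module S N'] {f : M →ₛₗ[σ] N} (hf : IsExt f) {f' : M' →ₛₗ[σ] N'} (hf' : IsExt f') :
    IsExt (TensorProduct.map f f') := by
  intro Q _ _ g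
  let c : M →ₛₗ[σ] (N' →ₗ[S] Q) :=
    { toFun := fun m => hf'.lift
        { toFun := fun m' => g (m ⊗ₜ m')
          map_add' := by simp [TensorProduct.tmul_add]
          map_smul' := by simp [TensorProduct.tmul_smul] }
      map_add' := fun m₁ m₂ => hf'.ext fun m' => by
        simp only [LinearMap.add_apply, hf'.lift_apply]
        simp [TensorProduct.add_tmul]
      map_smul' := fun r m => hf'.ext fun m' => by
        simp only [LinearMap.smul_apply, hf'.lift_apply]
        simp [← TensorProduct.smul_tmul'] }
  have key (m m') : hf.lift c (f m) (f' m') = g (m ⊗ₜ m') := by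
    rw [hf.lift_apply]; exact hf'.lift_apply _ m'
  refine ⟨TensorProduct.lift (hf.lift c), fun x => ?_, fun h hh => TensorProduct.ext ?_⟩
  · induction x with
    | zero => simp
    | tmul m m' => simp [key]
    | add x y hx hy => simp [hx, hy]
  · refine hf.ext fun m => hf'.ext fun m' => ?_
    have := hh (m ⊗ₜ m')
    simpa [key] using this

theorem exteriorMap_isExt (i : ℕ) {f : M →ₛₗ[σ] N} (hf : IsExt f) : IsExt (exteriorMap i f) := by
  intro Q _ _ g
  let _ : Module R Q := Module.compHom Q σ
  let g' : (⋀[R]^i M) →ₗ[R] Q := { g with map_smul' := fun r m => g.map_smulₛₗ r m }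
  obtain ⟨G, hG⟩ := hf.exists_multilinear i (g'.compAlternatingMap (exteriorPower.ιMulti R i)).toMultilinearMap
  let A : N [⋀^Fin i]→ₗ[S] Q := { G with
    map_eq_zero_of_eq' := fun v k l hv hkl => hf.alternating G (fun w k l hw hkl => by
      rw [hG]
      exact AlternatingMap.map_eq_zero_of_eq _ w hw hkl) v k l hv hkl }
  refine ⟨exteriorPower.alternatingMapLinearEquiv A, fun x => ?_, fun h hh => ?_⟩
  · have hx : x ∈ Submodule.span R (Set.range (exteriorPower.ιMulti R i (M := M))) :=
      exteriorPower.ιMulti_span R i M ▸ trivial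
    induction hx using Submodule.span_induction with
    | mem x hx =>
      obtain ⟨v, rfl⟩ := hx
      rw [exteriorMap_ιMulti, exteriorPower.alternatingMapLinearEquiv_apply_ιMulti]
      exact hG v
    | zero => simp
    | add x y _ _ hx hy => simp only [map_add, hx, hy]
    | smul r x _ hx => simp only [map_smulₛₗ, hx]; rfl
  · refine exteriorPower.linearMap_ext (AlternatingMap.coe_multilinearMap_injective ?_)
    refine hf.multilinear_ext fun v => ?_
    have h1 := exteriorMap_ιMulti i f v
    change h (exteriorPower.ιMulti S i (f ∘ v)) =
      exteriorPower.alternatingMapLinearEquiv A (exteriorPower.ιMulti S i (f ∘ v))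
    rw [exteriorPower.alternatingMapLinearEquiv_apply_ιMulti, ← h1, hh]
    exact (hG v).symm

/-- The linear map on a symmetric power defined by a symmetric multilinear map. -/
def symLift {ι : Type u} {Q : Type*} [AddCommGroup Q] [Module R Q]
    (g : MultilinearMap R (fun _ : ι => M) Q) (hg : ∀ (e : Equiv.Perm ι) v, g (fun i => v (e i)) = g v) :
    SymmetricPower R ι M →ₗ[R] Q :=
  { toFun := AddCon.lift _ (PiTensorProduct.lift g).toAddMonoidHom (by
      intro x y h
      induction h with
      | of x y h =>
        cases h with
        | perm e v => simpa [AddCon.ker_rel] using (hg e v).symm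
      | refl => exact AddCon.refl _ _
      | symm _ ih => exact AddCon.symm _ ih
      | trans _ _ ih ih' => exact AddCon.trans _ ih ih'
      | add _ _ ih ih' => exact AddCon.add _ ih ih')
    map_add' := map_add _
    map_smul' := fun r x => AddCon.induction_on x fun x => (PiTensorProduct.lift g).map_smul r x }

theorem symLift_tprod {ι : Type u} {Q : Type*} [AddCommGroup Q] [Module R Q]
    (g : MultilinearMap R (fun _ : ι => M) Q) (hg : ∀ (e : Equiv.Perm ι) v, g (fun i => v (e i)) = g v)
    (v : ι → M) : symLift g hg (SymmetricPower.tprod R v) = g v :=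
  PiTensorProduct.lift.tprod (φ := g) v

theorem symMap_isExt (j : ℕ) {f : M →ₛₗ[σ] N} (hf : IsExt f) : IsExt (symMap j f) := by
  intro Q _ _ g
  let _ : Module R Q := Module.compHom Q σ
  let g' : SymmetricPower R (ULift.{u} (Fin j)) M →ₗ[R] Q :=
    { g with map_smul' := fun r m => g.map_smulₛₗ r m }
  let k : MultilinearMap R (fun _ : ULift.{u} (Fin j) => M) Q :=
    g'.compMultilinearMap (SymmetricPower.tprod R)
  obtain ⟨G₀, hG₀⟩ := hf.exists_multilinear j (k.domDomCongr Equiv.ulift)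
  let G : MultilinearMap S (fun _ : ULift.{u} (Fin j) => N) Q := G₀.domDomCongr Equiv.ulift.symm
  have hG (v) : G (fun i => f (v i)) = k v := hG₀ (fun i => v ⟨i⟩)
  refine ⟨symLift G fun e v => ?_, fun x => ?_, fun h hh => ?_⟩
  · have : G.domDomCongr e = G := hf.multilinear_ext fun v => by
      refine (hG fun i => v (e i)).trans (Eq.trans ?_ (hG v).symm)
      exact congrArg g (SymmetricPower.tprod_equiv e v)
    exact congr($this v)
  · induction x using sym_induction with
    | h v => rw [symMap_tprod, symLift_tprod]; exact hG v
    | h0 => simp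
    | hadd x y hx hy => simp only [map_add, hx, hy]
    | hsmul r x hx => simp only [map_smulₛₗ, hx]; rfl
  · refine LinearMap.ext_on_range (SymmetricPower.span_tprod_eq_top S _ _) fun w => ?_
    have : h.compMultilinearMap (SymmetricPower.tprod S) = G := hf.multilinear_ext fun v => by
      rw [hG, LinearMap.compMultilinearMap_apply, ← symMap_tprod]
      exact hh _
    rw [symLift_tprod, ← this]; rfl

theorem sumMap_isExt {M' N' : Type u} [AddCommGroup M'] [AddCommGroup N'] [Module R M']
    [Module S N'] {f : M →ₛₗ[σ] N} (hf : IsExt f) {f' : M' →ₛₗ[σ] N'} (hf' : IsExt f') :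
    IsExt (sumMap f f') := by
  intro Q _ _ g
  let g₁ : M →ₛₗ[σ] Q := g ∘ₛₗ LinearMap.inl R M M'
  let g₂ : M' →ₛₗ[σ] Q := g ∘ₛₗ LinearMap.inr R M M'
  refine ⟨(hf.lift g₁).coprod (hf'.lift g₂), fun x => ?_, fun h hh => ?_⟩
  · change (hf.lift g₁).coprod (hf'.lift g₂) (f x.1, f' x.2) = _
    rw [LinearMap.coprod_apply, hf.lift_apply, hf'.lift_apply]
    change g _ + g _ = _
    rw [← map_add]; simp
  · refine LinearMap.prod_ext (hf.ext fun m => ?_) (hf'.ext fun m => ?_)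
    · have := hh (m, 0)
      simp only [sumMap, LinearMap.coe_mk, AddHom.coe_mk, map_zero] at this
      simpa [hf.lift_apply, g₁] using this
    · have := hh (0, m)
      simp only [sumMap, LinearMap.coe_mk, AddHom.coe_mk, map_zero] at this
      simpa [hf'.lift_apply, g₂] using this

/-- A finite projective module has a finite dual basis. -/
theorem exists_dualBasis (R : Type u) [CommRing R] (M : Type u) [AddCommGroup M] [Module R M]
    [Module.Finite R M] [Module.Projective R M] :
    ∃ (n : ℕ) (m : Fin n → M) (φ : Fin n → Module.Dual R M), ∀ x, x = ∑ i, φ i x • m i := by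
  obtain ⟨n, f, g, -, -, h⟩ := Module.Finite.exists_comp_eq_id_of_projective R M
  refine ⟨n, fun i => f (Pi.single i 1), fun i => LinearMap.proj i ∘ₗ g, fun x => ?_⟩
  conv_lhs => rw [← LinearMap.id_apply (R := R) x, ← h, LinearMap.comp_apply, pi_eq_sum_univ' (g x)]
  simp only [map_sum, map_smul, LinearMap.comp_apply, LinearMap.proj_apply]

theorem dualMap_isExt {f : M →ₛₗ[σ] N} (hf : IsExt f) [Module.Finite R M] [Module.Projective R M] :
    IsExt (dualMap f) := by
  obtain ⟨n, m, φ, h⟩ := exists_dualBasis R M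
  intro Q _ _ g
  have hd := dualMap_apply f (dual_existsUnique hf)
  refine ⟨∑ i, (LinearMap.toSpanSingleton S Q (g (φ i))) ∘ₗ (LinearMap.applyₗ (f (m i))), fun ψ => ?_,
    fun k hk => LinearMap.ext fun ψ => ?_⟩
  · have : ψ = ∑ i, ψ (m i) • φ i := LinearMap.ext fun x => by
      conv_lhs => rw [h x]
      simp [mul_comm]
    conv_rhs => rw [this]
    simp [hd]
  · have : ψ = ∑ i, ψ (f (m i)) • dualMap f (φ i) := hf.ext fun x => by
      conv_lhs => rw [h x]
      simp [hd, mul_comm]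
    conv_lhs => rw [this]
    simp [hk]

/-! ### Finite projective modules -/

theorem sym_projective_of_basis {I : Type u} [Finite I] {F : Type u} [AddCommGroup F] [Module R F]
    (b : Module.Basis I R F) (j : ℕ) : Module.Projective R (SymmetricPower R (ULift.{u} (Fin j)) F) := by
  classical
  letI := Fintype.ofFinite I
  let ι := ULift.{u} (Fin j)
  let c : F →ₗ[R] MvPolynomial I R := b.constr R fun i => MvPolynomial.X i
  let g : MultilinearMap R (fun _ : ι => F) (MvPolynomial I R) :=
    (MultilinearMap.mkPiAlgebra R ι (MvPolynomial I R)).compLinearMap fun _ => c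
  have hg (e : Equiv.Perm ι) (v : ι → F) : g (fun i => v (e i)) = g v := by
    simp only [g, MultilinearMap.compLinearMap_apply, MultilinearMap.mkPiAlgebra_apply]
    exact Equiv.prod_comp e fun i => c (v i)
  let deg (w : ι → I) : I →₀ ℕ := ∑ k, Finsupp.single (w k) 1
  let ψ : MvPolynomial I R →ₗ[R] SymmetricPower R ι F :=
    (MvPolynomial.basisMonomials I R).constr R fun s =>
      if h : ∃ w, deg w = s then SymmetricPower.tprod R (fun k => b (h.choose k)) else 0
  haveI : Module.Projective R (MvPolynomial I R) :=
    Module.Projective.of_basis (MvPolynomial.basisMonomials I R)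
  refine Module.Projective.of_split (symLift g hg) ψ (LinearMap.ext fun x => ?_)
  have key : (ψ ∘ₗ symLift g hg).compMultilinearMap (SymmetricPower.tprod R) =
      SymmetricPower.tprod R := by
    refine Module.Basis.ext_multilinear (fun _ => b) fun w => ?_
    rw [LinearMap.compMultilinearMap_apply, LinearMap.comp_apply, symLift_tprod]
    have h1 : g (fun k => b (w k)) = MvPolynomial.basisMonomials I R (deg w) := by
      simp only [g, MultilinearMap.compLinearMap_apply, MultilinearMap.mkPiAlgebra_apply, c,
        Module.Basis.constr_basis, MvPolynomial.coe_basisMonomials, deg]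
      simp only [MvPolynomial.X]
      exact (MvPolynomial.monomial_sum_one _ _).symm
    rw [h1]
    simp only [ψ, Module.Basis.constr_basis]
    have hex : ∃ w', deg w' = deg w := ⟨w, rfl⟩
    rw [dif_pos hex]
    have hc (i : I) : Nonempty ({k // w k = i} ≃ {k // hex.choose k = i}) := by
      have := DFunLike.congr_fun hex.choose_spec i
      simp only [deg, Finsupp.coe_finset_sum, Finset.sum_apply, Finsupp.single_apply,
        Finset.sum_boole, Nat.cast_id] at this
      refine ⟨Fintype.equivOfCardEq ?_⟩
      rw [Fintype.card_subtype, Fintype.card_subtype, this]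
    let e : Equiv.Perm ι := Equiv.ofFiberEquiv fun i => (hc i).some
    have he (k) : hex.choose (e k) = w k := Equiv.ofFiberEquiv_map _ k
    rw [← SymmetricPower.tprod_equiv e]
    simp only [he]
  induction x using sym_induction with
  | h v => exact congr($key v)
  | h0 => simp
  | hadd x y hx hy => simp only [map_add, hx, hy]
  | hsmul r x hx => simp only [map_smul, hx]

theorem sym_finite [Module.Finite R M] (j : ℕ) :
    Module.Finite R (SymmetricPower R (ULift.{u} (Fin j)) M) :=
  Module.Finite.of_surjective (SymmetricPower.mk R (ULift.{u} (Fin j)) M)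
    (LinearMap.range_eq_top.1 (SymmetricPower.range_mk R _ M))

theorem sym_projective [Module.Finite R M] [Module.Projective R M] (j : ℕ) :
    Module.Projective R (SymmetricPower R (ULift.{u} (Fin j)) M) := by
  obtain ⟨n, f, g, -, -, h⟩ := Module.Finite.exists_comp_eq_id_of_projective R M
  haveI := sym_projective_of_basis (Pi.basisFun R (ULift.{u} (Fin n))) j
  let e : (ULift.{u} (Fin n) → R) ≃ₗ[R] (Fin n → R) := LinearEquiv.funCongrLeft R R Equiv.ulift.symm
  refine Module.Projective.of_split (symMap j (e.symm.toLinearMap ∘ₗ g))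
    (symMap j (f ∘ₗ e.toLinearMap)) (LinearMap.ext fun x => ?_)
  have h' (m) : (f ∘ₗ e.toLinearMap) ((e.symm.toLinearMap ∘ₗ g) m) = m := by
    simpa using LinearMap.congr_fun h m
  refine (symMap_comp j _ _ LinearMap.id (fun _ => rfl) (fun m => (h' m).symm) x).symm.trans ?_
  induction x using sym_induction with
  | h v => exact symMap_tprod j _ v
  | h0 => simp
  | hadd x y hx hy => rw [map_add, hx, hy, map_add]
  | hsmul r x hx => rw [map_smul, hx, map_smul]

theorem exterior_projective [Module.Finite R M] [Module.Projective R M] (i : ℕ) :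
    Module.Projective R (⋀[R]^i M) := by
  obtain ⟨n, f, g, -, -, h⟩ := Module.Finite.exists_comp_eq_id_of_projective R M
  refine Module.Projective.of_split (exteriorPower.map i g) (exteriorPower.map i f) ?_
  rw [← exteriorPower.map_comp, h, exteriorPower.map_id]

theorem finite_projective (t : TensorialConstruction) (M : ModuleCat.{u} R) [Module.Finite R M]
    [Module.Projective R M] : Module.Finite R (t.obj M) ∧ Module.Projective R (t.obj M) := by
  induction t with
  | id => exact ⟨‹_›, ‹_›⟩
  | tensor a b ha hb =>
    haveI := ha.1; haveI := ha.2; haveI := hb.1; haveI := hb.2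
    exact ⟨inferInstanceAs (Module.Finite R (a.obj M ⊗[R] b.obj M)),
      inferInstanceAs (Module.Projective R (a.obj M ⊗[R] b.obj M))⟩
  | exterior i a ha =>
    haveI := ha.1; haveI := ha.2
    exact ⟨inferInstanceAs (Module.Finite R (⋀[R]^i (a.obj M))), exterior_projective i⟩
  | sym j a ha =>
    haveI := ha.1; haveI := ha.2
    exact ⟨sym_finite j, sym_projective j⟩
  | sum a b ha hb =>
    haveI := ha.1; haveI := ha.2; haveI := hb.1; haveI := hb.2
    exact ⟨inferInstanceAs (Module.Finite R (a.obj M × b.obj M)),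
      inferInstanceAs (Module.Projective R (a.obj M × b.obj M))⟩
  | dual a ha =>
    haveI := ha.1; haveI := ha.2
    exact ⟨inferInstanceAs (Module.Finite R (Module.Dual R (a.obj M))),
      inferInstanceAs (Module.Projective R (Module.Dual R (a.obj M)))⟩

theorem map_isExt (t : TensorialConstruction) {M : ModuleCat.{u} R} {N : ModuleCat.{u} S}
    [Module.Finite R M] [Module.Projective R M] {f : M →ₛₗ[σ] N} (hf : IsExt f) :
    IsExt (t.map f) := by
  induction t with
  | id => exact hf
  | tensor a b ha hb => exact tensorMap_isExt ha hb
  | exterior i a ha => exact exteriorMap_isExt i ha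
  | sym j a ha => exact symMap_isExt j ha
  | sum a b ha hb => exact sumMap_isExt ha hb
  | dual a ha =>
    haveI := (a.finite_projective M).1; haveI := (a.finite_projective M).2
    exact dualMap_isExt ha

theorem map_comp (t : TensorialConstruction) {M : ModuleCat.{u} R} {N : ModuleCat.{u} S}
    {P : ModuleCat.{u} T} [Module.Finite R M] [Module.Projective R M] {f : M →ₛₗ[σ] N} (hf : IsExt f)
    {g : N →ₛₗ[τ] P} (hg : IsExt g) (k : M →ₛₗ[ρ] P)
    (hρ : ∀ r, ρ r = τ (σ r)) (hk : ∀ m, k m = g (f m)) (x : t.obj M) :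
    t.map k x = t.map g (t.map f x) := by
  haveI := hf.finite; haveI := hf.projective
  induction t with
  | id => exact hk x
  | tensor a b ha hb => exact tensorMap_comp _ _ _ _ _ _ ha hb x
  | exterior i a ha => exact exteriorMap_comp i _ _ _ hρ ha x
  | sym j a ha => exact symMap_comp j _ _ _ hρ ha x
  | sum a b ha hb => exact Prod.ext (ha _) (hb _)
  | dual a ha => exact dualMap_comp (a.map_isExt hf) (a.map_isExt hg) _ hρ ha x

end TensorialConstruction

end

noncomputable section

namespace AlgebraicGeometry.Scheme.Modules
variable {X Y Z T : Scheme.{u}}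

/-! ### Pulling back sections -/

/-- The pullback of a section along a morphism of schemes. -/
def pullSection (f : Y ⟶ Z) {M : Z.Modules} {U : Z.Opens} (s : Γ(M, U)) :
    Γ((pullback f).obj M, f ⁻¹ᵁ U) :=
  ((pullbackPushforwardAdjunction f).unit.app M).app U s

theorem pullSection_add (f : Y ⟶ Z) {M : Z.Modules} {U : Z.Opens} (s s' : Γ(M, U)) :
    pullSection f (s + s') = pullSection f s + pullSection f s' :=
  map_add (((pullbackPushforwardAdjunction f).unit.app M).app U).hom s s'

theorem pullSection_smul (f : Y ⟶ Z) {M : Z.Modules} {U : Z.Opens} (r : Γ(Z, U)) (s : Γ(M, U)) :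
    pullSection f (r • s) = f.app U r • pullSection f s :=
  Hom.app_smul ((pullbackPushforwardAdjunction f).unit.app M) r s

theorem pullSection_map (f : Y ⟶ Z) {M : Z.Modules} {U V : Z.Opens} (i : U ⟶ V) (s : Γ(M, V)) :
    pullSection f (M.presheaf.map i.op s) =
      ((pullback f).obj M).presheaf.map ((TopologicalSpace.Opens.map f.base).map i).op (pullSection f s) :=
  congr($((((pullbackPushforwardAdjunction f).unit.app M).mapPresheaf).naturality i.op) s)

theorem pullSection_naturality (f : Y ⟶ Z) {M N : Z.Modules} (φ : M ⟶ N) {U : Z.Opens} (s : Γ(M, U)) :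
    pullSection f (φ.app U s) = ((pullback f).map φ).app (f ⁻¹ᵁ U) (pullSection f s) :=
  congr(Hom.app $((pullbackPushforwardAdjunction f).unit.naturality φ) U s)

theorem pullSection_comp (f : T ⟶ Y) (g : Y ⟶ Z) {M : Z.Modules} {U : Z.Opens} (s : Γ(M, U)) :
    ((pullbackComp f g).hom.app M).app _ (pullSection f (pullSection g s)) = pullSection (f ≫ g) s := by
  have h := unit_conjugateEquiv ((pullbackPushforwardAdjunction g).comp (pullbackPushforwardAdjunction f))
    (pullbackPushforwardAdjunction (f ≫ g)) (pullbackComp f g).inv M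
  rw [conjugateEquiv_pullbackComp_inv] at h
  have h' := congr(Hom.app $h U s)
  have h'' : pullSection f (pullSection g s) = ((pullbackComp f g).inv.app M).app _ (pullSection (f ≫ g) s) := h'
  rw [h'']
  exact congr(Hom.app $((pullbackComp f g).inv_hom_id_app M) _ (pullSection (f ≫ g) s))

theorem pullSection_id {M : Z.Modules} {U : Z.Opens} (s : Γ(M, U)) :
    ((pullbackId Z).hom.app M).app U (pullSection (𝟙 Z) s) = s := by
  have h := unit_conjugateEquiv .id (pullbackPushforwardAdjunction (𝟙 Z)) (pullbackId Z).hom M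
  rw [conjugateEquiv_pullbackId_hom] at h
  exact congr(Hom.app $h U s).symm

/-- For `f ≫ x = y`, the pullback along `f` of a section of `x^* M` to a section of `y^* M`. -/
def resSection (f : T ⟶ Y) {x : Y ⟶ Z} {y : T ⟶ Z} (h : f ≫ x = y) {M : Z.Modules} {U : Y.Opens}
    (s : Γ((pullback x).obj M, U)) : Γ((pullback y).obj M, f ⁻¹ᵁ U) :=
  ((pullbackComp f x).hom.app M ≫ eqToHom (by rw [h])).app _ (pullSection f s)

theorem resSection_rfl (f : T ⟶ Y) {x : Y ⟶ Z} {M : Z.Modules} {U : Y.Opens}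
    (s : Γ((pullback x).obj M, U)) :
    resSection f (rfl : f ≫ x = f ≫ x) s = ((pullbackComp f x).hom.app M).app _ (pullSection f s) := by
  simp [resSection]

theorem resSection_resSection {T' : Scheme.{u}} (f' : T' ⟶ T) (f : T ⟶ Y) {x : Y ⟶ Z} {y : T ⟶ Z}
    {z : T' ⟶ Z} (h : f ≫ x = y) (h' : f' ≫ y = z) {M : Z.Modules} {U : Y.Opens}
    (s : Γ((pullback x).obj M, U)) :
    resSection f' h' (resSection f h s) =
      resSection (f' ≫ f) (by rw [Category.assoc, h, h']) s := by
  subst h h'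
  rw [resSection_rfl, resSection_rfl, pullSection_naturality]
  have h := pullbackComp_assoc f' f x M
  refine congr(Hom.app $(h.symm) _ (pullSection f' (pullSection f s))).trans ?_
  rw [resSection, ← pullSection_comp]
  rfl

theorem resSection_naturality (f : T ⟶ Y) {x : Y ⟶ Z} {y : T ⟶ Z} (h : f ≫ x = y) {M N : Z.Modules}
    (φ : M ⟶ N) {U : Y.Opens} (s : Γ((pullback x).obj M, U)) :
    ((pullback y).map φ).app _ (resSection f h s) = resSection f h (((pullback x).map φ).app _ s) := by
  subst h
  rw [resSection_rfl, resSection_rfl, pullSection_naturality]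
  exact congr(Hom.app $((pullbackComp f x).hom.naturality φ) _ (pullSection f s)).symm

theorem resSection_pullbackComp {W : Scheme.{u}} (f : T ⟶ Y) {x : Y ⟶ Z} {y : T ⟶ Z} (h : f ≫ x = y)
    (g : Z ⟶ W) {M : W.Modules} {U : Y.Opens} (s : Γ((pullback x).obj ((pullback g).obj M), U)) :
    ((pullbackComp y g).hom.app M).app _ (resSection f h s) =
      resSection f (by rw [← h, Category.assoc]) (((pullbackComp x g).hom.app M).app _ s) := by
  subst h
  rw [resSection_rfl, resSection, pullSection_naturality]
  have h := pullbackComp_assoc f x g M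
  rw [← cancel_mono (eqToHom (by rw [Category.assoc] : (pullback (f ≫ x ≫ g)).obj M =
    (pullback ((f ≫ x) ≫ g)).obj M))] at h
  simp only [Category.assoc, eqToHom_trans, eqToHom_refl, Category.comp_id] at h
  exact congr(Hom.app $h _ (pullSection f s))

theorem resSection_id {x : Y ⟶ Z} {M : Z.Modules} {U : Y.Opens} (s : Γ((pullback x).obj M, U)) :
    resSection (𝟙 Y) (Category.id_comp x) s = s := by
  have h : pullSection (𝟙 Y) s = ((pullbackId Y).inv.app _).app _ s := by
    conv_rhs => rw [← pullSection_id s]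
    exact congr(Hom.app $((pullbackId Y).hom_inv_id_app _) _ (pullSection (𝟙 Y) s)).symm
  rw [resSection, h]
  exact congr(Hom.app $(pullbackId_inv_comp x M) _ s)

theorem resSection_map (f : T ⟶ Y) {x : Y ⟶ Z} {y : T ⟶ Z} (h : f ≫ x = y) {M : Z.Modules}
    {U V : Y.Opens} (i : U ⟶ V) (s : Γ((pullback x).obj M, V)) :
    resSection f h (((pullback x).obj M).presheaf.map i.op s) =
      ((pullback y).obj M).presheaf.map ((TopologicalSpace.Opens.map f.base).map i).op (resSection f h s) := by
  subst h
  rw [resSection_rfl, resSection_rfl, pullSection_map]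
  exact congr($((((pullbackComp f x).hom.app M).mapPresheaf).naturality
    ((TopologicalSpace.Opens.map f.base).map i).op) (pullSection f s))

/-! ### Modules of sections at affine points -/

section Points

variable {R S A : CommRingCat.{u}}

/-- The base change `Γ(Spec R, x^* M) → Γ(Spec S, y^* M)` for `x ∘ Spec σ = y`. -/
def res (M : Y.Modules) {x : Spec R ⟶ Y} {y : Spec S ⟶ Y} (σ : R ⟶ S) (h : Spec.map σ ≫ x = y) :
    (sectionsAt x).obj M →ₛₗ[σ.hom] (sectionsAt y).obj M :=
  h ▸ sectionsBaseChange x σ M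

/-- The elements of the module at an affine point are global sections. -/
def secEquiv (x : Spec R ⟶ Y) (M : Y.Modules) :
    (sectionsAt x).obj M ≃+ Γ((pullback x).obj M, ⊤) :=
  AddEquiv.refl Γ((pullback x).obj M, ⊤)

theorem secEquiv_map {M N : Y.Modules} (x : Spec R ⟶ Y) (φ : M ⟶ N) (m : (sectionsAt x).obj M) :
    secEquiv x N ((sectionsAt x).map φ m) = ((pullback x).map φ).app ⊤ (secEquiv x M m) := rfl

theorem secEquiv_sectionsPullback (x : Spec R ⟶ Y) (g : Y ⟶ Z) (M : Z.Modules)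
    (m : (sectionsAt x).obj ((pullback g).obj M)) :
    secEquiv (x ≫ g) M ((sectionsPullback x g M).hom m) =
      ((pullbackComp x g).hom.app M).app ⊤ (secEquiv x _ m) := rfl

/-- The pullback of a global section at an affine point. -/
def resTop (f : Spec S ⟶ Spec R) {x : Spec R ⟶ Y} {y : Spec S ⟶ Y} (h : f ≫ x = y) {M : Y.Modules}
    (s : Γ((pullback x).obj M, ⊤)) : Γ((pullback y).obj M, ⊤) :=
  resSection f h s

theorem resTop_resTop (f' : Spec A ⟶ Spec S) (f : Spec S ⟶ Spec R) (g : Spec A ⟶ Spec R)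
    {x : Spec R ⟶ Y} {y : Spec S ⟶ Y} {z : Spec A ⟶ Y} (h : f ≫ x = y) (h' : f' ≫ y = z)
    (hg : g = f' ≫ f) (h'' : g ≫ x = z) {M : Y.Modules} (s : Γ((pullback x).obj M, ⊤)) :
    resTop f' h' (resTop f h s) = resTop g h'' s := by
  subst hg
  exact resSection_resSection f' f h h' s

theorem secEquiv_res (M : Y.Modules) {x : Spec R ⟶ Y} {y : Spec S ⟶ Y} (σ : R ⟶ S)
    (h : Spec.map σ ≫ x = y) (m : (sectionsAt x).obj M) :
    secEquiv y M (res M σ h m) = resTop (Spec.map σ) h (secEquiv x M m) := by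
  subst h
  exact (resSection_rfl (Spec.map σ) (secEquiv x M m)).symm

theorem resTop_id {x : Spec R ⟶ Y} {M : Y.Modules} (f : Spec R ⟶ Spec R) (hf : f = 𝟙 _)
    (h : f ≫ x = x) (s : Γ((pullback x).obj M, ⊤)) : resTop f h s = s := by
  subst hf
  exact resSection_id s

theorem res_res (M : Y.Modules) {x : Spec R ⟶ Y} {y : Spec S ⟶ Y} {z : Spec A ⟶ Y} (σ : R ⟶ S)
    (τ : S ⟶ A) (h : Spec.map σ ≫ x = y) (h' : Spec.map τ ≫ y = z) (h'' : Spec.map (σ ≫ τ) ≫ x = z)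
    (m : (sectionsAt x).obj M) :
    res M τ h' (res M σ h m) = res M (σ ≫ τ) h'' m := by
  apply (secEquiv z M).injective
  rw [secEquiv_res, secEquiv_res, secEquiv_res]
  exact resTop_resTop _ _ _ h h' (Spec.map_comp σ τ) h'' _

theorem res_id (M : Y.Modules) {x : Spec R ⟶ Y} (h : Spec.map (𝟙 R) ≫ x = x) (m : (sectionsAt x).obj M) :
    res M (𝟙 R) h m = m := by
  apply (secEquiv x M).injective
  rw [secEquiv_res]
  exact resTop_id _ (Spec.map_id R) h _

theorem res_naturality {M N : Y.Modules} (φ : M ⟶ N) {x : Spec R ⟶ Y} {y : Spec S ⟶ Y} (σ : R ⟶ S)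
    (h : Spec.map σ ≫ x = y) (m : (sectionsAt x).obj M) :
    (sectionsAt y).map φ (res M σ h m) = res N σ h ((sectionsAt x).map φ m) := by
  apply (secEquiv y N).injective
  rw [secEquiv_res, secEquiv_map, secEquiv_res, secEquiv_map]
  exact resSection_naturality (Spec.map σ) h φ (secEquiv x M m)

theorem res_sectionsPullback (g : Y ⟶ Z) (M : Z.Modules) {x : Spec R ⟶ Y} {y : Spec S ⟶ Y} (σ : R ⟶ S)
    (h : Spec.map σ ≫ x = y) (m : (sectionsAt x).obj ((pullback g).obj M)) :
    (sectionsPullback y g M).hom (res _ σ h m) =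
      res M σ (by rw [← h, Category.assoc]) ((sectionsPullback x g M).hom m) := by
  apply (secEquiv (y ≫ g) M).injective
  rw [secEquiv_res, secEquiv_sectionsPullback, secEquiv_res, secEquiv_sectionsPullback]
  exact resSection_pullbackComp (Spec.map σ) h g (secEquiv x _ m)

/-- The value at `x : Spec R ⟶ Y` of a section of `M` over an open subset containing the image. -/
def ev {M : Y.Modules} (x : Spec R ⟶ Y) (U : Y.Opens) (hU : ⊤ ≤ x ⁻¹ᵁ U) (s : Γ(M, U)) :
    (sectionsAt x).obj M :=
  (secEquiv x M).symm (((pullback x).obj M).presheaf.map (homOfLE hU).op (pullSection x s))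

theorem secEquiv_ev {M : Y.Modules} (x : Spec R ⟶ Y) (U : Y.Opens) (hU : ⊤ ≤ x ⁻¹ᵁ U) (s : Γ(M, U)) :
    secEquiv x M (ev x U hU s) = ((pullback x).obj M).presheaf.map (homOfLE hU).op (pullSection x s) :=
  rfl

theorem ev_add {M : Y.Modules} (x : Spec R ⟶ Y) (U : Y.Opens) (hU : ⊤ ≤ x ⁻¹ᵁ U) (s s' : Γ(M, U)) :
    ev x U hU (s + s') = ev x U hU s + ev x U hU s' := by
  rw [ev, pullSection_add]
  exact map_add (((pullback x).obj M).presheaf.map (homOfLE hU).op).hom _ _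

/-- The restriction of functions to an affine point. -/
def evFun (x : Spec R ⟶ Y) (U : Y.Opens) (hU : ⊤ ≤ x ⁻¹ᵁ U) : Γ(Y, U) ⟶ R :=
  x.appLE U ⊤ hU ≫ (Scheme.ΓSpecIso R).hom

theorem ev_smul {M : Y.Modules} (x : Spec R ⟶ Y) (U : Y.Opens) (hU : ⊤ ≤ x ⁻¹ᵁ U) (r : Γ(Y, U))
    (s : Γ(M, U)) : ev x U hU (r • s) = evFun x U hU r • ev x U hU s := by
  rw [ev, pullSection_smul]
  refine (Modules.map_smul _ (homOfLE hU) _ _).trans ?_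
  refine Eq.trans ?_ (smul_Spec_def (M := (pullback x).obj M) (U := ⊤) _ _).symm
  congr 1
  have h1 : ((Spec R).presheaf.map (homOfLE (le_refl (⊤ : (Spec R).Opens))).op) = 𝟙 _ :=
    (Spec R).presheaf.map_id _
  change _ = ((Spec R).presheaf.map (homOfLE (le_refl (⊤ : (Spec R).Opens))).op)
    ((Scheme.ΓSpecIso R).inv ((Scheme.ΓSpecIso R).hom (x.appLE U ⊤ hU r)))
  rw [h1]
  have h2 := congr($((Scheme.ΓSpecIso R).hom_inv_id) (x.appLE U ⊤ hU r))
  refine Eq.trans ?_ h2.symm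
  rfl

theorem ev_map {M : Y.Modules} (x : Spec R ⟶ Y) {U V : Y.Opens} (i : U ⟶ V) (hU : ⊤ ≤ x ⁻¹ᵁ U)
    (s : Γ(M, V)) :
    ev x U hU (M.presheaf.map i.op s) = ev x V (hU.trans ((TopologicalSpace.Opens.map x.base).map i).le) s := by
  rw [ev, pullSection_map, ev]
  exact congr($(((pullback x).obj M).presheaf.map_comp _ _) _).symm

theorem ev_naturality {M N : Y.Modules} (φ : M ⟶ N) (x : Spec R ⟶ Y) (U : Y.Opens) (hU : ⊤ ≤ x ⁻¹ᵁ U)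
    (s : Γ(M, U)) : (sectionsAt x).map φ (ev x U hU s) = ev x U hU (φ.app U s) := by
  apply (secEquiv x N).injective
  rw [secEquiv_map, secEquiv_ev, secEquiv_ev, pullSection_naturality]
  exact congr($(((pullback x).map φ).mapPresheaf.naturality (homOfLE hU).op) (pullSection x s))

theorem res_ev {M : Y.Modules} {x : Spec R ⟶ Y} {y : Spec S ⟶ Y} (σ : R ⟶ S) (h : Spec.map σ ≫ x = y)
    (U : Y.Opens) (hU : ⊤ ≤ x ⁻¹ᵁ U) (s : Γ(M, U)) :
    res M σ h (ev x U hU s) = ev y U (by rw [← h]; exact fun _ _ => hU trivial) s := by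
  apply (secEquiv y M).injective
  rw [secEquiv_res, secEquiv_ev, secEquiv_ev]
  refine (resSection_map (Spec.map σ) h (homOfLE hU) (pullSection x s)).trans ?_
  subst h
  rw [resSection_rfl, pullSection_comp]
  rfl

theorem sectionsPullback_ev (g : Y ⟶ Z) {M : Z.Modules} (x : Spec R ⟶ Y) (U : Z.Opens)
    (hU : ⊤ ≤ x ⁻¹ᵁ (g ⁻¹ᵁ U)) (hU' : ⊤ ≤ (x ≫ g) ⁻¹ᵁ U) (s : Γ(M, U)) :
    (sectionsPullback x g M).hom (ev x (g ⁻¹ᵁ U) hU (pullSection g s)) = ev (x ≫ g) U hU' s := by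
  apply (secEquiv (x ≫ g) M).injective
  rw [secEquiv_sectionsPullback, secEquiv_ev, secEquiv_ev, ← pullSection_comp]
  exact congr($(((pullbackComp x g).hom.app M).mapPresheaf.naturality (homOfLE hU).op) _)

end Points

end AlgebraicGeometry.Scheme.Modules
end

noncomputable section

namespace AlgebraicGeometry.Scheme.Modules
variable {X Y Z T : Scheme.{u}}
open Limits

/-! ### Vector bundles -/

/-- The evident presentation of a free module. -/
def freePresentation (Y : Scheme.{u}) (I : Type u) :
    (SheafOfModules.free (R := Y.ringCatSheaf) I).Presentation where
  generators := SheafOfModules.free.generatingSections I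
  relations :=
    { I := ULift Empty
      s := fun j => j.down.elim
      epi := IsZero.epi (IsZero.of_iso (isZero_zero _) (Limits.kernel.ofMono _)) _ }

/-- A presentation of the restriction of `M` to `U`, as a module on the open subscheme, is one on the
slice site. -/
def overPresentation {M : Y.Modules} (U : Y.Opens)
    (p : SheafOfModules.Presentation (R := (U : Scheme.{u}).ringCatSheaf) (M.restrict U.ι)) :
    (SheafOfModules.over M U).Presentation :=
  let e : SheafOfModules (Y.ringCatSheaf.over U) ≌ SheafOfModules (U : Scheme.{u}).ringCatSheaf := overEquiv U
  let i : (SheafOfModules.overFunctor Y.ringCatSheaf U).obj M ≅ e.inverse.obj (M.restrict U.ι) :=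
    e.unitIso.app _ ≪≫ e.inverse.mapIso ((overFunctorEquiv U).app M)
  let j : SheafOfModules.unit (Y.ringCatSheaf.over U) ≅
      e.inverse.obj (SheafOfModules.unit (U : Scheme.{u}).ringCatSheaf) :=
    e.unitIso.app _ ≪≫ e.inverse.mapIso ((overFunctorEquiv U).app (SheafOfModules.unit Y.ringCatSheaf) ≪≫
      restrictUnitIso U.ι)
  SheafOfModules.Presentation.ofIsIso.{u, u, u} i.inv (p.map e.inverse j)

/-- Transport of a presentation along an isomorphism. -/
def presentationOfIso {M N : Y.Modules} (e : M ≅ N)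
    (p : SheafOfModules.Presentation (R := Y.ringCatSheaf) M) :
    SheafOfModules.Presentation (R := Y.ringCatSheaf) N :=
  haveI : IsIso (C := SheafOfModules Y.ringCatSheaf) e.hom :=
    inferInstanceAs (IsIso (C := Y.Modules) e.hom)
  SheafOfModules.Presentation.ofIsIso.{u, u, u} e.hom p

theorem IsVectorBundle.isQuasicoherent {M : Y.Modules} (hM : IsVectorBundle M) :
    M.IsQuasicoherent := by
  choose U hU n e using hM
  let d : SheafOfModules.QuasicoherentData (R := Y.ringCatSheaf) M :=
    { I := Y
      X := U
      coversTop := by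
        rw [Opens.coversTop_iff]
        exact TopologicalSpace.Opens.ext (Set.eq_univ_of_forall fun y =>
          Set.mem_of_mem_of_subset (hU y) (by exact le_iSup U y))
      presentation := fun y => overPresentation (U y)
        (presentationOfIso (e y).some.symm (freePresentation _ _)) }
  exact d.isQuasicoherent

instance opensMap_final (f : Y ⟶ Z) : (TopologicalSpace.Opens.map f.base).Final := by
  refine ⟨fun U => ?_⟩
  have : IsTerminal (StructuredArrow.mk (homOfLE le_top : U ⟶ (TopologicalSpace.Opens.map f.base).obj ⊤)) :=
    IsTerminal.ofUniqueHom (fun A => StructuredArrow.homMk (homOfLE le_top) (Subsingleton.elim _ _))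
      fun A m => by ext; exact Subsingleton.elim _ _
  exact isConnected_of_isTerminal _ this

/-- The pullback of a free module is free. -/
def pullbackFreeIso (f : Y ⟶ Z) (I : Type u) :
    (pullback f).obj (SheafOfModules.free (R := Z.ringCatSheaf) I) ≅
      (SheafOfModules.free (R := Y.ringCatSheaf) I : Y.Modules) :=
  haveI : (SheafOfModules.pushforward.{u} f.toRingCatSheafHom).IsRightAdjoint :=
    inferInstanceAs (Modules.pushforward f).IsRightAdjoint
  SheafOfModules.pullbackObjFreeIso f.toRingCatSheafHom I

theorem IsVectorBundle.pullback {M : Z.Modules} (hM : IsVectorBundle M) (f : Y ⟶ Z) :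
    IsVectorBundle ((pullback f).obj M) := by
  intro y
  obtain ⟨U, hU, n, ⟨e⟩⟩ := hM (f y)
  refine ⟨f ⁻¹ᵁ U, hU, n, ⟨?_⟩⟩
  refine (restrictFunctorIsoPullback (f ⁻¹ᵁ U).ι).app _ ≪≫ (pullbackComp _ f).app M ≪≫
    (pullbackCongr (morphismRestrict_ι f U).symm).app M ≪≫ ((pullbackComp (f ∣_ U) U.ι).app M).symm ≪≫
    (Modules.pullback (f ∣_ U)).mapIso (((restrictFunctorIsoPullback U.ι).app M).symm ≪≫ e) ≪≫
    pullbackFreeIso _ _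

end AlgebraicGeometry.Scheme.Modules
end

noncomputable section

namespace AlgebraicGeometry.Scheme.Modules
variable {X Y Z T : Scheme.{u}} {R S A : CommRingCat.{u}}

/-! ### Base change of the modules of sections -/

/-- The `R`-module of global sections of a module on `Spec R`. -/
def gammaMod (N : (Spec R).Modules) : ModuleCat.{u} R := (moduleSpecΓFunctor (R := R)).obj N

/-- The functoriality of `gammaMod`. -/
def gammaMap {N B : (Spec R).Modules} (k : N ⟶ B) : gammaMod N ⟶ gammaMod B :=
  (moduleSpecΓFunctor (R := R)).map k

theorem gammaMap_bijective {N : (Spec R).Modules} [IsIso N.fromTildeΓ] (B : (Spec R).Modules) :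
    Function.Bijective fun k : N ⟶ B => gammaMap k := by
  have key (k : N ⟶ B) : (tilde.adjunction.homEquiv _ _).symm ((moduleSpecΓFunctor (R := R)).map k) =
      N.fromTildeΓ ≫ k := by
    rw [Adjunction.homEquiv_counit]
    exact tilde.adjunction.counit.naturality k
  refine ⟨fun k k' h => ?_, fun g => ⟨inv N.fromTildeΓ ≫ (tilde.adjunction.homEquiv _ _).symm g, ?_⟩⟩
  · have := congrArg (tilde.adjunction.homEquiv _ _).symm h
    exact (cancel_epi N.fromTildeΓ).1 ((key k).symm.trans (this.trans (key k')))
  · apply (tilde.adjunction.homEquiv _ _).symm.injective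
    refine (key _).trans ?_
    exact IsIso.hom_inv_id_assoc _ _

theorem pushforward_smul_Spec (σ : R ⟶ S) (P : (Spec S).Modules) (r : R)
    (s : gammaMod ((pushforward (Spec.map σ)).obj P)) :
    r • s = (show gammaMod ((pushforward (Spec.map σ)).obj P) from σ r • (show gammaMod P from s)) := by
  have h : (Spec.map σ).app ⊤ ((Scheme.ΓSpecIso R).inv r) = (Scheme.ΓSpecIso S).inv (σ r) :=
    (congr($(Scheme.ΓSpecIso_inv_naturality σ) r)).symm
  have hR : ∀ (P : (Spec R).Modules) (a : Γ(P, ⊤)), r • a = (Scheme.ΓSpecIso R).inv r • a := by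
    intro P a; rw [smul_Spec_def]; congr 1
  have hS : ∀ (P : (Spec S).Modules) (a : Γ(P, ⊤)), σ r • a = (Scheme.ΓSpecIso S).inv (σ r) • a := by
    intro P a; rw [smul_Spec_def]; congr 1
  refine (hR _ s).trans (Eq.trans ?_ (hS P s).symm)
  exact congrArg (fun a : Γ(Spec S, ⊤) => a • (show Γ(P, ⊤) from s)) h

theorem isExt_of_homEquiv (σ : R ⟶ S) {N : (Spec R).Modules} {P : (Spec S).Modules}
    [IsIso N.fromTildeΓ] [IsIso P.fromTildeΓ] (i : (pullback (Spec.map σ)).obj N ≅ P)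
    (f : gammaMod N →ₛₗ[σ.hom] gammaMod P)
    (hf : ∀ s : Γ(N, ⊤), f s =
      ((pullbackPushforwardAdjunction (Spec.map σ)).homEquiv _ _ i.hom).app ⊤ s) : IsExt f := by
  let adj := pullbackPushforwardAdjunction (Spec.map σ)
  let u := adj.homEquiv _ _ i.hom
  intro Q _ _ g
  let B := tilde (ModuleCat.of S Q)
  let t : ModuleCat.of S Q ≅ gammaMod B := tilde.isoTop (ModuleCat.of S Q)
  have hu (l : P ⟶ B) : u ≫ (pushforward (Spec.map σ)).map l = adj.homEquiv _ _ (i.hom ≫ l) :=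
    (adj.homEquiv_naturality_right _ _).symm
  refine existsUnique_of_exists_of_unique ?_ fun h h' hh hh' => ?_
  · let g₀ : gammaMod N →ₗ[R] gammaMod ((pushforward (Spec.map σ)).obj B) :=
      { toFun := fun m => t.hom (g m)
        map_add' := fun m m' => (congrArg t.hom.hom (g.map_add m m')).trans (map_add t.hom.hom _ _)
        map_smul' := fun r m => by
          refine (congrArg t.hom.hom (map_smulₛₗ g r m)).trans ?_
          refine (_root_.map_smul t.hom.hom _ _).trans ?_
          exact (pushforward_smul_Spec σ B r _).symm }
    let g' := ModuleCat.ofHom g₀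
    obtain ⟨k, hk⟩ := (gammaMap_bijective ((pushforward (Spec.map σ)).obj B)).2 g'
    let l : P ⟶ B := i.inv ≫ (adj.homEquiv _ _).symm k
    have hl : u ≫ (pushforward (Spec.map σ)).map l = k := by
      rw [hu]; simp [l]
    refine ⟨t.inv.hom ∘ₗ (gammaMap l).hom, fun m => ?_⟩
    have h1 : l.app ⊤ (u.app ⊤ m) = t.hom (g m) :=
      (congr(Hom.app $hl ⊤ m)).trans (congrArg (fun q => q.hom m) hk)
    have h2 : (gammaMap l).hom (f m) = t.hom (g m) :=
      (congrArg _ (hf m)).trans h1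
    rw [LinearMap.comp_apply, h2]
    exact congr($(t.hom_inv_id) (g m))
  · let h₀ := ModuleCat.ofHom h
    let h₀' := ModuleCat.ofHom h'
    obtain ⟨l, hl⟩ := (gammaMap_bijective (N := P) B).2 (h₀ ≫ t.hom)
    obtain ⟨l', hl'⟩ := (gammaMap_bijective (N := P) B).2 (h₀' ≫ t.hom)
    have h3 : u ≫ (pushforward (Spec.map σ)).map l = u ≫ (pushforward (Spec.map σ)).map l' := by
      apply (gammaMap_bijective _).1
      ext m
      have e1 : (gammaMap l).hom (f m) = t.hom (g m) :=
        (congrArg (fun q => q.hom (f m)) hl).trans (congrArg t.hom (hh m))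
      have e2 : (gammaMap l').hom (f m) = t.hom (g m) :=
        (congrArg (fun q => q.hom (f m)) hl').trans (congrArg t.hom (hh' m))
      have e3 := (congrArg (gammaMap l).hom (hf m)).symm.trans (e1.trans e2.symm)
      exact e3.trans (congrArg (gammaMap l').hom (hf m))
    rw [hu, hu] at h3
    have h4 : l = l' := (cancel_epi i.hom).1 ((adj.homEquiv _ _).injective h3)
    have h5 : h₀ = h₀' := (cancel_mono t.hom).1 (hl.symm.trans (Eq.trans (by rw [h4]) hl'))
    exact congrArg ModuleCat.Hom.hom h5

theorem IsVectorBundle.isIso_fromTildeΓ {M : Y.Modules} (hM : IsVectorBundle M) (x : Spec R ⟶ Y) :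
    IsIso ((Modules.pullback x).obj M).fromTildeΓ :=
  haveI := (hM.pullback x).isQuasicoherent
  inferInstance

theorem res_isExt_of_isIso {M : Y.Modules} {x : Spec R ⟶ Y} {y : Spec S ⟶ Y}
    (hx : IsIso ((pullback x).obj M).fromTildeΓ) (hy : IsIso ((pullback y).obj M).fromTildeΓ)
    (σ : R ⟶ S) (h : Spec.map σ ≫ x = y) : IsExt (res M σ h) := by
  subst h
  refine isExt_of_homEquiv σ ((pullbackComp (Spec.map σ) x).app M) (res M σ rfl) fun s => ?_
  rw [Adjunction.homEquiv_unit]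
  rfl

theorem IsVectorBundle.res_isExt {M : Y.Modules} (hM : IsVectorBundle M) {x : Spec R ⟶ Y}
    {y : Spec S ⟶ Y} (σ : R ⟶ S) (h : Spec.map σ ≫ x = y) : IsExt (res M σ h) :=
  res_isExt_of_isIso (hM.isIso_fromTildeΓ x) (hM.isIso_fromTildeΓ y) σ h

theorem pullSection_bijective (f : Y ⟶ Z) [IsOpenImmersion f] (M : Z.Modules) (U : Z.Opens)
    (hU : U ≤ f.opensRange) : Function.Bijective (pullSection f (M := M) (U := U)) := by
  have h := Adjunction.unit_leftAdjointUniq_hom_app (restrictAdjunction f)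
    (pullbackPushforwardAdjunction f) M
  have h1 : ((pullbackPushforwardAdjunction f).unit.app M).app U =
      M.presheaf.map (homOfLE (f.image_preimage_le U)).op ≫
        ((restrictFunctorIsoPullback f).hom.app M).app (f ⁻¹ᵁ U) := congr(Hom.app $h U).symm
  have h2 : f ''ᵁ f ⁻¹ᵁ U = U := by
    rw [Scheme.Hom.image_preimage_eq_opensRange_inf]; exact inf_eq_right.2 hU
  haveI : IsIso (homOfLE (f.image_preimage_le U)) := ⟨eqToHom h2.symm, by simp, by simp⟩
  haveI : IsIso (((restrictFunctorIsoPullback f).hom.app M).app (f ⁻¹ᵁ U)) := inferInstance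
  have h3 := (ConcreteCategory.bijective_of_isIso
    (((restrictFunctorIsoPullback f).hom.app M).app (f ⁻¹ᵁ U))).comp
    (ConcreteCategory.bijective_of_isIso (M.presheaf.map (homOfLE (f.image_preimage_le U)).op))
  convert h3 using 1
  funext s
  exact congr($h1 s)

/-- Sections over an affine open are the module at the corresponding affine point. -/
theorem ev_bijective (x : Spec R ⟶ Y) [IsOpenImmersion x] (M : Y.Modules) (U : Y.Opens)
    (hU : U = x.opensRange) (h : ⊤ ≤ x ⁻¹ᵁ U) : Function.Bijective (ev (M := M) x U h) := by
  have h1 : IsIso (homOfLE h) := ⟨homOfLE le_top, by simp, by simp⟩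
  have h2 : IsIso (((pullback x).obj M).presheaf.map (homOfLE h).op) := inferInstance
  exact (secEquiv x M).symm.bijective.comp ((ConcreteCategory.bijective_of_isIso
    (((pullback x).obj M).presheaf.map (homOfLE h).op)).comp (pullSection_bijective x M U hU.le))

/-- Compatible isomorphisms between the modules of a free module at a point. -/
def sectionsAtFreeIso (x : Spec R ⟶ Y) (I : Type u) :
    (sectionsAt x).obj (SheafOfModules.free (R := Y.ringCatSheaf) I) ≅ ModuleCat.of R (I →₀ R) :=
  (moduleSpecΓFunctor (R := R)).mapIso (pullbackFreeIso x I ≪≫ (tildeFinsupp (R := R) I).symm) ≪≫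
    (tilde.isoTop (ModuleCat.of R (I →₀ R))).symm

theorem sectionsAt_free {M : Y.Modules} {U : Y.Opens} {I : Type u}
    (e : M.restrict U.ι ≅ SheafOfModules.free (R := (U : Scheme.{u}).ringCatSheaf) I)
    (z : Spec R ⟶ U) :
    Nonempty ((sectionsAt (z ≫ U.ι)).obj M ≅ ModuleCat.of R (I →₀ R)) :=
  ⟨(sectionsPullback z U.ι M).symm ≪≫ (sectionsAt z).mapIso (((restrictFunctorIsoPullback U.ι).app M).symm
    ≪≫ e) ≪≫ sectionsAtFreeIso z I⟩

end AlgebraicGeometry.Scheme.Modules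
end

noncomputable section

/-! ### Faithfully flat descent for elements of modules -/

section FlatCover

open TensorProduct

/-- A finite family of flat ring homomorphisms which is jointly surjective on spectra. -/
structure IsFlatCover {ι : Type u} {R : Type u} [CommRing R] {S : ι → Type u} [∀ i, CommRing (S i)]
    (σ : ∀ i, R →+* S i) : Prop where
  finite : Finite ι
  flat : ∀ i, (σ i).Flat
  surj : ∀ p : PrimeSpectrum R, ∃ i q, PrimeSpectrum.comap (σ i) q = p

section Algebra

variable {ι R : Type u} [CommRing R] {S : ι → Type u} [∀ i, CommRing (S i)] [∀ i, Algebra R (S i)]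
  (N : Type u) [AddCommGroup N] [Module R N]

theorem IsFlatCover.faithfullyFlat (h : IsFlatCover fun i => algebraMap R (S i)) :
    Module.FaithfullyFlat R (∀ i, S i) := by
  have := h.finite
  have h1 (i) : Module.Flat R (S i) := (RingHom.flat_algebraMap_iff).1 (h.flat i)
  classical
  have : Module.Flat R (∀ i, S i) := by
    cases nonempty_fintype ι
    exact Module.Flat.of_linearEquiv (DirectSum.linearEquivFunOnFintype R ι S).symm
  refine .of_comap_surjective fun p => ?_
  obtain ⟨i, q, hq⟩ := h.surj p
  refine ⟨PrimeSpectrum.comap (Pi.evalRingHom S i) q, ?_⟩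
  rw [← hq, ← PrimeSpectrum.comap_comp_apply]
  rfl

variable {N} in
theorem pi_tensor_eq_zero [Finite ι] (y : (∀ i, S i) ⊗[R] N)
    (h : ∀ i, (LinearMap.proj (R := R) (φ := S) i).rTensor N y = 0) : y = 0 := by
  classical
  cases nonempty_fintype ι
  apply (TensorProduct.piLeft R N S).injective
  rw [map_zero]
  funext i
  have key : ∀ y : (∀ i, S i) ⊗[R] N, TensorProduct.piLeft R N S y i =
      (LinearMap.proj (R := R) (φ := S) i).rTensor N y := by
    intro y
    induction y with
    | zero => simp
    | add a b ha hb => rw [map_add, map_add, Pi.add_apply, ha, hb]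
    | tmul a n => simp
  rw [key]; exact h i

variable {N} in
theorem exists_pi_tensor [Finite ι] (x : ∀ i, S i ⊗[R] N) :
    ∃ y : (∀ i, S i) ⊗[R] N, ∀ i, (LinearMap.proj (R := R) (φ := S) i).rTensor N y = x i := by
  classical
  cases nonempty_fintype ι
  refine ⟨(TensorProduct.piLeft R N S).symm x, fun i => ?_⟩
  have key : ∀ y : (∀ i, S i) ⊗[R] N, TensorProduct.piLeft R N S y i =
      (LinearMap.proj (R := R) (φ := S) i).rTensor N y := by
    intro y
    induction y with
    | zero => simp
    | add a b ha hb => rw [map_add, map_add, Pi.add_apply, ha, hb]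
    | tmul a n => simp
  rw [← key, LinearEquiv.apply_symm_apply]

theorem amitsur_exact (A : Type u) [CommRing A] [Algebra R A] [Module.FaithfullyFlat R A] :
    Function.Exact (TensorProduct.mk R A N 1)
      ((TensorProduct.mk R A N 1).lTensor A - TensorProduct.mk R A (A ⊗[R] N) 1) := by
  apply Module.FaithfullyFlat.lTensor_reflects_exact R A
  let c {P : Type u} [AddCommGroup P] [Module R P] : A ⊗[R] (A ⊗[R] P) →ₗ[R] A ⊗[R] P :=
    (LinearMap.mul' R A).rTensor P ∘ₗ (TensorProduct.assoc R A A P).symm.toLinearMap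
  have hc {P : Type u} [AddCommGroup P] [Module R P] (a b : A) (p : P) :
    c (a ⊗ₜ[R] (b ⊗ₜ[R] p)) = (a * b) ⊗ₜ p := by simp [c]
  intro z
  have h1 : ∀ z : A ⊗[R] (A ⊗[R] N),
      c (((TensorProduct.mk R A N 1).lTensor A - TensorProduct.mk R A (A ⊗[R] N) 1).lTensor A z) =
        (TensorProduct.mk R A N 1).lTensor A (c z) - z := by
    intro z
    induction z with
    | zero => simp
    | add x y hx hy => rw [map_add, map_add, hx, hy, map_add, map_add]; abel
    | tmul a w =>
      induction w with
      | zero => simp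
      | add x y hx hy => rw [tmul_add, map_add, map_add, hx, hy, map_add, map_add]; abel
      | tmul b n =>
        rw [LinearMap.lTensor_tmul, LinearMap.sub_apply, tmul_sub, map_sub, LinearMap.lTensor_tmul]
        simp [hc]
  constructor
  · intro hz
    have h2 := h1 z
    rw [hz, map_zero] at h2
    exact ⟨c z, sub_eq_zero.1 h2.symm⟩
  · rintro ⟨w, rfl⟩
    rw [← LinearMap.comp_apply, ← LinearMap.lTensor_comp]
    have h3 : ((TensorProduct.mk R A N 1).lTensor A - TensorProduct.mk R A (A ⊗[R] N) 1) ∘ₗ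
      TensorProduct.mk R A N 1 = 0 := by ext n; simp
    rw [h3]; simp

variable {N} in
theorem IsFlatCover.exists_of_tensor (h : IsFlatCover fun i => algebraMap R (S i))
    (x : ∀ i, S i ⊗[R] N)
    (hx : ∀ i j, (TensorProduct.mk R (S j) N 1).lTensor (S i) (x i) =
      TensorProduct.mk R (S i) (S j ⊗[R] N) 1 (x j)) : ∃ n : N, ∀ i, 1 ⊗ₜ n = x i := by
  have := h.finite
  have := h.faithfullyFlat
  obtain ⟨y, hy⟩ := exists_pi_tensor x
  obtain ⟨n, hn⟩ := (amitsur_exact N (∀ i, S i) y).1 (by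
    apply pi_tensor_eq_zero
    intro i
    let e := TensorProduct.leftComm R (S i) (∀ i, S i) N
    apply e.injective
    rw [map_zero]
    apply pi_tensor_eq_zero
    intro j
    have key : ∀ y : (∀ i, S i) ⊗[R] N, (LinearMap.proj (R := R) (φ := S) j).rTensor (S i ⊗[R] N)
        (e ((LinearMap.proj (R := R) (φ := S) i).rTensor ((∀ i, S i) ⊗[R] N)
        (((TensorProduct.mk R (∀ i, S i) N 1).lTensor (∀ i, S i) -
          TensorProduct.mk R (∀ i, S i) ((∀ i, S i) ⊗[R] N) 1) y))) =
        TensorProduct.leftComm R (S i) (S j) N ((TensorProduct.mk R (S j) N 1).lTensor (S i)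
          ((LinearMap.proj (R := R) (φ := S) i).rTensor N y) -
        TensorProduct.mk R (S i) (S j ⊗[R] N) 1 ((LinearMap.proj (R := R) (φ := S) j).rTensor N y)) := by
      intro y
      induction y with
      | zero => simp
      | add a b ha hb => simp only [map_add, ha, hb, map_sub]; abel
      | tmul a n => simp [e, map_sub]
    rw [key, hy, hy, hx, sub_self, map_zero])
  refine ⟨n, fun i => ?_⟩
  rw [← hy, ← hn]; simp

end Algebra

variable {ι R : Type u} [CommRing R] {S : ι → Type u} [∀ i, CommRing (S i)] {σ : ∀ i, R →+* S i}
  {N : Type u} [AddCommGroup N] [Module R N] {N' : ι → Type u} [∀ i, AddCommGroup (N' i)]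
  [∀ i, Module (S i) (N' i)] {g : ∀ i, N →ₛₗ[σ i] N' i}

/-- An element of a module is determined by its images under the members of a cover. -/
theorem IsFlatCover.eq_zero (h : IsFlatCover σ) (hg : ∀ i, IsExt (g i)) (n : N)
    (hn : ∀ i, g i n = 0) : n = 0 := by
  letI : ∀ i, Algebra R (S i) := fun i => (σ i).toAlgebra
  have h' : IsFlatCover fun i => algebraMap R (S i) := h
  have := h'.finite
  have := h'.faithfullyFlat
  apply Module.FaithfullyFlat.tensorProduct_mk_injective (A := R) (B := ∀ i, S i) N
  rw [map_zero]
  apply pi_tensor_eq_zero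
  intro i
  have h1 := (hg i).equiv_apply (tensorUnit_isExt (σ i)) n
  rw [hn, map_zero] at h1
  exact h1.symm

theorem IsFlatCover.ext (h : IsFlatCover σ) (hg : ∀ i, IsExt (g i)) {n n' : N}
    (hn : ∀ i, g i n = g i n') : n = n' :=
  sub_eq_zero.1 (h.eq_zero hg _ fun i => by rw [map_sub, hn, sub_self])

/-- Elements over the members of a cover which agree on the overlaps come from an element. -/
theorem IsFlatCover.exists_of_overlap (h : IsFlatCover σ) (hg : ∀ i, IsExt (g i)) (x : ∀ i, N' i)
    (hx : ∀ (i j) (A : Type u) [CommRing A] (τ : S i →+* A) (τ' : S j →+* A) (_ : τ.comp (σ i) = τ'.comp (σ j))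
      (Q : Type u) [AddCommGroup Q] [Module A Q] (k : N' i →ₛₗ[τ] Q) (k' : N' j →ₛₗ[τ'] Q),
      (∀ n, k (g i n) = k' (g j n)) → IsExt k → IsExt k' → k (x i) = k' (x j)) :
    ∃ n, ∀ i, g i n = x i := by
  letI : ∀ i, Algebra R (S i) := fun i => (σ i).toAlgebra
  have h' : IsFlatCover fun i => algebraMap R (S i) := h
  let e (i) : N' i ≃ₗ[S i] S i ⊗[R] N := (hg i).equiv (tensorUnit_isExt (σ i))
  have he (i n) : e i (g i n) = 1 ⊗ₜ n := (hg i).equiv_apply (tensorUnit_isExt (σ i)) n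
  obtain ⟨n, hn⟩ := h'.exists_of_tensor (fun i => e i (x i)) fun i j => by
    let A := S i ⊗[R] S j
    let Q := A ⊗[R] N
    let τ : S i →+* A := (Algebra.TensorProduct.includeLeft : S i →ₐ[R] A).toRingHom
    let τ' : S j →+* A := (Algebra.TensorProduct.includeRight : S j →ₐ[R] A).toRingHom
    let k₀ : S i ⊗[R] N →ₛₗ[τ] Q :=
      { toFun := (Algebra.TensorProduct.includeLeft : S i →ₐ[R] A).toLinearMap.rTensor N
        map_add' := map_add _
        map_smul' := fun s z => by
          induction z with
          | zero => simp
          | add a b ha hb => simp only [smul_add, map_add, ha, hb]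
          | tmul a n =>
            rw [smul_tmul', LinearMap.rTensor_tmul, LinearMap.rTensor_tmul, smul_tmul']
            exact congrArg (· ⊗ₜ[R] n) (map_mul Algebra.TensorProduct.includeLeft s a) }
    let k₁ : S j ⊗[R] N →ₛₗ[τ'] Q :=
      { toFun := (Algebra.TensorProduct.includeRight : S j →ₐ[R] A).toLinearMap.rTensor N
        map_add' := map_add _
        map_smul' := fun s z => by
          induction z with
          | zero => simp
          | add a b ha hb => simp only [smul_add, map_add, ha, hb]
          | tmul a n =>
            rw [smul_tmul', LinearMap.rTensor_tmul, LinearMap.rTensor_tmul, smul_tmul']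
            exact congrArg (· ⊗ₜ[R] n) (map_mul Algebra.TensorProduct.includeRight s a) }
    let ρ : R →+* A := algebraMap R A
    have hρ : ∀ r, ρ r = τ (σ i r) := fun r => rfl
    have hρ' : ∀ r, ρ r = τ' (σ j r) := fun r => (Algebra.TensorProduct.includeRight.commutes r).symm
    let u : N →ₛₗ[algebraMap R A] Q :=
      { toFun := fun n => 1 ⊗ₜ[R] n
        map_add' := fun _ _ => TensorProduct.tmul_add _ _ _
        map_smul' := fun r m => by
          rw [TensorProduct.tmul_smul]
          exact (algebraMap_smul A r (1 ⊗ₜ[R] m : A ⊗[R] N)).symm }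
    have hu : IsExt u := IsExt.of_isBaseChange (TensorProduct.mk R A N 1) u (fun _ => rfl)
      (TensorProduct.isBaseChange R N A)
    have hk₀ : IsExt k₀ := (tensorUnit_isExt (σ i)).of_comp k₀ hu hρ
      (fun m => by
        change (1 : A) ⊗ₜ[R] m = k₀ (1 ⊗ₜ m)
        simp [k₀]; rfl)
    have hk₁ : IsExt k₁ := (tensorUnit_isExt (σ j)).of_comp k₁ hu hρ'
      (fun m => by
        change (1 : A) ⊗ₜ[R] m = k₁ (1 ⊗ₜ m)
        simp [k₁]; rfl)
    have h0 := hx i j A τ τ' (RingHom.ext fun r => (hρ r).symm.trans (hρ' r)) Q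
      (k₀.comp (e i).toLinearMap) (k₁.comp (e j).toLinearMap)
      (fun n => by
        change k₀ (e i (g i n)) = k₁ (e j (g j n))
        rw [he, he]; simp [k₀, k₁])
      ((IsExt.of_linearEquiv (e i)).comp hk₀ _ (fun _ => rfl) fun _ => rfl)
      ((IsExt.of_linearEquiv (e j)).comp hk₁ _ (fun _ => rfl) fun _ => rfl)
    have h1 : ∀ z : S i ⊗[R] N, (TensorProduct.assoc R (S i) (S j) N) (k₀ z) =
        (TensorProduct.mk R (S j) N 1).lTensor (S i) z := by
      intro z
      induction z with
      | zero => simp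
      | add a b ha hb => simp only [map_add, ha, hb]
      | tmul a n => simp [k₀]
    have h2 : ∀ z : S j ⊗[R] N, (TensorProduct.assoc R (S i) (S j) N) (k₁ z) =
        TensorProduct.mk R (S i) (S j ⊗[R] N) 1 z := by
      intro z
      induction z with
      | zero => simp
      | add a b ha hb => simp only [map_add, ha, hb]
      | tmul a n => simp [k₁]
    exact (h1 _).symm.trans ((congrArg _ h0).trans (h2 _))
  exact ⟨n, fun i => (e i).injective ((he i n).trans (hn i))⟩

end FlatCover
end

noncomputable section

/-! ### Covers of affine points -/

namespace AlgebraicGeometry.Scheme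
variable {Y Z : Scheme.{u}} {R : CommRingCat.{u}}

theorem exists_zariski_cover (y : Spec R ⟶ Y) (p : Y.Opens → Prop)
    (hp : ∀ r : Spec R, ∃ U, y r ∈ U ∧ p U) :
    ∃ (ι : Type u) (S : ι → CommRingCat.{u}) (σ : ∀ i, R ⟶ S i), IsFlatCover (fun i => (σ i).hom) ∧
      ∀ i, ∃ U, p U ∧ ⊤ ≤ (Spec.map (σ i) ≫ y) ⁻¹ᵁ U := by
  have h1 (r : Spec R) : ∃ f : R, r ∈ PrimeSpectrum.basicOpen f ∧
      ∃ U, p U ∧ (PrimeSpectrum.basicOpen f : TopologicalSpace.Opens (PrimeSpectrum R)) ≤ y ⁻¹ᵁ U := by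
    obtain ⟨U, hU, hpU⟩ := hp r
    obtain ⟨_, ⟨_, ⟨f, rfl⟩, rfl⟩, h, h'⟩ := PrimeSpectrum.isBasis_basic_opens.exists_subset_of_mem_open
      (show r ∈ ((y ⁻¹ᵁ U : (Spec R).Opens) : Set (Spec R)) from hU) (y ⁻¹ᵁ U).2
    exact ⟨f, h, U, hpU, h'⟩
  choose f hf U hpU hfU using h1
  obtain ⟨t, ht⟩ := (isCompact_univ (X := PrimeSpectrum R)).elim_finite_subcover
    (fun r => (PrimeSpectrum.basicOpen (f r) : Set (PrimeSpectrum R)))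
    (fun r => (PrimeSpectrum.basicOpen (f r)).2) (fun r _ => Set.mem_iUnion.2 ⟨r, hf r⟩)
  refine ⟨t, fun i => CommRingCat.of (Localization.Away (f i)),
    fun i => CommRingCat.ofHom (algebraMap R _), ⟨inferInstance, fun i => ?_, fun q => ?_⟩, fun i =>
      ⟨U i, hpU i, fun s _ => hfU i ?_⟩⟩
  · exact (RingHom.flat_algebraMap_iff).2 (IsLocalization.flat _ (Submonoid.powers (f i)))
  · obtain ⟨r, hr, hq⟩ := Set.mem_iUnion₂.1 (ht (Set.mem_univ q))
    have := PrimeSpectrum.localization_away_comap_range (Localization.Away (f r)) (f r)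
    obtain ⟨q', hq'⟩ := this.ge hq
    exact ⟨⟨r, hr⟩, q', hq'⟩
  · have := PrimeSpectrum.localization_away_comap_range (Localization.Away (f i)) (f i)
    exact this.le ⟨s, rfl⟩

end AlgebraicGeometry.Scheme

namespace AlgebraicGeometry.Scheme.Modules
variable {X Y Z T : Scheme.{u}} {R : CommRingCat.{u}}

theorem res_congr (M : Y.Modules) {A : CommRingCat.{u}} {x : Spec R ⟶ Y} {z : Spec A ⟶ Y} {ρ ρ' : R ⟶ A}
    (e : ρ = ρ') (h : Spec.map ρ ≫ x = z) (h' : Spec.map ρ' ≫ x = z) (m : (sectionsAt x).obj M) :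
    res M ρ h m = res M ρ' h' m := by
  cases e
  rfl

theorem res_comm' (M : Y.Modules) {S S' A : CommRingCat.{u}} {x : Spec R ⟶ Y} {y : Spec S ⟶ Y}
    {y' : Spec S' ⟶ Y} {z : Spec A ⟶ Y} (σ : R ⟶ S) (τ : S ⟶ A) (σ' : R ⟶ S') (τ' : S' ⟶ A)
    (h : Spec.map σ ≫ x = y) (h₂ : Spec.map τ ≫ y = z) (h' : Spec.map σ' ≫ x = y')
    (h₂' : Spec.map τ' ≫ y' = z) (h3 : Spec.map (σ ≫ τ) ≫ x = z) (h4 : Spec.map (σ' ≫ τ') ≫ x = z)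
    (e : σ ≫ τ = σ' ≫ τ') (m : (sectionsAt x).obj M) :
    res M τ h₂ (res M σ h m) = res M τ' h₂' (res M σ' h' m) :=
  (res_res M σ τ h h₂ h3 m).trans ((res_congr M e h3 h4 m).trans (res_res M σ' τ' h' h₂' h4 m).symm)

theorem res_comm (M : Y.Modules) {S S' A : CommRingCat.{u}} {x : Spec R ⟶ Y} {y : Spec S ⟶ Y}
    {y' : Spec S' ⟶ Y} {z : Spec A ⟶ Y} (σ : R ⟶ S) (τ : S ⟶ A) (σ' : R ⟶ S') (τ' : S' ⟶ A)
    (h : Spec.map σ ≫ x = y) (h₂ : Spec.map τ ≫ y = z) (h' : Spec.map σ' ≫ x = y')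
    (h₂' : Spec.map τ' ≫ y' = z) (e : σ ≫ τ = σ' ≫ τ') (m : (sectionsAt x).obj M) :
    res M τ h₂ (res M σ h m) = res M τ' h₂' (res M σ' h' m) :=
  have h3 : Spec.map (σ ≫ τ) ≫ x = z := by rw [Spec.map_comp_assoc, h, h₂]
  have h4 : Spec.map (σ' ≫ τ') ≫ x = z := by rw [Spec.map_comp_assoc, h', h₂']
  res_comm' M σ τ σ' τ' h h₂ h' h₂' h3 h4 e m

theorem top_le_fromSpec_preimage {U : Y.Opens} (hU : IsAffineOpen U) : ⊤ ≤ hU.fromSpec ⁻¹ᵁ U := by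
  rw [hU.fromSpec_preimage_self]

theorem ev_fromSpec_bijective (M : Y.Modules) {U : Y.Opens} (hU : IsAffineOpen U)
    (h : ⊤ ≤ hU.fromSpec ⁻¹ᵁ U) : Function.Bijective (ev (M := M) hU.fromSpec U h) :=
  have := hU.isOpenImmersion_fromSpec
  ev_bijective hU.fromSpec M U hU.opensRange_fromSpec.symm h

theorem exists_lift_fromSpec {U : Y.Opens} (hU : IsAffineOpen U) (x : Spec R ⟶ Y)
    (hx : ⊤ ≤ x ⁻¹ᵁ U) : ∃ l : Γ(Y, U) ⟶ R, Spec.map l ≫ hU.fromSpec = x := by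
  have := hU.isOpenImmersion_fromSpec
  have hr : Set.range x ⊆ Set.range hU.fromSpec := by
    rw [hU.range_fromSpec]
    rintro _ ⟨r, rfl⟩
    exact hx (Set.mem_univ r)
  refine ⟨Spec.preimage (IsOpenImmersion.lift hU.fromSpec x hr), ?_⟩
  rw [Spec.map_preimage]
  exact IsOpenImmersion.lift_fac _ _ _

section

variable {ι : Type u} {S : ι → CommRingCat.{u}} {σ : ∀ i, R ⟶ S i}

theorem IsVectorBundle.ext_of_cover {M : Y.Modules} (hM : IsVectorBundle M)
    (h : IsFlatCover fun i => (σ i).hom) {y : Spec R ⟶ Y} {y' : ∀ i, Spec (S i) ⟶ Y}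
    (hy : ∀ i, Spec.map (σ i) ≫ y = y' i) {m m' : (sectionsAt y).obj M}
    (hm : ∀ i, res M (σ i) (hy i) m = res M (σ i) (hy i) m') : m = m' :=
  h.ext (fun i => hM.res_isExt (σ i) (hy i)) hm

theorem IsVectorBundle.exists_of_cover {M : Y.Modules} (hM : IsVectorBundle M)
    (h : IsFlatCover fun i => (σ i).hom) {y : Spec R ⟶ Y} {y' : ∀ i, Spec (S i) ⟶ Y}
    (hy : ∀ i, Spec.map (σ i) ≫ y = y' i) (m : ∀ i, (sectionsAt (y' i)).obj M)
    (hm : ∀ (i j) (A : CommRingCat.{u}) (τ : S i ⟶ A) (τ' : S j ⟶ A) (z : Spec A ⟶ Y)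
      (hz : Spec.map τ ≫ y' i = z) (hz' : Spec.map τ' ≫ y' j = z) (_ : σ i ≫ τ = σ j ≫ τ'),
      res M τ hz (m i) = res M τ' hz' (m j)) :
    ∃ n : (sectionsAt y).obj M, ∀ i, res M (σ i) (hy i) n = m i := by
  refine h.exists_of_overlap (fun i => hM.res_isExt (σ i) (hy i)) m ?_
  intro i j A _ τ τ' hτ Q _ _ k k' hk hke hke'
  let τ₁ : S i ⟶ CommRingCat.of A := CommRingCat.ofHom τ
  let τ₂ : S j ⟶ CommRingCat.of A := CommRingCat.ofHom τ'
  have hστ : σ i ≫ τ₁ = σ j ≫ τ₂ := CommRingCat.hom_ext hτ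
  let z : Spec (CommRingCat.of A) ⟶ Y := Spec.map τ₁ ≫ y' i
  have hz' : Spec.map τ₂ ≫ y' j = z := by
    change _ = Spec.map τ₁ ≫ y' i
    rw [← hy, ← hy, ← Spec.map_comp_assoc, ← Spec.map_comp_assoc, hστ]
  have hi := hM.res_isExt τ₁ (y := z) rfl
  let φ : (sectionsAt z).obj M →ₗ[A] Q := hi.lift (Q := Q) k
  have hφ (n) : φ (res M τ₁ rfl n) = k n := hi.lift_apply k n
  have hφ' (n) : φ (res M τ₂ hz' n) = k' n := by
    refine (hM.res_isExt (σ j) (hy j)).induction (p := fun n => φ (res M τ₂ hz' n) = k' n) n ?_ ?_ ?_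
    · simp
    · intro a b ha hb
      rw [map_add, map_add, map_add, ha, hb]
    · intro s n
      have h2 : res M τ₂ hz' (res M (σ j) (hy j) n) = res M τ₁ rfl (res M (σ i) (hy i) n) :=
        res_comm M _ _ _ _ _ _ _ _ hστ.symm n
      rw [map_smulₛₗ, map_smulₛₗ, h2]
      rw [hφ, hk]
      exact (map_smulₛₗ k' s _).symm
  rw [← hφ, ← hφ']
  exact congrArg φ (hm i j (CommRingCat.of A) τ₁ τ₂ z rfl hz' hστ)

end

/-- A section is determined by its values at affine open subschemes. -/
theorem section_ext {M : Y.Modules} {U : Y.Opens} {s s' : Γ(M, U)}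
    (h : ∀ {R : CommRingCat.{u}} (x : Spec R ⟶ Y) (hx : ⊤ ≤ x ⁻¹ᵁ U), ev x U hx s = ev x U hx s') :
    s = s' := by
  let F : TopCat.Sheaf Ab Y := ⟨M.presheaf, M.isSheaf⟩
  refine F.eq_of_locally_eq' (fun W : {W : Y.affineOpens // W.1 ≤ U} => W.1.1) U
    (fun W => homOfLE W.2) (fun x hx => ?_) s s' fun W => ?_
  · obtain ⟨_, ⟨V, hV, rfl⟩, hxV, hVU⟩ := Y.isBasis_affineOpens.exists_subset_of_mem_open hx U.2
    exact TopologicalSpace.Opens.mem_iSup.2 ⟨⟨⟨V, hV⟩, hVU⟩, hxV⟩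
  · have hW : ⊤ ≤ W.1.2.fromSpec ⁻¹ᵁ W.1.1 := by rw [W.1.2.fromSpec_preimage_self]
    apply (ev_fromSpec_bijective M W.1.2 hW).1
    exact (ev_map _ (homOfLE W.2) _ s).trans ((h _ _).trans (ev_map _ (homOfLE W.2) _ s').symm)

/-- A compatible family of values at the affine points of an open subset comes from a section. -/
theorem IsVectorBundle.exists_section {M : Y.Modules} (hM : IsVectorBundle M) (U : Y.Opens)
    (n : ∀ {R : CommRingCat.{u}} (x : Spec R ⟶ Y), ⊤ ≤ x ⁻¹ᵁ U → (sectionsAt x).obj M)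
    (hn : ∀ {R S : CommRingCat.{u}} {x : Spec R ⟶ Y} {y : Spec S ⟶ Y} (σ : R ⟶ S)
      (h : Spec.map σ ≫ x = y) (hx : ⊤ ≤ x ⁻¹ᵁ U) (hy : ⊤ ≤ y ⁻¹ᵁ U), res M σ h (n x hx) = n y hy) :
    ∃ s : Γ(M, U), ∀ {R : CommRingCat.{u}} (x : Spec R ⟶ Y) (hx : ⊤ ≤ x ⁻¹ᵁ U), ev x U hx s = n x hx := by
  let F : TopCat.Sheaf Ab Y := ⟨M.presheaf, M.isSheaf⟩
  have hW (W : Y.affineOpens) : ⊤ ≤ W.2.fromSpec ⁻¹ᵁ W.1 := by rw [W.2.fromSpec_preimage_self]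
  have hWU (W : {W : Y.affineOpens // W.1 ≤ U}) : ⊤ ≤ W.1.2.fromSpec ⁻¹ᵁ U :=
    (hW W.1).trans ((TopologicalSpace.Opens.map _).map (homOfLE W.2)).le
  have h1 (W : {W : Y.affineOpens // W.1 ≤ U}) : ∃ s : Γ(M, W.1.1),
      ev W.1.2.fromSpec W.1.1 (hW W.1) s = n W.1.2.fromSpec (hWU W) :=
    (ev_fromSpec_bijective M W.1.2 (hW W.1)).2 _
  choose sf hsf using h1
  have hcov : U ≤ ⨆ W : {W : Y.affineOpens // W.1 ≤ U}, W.1.1 := fun x hx => by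
    obtain ⟨_, ⟨V, hV, rfl⟩, hxV, hVU⟩ := Y.isBasis_affineOpens.exists_subset_of_mem_open hx U.2
    exact TopologicalSpace.Opens.mem_iSup.2 ⟨⟨⟨V, hV⟩, hVU⟩, hxV⟩
  have hsf' (W : {W : Y.affineOpens // W.1 ≤ U}) {R : CommRingCat.{u}} (x : Spec R ⟶ Y)
      (hx : ⊤ ≤ x ⁻¹ᵁ W.1.1) (hx' : ⊤ ≤ x ⁻¹ᵁ U) : ev x W.1.1 hx (sf W) = n x hx' := by
    obtain ⟨l, hl⟩ := exists_lift_fromSpec W.1.2 x hx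
    rw [← res_ev l hl W.1.1 (hW W.1) (sf W), hsf, hn]
  obtain ⟨s, hs, -⟩ := F.existsUnique_gluing' (fun W : {W : Y.affineOpens // W.1 ≤ U} => W.1.1) U
    (fun W => homOfLE W.2) hcov sf fun W W' => by
      refine section_ext (M := M) fun x hx => ?_
      have hx1 : ⊤ ≤ x ⁻¹ᵁ W.1.1 := fun r hr => (hx hr).1
      have hx2 : ⊤ ≤ x ⁻¹ᵁ W'.1.1 := fun r hr => (hx hr).2
      have hx' : ⊤ ≤ x ⁻¹ᵁ U := fun r hr => W.2 (hx1 hr)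
      exact (ev_map x (TopologicalSpace.Opens.infLELeft W.1.1 W'.1.1) hx (sf W)).trans
        ((hsf' W x hx1 hx').trans ((hsf' W' x hx2 hx').symm.trans
        (ev_map x (TopologicalSpace.Opens.infLERight W.1.1 W'.1.1) hx (sf W')).symm))
  refine ⟨s, fun {R} x hx => ?_⟩
  obtain ⟨ι, S, σ, hσ, h⟩ := exists_zariski_cover x (fun V => V ≤ U ∧ IsAffineOpen V) fun r => by
    obtain ⟨_, ⟨V, hV, rfl⟩, hxV, hVU⟩ :=
      Y.isBasis_affineOpens.exists_subset_of_mem_open (hx (Set.mem_univ r)) U.2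
    exact ⟨V, hxV, hVU, hV⟩
  refine hM.ext_of_cover hσ (fun i => rfl) fun i => ?_
  obtain ⟨V, ⟨hVU, hV⟩, hi⟩ := h i
  have hiU : ⊤ ≤ (Spec.map (σ i) ≫ x) ⁻¹ᵁ U := fun r hr => hVU (hi hr)
  rw [hn _ _ _ hiU, res_ev]
  have h2 := hsf' ⟨⟨V, hV⟩, hVU⟩ _ hi hiU
  rw [← hs ⟨⟨V, hV⟩, hVU⟩] at h2
  exact (ev_map _ (homOfLE hVU) hi s).symm.trans h2

/-- A morphism of modules is determined by its values on sections at affine points. -/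
theorem hom_ext_sectionsAt {M N : Y.Modules} {φ ψ : M ⟶ N}
    (h : ∀ {R : CommRingCat.{u}} (x : Spec R ⟶ Y), (sectionsAt x).map φ = (sectionsAt x).map ψ) :
    φ = ψ := by
  refine hom_ext _ _ fun U => ?_
  ext s
  refine section_ext fun x hx => ?_
  rw [← ev_naturality, ← ev_naturality, h]

theorem sectionsAt_isExt_ev {M : Y.Modules} (hM : IsVectorBundle M) (x : Spec R ⟶ Y) (U : Y.affineOpens)
    (hx : ⊤ ≤ x ⁻¹ᵁ U.1) : Submodule.span R (Set.range (ev (M := M) x U.1 hx)) = ⊤ := by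
  have hW := top_le_fromSpec_preimage U.2
  obtain ⟨l, hl⟩ := exists_lift_fromSpec U.2 x hx
  rw [← (hM.res_isExt l hl).span_range]
  congr 1
  ext n
  constructor
  · rintro ⟨s, rfl⟩
    exact ⟨_, res_ev _ hl U.1 hW s⟩
  · rintro ⟨m, rfl⟩
    obtain ⟨s, rfl⟩ := (ev_fromSpec_bijective M U.2 hW).2 m
    exact ⟨s, (res_ev _ hl U.1 hW s).symm⟩

/-- A natural family of linear maps between the modules at affine points is a morphism of modules. -/
theorem IsVectorBundle.exists_hom {M N : Y.Modules} (hM : IsVectorBundle M) (hN : IsVectorBundle N)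
    (θ : ∀ {R : CommRingCat.{u}} (x : Spec R ⟶ Y), (sectionsAt x).obj M →ₗ[R] (sectionsAt x).obj N)
    (hθ : ∀ {R S : CommRingCat.{u}} {x : Spec R ⟶ Y} {y : Spec S ⟶ Y} (σ : R ⟶ S)
      (h : Spec.map σ ≫ x = y) (m), θ y (res M σ h m) = res N σ h (θ x m)) :
    ∃ ψ : M ⟶ N, ∀ {R : CommRingCat.{u}} (x : Spec R ⟶ Y), ((sectionsAt x).map ψ).hom = θ x := by
  have h1 (U : Y.Opens) (s : Γ(M, U)) : ∃ t : Γ(N, U), ∀ {R : CommRingCat.{u}} (x : Spec R ⟶ Y)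
      (hx : ⊤ ≤ x ⁻¹ᵁ U), ev x U hx t = θ x (ev x U hx s) :=
    hN.exists_section U (fun x hx => θ x (ev x U hx s)) fun σ h hx hy => by
      rw [← hθ, res_ev]
  choose f hf using h1
  let φ : M.presheaf ⟶ N.presheaf :=
    { app := fun U => AddCommGrpCat.ofHom
        { toFun := f U.unop
          map_zero' := by
            refine section_ext fun x hx => ?_
            have h0 (N : Y.Modules) : ev (M := N) x U.unop hx 0 = 0 := by
              have := ev_add (M := N) x U.unop hx 0 0
              rw [add_zero] at this
              exact left_eq_add.1 this
            refine (hf _ _ x hx).trans ((congrArg (θ x) (h0 M)).trans ?_)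
            exact (map_zero _).trans (h0 N).symm
          map_add' := fun s s' => by
            refine section_ext fun x hx => ?_
            refine (hf _ _ x hx).trans ((congrArg (θ x) (ev_add x _ hx s s')).trans ?_)
            refine (map_add _ _ _).trans (Eq.trans ?_ (ev_add x _ hx _ _).symm)
            exact congrArg₂ (· + ·) (hf _ s x hx).symm (hf _ s' x hx).symm }
      naturality := fun U V i => by
        ext s
        refine section_ext fun x hx => ?_
        change ev x V.unop hx (f V.unop (M.presheaf.map i s)) = ev x V.unop hx (N.presheaf.map i (f U.unop s))
        have e1 := ev_map x i.unop hx s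
        have e2 := ev_map x i.unop hx (f U.unop s)
        rw [Quiver.Hom.op_unop] at e1 e2
        rw [hf, e1, e2, hf] }
  let ψ : M ⟶ N := ⟨PresheafOfModules.homMk φ fun U r m => by
    refine section_ext (U := U.unop) fun x hx => ?_
    have h2 := fun (U : Y.Opens) (r : Γ(Y, U)) (m : Γ(M, U)) (hx : ⊤ ≤ x ⁻¹ᵁ U) =>
      show ev x U hx (f U (r • m)) = ev x U hx (r • f U m) by
        rw [hf, ev_smul, ev_smul, hf, _root_.map_smul]
    exact h2 U.unop r m hx⟩
  have hψ (U : Y.Opens) (s : Γ(M, U)) : ψ.app U s = f U s := rfl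
  refine ⟨ψ, fun {R} x => LinearMap.ext fun m => ?_⟩
  obtain ⟨ι, S, σ, hσ, h⟩ := exists_zariski_cover x (fun V => IsAffineOpen V) fun r => by
    obtain ⟨_, ⟨V, hV, rfl⟩, hxV, -⟩ :=
      Y.isBasis_affineOpens.exists_subset_of_mem_open (Set.mem_univ (x r)) isOpen_univ
    exact ⟨V, hxV, hV⟩
  refine hN.ext_of_cover hσ (fun i => rfl) fun i => ?_
  obtain ⟨V, hV, hi⟩ := h i
  rw [← hθ]
  refine (res_naturality ψ (σ i) rfl m).symm.trans ?_
  refine LinearMap.congr_fun (f := ((sectionsAt (Spec.map (σ i) ≫ x)).map ψ).hom) ?_ (res M (σ i) rfl m)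
  refine LinearMap.ext_on_range (sectionsAt_isExt_ev hM _ ⟨V, hV⟩ hi) fun s => ?_
  exact (ev_naturality ψ _ V hi s).trans (hf V s _ hi)

end AlgebraicGeometry.Scheme.Modules
end

noncomputable section

/-! ### Descent of finiteness conditions -/

section FlatCover

open TensorProduct

section Algebra

variable {ι R : Type u} [CommRing R] {S : ι → Type u} [∀ i, CommRing (S i)] [∀ i, Algebra R (S i)]
  (N : Type u) [AddCommGroup N] [Module R N]

theorem IsFlatCover.eq_zero_of_tensor (h : IsFlatCover fun i => algebraMap R (S i)) (n : N)
    (hn : ∀ i, (1 : S i) ⊗ₜ[R] n = 0) : n = 0 := by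
  have := h.finite
  have := h.faithfullyFlat
  apply Module.FaithfullyFlat.tensorProduct_mk_injective (A := R) (B := ∀ i, S i) N
  rw [map_zero]
  exact pi_tensor_eq_zero _ fun i => hn i

theorem IsFlatCover.module_finite (h : IsFlatCover fun i => algebraMap R (S i))
    [hN : ∀ i, Module.Finite (S i) (S i ⊗[R] N)] : Module.Finite R N := by
  have := h.finite
  have h1 (i) : ∃ P : Submodule R N, Module.Finite R P ∧
      ∀ n, (1 : S i) ⊗ₜ[R] n ∈ LinearMap.range (P.subtype.baseChange (S i)) := by
    obtain ⟨s, hs⟩ := (hN i).fg_top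
    obtain ⟨P, hP, hsP⟩ := TensorProduct.exists_finite_submodule_right_of_setFinite (s : Set (S i ⊗[R] N))
      s.finite_toSet
    refine ⟨P, hP, fun n => ?_⟩
    have h2 : Submodule.span (S i) (s : Set (S i ⊗[R] N)) ≤ LinearMap.range (P.subtype.baseChange (S i)) :=
      Submodule.span_le.2 hsP
    rw [hs] at h2
    exact h2 trivial
  choose P hP hPn using h1
  have hfg : (⨆ i, P i).FG := Submodule.fg_iSup _ fun i => Module.Finite.iff_fg.1 (hP i)
  have htop : (⨆ i, P i) = ⊤ := by
    rw [eq_top_iff]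
    intro n _
    rw [← Submodule.Quotient.mk_eq_zero]
    refine h.eq_zero_of_tensor _ _ fun i => ?_
    obtain ⟨w, hw⟩ := hPn i n
    have h3 : ((⨆ i, P i).mkQ.lTensor (S i)) ((P i).subtype.lTensor (S i) w) = 0 := by
      rw [← LinearMap.comp_apply, ← LinearMap.lTensor_comp]
      have : (⨆ i, P i).mkQ ∘ₗ (P i).subtype = 0 := by
        ext p
        exact (Submodule.Quotient.mk_eq_zero _).2 ((le_iSup P i) p.2)
      rw [this]; simp
    have h4 : (P i).subtype.lTensor (S i) w = 1 ⊗ₜ[R] n := hw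
    rw [h4] at h3
    exact h3
  exact ⟨htop ▸ hfg⟩

theorem IsFlatCover.module_flat (h : IsFlatCover fun i => algebraMap R (S i))
    [hN : ∀ i, Module.Flat (S i) (S i ⊗[R] N)] : Module.Flat R N := by
  rw [Module.Flat.iff_lTensor_preserves_injective_linearMap]
  intro P Q _ _ _ _ f hf
  rw [injective_iff_map_eq_zero]
  intro z hz
  refine h.eq_zero_of_tensor _ _ fun i => ?_
  have : Module.Flat R (S i) := (RingHom.flat_algebraMap_iff).1 (h.flat i)
  have : Module.Flat R (S i ⊗[R] N) := Module.Flat.trans R (S i) _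
  have h1 := Module.Flat.lTensor_preserves_injective_linearMap (M := S i ⊗[R] N) f hf
  apply (TensorProduct.assoc R (S i) N P).symm.injective
  apply h1
  rw [map_zero, map_zero]
  have key : ∀ z : N ⊗[R] P, f.lTensor (S i ⊗[R] N) ((TensorProduct.assoc R (S i) N P).symm (1 ⊗ₜ z)) =
      (TensorProduct.assoc R (S i) N Q).symm (1 ⊗ₜ f.lTensor N z) := by
    intro z
    induction z with
    | zero => simp
    | add a b ha hb => simp only [tmul_add, map_add, ha, hb]
    | tmul a b => simp
  rw [key, hz]; simp

theorem IsFlatCover.module_projective (h : IsFlatCover fun i => algebraMap R (S i))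
    [hN : ∀ i, Module.Finite (S i) (S i ⊗[R] N)] [hP : ∀ i, Module.Projective (S i) (S i ⊗[R] N)] :
    Module.Finite R N ∧ Module.Projective R N := by
  have h1 := h.module_finite N
  have h2 := h.module_flat N
  refine ⟨h1, ?_⟩
  obtain ⟨n, l, hl⟩ := Module.Finite.exists_fin' R N
  have h3 : Module.Finite R (LinearMap.ker l) := by
    have hK : ∀ i, Module.Finite (S i) (S i ⊗[R] LinearMap.ker l) := fun i => by
      have : Module.Flat R (S i) := (RingHom.flat_algebraMap_iff).1 (h.flat i)
      have := Module.finitePresentation_of_projective (S i) (S i ⊗[R] N)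
      have h4 := Module.FinitePresentation.fg_ker (l.baseChange (S i)) (LinearMap.lTensor_surjective _ hl)
      have h5 : LinearMap.ker (l.baseChange (S i)) =
          LinearMap.range ((LinearMap.ker l).subtype.baseChange (S i)) := by
        have h6 : Function.Exact ((LinearMap.ker l).subtype.lTensor (S i)) (l.lTensor (S i)) :=
          lTensor_exact (S i) (LinearMap.exact_subtype_ker_map l) hl
        ext z
        exact h6 z
      rw [h5, ← Module.Finite.iff_fg] at h4
      have h7 : Function.Injective ((LinearMap.ker l).subtype.baseChange (S i)) :=
        Module.Flat.lTensor_preserves_injective_linearMap (M := S i) _ (LinearMap.ker l).injective_subtype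
      exact Module.Finite.equiv (LinearEquiv.ofInjective _ h7).symm
    exact h.module_finite _
  have := Module.finitePresentation_of_surjective l hl (Module.Finite.iff_fg.1 h3)
  exact Module.Flat.projective_of_finitePresentation

end Algebra

variable {ι R : Type u} [CommRing R] {S : ι → Type u} [∀ i, CommRing (S i)] {σ : ∀ i, R →+* S i}
  {N : Type u} [AddCommGroup N] [Module R N] {N' : ι → Type u} [∀ i, AddCommGroup (N' i)]
  [∀ i, Module (S i) (N' i)] {g : ∀ i, N →ₛₗ[σ i] N' i}

theorem IsFlatCover.finite_projective (h : IsFlatCover σ) (hg : ∀ i, IsExt (g i))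
    (h' : ∀ i, Module.Finite (S i) (N' i) ∧ Module.Projective (S i) (N' i)) :
    Module.Finite R N ∧ Module.Projective R N := by
  letI : ∀ i, Algebra R (S i) := fun i => (σ i).toAlgebra
  have h'' : IsFlatCover fun i => algebraMap R (S i) := h
  let e (i) : N' i ≃ₗ[S i] S i ⊗[R] N := (hg i).equiv (tensorUnit_isExt (σ i))
  have hf : ∀ i, Module.Finite (S i) (S i ⊗[R] N) := fun i => have := (h' i).1; Module.Finite.equiv (e i)
  have hp : ∀ i, Module.Projective (S i) (S i ⊗[R] N) := fun i => have := (h' i).2; Module.Projective.of_equiv (e i)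
  exact h''.module_projective N

end FlatCover

/-- Base change of a cover. -/
theorem IsFlatCover.exists_pushout {ι : Type u} {R T : CommRingCat.{u}} {S : ι → CommRingCat.{u}}
    {σ : ∀ i, R ⟶ S i} (h : IsFlatCover fun i => (σ i).hom) (τ : R ⟶ T) :
    ∃ (A : ι → CommRingCat.{u}) (inl : ∀ i, T ⟶ A i) (inr : ∀ i, S i ⟶ A i),
      (∀ i, τ ≫ inl i = σ i ≫ inr i) ∧ IsFlatCover fun i => (inl i).hom := by
  have hp (i) := isPullback_SpecMap_pushout τ (σ i)
  refine ⟨fun i => Limits.pushout τ (σ i), fun i => Limits.pushout.inl _ _, fun i => Limits.pushout.inr _ _,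
    fun i => Limits.pushout.condition, h.finite, fun i => ?_, fun p => ?_⟩
  · have h1 : Flat (Spec.map (σ i)) := (HasRingHomProperty.Spec_iff (P := @Flat)).2 (h.flat i)
    have h2 : Flat (Spec.map (Limits.pushout.inl τ (σ i))) := MorphismProperty.of_isPullback (hp i).flip h1
    exact (HasRingHomProperty.Spec_iff (P := @Flat)).1 h2
  · obtain ⟨i, q, hq⟩ := h.surj (PrimeSpectrum.comap τ.hom p)
    obtain ⟨r, hr, -⟩ := Scheme.exists_preimage_of_isPullback (hp i) p q hq.symm
    exact ⟨i, r, hr⟩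

namespace AlgebraicGeometry.Scheme.Modules
variable {X Y Z T : Scheme.{u}} {R : CommRingCat.{u}}

theorem IsVectorBundle.finite_projective {M : Y.Modules} (hM : IsVectorBundle M) (x : Spec R ⟶ Y) :
    Module.Finite R ((sectionsAt x).obj M) ∧ Module.Projective R ((sectionsAt x).obj M) := by
  obtain ⟨ι, S, σ, hσ, h⟩ := exists_zariski_cover x (fun U => ∃ n : ℕ, Nonempty (M.restrict U.ι ≅
    SheafOfModules.free (R := (U : Scheme.{u}).ringCatSheaf) (ULift.{u} (Fin n)))) fun r => hM (x r)
  refine hσ.finite_projective (fun i => hM.res_isExt (σ i) rfl) fun i => ?_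
  obtain ⟨U, ⟨n, ⟨e⟩⟩, hU⟩ := h i
  have hr : Set.range (Spec.map (σ i) ≫ x) ⊆ Set.range U.ι := by
    rw [Scheme.Opens.range_ι]
    rintro _ ⟨r, rfl⟩
    exact hU (Set.mem_univ r)
  have hl := IsOpenImmersion.lift_fac U.ι (Spec.map (σ i) ≫ x) hr
  obtain ⟨f⟩ := sectionsAt_free e (IsOpenImmersion.lift U.ι (Spec.map (σ i) ≫ x) hr)
  rw [hl] at f
  exact ⟨Module.Finite.equiv f.toLinearEquiv.symm, Module.Projective.of_equiv f.toLinearEquiv.symm⟩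

theorem IsVectorBundle.existsUnique_of_cover {M N : Y.Modules} (hN : IsVectorBundle N)
    (Θ : ∀ {R : CommRingCat.{u}} (y : Spec R ⟶ Y), ((sectionsAt y).obj M →ₗ[R] (sectionsAt y).obj N) → Prop)
    (huniq : ∀ {R : CommRingCat.{u}} (y : Spec R ⟶ Y) (f f'), Θ y f → Θ y f' → f = f')
    (hres : ∀ {R S : CommRingCat.{u}} (y : Spec R ⟶ Y) (y' : Spec S ⟶ Y) (σ : R ⟶ S)
      (h : Spec.map σ ≫ y = y') (f), Θ y f → ∃ f', Θ y' f' ∧ ∀ m, f' (res M σ h m) = res N σ h (f m))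
    (hcov : ∀ {R : CommRingCat.{u}} (y : Spec R ⟶ Y), ∃ (ι : Type u) (S : ι → CommRingCat.{u})
      (σ : ∀ i, R ⟶ S i), IsFlatCover (fun i => (σ i).hom) ∧ ∀ i, ∃ f, Θ (Spec.map (σ i) ≫ y) f)
    (y : Spec R ⟶ Y) (m : (sectionsAt y).obj M) :
    ∃! n : (sectionsAt y).obj N, ∀ {S : CommRingCat.{u}} (τ : R ⟶ S) (y' : Spec S ⟶ Y)
        (h : Spec.map τ ≫ y = y') (f), Θ y' f → res N τ h n = f (res M τ h m) := by
  obtain ⟨ι, S, σ, hσ, hf⟩ := hcov y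
  choose f hf using hf
  refine existsUnique_of_exists_of_unique ?_ fun n n' hn hn' => ?_
  · obtain ⟨n, hn⟩ := hN.exists_of_cover hσ (fun i => rfl) (fun i => f i (res M (σ i) rfl m))
      fun i j A τ τ' z hz hz' e => by
        obtain ⟨f₁, hf₁, h₁⟩ := hres _ _ τ hz _ (hf i)
        obtain ⟨f₂, hf₂, h₂⟩ := hres _ _ τ' hz' _ (hf j)
        rw [← h₁, ← h₂, huniq z f₁ f₂ hf₁ hf₂]
        exact congrArg f₂ (res_comm M _ _ _ _ rfl hz rfl hz' e m)
    refine ⟨n, fun {S'} τ y' h g hg => ?_⟩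
    obtain ⟨A, inl, inr, hA, hc⟩ := hσ.exists_pushout τ
    refine hN.ext_of_cover hc (fun i => rfl) fun i => ?_
    have hz : Spec.map (inr i) ≫ Spec.map (σ i) ≫ y = Spec.map (inl i) ≫ y' := by
      rw [← h, ← Spec.map_comp_assoc, ← Spec.map_comp_assoc, hA]
    obtain ⟨f₁, hf₁, h₁⟩ := hres _ _ (inl i) rfl _ hg
    obtain ⟨f₂, hf₂, h₂⟩ := hres _ _ (inr i) hz _ (hf i)
    rw [← h₁, huniq _ f₁ f₂ hf₁ hf₂, res_comm N τ (inl i) (σ i) (inr i) h rfl rfl hz (hA i) n,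
      hn, ← h₂]
    exact congrArg f₂ (res_comm M (σ i) (inr i) τ (inl i) rfl hz h rfl (hA i).symm m)
  · refine hN.ext_of_cover hσ (fun i => rfl) fun i => ?_
    rw [hn _ _ rfl _ (hf i), hn' _ _ rfl _ (hf i)]

end AlgebraicGeometry.Scheme.Modules
end

noncomputable section

namespace AlgebraicGeometry.Scheme.Modules
variable {X Y Z T : Scheme.{u}} {R : CommRingCat.{u}}

/-- Descent of morphisms of vector bundles. -/
theorem IsVectorBundle.exists_hom_of_cover {M N : Y.Modules} (hM : IsVectorBundle M)
    (hN : IsVectorBundle N)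
    (Θ : ∀ {R : CommRingCat.{u}} (y : Spec R ⟶ Y), ((sectionsAt y).obj M →ₗ[R] (sectionsAt y).obj N) → Prop)
    (huniq : ∀ {R : CommRingCat.{u}} (y : Spec R ⟶ Y) (f f'), Θ y f → Θ y f' → f = f')
    (hres : ∀ {R S : CommRingCat.{u}} (y : Spec R ⟶ Y) (y' : Spec S ⟶ Y) (σ : R ⟶ S)
      (h : Spec.map σ ≫ y = y') (f), Θ y f → ∃ f', Θ y' f' ∧ ∀ m, f' (res M σ h m) = res N σ h (f m))
    (hcov : ∀ {R : CommRingCat.{u}} (y : Spec R ⟶ Y), ∃ (ι : Type u) (S : ι → CommRingCat.{u})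
      (σ : ∀ i, R ⟶ S i), IsFlatCover (fun i => (σ i).hom) ∧ ∀ i, ∃ f, Θ (Spec.map (σ i) ≫ y) f) :
    ∃ ψ : M ⟶ N, ∀ {R : CommRingCat.{u}} (y : Spec R ⟶ Y) (f), Θ y f → ((sectionsAt y).map ψ).hom = f := by
  have h1 {R : CommRingCat.{u}} (y : Spec R ⟶ Y) (m : (sectionsAt y).obj M) :=
    hN.existsUnique_of_cover Θ huniq hres hcov y m
  have hadd {R : CommRingCat.{u}} (y : Spec R ⟶ Y) (a b : (sectionsAt y).obj M) :
      (h1 y (a + b)).choose = (h1 y a).choose + (h1 y b).choose := by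
    refine ((h1 y (a + b)).choose_spec.2 _ fun {S} τ y' h f hf => ?_).symm
    rw [map_add, (h1 y a).choose_spec.1 τ y' h f hf, (h1 y b).choose_spec.1 τ y' h f hf, map_add,
      map_add]
  have hsmul {R : CommRingCat.{u}} (y : Spec R ⟶ Y) (r : R) (a : (sectionsAt y).obj M) :
      (h1 y (r • a)).choose = r • (h1 y a).choose := by
    refine ((h1 y (r • a)).choose_spec.2 _ fun {S} τ y' h f hf => ?_).symm
    rw [map_smulₛₗ, map_smulₛₗ, (h1 y a).choose_spec.1 τ y' h f hf, _root_.map_smul]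
  have hnat {R S : CommRingCat.{u}} {x : Spec R ⟶ Y} {y : Spec S ⟶ Y} (σ : R ⟶ S)
      (h : Spec.map σ ≫ x = y) (m : (sectionsAt x).obj M) :
      (h1 y (res M σ h m)).choose = res N σ h (h1 x m).choose := by
    refine ((h1 y (res M σ h m)).choose_spec.2 _ fun {A} τ y' h' f hf => ?_).symm
    have h3 : Spec.map (σ ≫ τ) ≫ x = y' := by rw [Spec.map_comp_assoc, h, h']
    have e1 := res_res N σ τ h h' h3 (h1 x m).choose
    have e2 := (h1 x m).choose_spec.1 _ _ h3 _ hf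
    have e3 := congrArg f (res_res M σ τ h h' h3 m).symm
    exact e1.trans (e2.trans e3)
  obtain ⟨ψ, hψ⟩ := hM.exists_hom hN
    (fun {R} y => { toFun := fun m => (h1 y m).choose, map_add' := hadd y, map_smul' := hsmul y })
    hnat
  refine ⟨ψ, fun {R} y f hf => ?_⟩
  rw [hψ]
  ext m
  have h4 : Spec.map (𝟙 R) ≫ y = y := by rw [Spec.map_id, Category.id_comp]
  have h5 := (h1 y m).choose_spec.1 (𝟙 R) y h4 f hf
  rw [res_id N h4, res_id M h4] at h5
  exact h5

/-- Morphisms of vector bundles which agree on a cover are equal. -/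
theorem IsVectorBundle.hom_ext_of_cover {M N : Y.Modules} (hN : IsVectorBundle N) {φ ψ : M ⟶ N}
    (h : ∀ {R : CommRingCat.{u}} (y : Spec R ⟶ Y), ∃ (ι : Type u) (S : ι → CommRingCat.{u})
      (σ : ∀ i, R ⟶ S i), IsFlatCover (fun i => (σ i).hom) ∧
      ∀ i, (sectionsAt (Spec.map (σ i) ≫ y)).map φ = (sectionsAt (Spec.map (σ i) ≫ y)).map ψ) : φ = ψ := by
  refine hom_ext_sectionsAt fun y => ?_
  obtain ⟨ι, S, σ, hσ, hf⟩ := h y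
  ext m
  refine hN.ext_of_cover hσ (fun i => rfl) fun i => ?_
  rw [← res_naturality, ← res_naturality, hf]

end AlgebraicGeometry.Scheme.Modules
end

noncomputable section

/-! ### Submodules and base change -/

section SubmoduleExt

open TensorProduct

variable {R S T : Type u} [CommRing R] [CommRing S] [CommRing T] {σ : R →+* S} {τ : S →+* T}
  {ρ : R →+* T} {M N P : Type u} [AddCommGroup M] [AddCommGroup N] [AddCommGroup P] [Module R M]
  [Module S N] [Module T P]

/-- The restriction of a semilinear map to a submodule and the submodule generated by its image. -/
def spanRestrict (f : M →ₛₗ[σ] N) (K : Submodule R M) (K' : Submodule S N)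
    (h : K' = Submodule.span S (f '' K)) : K →ₛₗ[σ] K' where
  toFun k := ⟨f k, h ▸ Submodule.subset_span ⟨k, k.2, rfl⟩⟩
  map_add' x y := Subtype.ext (map_add f x.1 y.1)
  map_smul' r x := Subtype.ext (map_smulₛₗ f r x.1)

theorem spanRestrict_span_range (f : M →ₛₗ[σ] N) (K : Submodule R M) (K' : Submodule S N)
    (h : K' = Submodule.span S (f '' K)) :
    Submodule.span S (Set.range (spanRestrict f K K' h)) = ⊤ := by
  rw [eq_top_iff]
  rintro ⟨x, hx⟩ _
  have h1 : Submodule.map K'.subtype (Submodule.span S (Set.range (spanRestrict f K K' h))) = K' := by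
    refine (Submodule.map_span _ _).trans (Eq.trans ?_ h.symm)
    congr 1
    ext y
    constructor
    · rintro ⟨_, ⟨k, rfl⟩, rfl⟩; exact ⟨k, k.2, rfl⟩
    · rintro ⟨k, hk, rfl⟩; exact ⟨_, ⟨⟨k, hk⟩, rfl⟩, rfl⟩
  have h2 := hx
  rw [← h1] at h2
  obtain ⟨z, hz, hzx⟩ := h2
  obtain rfl : z = ⟨x, hx⟩ := Subtype.ext hzx
  exact hz

/-- The map induced on quotients. -/
def quotientMap (f : M →ₛₗ[σ] N) (K : Submodule R M) (K' : Submodule S N)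
    (h : ∀ k ∈ K, f k ∈ K') : M ⧸ K →ₛₗ[σ] N ⧸ K' :=
  Submodule.mapQ K K' f h

theorem quotientMap_mk (f : M →ₛₗ[σ] N) (K : Submodule R M) (K' : Submodule S N)
    (h : ∀ k ∈ K, f k ∈ K') (m : M) :
    quotientMap f K K' h (Submodule.Quotient.mk m) = Submodule.Quotient.mk (f m) := rfl

theorem IsExt.quotient {f : M →ₛₗ[σ] N} (hf : IsExt f) (K : Submodule R M) (K' : Submodule S N)
    (hK : K' = Submodule.span S (f '' K)) (h : ∀ k ∈ K, f k ∈ K') : IsExt (quotientMap f K K' h) := by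
  intro Q _ _ g
  let g' : M →ₛₗ[σ] Q := g.comp K.mkQ
  have h1 : K' ≤ LinearMap.ker (hf.lift g') := by
    rw [hK, Submodule.span_le]
    rintro _ ⟨k, hk, rfl⟩
    change hf.lift g' (f k) = 0
    rw [hf.lift_apply]
    change g (Submodule.Quotient.mk k) = 0
    rw [(Submodule.Quotient.mk_eq_zero K).2 hk, map_zero]
  refine ⟨K'.liftQ (hf.lift g') h1, fun m => ?_, fun l hl => ?_⟩
  · obtain ⟨m, rfl⟩ := Submodule.Quotient.mk_surjective _ m
    exact hf.lift_apply g' m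
  · refine Submodule.linearMap_qext _ (hf.ext fun m => ?_)
    exact (hl (Submodule.Quotient.mk m)).trans (hf.lift_apply g' m).symm

/-- A restriction of a base change to a submodule is a base change if the submodule stays a
submodule after base change. -/
theorem IsExt.restrict_of_injective {f : M →ₛₗ[σ] N} (K : Submodule R M)
    (K' : Submodule S N) (hK : K' = Submodule.span S (f '' K))
    {A : Type u} [AddCommGroup A] [Module S A] {a : K →ₛₗ[σ] A} (ha : IsExt a)
    (l : A →ₗ[S] N) (hl : ∀ k, l (a k) = f k) (hinj : Function.Injective l) :
    IsExt (spanRestrict f K K' hK) := by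
  let l' : A →ₗ[S] K' := ha.lift (spanRestrict f K K' hK)
  have hl' (k) : l' (a k) = spanRestrict f K K' hK k := ha.lift_apply _ k
  have h2 : K'.subtype ∘ₗ l' = l := ha.ext fun k => by
    rw [hl, LinearMap.comp_apply, hl']; rfl
  have hbij : Function.Bijective l' := by
    constructor
    · intro x y hxy
      apply hinj
      rw [← h2, LinearMap.comp_apply, LinearMap.comp_apply, hxy]
    · rw [← LinearMap.range_eq_top, eq_top_iff, ← spanRestrict_span_range f K K' hK,
        Submodule.span_le]
      rintro _ ⟨k, rfl⟩
      exact ⟨a k, hl' k⟩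
  exact ha.comp (IsExt.of_bijective l' hbij) _ (fun _ => rfl) fun k => (hl' k).symm

theorem IsExt.restrict_of_flat {f : M →ₛₗ[σ] N} (hf : IsExt f) (hσ : σ.Flat) (K : Submodule R M)
    (K' : Submodule S N) (hK : K' = Submodule.span S (f '' K)) :
    IsExt (spanRestrict f K K' hK) := by
  letI := σ.toAlgebra
  have : Module.Flat R S := hσ
  have hu := tensorUnit_isExt (M := K) σ
  let f' : K →ₛₗ[σ] N := f.comp K.subtype
  refine IsExt.restrict_of_injective K K' hK hu (hu.lift f') (hu.lift_apply f') ?_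
  have hM := tensorUnit_isExt (M := M) σ
  let e := hM.equiv hf
  have h1 : hu.lift f' = e.toLinearMap ∘ₗ K.subtype.baseChange S := by
    refine hu.ext fun k => ?_
    rw [hu.lift_apply]
    change _ = e (K.subtype.baseChange S (tensorUnit σ K k))
    have : K.subtype.baseChange S (tensorUnit σ K k) = tensorUnit σ M k := by
      change K.subtype.baseChange S (1 ⊗ₜ k) = 1 ⊗ₜ (k : M)
      simp
    rw [this]
    exact (hM.equiv_apply hf k).symm
  rw [h1]
  exact e.injective.comp (Module.Flat.lTensor_preserves_injective_linearMap K.subtype K.injective_subtype)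

theorem IsExt.restrict_of_retraction {f : M →ₛₗ[σ] N} (hf : IsExt f) (K : Submodule R M)
    (r : M →ₗ[R] K) (hr : ∀ k : K, r k = k)
    (K' : Submodule S N) (hK : K' = Submodule.span S (f '' K)) :
    IsExt (spanRestrict f K K' hK) := by
  letI := σ.toAlgebra
  have hu := tensorUnit_isExt (M := K) σ
  let f' : K →ₛₗ[σ] N := f.comp K.subtype
  refine IsExt.restrict_of_injective K K' hK hu (hu.lift f') (hu.lift_apply f') ?_
  let r' : N →ₗ[S] S ⊗[R] K := hf.lift ((tensorUnit σ K).comp r)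
  have h1 : r' ∘ₗ hu.lift f' = LinearMap.id := hu.ext fun k => by
    rw [LinearMap.comp_apply, hu.lift_apply, LinearMap.id_apply]
    refine (hf.lift_apply ((tensorUnit σ K).comp r) k).trans ?_
    change tensorUnit σ K (r k) = _
    rw [hr]
  exact Function.LeftInverse.injective (g := r') fun x => LinearMap.congr_fun h1 x

section Cover

variable {ι R : Type u} [CommRing R] {S : ι → Type u} [∀ i, CommRing (S i)] {σ : ∀ i, R →+* S i}
  {N : Type u} [AddCommGroup N] [Module R N] {N' : ι → Type u} [∀ i, AddCommGroup (N' i)]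
  [∀ i, Module (S i) (N' i)] {g : ∀ i, N →ₛₗ[σ i] N' i}

theorem IsFlatCover.mem_of_mem_span (h : IsFlatCover σ) (hg : ∀ i, IsExt (g i)) (K : Submodule R N)
    (n : N) (hn : ∀ i, g i n ∈ Submodule.span (S i) (g i '' K)) : n ∈ K := by
  rw [← Submodule.Quotient.mk_eq_zero]
  refine h.eq_zero (g := fun i => quotientMap (g i) K (Submodule.span (S i) (g i '' K))
    fun k hk => Submodule.subset_span ⟨k, hk, rfl⟩)
    (fun i => (hg i).quotient K _ rfl _) _ fun i => ?_
  rw [quotientMap_mk, Submodule.Quotient.mk_eq_zero]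
  exact hn i

theorem IsFlatCover.eq_of_span_eq (h : IsFlatCover σ) (hg : ∀ i, IsExt (g i)) {K K' : Submodule R N}
    (hK : ∀ i, Submodule.span (S i) (g i '' K) = Submodule.span (S i) (g i '' K')) : K = K' :=
  le_antisymm
    (fun n hn => h.mem_of_mem_span hg K' n fun i => hK i ▸ Submodule.subset_span ⟨n, hn, rfl⟩)
    fun n hn => h.mem_of_mem_span hg K n fun i => (hK i).symm ▸ Submodule.subset_span ⟨n, hn, rfl⟩

theorem IsFlatCover.bijective (h : IsFlatCover σ) {N₂ : Type u} [AddCommGroup N₂] [Module R N₂]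
    {N₂' : ι → Type u} [∀ i, AddCommGroup (N₂' i)] [∀ i, Module (S i) (N₂' i)]
    {g₂ : ∀ i, N₂ →ₛₗ[σ i] N₂' i} (hg : ∀ i, IsExt (g i)) (hg₂ : ∀ i, IsExt (g₂ i))
    (l : N →ₗ[R] N₂) (l' : ∀ i, N' i →ₗ[S i] N₂' i) (hl : ∀ i n, g₂ i (l n) = l' i (g i n))
    (hl' : ∀ i, Function.Bijective (l' i)) : Function.Bijective l := by
  constructor
  · rw [injective_iff_map_eq_zero]
    intro n hn
    refine h.eq_zero hg n fun i => (hl' i).1 ?_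
    rw [← hl, hn, map_zero, map_zero]
  · intro n
    refine h.mem_of_mem_span hg₂ (LinearMap.range l) n fun i => ?_
    obtain ⟨x, hx⟩ := (hl' i).2 (g₂ i n)
    rw [← hx]
    have hx' : x ∈ Submodule.span (S i) (Set.range (g i)) := (hg i).span_range ▸ trivial
    have h2 : Submodule.map (l' i) (Submodule.span (S i) (Set.range (g i))) ≤
        Submodule.span (S i) (g₂ i '' (LinearMap.range l)) := by
      rw [Submodule.map_span, Submodule.span_le]
      rintro _ ⟨_, ⟨m, rfl⟩, rfl⟩
      rw [← hl]
      exact Submodule.subset_span ⟨_, ⟨m, rfl⟩, rfl⟩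
    exact h2 ⟨x, hx', rfl⟩

end Cover

theorem isFlatCover_of_faithfullyFlat (hσ : σ.FaithfullyFlat) :
    IsFlatCover (fun _ : PUnit.{u + 1} => σ) where
  finite := inferInstance
  flat _ := hσ.flat
  surj p := by
    obtain ⟨q, hq⟩ := (RingHom.FaithfullyFlat.iff_flat_and_comap_surjective.1 hσ).2 p
    exact ⟨PUnit.unit, q, hq⟩

/-- If `f` becomes a base change after composition with a faithfully flat base change, then `f` is
a base change. -/
theorem IsExt.of_comp_faithfullyFlat {f : M →ₛₗ[σ] N} {g : N →ₛₗ[τ] P} (hg : IsExt g)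
    (hτ : τ.FaithfullyFlat) {k : M →ₛₗ[ρ] P} (hk' : IsExt k) (hρ : ∀ r, ρ r = τ (σ r))
    (hk : ∀ m, k m = g (f m)) : IsExt f := by
  letI := σ.toAlgebra
  have hu := tensorUnit_isExt (M := M) σ
  letI : Algebra S T := τ.toAlgebra
  have hu' := tensorUnit_isExt (M := S ⊗[R] M) τ
  let k' : M →ₛₗ[ρ] T ⊗[S] (S ⊗[R] M) :=
    { toFun := fun m => tensorUnit τ _ (tensorUnit σ M m)
      map_add' := fun x y => by rw [map_add, map_add]
      map_smul' := fun r m => by rw [map_smulₛₗ, map_smulₛₗ, hρ] }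
  have hk'' : IsExt k' := hu.comp hu' k' hρ fun _ => rfl
  have hb : Function.Bijective (hu.lift f) := by
    refine (isFlatCover_of_faithfullyFlat hτ).bijective (g := fun _ => tensorUnit τ (S ⊗[R] M))
      (g₂ := fun _ => g) (fun _ => hu') (fun _ => hg) (hu.lift f)
      (fun _ => (hk''.equiv hk').toLinearMap) (fun _ => ?_) fun _ => (hk''.equiv hk').bijective
    intro n
    change g (hu.lift f n) = hk''.equiv hk' (tensorUnit τ (S ⊗[R] M) n)
    refine hu.induction (p := fun n => g (hu.lift f n) = hk''.equiv hk' (tensorUnit τ (S ⊗[R] M) n)) n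
      (by rw [map_zero, map_zero, map_zero, map_zero])
      (fun x y hx hy => by rw [map_add, map_add, map_add, map_add, hx, hy]) fun s m => ?_
    rw [map_smul, map_smulₛₗ, map_smulₛₗ, map_smul, hu.lift_apply, ← hk]
    congr 1
    exact (hk''.equiv_apply hk' m).symm
  exact hu.comp (IsExt.of_bijective _ hb) f (fun _ => rfl) fun m => (hu.lift_apply f m).symm

end SubmoduleExt

/-! ### Effective descent of modules -/

section Descent

open TensorProduct

/-- Base change along a pushout can be computed over the smaller ring. -/
theorem IsExt.exists_tensor_bijective {R R' S : Type u} [CommRing R] [CommRing R'] [CommRing S] [Algebra R R']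
    [Algebra R S] {N N' : Type u} [AddCommGroup N] [AddCommGroup N'] [Module S N] [Module R N]
    [IsScalarTower R S N] [Module (S ⊗[R] R') N']
    {f : N →ₛₗ[(Algebra.TensorProduct.includeLeftRingHom : S →+* S ⊗[R] R')] N'} (hf : IsExt f) :
    ∃ Φ : N ⊗[R] R' ≃+ N', ∀ n r, Φ (n ⊗ₜ r) = ((1 : S) ⊗ₜ[R] r) • f n := by
  letI : Module S N' := Module.compHom _ (Algebra.TensorProduct.includeLeftRingHom : S →+* S ⊗[R] R')
  haveI : IsScalarTower S (S ⊗[R] R') N' := IsScalarTower.of_algebraMap_smul fun _ _ => rfl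
  let f' : N →ₗ[S] N' := { toFun := f, map_add' := f.map_add, map_smul' := fun s n => f.map_smulₛₗ s n }
  have h1 : IsBaseChange (S ⊗[R] R') f' := IsExt.isBaseChange f' f (fun _ => rfl) hf
  let e1 : N ⊗[R] R' ≃ₗ[S] N ⊗[S] (S ⊗[R] R') :=
    (TensorProduct.AlgebraTensorModule.cancelBaseChange R S S N R').symm
  let e2 : N ⊗[S] (S ⊗[R] R') ≃ₗ[S] (S ⊗[R] R') ⊗[S] N := TensorProduct.comm _ _ _
  refine ⟨(e1.toAddEquiv.trans e2.toAddEquiv).trans h1.equiv.toAddEquiv, fun n r => ?_⟩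
  exact h1.equiv_tmul _ _

variable {R R' : Type u} [CommRing R] [CommRing R'] [Algebra R R'] [Module.FaithfullyFlat R R']
  {D V₁ V₂ V₃ : Type u} [AddCommGroup D] [Module R D] [AddCommGroup V₁] [Module R' V₁]
  [AddCommGroup V₂] [Module (R' ⊗[R] R') V₂] [AddCommGroup V₃] [Module ((R' ⊗[R] R') ⊗[R] R') V₃]

/-- Effective descent: `D`, the equalizer of `d₀` and `d₁`, is a form of `V₁` over `R`. -/
theorem isExt_of_descent
    (d₀ : V₁ →ₛₗ[(Algebra.TensorProduct.includeRight : R' →ₐ[R] R' ⊗[R] R').toRingHom] V₂)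
    (d₁ : V₁ →ₛₗ[(Algebra.TensorProduct.includeLeftRingHom : R' →+* R' ⊗[R] R')] V₂)
    (hd₀ : Function.Injective d₀) (hd₁ : IsExt d₁)
    {c₀ c₁ : R' ⊗[R] R' →+* (R' ⊗[R] R') ⊗[R] R'}
    (hc₀ : ∀ r : R', c₀ (1 ⊗ₜ r) = 1 ⊗ₜ r) (hc₁ : ∀ r : R', c₁ (1 ⊗ₜ r) = 1 ⊗ₜ r)
    (k₀₁ : V₂ →ₛₗ[c₀] V₃) (k₀₂ : V₂ →ₛₗ[c₁] V₃)
    (k₁₂ : V₂ →ₛₗ[(Algebra.TensorProduct.includeLeftRingHom : _ →+* (R' ⊗[R] R') ⊗[R] R')] V₃)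
    (hk₁₂ : IsExt k₁₂) (h₀ : ∀ v, k₀₁ (d₀ v) = k₀₂ (d₀ v)) (h₁ : ∀ v, k₀₁ (d₁ v) = k₁₂ (d₀ v))
    (h₂ : ∀ v, k₀₂ (d₁ v) = k₁₂ (d₁ v))
    (f : D →ₛₗ[algebraMap R R'] V₁) (hf : Function.Injective f)
    (hrange : ∀ v, d₀ v = d₁ v ↔ ∃ x, f x = v) : IsExt f := by
  letI : Module R V₁ := Module.compHom _ (algebraMap R R')
  haveI : IsScalarTower R R' V₁ := IsScalarTower.of_algebraMap_smul fun _ _ => rfl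
  letI : Module R V₂ := Module.compHom _ (algebraMap R (R' ⊗[R] R'))
  haveI : IsScalarTower R (R' ⊗[R] R') V₂ := IsScalarTower.of_algebraMap_smul fun _ _ => rfl
  have smul_def₁ (r : R) (v : V₁) : r • v = algebraMap R R' r • v := rfl
  have smul_def₂ (r : R) (v : V₂) : r • v = algebraMap R (R' ⊗[R] R') r • v := rfl
  obtain ⟨Φ, hΦ⟩ := hd₁.exists_tensor_bijective
  obtain ⟨Φ', hΦ'⟩ := hk₁₂.exists_tensor_bijective
  let f' : D →ₗ[R] V₁ := { toFun := f, map_add' := f.map_add, map_smul' := fun r x => f.map_smulₛₗ r x }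
  have hD₀ (r : R) (x : V₁) : d₀ (r • x) = r • d₀ x :=
    (d₀.map_smulₛₗ _ x).trans (congrArg (fun a => a • d₀ x)
      ((Algebra.TensorProduct.includeRight : R' →ₐ[R] R' ⊗[R] R').commutes r))
  have hD₁ (r : R) (x : V₁) : d₁ (r • x) = r • d₁ x := d₁.map_smulₛₗ _ x
  let D₀ : V₁ →ₗ[R] V₂ := { toFun := d₀, map_add' := d₀.map_add, map_smul' := hD₀ }
  let D₁ : V₁ →ₗ[R] V₂ := { toFun := d₁, map_add' := d₁.map_add, map_smul' := hD₁ }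
  have hex : Function.Exact f' (D₀ - D₁) := fun v => by
    rw [LinearMap.sub_apply, sub_eq_zero]
    exact hrange v
  have hexT : Function.Exact (f'.rTensor R') ((D₀ - D₁).rTensor R') := Module.Flat.rTensor_exact R' hex
  have hinjT : Function.Injective (f'.rTensor R') :=
    Module.Flat.rTensor_preserves_injective_linearMap f' hf
  let m : D ⊗[R] R' →+ V₁ := (TensorProduct.lift
    (LinearMap.mk₂ R (fun x (r : R') => r • f' x) (by intros; simp) (by
      intro c x r; rw [map_smul, smul_comm]) (by intros; simp [add_smul]) (by
      intro c x r; rw [smul_assoc]))).toAddMonoidHom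
  have hm (x : D) (r : R') : m (x ⊗ₜ r) = r • f x := rfl
  have hmΦ (z : D ⊗[R] R') : d₀ (m z) = Φ (f'.rTensor R' z) := by
    induction z with
    | zero => rw [map_zero, map_zero, map_zero, map_zero]
    | add a b ha hb => rw [map_add, map_add, map_add, map_add, ha, hb]
    | tmul x r =>
      rw [hm, LinearMap.rTensor_tmul, hΦ, map_smulₛₗ, (hrange _).2 ⟨x, rfl⟩]
      rfl
  have hminj : Function.Injective m := by
    refine Function.Injective.of_comp (f := d₀) ?_
    have : d₀ ∘ m = Φ ∘ (f'.rTensor R') := funext hmΦ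
    rw [this]
    exact Φ.injective.comp hinjT
  have hk1 (w : V₁ ⊗[R] R') : Φ' (D₀.rTensor R' w) = k₀₁ (Φ w) := by
    induction w with
    | zero => simp
    | add a b ha hb => simp only [map_add, ha, hb]
    | tmul v r =>
      rw [LinearMap.rTensor_tmul, hΦ', hΦ, map_smulₛₗ, hc₀, h₁]
      rfl
  have hk2 (w : V₁ ⊗[R] R') : Φ' (D₁.rTensor R' w) = k₀₂ (Φ w) := by
    induction w with
    | zero => simp
    | add a b ha hb => simp only [map_add, ha, hb]
    | tmul v r =>
      rw [LinearMap.rTensor_tmul, hΦ', hΦ, map_smulₛₗ, hc₁, h₂]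
      rfl
  have hmsurj : Function.Surjective m := by
    intro v
    obtain ⟨w, hw⟩ := Φ.surjective (d₀ v)
    have h3 : (D₀ - D₁).rTensor R' w = 0 := by
      apply Φ'.injective
      rw [LinearMap.rTensor_sub, LinearMap.sub_apply, map_sub, hk1, hk2, hw, h₀, sub_self, map_zero]
    obtain ⟨z, hz⟩ := (hexT w).1 h3
    exact ⟨z, hd₀ (by rw [hmΦ, hz, hw])⟩
  have hbc : IsBaseChange R' f' := by
    refine IsBaseChange.of_equiv ?_ ?_
    · exact { (TensorProduct.comm R R' D).toAddEquiv.trans (AddEquiv.ofBijective m ⟨hminj, hmsurj⟩) with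
        map_smul' := fun r x => by
          change m (TensorProduct.comm R R' D (r • x)) = r • m (TensorProduct.comm R R' D x)
          induction x with
          | zero => simp
          | add a b ha hb => simp only [smul_add, map_add, ha, hb]
          | tmul s x => simp [smul_tmul', hm, mul_smul] }
    · intro x
      change m (x ⊗ₜ 1) = f x
      rw [hm, one_smul]
  exact IsExt.of_isBaseChange f' f (fun _ => rfl) hbc

end Descent

end

noncomputable section

/-! ### Locally split lines -/

section Invertible

open TensorProduct

variable {R S : Type u} [CommRing R] [CommRing S] {σ : R →+* S}
  {M N : Type u} [AddCommGroup M] [AddCommGroup N] [Module R M] [Module S N]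

/-- A ring homomorphism as a semilinear map. -/
def RingHom.toSemilinear (σ : R →+* S) : R →ₛₗ[σ] S where
  toFun := σ
  map_add' := σ.map_add
  map_smul' := σ.map_mul

theorem RingHom.isExt_toSemilinear (σ : R →+* S) : IsExt σ.toSemilinear := by
  intro Q _ _ g
  refine ⟨LinearMap.toSpanSingleton S Q (g 1), fun r => ?_, fun h hh => LinearMap.ext_ring ?_⟩
  · change σ r • g 1 = g r
    rw [← map_smulₛₗ, smul_eq_mul, mul_one]
  · rw [LinearMap.toSpanSingleton_apply, one_smul, ← hh]
    congr 1
    exact (map_one σ).symm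

theorem Module.Invertible.of_isExt {f : M →ₛₗ[σ] N} (hf : IsExt f) [Module.Invertible R M] :
    Module.Invertible S N := by
  letI := σ.toAlgebra
  exact Module.Invertible.congr ((tensorUnit_isExt (M := M) σ).equiv hf)

/-- The construction `M ↦ M^* ⊗ M`. -/
def TensorialConstruction.dualTensor : TensorialConstruction := .tensor (.dual .id) .id

/-- The evaluation `M^* ⊗ M → R`. -/
def TensorialConstruction.contract (R : Type u) [CommRing R] (M : ModuleCat.{u} R) :
    dualTensor.obj M →ₗ[R] R := contractLeft R M

theorem TensorialConstruction.contract_map {M : ModuleCat.{u} R} {N : ModuleCat.{u} S}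
    {f : M →ₛₗ[σ] N} (hf : IsExt f)
    (z : dualTensor.obj M) : contract S N (dualTensor.map f z) = σ (contract R M z) := by
  have h : ∀ φ : Module.Dual R M, ∃! ψ : Module.Dual S N, ∀ x, ψ (f x) = σ (φ x) := fun φ =>
    hf S (σ.toSemilinear.comp φ)
  let F : Module.Dual R M ⊗[R] M →+ S :=
    (contract S N).toAddMonoidHom.comp (dualTensor.map f).toAddMonoidHom
  let F' : Module.Dual R M ⊗[R] M →+ S := σ.toAddMonoidHom.comp (contract R M).toAddMonoidHom
  have key (z : Module.Dual R M ⊗[R] M) : F z = F' z := by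
    induction z with
    | zero => rw [map_zero, map_zero]
    | add a b ha hb => rw [map_add, map_add, ha, hb]
    | tmul φ m => exact dualMap_apply f h φ m
  exact key z

theorem IsFlatCover.invertible {ι : Type u} {S : ι → Type u} [∀ i, CommRing (S i)] {σ : ∀ i, R →+* S i}
    (h : IsFlatCover σ) {N' : ι → Type u} [∀ i, AddCommGroup (N' i)]
    [∀ i, Module (S i) (N' i)] {g : ∀ i, M →ₛₗ[σ i] N' i} (hg : ∀ i, IsExt (g i))
    (hN : ∀ i, Module.Invertible (S i) (N' i)) : Module.Invertible R M := by
  obtain ⟨h1, h2⟩ := h.finite_projective hg fun i => ⟨inferInstance, inferInstance⟩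
  let M' : ModuleCat.{u} R := .of R M
  have : Module.Finite R M' := h1
  have : Module.Projective R M' := h2
  constructor
  refine h.bijective (g := fun i => TensorialConstruction.dualTensor.map (M := M')
      (N := .of (S i) (N' i)) (g i))
    (g₂ := fun i => (σ i).toSemilinear)
    (fun i => TensorialConstruction.map_isExt _ (hg i))
    (fun i => (σ i).isExt_toSemilinear) (TensorialConstruction.contract R M')
    (fun i => TensorialConstruction.contract (S i) (.of (S i) (N' i)))
    (fun i n => (TensorialConstruction.contract_map (hg i) n).symm) fun i => ?_
  exact (hN i).bijective

/-- The submodule `K ⊆ M` is invertible and the quotient is projective. -/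
structure IsSplitLine (K : Submodule R M) : Prop where
  invertible : Module.Invertible R K
  projective : Module.Projective R (M ⧸ K)

namespace IsSplitLine

theorem exists_isCompl {K : Submodule R M} (hK : IsSplitLine K) : ∃ C, IsCompl K C := by
  have := hK.projective
  obtain ⟨s, hs⟩ := Module.projective_lifting_property K.mkQ LinearMap.id K.mkQ_surjective
  have hs' (x) : Submodule.Quotient.mk (s x) = x := LinearMap.congr_fun hs x
  let r : M →ₗ[R] K := (LinearMap.id - s ∘ₗ K.mkQ).codRestrict K fun m => by
    rw [← Submodule.Quotient.mk_eq_zero]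
    simp [hs']
  refine ⟨LinearMap.ker r, LinearMap.isCompl_of_proj fun k => Subtype.ext ?_⟩
  have : (Submodule.Quotient.mk (k : M) : M ⧸ K) = 0 := (Submodule.Quotient.mk_eq_zero K).2 k.2
  simp [r, this]

theorem of_isCompl [Module.Projective R M] {K C : Submodule R M} (hK : Module.Invertible R K)
    (h : IsCompl K C) : IsSplitLine K := by
  refine ⟨hK, ?_⟩
  have : Module.Projective R C := Module.Projective.of_split C.subtype
    (C.projectionOnto K h.symm) (by ext; simp)
  exact Module.Projective.of_equiv (Submodule.quotientEquivOfIsCompl K C h).symm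

theorem baseChange {K : Submodule R M} (hK : IsSplitLine K) {f : M →ₛₗ[σ] N} (hf : IsExt f)
    (K' : Submodule S N) (h : K' = Submodule.span S (f '' K)) :
    IsSplitLine K' ∧ IsExt (spanRestrict f K K' h) := by
  obtain ⟨C, hC⟩ := hK.exists_isCompl
  have h1 := hf.restrict_of_retraction K (K.projectionOnto C hC) (by simp) K' h
  have := hK.invertible
  have := hK.projective
  exact ⟨⟨.of_isExt h1, (hf.quotient K K' h fun k hk => h ▸ Submodule.subset_span ⟨k, hk, rfl⟩).projective⟩, h1⟩

end IsSplitLine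

theorem IsFlatCover.isSplitLine {ι : Type u} {S : ι → Type u} [∀ i, CommRing (S i)] {σ : ∀ i, R →+* S i}
    (h : IsFlatCover σ) {N' : ι → Type u} [∀ i, AddCommGroup (N' i)] [Module.Finite R M]
    [∀ i, Module (S i) (N' i)] {g : ∀ i, M →ₛₗ[σ i] N' i} (hg : ∀ i, IsExt (g i))
    {K : Submodule R M} (hK : ∀ i, IsSplitLine (Submodule.span (S i) (g i '' K))) : IsSplitLine K := by
  refine ⟨h.invertible (fun i => (hg i).restrict_of_flat (h.flat i) K _ rfl) fun i => (hK i).invertible, ?_⟩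
  refine (h.finite_projective (fun i => (hg i).quotient K _ rfl
    fun k hk => Submodule.subset_span ⟨k, hk, rfl⟩) fun i => ?_).2
  have := (hg i).finite
  exact ⟨inferInstance, (hK i).projective⟩

/-- Descent of submodules along `R → S`. -/
theorem IsExt.span_comap_eq [Algebra R S] [Module.FaithfullyFlat R S]
    {P : Type u} [AddCommGroup P] [Module (S ⊗[R] S) P]
    {f : M →ₛₗ[algebraMap R S] N} (hf : IsExt f)
    (d₀ : N →ₛₗ[(Algebra.TensorProduct.includeRight : S →ₐ[R] S ⊗[R] S).toRingHom] P)
    (d₁ : N →ₛₗ[(Algebra.TensorProduct.includeLeftRingHom : S →+* S ⊗[R] S)] P)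
    (hd₁ : IsExt d₁) (hd : ∀ m, d₀ (f m) = d₁ (f m)) (K : Submodule S N)
    (hK : Submodule.span (S ⊗[R] S) (d₀ '' K) = Submodule.span (S ⊗[R] S) (d₁ '' K)) :
    Submodule.span S (f '' (K.comap f)) = K := by
  refine le_antisymm (Submodule.span_le.2 (by rintro _ ⟨x, hx, rfl⟩; exact hx)) fun l hl => ?_
  letI : Module R N := Module.compHom _ (algebraMap R S)
  haveI : IsScalarTower R S N := IsScalarTower.of_algebraMap_smul fun _ _ => rfl
  let f' : M →ₗ[R] N := { toFun := f, map_add' := f.map_add, map_smul' := fun r x => f.map_smulₛₗ r x }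
  have hbc : IsBaseChange S f' := IsExt.isBaseChange f' f (fun _ => rfl) hf
  let L : Submodule R M := K.comap f
  let i : M ⧸ L →ₗ[R] N ⧸ K := L.liftQ ((K.mkQ.restrictScalars R) ∘ₗ f') fun x hx => by
    exact (Submodule.Quotient.mk_eq_zero K).2 hx
  have hi : Function.Injective i := by
    rw [injective_iff_map_eq_zero]
    intro x hx
    obtain ⟨x, rfl⟩ := Submodule.Quotient.mk_surjective _ x
    exact (Submodule.Quotient.mk_eq_zero L).2 ((Submodule.Quotient.mk_eq_zero K).1 hx)
  have hq := hd₁.quotient K _ rfl fun k hk => Submodule.subset_span ⟨k, hk, rfl⟩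
  obtain ⟨Φ, hΦ⟩ := hq.exists_tensor_bijective
  have key (z : M ⊗[R] S) : Φ (i.rTensor S (L.mkQ.rTensor S z)) =
      Submodule.Quotient.mk (d₀ (hbc.equiv (TensorProduct.comm R M S z))) := by
    induction z with
    | zero => rw [map_zero, map_zero, map_zero, map_zero, map_zero, map_zero]; rfl
    | add a b ha hb =>
      rw [map_add, map_add, map_add, map_add, map_add, map_add, ha, hb]; rfl
    | tmul m s =>
      rw [LinearMap.rTensor_tmul, LinearMap.rTensor_tmul, hΦ, TensorProduct.comm_tmul, hbc.equiv_tmul,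
        map_smulₛₗ]
      refine congrArg (Submodule.Quotient.mk) ?_
      exact congrArg (fun y => ((1 : S) ⊗ₜ[R] s) • y) (hd m).symm
  obtain ⟨z, hz⟩ : ∃ z, hbc.equiv (TensorProduct.comm R M S z) = l :=
    (hbc.equiv.surjective.comp (TensorProduct.comm R M S).surjective) l
  have h1 : L.mkQ.rTensor S z = 0 := by
    have hinj := Module.Flat.rTensor_preserves_injective_linearMap (M := S) i hi
    apply hinj
    apply Φ.injective
    rw [key, hz, map_zero, map_zero]
    refine (Submodule.Quotient.mk_eq_zero _).2 ?_
    rw [← hK]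
    exact Submodule.subset_span ⟨l, hl, rfl⟩
  obtain ⟨w, hw⟩ := ((rTensor_exact S (f := L.subtype) (g := L.mkQ)
    (LinearMap.exact_subtype_mkQ L) L.mkQ_surjective) z).1 h1
  rw [← hz, ← hw]
  clear hw
  induction w with
  | zero => rw [map_zero, map_zero, map_zero]; exact zero_mem _
  | add a b ha hb => rw [map_add, map_add, map_add]; exact add_mem ha hb
  | tmul m s =>
    rw [LinearMap.rTensor_tmul, TensorProduct.comm_tmul, hbc.equiv_tmul]
    exact Submodule.smul_mem _ _ (Submodule.subset_span ⟨m, m.2, rfl⟩)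

end Invertible

end

noncomputable section

/-! ### A criterion for a module to be a vector bundle -/

section

variable {R S R' S' : Type u} [CommRing R] [CommRing S] [CommRing R'] [CommRing S'] {σ : R →+* S}
  {σ' : R' →+* S'} {M N M' N' : Type u} [AddCommGroup M] [AddCommGroup N] [Module R M] [Module S N]
  [AddCommGroup M'] [AddCommGroup N'] [Module R' M'] [Module S' N']

theorem IsExt.of_bijective_semilinear {f : M →ₛₗ[σ] N} (hσ : Function.Bijective σ)
    (hf : Function.Bijective f) : IsExt f := by
  intro Q _ _ g
  let e := Equiv.ofBijective f hf
  have he (m) : e.symm (f m) = m := e.symm_apply_apply m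
  refine ⟨{ toFun := fun n => g (e.symm n), map_add' := fun x y => ?_, map_smul' := fun s x => ?_ },
    fun m => congrArg g (he m), fun h hh => LinearMap.ext fun n => ?_⟩
  · obtain ⟨x, rfl⟩ := hf.2 x
    obtain ⟨y, rfl⟩ := hf.2 y
    rw [← map_add, he, he, he, map_add]
  · obtain ⟨x, rfl⟩ := hf.2 x
    obtain ⟨s, rfl⟩ := hσ.2 s
    rw [← map_smulₛₗ, he, he, map_smulₛₗ, RingHom.id_apply]
  · obtain ⟨n, rfl⟩ := hf.2 n
    rw [hh]
    exact (congrArg g (he n)).symm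

theorem IsExt.of_ringEquiv {f : M →ₛₗ[σ] N} (hf : IsExt f) (α : R' ≃+* R) (β : S' ≃+* S)
    (a : M' ≃+ M) (b : N' ≃+ N) (ha : ∀ (r : R') m, a (r • m) = α r • a m)
    (hb : ∀ (r : S') m, b (r • m) = β r • b m) (f' : M' →ₛₗ[σ'] N')
    (hσ : ∀ r, β (σ' r) = σ (α r)) (hff : ∀ m, b (f' m) = f (a m)) : IsExt f' := by
  let a' : M' →ₛₗ[(α : R' →+* R)] M := { toFun := a, map_add' := a.map_add, map_smul' := ha }
  let b' : N →ₛₗ[(β.symm : S →+* S')] N' :=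
    { toFun := b.symm, map_add' := b.symm.map_add, map_smul' := fun r x => by
        apply b.injective
        rw [b.apply_symm_apply, hb, b.apply_symm_apply]
        exact congrArg (fun r => r • x) (β.apply_symm_apply r).symm }
  have h1 : IsExt a' := .of_bijective_semilinear α.bijective a.bijective
  have h2 : IsExt b' := .of_bijective_semilinear β.symm.bijective b.symm.bijective
  let k : M' →ₛₗ[σ.comp (α : R' →+* R)] N :=
    { toFun := fun m => f (a m), map_add' := by simp, map_smul' := fun r m => by rw [ha, map_smulₛₗ]; rfl }
  have h3 : IsExt k := h1.comp hf k (fun _ => rfl) fun _ => rfl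
  refine h3.comp h2 f' (fun r => ?_) fun m => ?_
  · exact (β.symm_apply_eq.2 (hσ r).symm).symm
  · exact (b.symm_apply_eq.2 (hff m).symm).symm

theorem IsExt.free {f : M →ₛₗ[σ] N} (hf : IsExt f) [Module.Free R M] : Module.Free S N := by
  letI := σ.toAlgebra
  exact Module.Free.of_equiv ((tensorUnit_isExt (M := M) σ).equiv hf)

theorem IsExt.free_of_away [Algebra R S] (r : R) [IsLocalization.Away r S]
    {f : M →ₛₗ[algebraMap R S] N} (hf : IsExt f)
    [Module.Free (Localization.Away r) (LocalizedModule.Away r M)] : Module.Free S N := by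
  let β : Localization.Away r ≃+* S :=
    (IsLocalization.algEquiv (.powers r) (Localization.Away r) S).toRingEquiv
  have hβ (a) : β (algebraMap R _ a) = algebraMap R S a :=
    (IsLocalization.algEquiv (.powers r) (Localization.Away r) S).commutes a
  letI : Module (Localization.Away r) N := Module.compHom N (β : Localization.Away r →+* S)
  let k : M →ₛₗ[algebraMap R (Localization.Away r)] N :=
    { toFun := f, map_add' := f.map_add, map_smul' := fun a m => by
        rw [map_smulₛₗ, ← hβ]; rfl }
  have hk : IsExt k := hf.of_ringEquiv (RingEquiv.refl R) β (AddEquiv.refl M) (AddEquiv.refl N)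
    (fun _ _ => rfl) (fun _ _ => rfl) k hβ fun _ => rfl
  let m := LocalizedModule.mkLinearMap (.powers r) M
  let m' : M →ₛₗ[algebraMap R (Localization.Away r)] LocalizedModule.Away r M :=
    { toFun := m, map_add' := m.map_add, map_smul' := fun a x =>
        (m.map_smul a x).trans (algebraMap_smul (Localization.Away r) a (m x)).symm }
  have hm : IsExt m' := .of_isBaseChange m m' (fun _ => rfl)
    (IsLocalizedModule.isBaseChange (.powers r) (Localization.Away r) m)
  have : Module.Free (Localization.Away r) N := Module.Free.of_equiv (hm.equiv hk)
  let i : N →ₛₗ[(β : Localization.Away r →+* S)] N :=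
    { toFun := id, map_add' := fun _ _ => rfl, map_smul' := fun _ _ => rfl }
  exact (IsExt.of_bijective_semilinear (f := i) β.bijective Function.bijective_id).free

end

namespace AlgebraicGeometry.Scheme.Modules
variable {X Y Z T : Scheme.{u}}

/-- The restriction of sections. -/
def rest (E : Y.Modules) {W W' : Y.Opens} (h : W' ≤ W) :
    Γ(E, W) →ₛₗ[(Y.presheaf.map (homOfLE h).op).hom] Γ(E, W') where
  toFun := E.presheaf.map (homOfLE h).op
  map_add' := map_add _
  map_smul' r x := map_smul E (homOfLE h) r x

theorem isVectorBundle_of_restrict {E : Y.Modules} (h : ∀ y : Y, ∃ (Z : Scheme.{u}) (f : Z ⟶ Y)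
    (_ : IsOpenImmersion f), y ∈ Set.range f ∧ ∃ n : ℕ, Nonempty (E.restrict f ≅
      (SheafOfModules.free (R := Z.ringCatSheaf) (ULift.{u} (Fin n)) : Z.Modules))) :
    IsVectorBundle E := by
  intro y
  obtain ⟨Z, f, hf, hy, n, ⟨e⟩⟩ := h y
  refine ⟨f.opensRange, hy, n, ⟨?_⟩⟩
  let i : (f.opensRange : Scheme.{u}) ⟶ Z := (Scheme.Hom.isoOpensRange f).inv
  have hi : i ≫ f = f.opensRange.ι := Scheme.Hom.isoOpensRange_inv_comp f
  exact (restrictFunctorCongr hi.symm).app E ≪≫ (restrictFunctorComp i f).app E ≪≫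
    (restrictFunctor i).mapIso e ≪≫ (restrictFunctorIsoPullback i).app _ ≪≫ pullbackFreeIso _ _

theorem isIso_fromTildeΓ_restrict (E : Y.Modules)
    (hE : ∀ W W' : Y.affineOpens, ∀ h : W'.1 ≤ W.1, IsExt (rest E h)) {A : CommRingCat.{u}}
    (x : Spec A ⟶ Y) [IsOpenImmersion x] : IsIso (E.restrict x).fromTildeΓ := by
  rw [isIso_fromTildeΓ_iff_isLocalizing]
  intro f
  let N := E.restrict x
  let D : (Spec A).Opens := PrimeSpectrum.basicOpen f
  let S : CommRingCat.{u} := Γ(Spec A, D)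
  have hT : IsAffineOpen (x ''ᵁ ⊤) := (isAffineOpen_top (Spec A)).image_of_isOpenImmersion x
  have hD : IsAffineOpen (x ''ᵁ D) :=
    (IsAffineOpen.Spec_basicOpen (R := A) f).image_of_isOpenImmersion x
  have hle : x ''ᵁ D ≤ x ''ᵁ ⊤ := x.image_mono le_top
  have h1 := hE ⟨_, hT⟩ ⟨_, hD⟩ hle
  let g : Γ(N, ⊤) →ₗ[A] Γ(N, D) := ((modulesSpecToSheaf.obj N).obj.map (homOfLE (le_top : D ≤ ⊤)).op).hom
  change IsLocalizedModule (.powers f) g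
  rw [isLocalizedModule_iff_isBaseChange (.powers f) Γ(Spec A, D)]
  let g' : Γ(N, ⊤) →ₛₗ[algebraMap A Γ(Spec A, D)] Γ(N, D) :=
    { toFun := g
      map_add' := g.map_add
      map_smul' := fun r m => (g.map_smul r m).trans (algebraMap_smul Γ(Spec A, D) r (g m)).symm }
  refine IsExt.isBaseChange g g' (fun _ => rfl) ?_
  let α : A ≃+* Γ(Y, x ''ᵁ ⊤) :=
    ((Scheme.ΓSpecIso A).symm ≪≫ (x.appIso ⊤).symm).commRingCatIsoToRingEquiv
  let β : Γ(Spec A, D) ≃+* Γ(Y, x ''ᵁ D) := (x.appIso D).symm.commRingCatIsoToRingEquiv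
  let a : Γ(N, ⊤) ≃+ Γ(E, x ''ᵁ ⊤) := AddEquiv.refl Γ(E, x ''ᵁ ⊤)
  let b : Γ(N, D) ≃+ Γ(E, x ''ᵁ D) := AddEquiv.refl Γ(E, x ''ᵁ D)
  refine h1.of_ringEquiv α β a b (fun r m => ?_) (fun r m => rfl) g'
    (fun r => ?_) fun m => rfl
  · refine (smul_Spec_def (M := N) r m).trans ?_
    change (x.appIso ⊤).inv _ • _ = (x.appIso ⊤).inv ((Scheme.ΓSpecIso A).inv r) • (show Γ(E, x ''ᵁ ⊤) from m)
    have : (Spec A).presheaf.map (homOfLE (le_top : (⊤ : (Spec A).Opens) ≤ ⊤)).op = 𝟙 _ :=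
      (Spec A).presheaf.map_id _
    exact congr((x.appIso ⊤).inv ($this ((Scheme.ΓSpecIso A).inv r)) • (show Γ(E, x ''ᵁ ⊤) from m))
  · have h2 := x.appIso_inv_naturality (homOfLE (le_top : D ≤ ⊤)).op
    exact congr($h2 ((Scheme.ΓSpecIso A).inv r))

theorem gammaMod_restrict_free (E : Y.Modules)
    (hE : ∀ W W' : Y.affineOpens, ∀ h : W'.1 ≤ W.1, IsExt (rest E h)) (W : Y.affineOpens)
    [IsOpenImmersion W.2.fromSpec] (hle : W.2.fromSpec ''ᵁ ⊤ ≤ W.1)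
    (hf : Module.Free Γ(Y, W) Γ(E, W)) (hfin : Module.Finite Γ(Y, W) Γ(E, W)) :
    Module.Free Γ(Y, W) (gammaMod (E.restrict W.2.fromSpec)) ∧
      Module.Finite Γ(Y, W) (gammaMod (E.restrict W.2.fromSpec)) := by
  let x := W.2.fromSpec
  let A := Γ(Y, W)
  have hT : IsAffineOpen (x ''ᵁ ⊤) := (isAffineOpen_top (Spec A)).image_of_isOpenImmersion x
  have h1 := hE W ⟨_, hT⟩ hle
  let α : A ≃+* Γ(Y, x ''ᵁ ⊤) :=
    ((Scheme.ΓSpecIso A).symm ≪≫ (x.appIso ⊤).symm).commRingCatIsoToRingEquiv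
  let b : gammaMod (E.restrict x) ≃+ Γ(E, x ''ᵁ ⊤) := AddEquiv.refl Γ(E, x ''ᵁ ⊤)
  have hb (r : A) (m) : b (r • m) = α r • b m := by
    refine (smul_Spec_def (M := E.restrict x) r m).trans ?_
    change (x.appIso ⊤).inv _ • _ = (x.appIso ⊤).inv ((Scheme.ΓSpecIso A).inv r) • (show Γ(E, x ''ᵁ ⊤) from m)
    have : (Spec A).presheaf.map (homOfLE (le_top : (⊤ : (Spec A).Opens) ≤ ⊤)).op = 𝟙 _ :=
      (Spec A).presheaf.map_id _
    exact congr((x.appIso ⊤).inv ($this ((Scheme.ΓSpecIso A).inv r)) • (show Γ(E, x ''ᵁ ⊤) from m))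
  let f' : Γ(E, W) →ₛₗ[(α.symm : Γ(Y, x ''ᵁ ⊤) →+* A).comp (Y.presheaf.map (homOfLE hle).op).hom]
      gammaMod (E.restrict x) :=
    { toFun := fun m => b.symm (rest E hle m)
      map_add' := by simp
      map_smul' := fun r m => by
        apply b.injective
        rw [b.apply_symm_apply, hb, b.apply_symm_apply, map_smulₛₗ]
        exact congrArg (fun r => r • _) (α.apply_symm_apply _).symm }
  have h2 : IsExt f' := h1.of_ringEquiv (RingEquiv.refl A) α (AddEquiv.refl Γ(E, W)) b
    (fun _ _ => rfl) hb f' (fun r => α.apply_symm_apply _) fun m => rfl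
  exact ⟨h2.free, h2.finite⟩

theorem exists_finsupp_equiv (A : CommRingCat.{u}) (P : ModuleCat.{u} A) [Module.Free A P] [Module.Finite A P] :
    ∃ n : ℕ, Nonempty (P ≃ₗ[A] ModuleCat.of A (ULift.{u} (Fin n) →₀ A)) := by
  rcases subsingleton_or_nontrivial A with h | h
  · have : Subsingleton P := Module.subsingleton A P
    exact ⟨0, ⟨LinearEquiv.ofSubsingleton _ (ULift.{u} (Fin 0) →₀ A)⟩⟩
  · let b := Module.finBasis A P
    exact ⟨_, ⟨(b.reindex Equiv.ulift.symm).repr⟩⟩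

theorem isVectorBundle_of_isExt (E : Y.Modules)
    (hE : ∀ W W' : Y.affineOpens, ∀ h : W'.1 ≤ W.1, IsExt (rest E h))
    (hfin : ∀ W : Y.affineOpens, Module.Finite Γ(Y, W) Γ(E, W) ∧ Module.Projective Γ(Y, W) Γ(E, W)) :
    IsVectorBundle E := by
  have hfree : ∀ y : Y, ∃ W : Y.affineOpens, y ∈ W.1 ∧ Module.Free Γ(Y, W) Γ(E, W) := by
    intro y
    obtain ⟨W, hyW⟩ : ∃ W : Y.affineOpens, y ∈ W.1 := by
      obtain ⟨_, ⟨W, hW', rfl⟩, hW, -⟩ := Y.isBasis_affineOpens.exists_subset_of_mem_open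
        (Set.mem_univ y) isOpen_univ
      exact ⟨⟨W, hW'⟩, hW⟩
    obtain ⟨h1, h2⟩ := hfin W
    let p := W.2.primeIdealOf ⟨y, hyW⟩
    have : Module.FinitePresentation Γ(Y, W) Γ(E, W) := Module.finitePresentation_of_projective _ _
    let Rp := Localization.AtPrime p.asIdeal
    have : Module.Free Rp (LocalizedModule p.asIdeal.primeCompl Γ(E, W)) :=
      Module.free_of_flat_of_isLocalRing
    obtain ⟨r, hr, hfr, -⟩ := Module.FinitePresentation.exists_free_localizedModule_powers
      p.asIdeal.primeCompl (LocalizedModule.mkLinearMap p.asIdeal.primeCompl Γ(E, W)) Rp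
    let D : Y.affineOpens := ⟨Y.basicOpen r, W.2.basicOpen r⟩
    have hD : D.1 ≤ W.1 := Y.basicOpen_le r
    refine ⟨D, ?_, ?_⟩
    · have h3 : p ∈ W.2.fromSpec ⁻¹ᵁ Y.basicOpen r := by
        rw [W.2.fromSpec_preimage_basicOpen]; exact hr
      have h4 : W.2.fromSpec p = y := W.2.fromSpec_primeIdealOf ⟨y, hyW⟩
      rw [← h4]
      exact h3
    · letI : Algebra Γ(Y, W) Γ(Y, D) := (Y.presheaf.map (homOfLE hD).op).hom.toAlgebra
      have : IsLocalization.Away r Γ(Y, D) := W.2.isLocalization_of_eq_basicOpen r (homOfLE hD) rfl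
      exact IsExt.free_of_away (f := rest E hD) r (hE W D hD)
  refine isVectorBundle_of_restrict fun y => ?_
  obtain ⟨W, hy, hf⟩ := hfree y
  have := W.2.isOpenImmersion_fromSpec
  have := isIso_fromTildeΓ_restrict E hE W.2.fromSpec
  refine ⟨_, W.2.fromSpec, inferInstance, ?_, ?_⟩
  · rw [W.2.range_fromSpec]; exact hy
  obtain ⟨h1, h2⟩ := gammaMod_restrict_free E hE W
    (le_of_eq ((Scheme.Hom.image_top_eq_opensRange _).trans W.2.opensRange_fromSpec)) hf (hfin W).1
  obtain ⟨n, ⟨e⟩⟩ := exists_finsupp_equiv Γ(Y, W) (gammaMod (E.restrict W.2.fromSpec))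
  exact ⟨n, ⟨(asIso (E.restrict W.2.fromSpec).fromTildeΓ).symm ≪≫
    (tilde.functor _).mapIso e.toModuleIso ≪≫ tildeFinsupp _⟩⟩

end AlgebraicGeometry.Scheme.Modules
end

noncomputable section

namespace AlgebraicGeometry.Scheme.Modules
variable {X Y Z T : Scheme.{u}} {R S : CommRingCat.{u}}
open Limits

/-! ### Affine points of an affine faithfully flat morphism -/

theorem exists_isPullback_Spec (p : Z ⟶ Y) [IsAffineHom p] [Flat p] [Surjective p] (y : Spec R ⟶ Y) :
    ∃ (R' : CommRingCat.{u}) (σ : R ⟶ R') (z : Spec R' ⟶ Z), IsPullback z (Spec.map σ) p y ∧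
      σ.hom.FaithfullyFlat := by
  let Q := Limits.pullback p y
  let q : Q ⟶ Spec R := Limits.pullback.snd p y
  have : IsAffine Q := isAffine_of_isAffineHom q
  let σ : R ⟶ Γ(Q, ⊤) := Spec.preimage (Q.isoSpec.inv ≫ q)
  have hσ : Spec.map σ = Q.isoSpec.inv ≫ q := Spec.map_preimage _
  have h1 : IsPullback (Q.isoSpec.inv ≫ Limits.pullback.fst p y) (Spec.map σ) p y :=
    (IsPullback.of_hasPullback p y).of_iso Q.isoSpec (Iso.refl _) (Iso.refl _) (Iso.refl _)
      (by simp) (by simp [hσ, q]) (by simp) (by simp)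
  refine ⟨_, σ, _, h1, (flat_and_surjective_SpecMap_iff σ).1 ?_⟩
  exact ⟨MorphismProperty.of_isPullback (P := @Flat) h1 ‹_›,
    MorphismProperty.of_isPullback (P := @Surjective) h1 ‹_›⟩

theorem isOpenImmersion_of_isPullback_fromSpec {p : Z ⟶ Y} {U : Y.Opens} (hU : IsAffineOpen U)
    {T : Scheme.{u}} {z : T ⟶ Z} {s : T ⟶ Spec Γ(Y, U)} (h : IsPullback z s p hU.fromSpec) :
    ∃ _ : IsOpenImmersion z, p ⁻¹ᵁ U = z.opensRange := by
  have := hU.isOpenImmersion_fromSpec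
  have h1 : IsOpenImmersion z := MorphismProperty.of_isPullback (P := @IsOpenImmersion) h.flip ‹_›
  refine ⟨h1, ?_⟩
  have h2 : z = h.isoPullback.hom ≫ Limits.pullback.fst p hU.fromSpec := h.isoPullback_hom_fst.symm
  apply TopologicalSpace.Opens.ext
  have h3 : Set.range z = Set.range (Limits.pullback.fst p hU.fromSpec) := by
    rw [h2, Scheme.Hom.comp_base, TopCat.coe_comp, Set.range_comp, Set.range_eq_univ.2
      h.isoPullback.hom.surjective, Set.image_univ]
  have h4 := IsOpenImmersion.range_pullbackFst hU.fromSpec p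
  refine Eq.trans ?_ (h3.trans h4).symm
  rw [hU.opensRange_fromSpec]

theorem exists_Spec_lift {p : Z ⟶ Y} {R' : CommRingCat.{u}} {σ : R ⟶ R'} {z : Spec R' ⟶ Z}
    {y : Spec R ⟶ Y} (h : IsPullback z (Spec.map σ) p y) (z' : Spec S ⟶ Z) (a : R ⟶ S)
    (ha : z' ≫ p = Spec.map a ≫ y) : ∃ τ : R' ⟶ S, Spec.map τ ≫ z = z' ∧ σ ≫ τ = a := by
  refine ⟨Spec.preimage (h.lift z' (Spec.map a) ha), by simp, ?_⟩
  apply Spec.map_injective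
  simp

/-! ### Equalizers of modules -/

theorem exists_equalizer {A B : Y.Modules} (f g : A ⟶ B) :
    ∃ (E : Y.Modules) (ι : E ⟶ A), ι ≫ f = ι ≫ g ∧
      ∀ (U : Y.Opens) (s : Γ(A, U)), f.app U s = g.app U s → ∃! t : Γ(E, U), ι.app U t = s := by
  refine ⟨equalizer f g, equalizer.ι f g, equalizer.condition f g, fun U s hs => ?_⟩
  let Φ : Y.Modules ⥤ Type u := toPresheaf Y ⋙ (CategoryTheory.evaluation _ _).obj (.op U) ⋙ CategoryTheory.forget Ab
  have : PreservesFiniteLimits (toPresheaf Y) := PreservesLimits.preservesFiniteLimits _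
  have : PreservesLimitsOfShape WalkingParallelPair (toPresheaf Y) := inferInstance
  have : PreservesLimitsOfShape WalkingParallelPair
      ((CategoryTheory.evaluation (TopologicalSpace.Opens Y)ᵒᵖ Ab.{u}).obj (.op U)) := inferInstance
  have : PreservesLimitsOfShape WalkingParallelPair (CategoryTheory.forget Ab.{u}) := inferInstance
  have : PreservesLimitsOfShape WalkingParallelPair Φ := comp_preservesLimitsOfShape _ _
  have h := isLimitForkMapOfIsLimit Φ (equalizer.condition f g) (equalizerIsEqualizer f g)
  exact (Types.type_equalizer_iff_unique _ _).1 ⟨h⟩ s hs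

/-! ### Descent of vector bundles along affine faithfully flat morphisms -/

/-- A descent datum for `M` along `p`, in terms of the modules at affine points. -/
structure DescentDatum (p : Z ⟶ Y) (M : Z.Modules) where
  iso {R : CommRingCat.{u}} (z z' : Spec R ⟶ Z) (h : z ≫ p = z' ≫ p) :
    (sectionsAt z).obj M ≃ₗ[R] (sectionsAt z').obj M
  natural {R S : CommRingCat.{u}} (σ : R ⟶ S) {z z' : Spec R ⟶ Z} {w w' : Spec S ⟶ Z}
    (h : z ≫ p = z' ≫ p) (hw : Spec.map σ ≫ z = w) (hw' : Spec.map σ ≫ z' = w')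
    (h' : w ≫ p = w' ≫ p) (m : (sectionsAt z).obj M) :
    iso w w' h' (res M σ hw m) = res M σ hw' (iso z z' h m)
  cocycle {R : CommRingCat.{u}} (z z' z'' : Spec R ⟶ Z) (h : z ≫ p = z' ≫ p) (h' : z' ≫ p = z'' ≫ p)
    (h'' : z ≫ p = z'' ≫ p) (m : (sectionsAt z).obj M) : iso z' z'' h' (iso z z' h m) = iso z z'' h'' m

namespace DescentDatum

variable {p : Z ⟶ Y} {M : Z.Modules} (φ : DescentDatum p M)

/-- The sections of `M` on the inverse image of `U` which are compatible with the descent datum. -/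
def Compatible (U : Y.Opens) (s : Γ(M, p ⁻¹ᵁ U)) : Prop :=
  ∀ {R : CommRingCat.{u}} (z z' : Spec R ⟶ Z) (h : z ≫ p = z' ≫ p) (hz : ⊤ ≤ z ⁻¹ᵁ (p ⁻¹ᵁ U))
    (hz' : ⊤ ≤ z' ⁻¹ᵁ (p ⁻¹ᵁ U)), φ.iso z z' h (ev z _ hz s) = ev z' _ hz' s

theorem exists_module (hM : IsVectorBundle M) : ∃ (E : Y.Modules) (ι : E ⟶ (pushforward p).obj M),
    (∀ U (t : Γ(E, U)), φ.Compatible U (ι.app U t)) ∧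
    ∀ U (s : Γ(M, p ⁻¹ᵁ U)), φ.Compatible U s → ∃! t : Γ(E, U), ι.app U t = s := by
  let p₁ : Limits.pullback p p ⟶ Z := pullback.fst p p
  let p₂ : Limits.pullback p p ⟶ Z := pullback.snd p p
  have hp : p₁ ≫ p = p₂ ≫ p := pullback.condition
  have hw {R : CommRingCat.{u}} (w : Spec R ⟶ Limits.pullback p p) : (w ≫ p₂) ≫ p = (w ≫ p₁) ≫ p := by
    rw [Category.assoc, Category.assoc, hp]
  obtain ⟨Ψ, hΨ⟩ := (hM.pullback p₂).exists_hom (hM.pullback p₁)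
    (fun w => ((sectionsPullback w p₁ M).toLinearEquiv.symm.toLinearMap ∘ₗ
      (φ.iso (w ≫ p₂) (w ≫ p₁) (hw w)).toLinearMap) ∘ₗ (sectionsPullback w p₂ M).toLinearEquiv.toLinearMap)
    (by
      intro R S x y σ h m
      have e1 := res_sectionsPullback p₂ M σ h m
      have e2 := φ.natural σ (hw x) (by rw [← h, Category.assoc] : Spec.map σ ≫ x ≫ p₂ = y ≫ p₂)
        (by rw [← h, Category.assoc] : Spec.map σ ≫ x ≫ p₁ = y ≫ p₁) (hw y)
        ((sectionsPullback x p₂ M).hom m)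
      apply (sectionsPullback y p₁ M).toLinearEquiv.injective
      refine ((sectionsPullback y p₁ M).toLinearEquiv.apply_symm_apply _).trans ?_
      refine (congrArg (φ.iso (y ≫ p₂) (y ≫ p₁) (hw y)) e1).trans (e2.trans ?_)
      refine Eq.trans ?_ (res_sectionsPullback p₁ M σ h _).symm
      exact congrArg (res M σ _) ((sectionsPullback x p₁ M).toLinearEquiv.apply_symm_apply _).symm)
  have hΨ' {R : CommRingCat.{u}} (w : Spec R ⟶ Limits.pullback p p) (m) :
      (sectionsPullback w p₁ M).hom ((sectionsAt w).map Ψ m) =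
        φ.iso (w ≫ p₂) (w ≫ p₁) (hw w) ((sectionsPullback w p₂ M).hom m) := by
    have h1 := LinearMap.congr_fun (hΨ w) m
    refine (congrArg (sectionsPullback w p₁ M).hom h1).trans ?_
    exact (sectionsPullback w p₁ M).toLinearEquiv.apply_symm_apply _
  let d₀ : (pushforward p).obj M ⟶ (pushforward (p₁ ≫ p)).obj ((Modules.pullback p₁).obj M) :=
    (pushforward p).map ((pullbackPushforwardAdjunction p₁).unit.app M) ≫ (pushforwardComp p₁ p).hom.app _
  let d₁ : (pushforward p).obj M ⟶ (pushforward (p₁ ≫ p)).obj ((Modules.pullback p₁).obj M) :=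
    (pushforward p).map ((pullbackPushforwardAdjunction p₂).unit.app M ≫ (pushforward p₂).map Ψ) ≫
      (pushforwardComp p₂ p).hom.app _ ≫ (pushforwardCongr hp.symm).hom.app _
  have hd₀ {R : CommRingCat.{u}} (w : Spec R ⟶ Limits.pullback p p) (U : Y.Opens)
      (hU : ⊤ ≤ w ⁻¹ᵁ ((p₁ ≫ p) ⁻¹ᵁ U)) (h' : ⊤ ≤ (w ≫ p₁) ⁻¹ᵁ (p ⁻¹ᵁ U)) (s : Γ(M, p ⁻¹ᵁ U)) :
      (sectionsPullback w p₁ M).hom (ev w ((p₁ ≫ p) ⁻¹ᵁ U) hU (d₀.app U s)) = ev (w ≫ p₁) _ h' s :=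
    sectionsPullback_ev p₁ w (p ⁻¹ᵁ U) h' h' s
  have hd₁ {R : CommRingCat.{u}} (w : Spec R ⟶ Limits.pullback p p) (U : Y.Opens)
      (hU : ⊤ ≤ w ⁻¹ᵁ ((p₁ ≫ p) ⁻¹ᵁ U)) (h' : ⊤ ≤ (w ≫ p₂) ⁻¹ᵁ (p ⁻¹ᵁ U)) (s : Γ(M, p ⁻¹ᵁ U)) :
      (sectionsPullback w p₁ M).hom (ev w ((p₁ ≫ p) ⁻¹ᵁ U) hU (d₁.app U s)) =
        φ.iso (w ≫ p₂) (w ≫ p₁) (hw w) (ev (w ≫ p₂) _ h' s) := by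
    have hle : (p₁ ≫ p) ⁻¹ᵁ U ≤ p₂ ⁻¹ᵁ (p ⁻¹ᵁ U) := by rw [hp]; exact le_rfl
    have e1 : d₁.app U s = ((Modules.pullback p₁).obj M).presheaf.map (homOfLE hle).op
        (Ψ.app _ (pullSection p₂ s)) := rfl
    have e2 := ev_map w (homOfLE hle) hU (Ψ.app _ (pullSection p₂ s))
    have e3 := ev_naturality Ψ w (p₂ ⁻¹ᵁ (p ⁻¹ᵁ U)) h' (pullSection p₂ s)
    have e4 := hΨ' w (ev w (p₂ ⁻¹ᵁ (p ⁻¹ᵁ U)) h' (pullSection p₂ s))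
    rw [sectionsPullback_ev p₂ w (p ⁻¹ᵁ U) h' h' s] at e4
    rw [e1]
    exact (congrArg (sectionsPullback w p₁ M).hom (e2.trans e3.symm)).trans e4
  have key (U : Y.Opens) (s : Γ(M, p ⁻¹ᵁ U)) : d₀.app U s = d₁.app U s ↔ φ.Compatible U s := by
    constructor
    · intro hs R z z' h hz hz'
      let w : Spec R ⟶ Limits.pullback p p := pullback.lift z' z h.symm
      have h₁ : w ≫ p₁ = z' := pullback.lift_fst _ _ _
      have h₂ : w ≫ p₂ = z := pullback.lift_snd _ _ _
      clear_value w
      subst h₁ h₂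
      exact (hd₁ w U hz' hz s).symm.trans ((congrArg (fun t => (sectionsPullback w p₁ M).hom
        (ev w ((p₁ ≫ p) ⁻¹ᵁ U) hz' t)) hs.symm).trans (hd₀ w U hz' hz' s))
    · intro hs
      refine section_ext (M := (Modules.pullback p₁).obj M) (U := (p₁ ≫ p) ⁻¹ᵁ U) fun w hU => ?_
      have h' : ⊤ ≤ (w ≫ p₂) ⁻¹ᵁ (p ⁻¹ᵁ U) := by
        intro a _
        have h2 := hU (Set.mem_univ a)
        rw [hp] at h2
        exact h2
      apply (sectionsPullback w p₁ M).toLinearEquiv.injective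
      exact (hd₀ w U hU hU s).trans ((hs (w ≫ p₂) (w ≫ p₁) (hw w) h' hU).symm.trans (hd₁ w U hU h' s).symm)
  obtain ⟨E, ι, hι, hE⟩ := exists_equalizer d₀ d₁
  refine ⟨E, ι, fun U t => (key U _).1 ?_, fun U s hs => hE U s ((key U s).2 hs)⟩
  exact congr(Hom.app $hι U t)

end DescentDatum

end AlgebraicGeometry.Scheme.Modules
end

noncomputable section

open scoped TensorProduct

/-- The first terms of the Čech nerve of a faithfully flat ring homomorphism, with effective descent
for modules and submodules. -/
structure DescentRings {R R' : CommRingCat.{u}} (σ : R ⟶ R') where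
  A₂ : CommRingCat.{u}
  A₃ : CommRingCat.{u}
  iL : R' ⟶ A₂
  iR : R' ⟶ A₂
  jL : A₂ ⟶ A₃
  jR : R' ⟶ A₃
  c₀ : A₂ ⟶ A₃
  c₁ : A₂ ⟶ A₃
  μ : A₂ ⟶ R'
  σ_i : σ ≫ iL = σ ≫ iR
  iR_c₀ : iR ≫ c₀ = jR
  iR_c₁ : iR ≫ c₁ = jR
  iL_c₀ : iL ≫ c₀ = iR ≫ jL
  iL_c₁ : iL ≫ c₁ = iL ≫ jL
  iR_μ : iR ≫ μ = 𝟙 R'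
  exists_desc {S : CommRingCat.{u}} (a b : R' ⟶ S) (h : σ ≫ a = σ ≫ b) :
    ∃ c : A₂ ⟶ S, iL ≫ c = a ∧ iR ≫ c = b
  descent {D V₁ V₂ V₃ : Type u} [AddCommGroup D] [Module R D] [AddCommGroup V₁] [Module R' V₁]
    [AddCommGroup V₂] [Module A₂ V₂] [AddCommGroup V₃] [Module A₃ V₃]
    (d₀ : V₁ →ₛₗ[iR.hom] V₂) (d₁ : V₁ →ₛₗ[iL.hom] V₂) (_ : Function.Injective d₀) (_ : IsExt d₁)
    (k₀₁ : V₂ →ₛₗ[c₀.hom] V₃) (k₀₂ : V₂ →ₛₗ[c₁.hom] V₃) (k₁₂ : V₂ →ₛₗ[jL.hom] V₃)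
    (_ : IsExt k₁₂) (_ : ∀ v, k₀₁ (d₀ v) = k₀₂ (d₀ v)) (_ : ∀ v, k₀₁ (d₁ v) = k₁₂ (d₀ v))
    (_ : ∀ v, k₀₂ (d₁ v) = k₁₂ (d₁ v)) (f : D →ₛₗ[σ.hom] V₁) (_ : Function.Injective f)
    (_ : ∀ v, d₀ v = d₁ v ↔ ∃ x, f x = v) : IsExt f
  span_comap {M N P : Type u} [AddCommGroup M] [Module R M] [AddCommGroup N] [Module R' N]
    [AddCommGroup P] [Module A₂ P] {f : M →ₛₗ[σ.hom] N} (_ : IsExt f)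
    (d₀ : N →ₛₗ[iR.hom] P) (d₁ : N →ₛₗ[iL.hom] P) (_ : IsExt d₁) (_ : ∀ m, d₀ (f m) = d₁ (f m))
    (K : Submodule R' N) (_ : Submodule.span A₂ (d₀ '' K) = Submodule.span A₂ (d₁ '' K)) :
    Submodule.span R' (f '' (K.comap f)) = K

theorem DescentRings.nonempty {R R' : CommRingCat.{u}} (σ : R ⟶ R') (hσ : σ.hom.FaithfullyFlat) :
    Nonempty (DescentRings σ) := by
  letI : Algebra R R' := σ.hom.toAlgebra
  have : Module.FaithfullyFlat R R' := hσ
  let iL : R' →ₐ[R] R' ⊗[R] R' := Algebra.TensorProduct.includeLeft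
  let iR : R' →ₐ[R] R' ⊗[R] R' := Algebra.TensorProduct.includeRight
  refine ⟨{
    A₂ := .of (R' ⊗[R] R')
    A₃ := .of ((R' ⊗[R] R') ⊗[R] R')
    iL := CommRingCat.ofHom Algebra.TensorProduct.includeLeftRingHom
    iR := CommRingCat.ofHom iR.toRingHom
    jL := CommRingCat.ofHom Algebra.TensorProduct.includeLeftRingHom
    jR := CommRingCat.ofHom
      (Algebra.TensorProduct.includeRight : R' →ₐ[R] (R' ⊗[R] R') ⊗[R] R').toRingHom
    c₀ := CommRingCat.ofHom (Algebra.TensorProduct.map iR (AlgHom.id R R')).toRingHom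
    c₁ := CommRingCat.ofHom (Algebra.TensorProduct.map iL (AlgHom.id R R')).toRingHom
    μ := CommRingCat.ofHom (Algebra.TensorProduct.lmul' R (S := R')).toRingHom
    σ_i := by ext r; exact (iL.commutes r).trans (iR.commutes r).symm
    iR_c₀ := by ext r; exact Algebra.TensorProduct.map_tmul _ _ _ _
    iR_c₁ := by ext r; exact Algebra.TensorProduct.map_tmul _ _ _ _
    iL_c₀ := by ext r; exact Algebra.TensorProduct.map_tmul _ _ _ _
    iL_c₁ := by ext r; exact Algebra.TensorProduct.map_tmul _ _ _ _
    iR_μ := by ext r; exact (Algebra.TensorProduct.lmul'_apply_tmul _ _).trans (one_mul r)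
    exists_desc := fun {S} a b h => ?_
    descent := fun d₀ d₁ h₀ h₁ k₀₁ k₀₂ k₁₂ hk e₁ e₂ e₃ f hf hr =>
      isExt_of_descent (R := R) (R' := R') d₀ d₁ h₀ h₁
      (fun r => Algebra.TensorProduct.map_tmul _ _ _ _) (fun r => Algebra.TensorProduct.map_tmul _ _ _ _)
      k₀₁ k₀₂ k₁₂ hk e₁ e₂ e₃ f hf hr
    span_comap := fun hf d₀ d₁ h₁ hd K hK => IsExt.span_comap_eq (R := R) (S := R') hf d₀ d₁ h₁ hd K hK }⟩
  letI : Algebra R S := (σ ≫ a).hom.toAlgebra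
  let a' : R' →ₐ[R] S := { a.hom with commutes' := fun _ => rfl }
  let b' : R' →ₐ[R] S := { b.hom with commutes' := fun r => congr($h.symm r) }
  refine ⟨CommRingCat.ofHom (Algebra.TensorProduct.lift a' b' fun _ _ => Commute.all _ _).toRingHom, ?_, ?_⟩
  · ext r
    refine (Algebra.TensorProduct.lift_tmul a' b' (fun _ _ => Commute.all _ _) r 1).trans ?_
    rw [map_one, mul_one]; rfl
  · ext r
    refine (Algebra.TensorProduct.lift_tmul a' b' (fun _ _ => Commute.all _ _) 1 r).trans ?_
    rw [map_one, one_mul]; rfl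

end

noncomputable section

namespace AlgebraicGeometry.Scheme.Modules
variable {X Y Z T : Scheme.{u}} {R S : CommRingCat.{u}}
open Limits

theorem evFun_comp {x : Spec R ⟶ Y} {y : Spec S ⟶ Y} (a : R ⟶ S) (h : Spec.map a ≫ x = y) (U : Y.Opens)
    (hx : ⊤ ≤ x ⁻¹ᵁ U) (hy : ⊤ ≤ y ⁻¹ᵁ U) : evFun y U hy = evFun x U hx ≫ a := by
  subst h
  have h1 := Scheme.Hom.appLE_comp_appLE (Spec.map a) x U ⊤ ⊤ hx le_top
  have h2 : (Spec.map a).appLE ⊤ ⊤ le_top = (Spec.map a).appTop := Scheme.Hom.appLE_eq_app _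
  rw [h2] at h1
  have h3 := Scheme.ΓSpecIso_naturality a
  exact (congrArg (· ≫ (Scheme.ΓSpecIso S).hom) h1.symm).trans ((Category.assoc _ _ _).trans
    ((congrArg (x.appLE U ⊤ hx ≫ ·) h3).trans (Category.assoc _ _ _).symm))

theorem evFun_fromSpec {U : Y.Opens} (hU : IsAffineOpen U) (h : ⊤ ≤ hU.fromSpec ⁻¹ᵁ U) :
    evFun hU.fromSpec U h = 𝟙 _ := by
  rw [evFun, Scheme.Hom.appLE, hU.fromSpec_app_self, Category.assoc, Category.assoc,
    ← Functor.map_comp_assoc]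
  have h1 : (eqToHom (by rw [hU.fromSpec_preimage_self]) ≫ (homOfLE h).op :
      Opposite.op (⊤ : (Spec Γ(Y, U)).Opens) ⟶ Opposite.op ⊤) = 𝟙 _ := Subsingleton.elim _ _
  refine (congrArg (fun k => (Scheme.ΓSpecIso Γ(Y, U)).inv ≫ (Spec Γ(Y, U)).presheaf.map k ≫
    (Scheme.ΓSpecIso Γ(Y, U)).hom) h1).trans ?_
  simp

theorem evFun_of_fromSpec {U : Y.Opens} (hU : IsAffineOpen U) {x : Spec S ⟶ Y} (a : Γ(Y, U) ⟶ S)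
    (h : Spec.map a ≫ hU.fromSpec = x) (hx : ⊤ ≤ x ⁻¹ᵁ U) : evFun x U hx = a := by
  have h1 := top_le_fromSpec_preimage hU
  rw [evFun_comp a h U h1 hx, evFun_fromSpec hU h1, Category.id_comp]

/-- Evaluation of sections, as a semilinear map. -/
def evLin (M : Y.Modules) (x : Spec R ⟶ Y) (U : Y.Opens) (h : ⊤ ≤ x ⁻¹ᵁ U) :
    Γ(M, U) →ₛₗ[(evFun x U h).hom] (sectionsAt x).obj M where
  toFun := ev x U h
  map_add' := ev_add x U h
  map_smul' := ev_smul x U h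

theorem IsVectorBundle.isExt_evLin {M : Y.Modules} (hM : IsVectorBundle M) (x : Spec R ⟶ Y) {U : Y.Opens}
    (hU : IsAffineOpen U) (h : ⊤ ≤ x ⁻¹ᵁ U) : IsExt (evLin M x U h) := by
  obtain ⟨a, ha⟩ := exists_lift_fromSpec hU x h
  have h1 := top_le_fromSpec_preimage hU
  have h2 : IsExt (evLin M hU.fromSpec U h1) := .of_bijective_semilinear
    (by rw [evFun_fromSpec]; exact Function.bijective_id) (ev_fromSpec_bijective M hU h1)
  refine h2.comp (hM.res_isExt a ha) _ (fun r => ?_) fun m => (res_ev a ha U h1 m).symm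
  rw [evFun_comp a ha U h1 h]; rfl

theorem _root_.IsExt.congr_hom {R S M N : Type u} [CommRing R] [CommRing S] {σ τ : R →+* S}
    [AddCommGroup M] [AddCommGroup N] [Module R M] [Module S N] {f : M →ₛₗ[σ] N} (hf : IsExt f)
    {g : M →ₛₗ[τ] N} (h : ∀ r, τ r = σ r) (hg : ∀ m, g m = f m) : IsExt g :=
  hf.comp (.of_linearEquiv (.refl S N)) g h hg

namespace DescentDatum

variable {p : Z ⟶ Y} {M : Z.Modules} (φ : DescentDatum p M) {E : Y.Modules}
  (ι : E ⟶ (pushforward p).obj M)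

/-- The values of the sections of `E` at the points of `Z`. -/
def val (z : Spec R ⟶ Z) (U : Y.Opens) (h : ⊤ ≤ (z ≫ p) ⁻¹ᵁ U) :
    Γ(E, U) →ₛₗ[(evFun (z ≫ p) U h).hom] (sectionsAt z).obj M where
  toFun t := ev z (p ⁻¹ᵁ U) h (ι.app U t)
  map_add' s t := by
    exact (congrArg (ev z (p ⁻¹ᵁ U) h) (map_add _ s t)).trans (ev_add z (p ⁻¹ᵁ U) h _ _)
  map_smul' r t := by
    refine (congrArg (ev z (p ⁻¹ᵁ U) h) (Hom.app_smul ι r t)).trans ?_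
    refine (ev_smul z (p ⁻¹ᵁ U) h (p.app U r) (ι.app U t)).trans ?_
    have h1 : p.app U ≫ evFun z (p ⁻¹ᵁ U) h = evFun (z ≫ p) U h := by
      have h2 : p.app U ≫ z.appLE (p ⁻¹ᵁ U) ⊤ h = (z ≫ p).appLE U ⊤ h := by
        rw [Scheme.Hom.app_eq_appLE]
        exact Scheme.Hom.appLE_comp_appLE z p U _ ⊤ le_rfl h
      exact congrArg (· ≫ (Scheme.ΓSpecIso R).hom) h2
    exact congr($h1 r • _)

theorem val_res {z : Spec R ⟶ Z} {w : Spec S ⟶ Z} (σ : R ⟶ S) (hw : Spec.map σ ≫ z = w) (U : Y.Opens)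
    (h : ⊤ ≤ (z ≫ p) ⁻¹ᵁ U) (h' : ⊤ ≤ (w ≫ p) ⁻¹ᵁ U) (t : Γ(E, U)) :
    res M σ hw (val ι z U h t) = val ι w U h' t :=
  res_ev σ hw (p ⁻¹ᵁ U) h (ι.app U t)

theorem isExt_of_range {R R' : CommRingCat.{u}} {σ : R ⟶ R'} (D : DescentRings σ) (hM : IsVectorBundle M)
    {z : Spec R' ⟶ Z} {wL wR : Spec D.A₂ ⟶ Z} (hL : Spec.map D.iL ≫ z = wL) (hR : Spec.map D.iR ≫ z = wR)
    (hLR : wL ≫ p = wR ≫ p) {N : Type u} [AddCommGroup N] [Module R N]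
    (f : N →ₛₗ[σ.hom] (sectionsAt z).obj M) (hf : Function.Injective f)
    (hr : ∀ v, res M D.iR hR v = φ.iso wL wR hLR (res M D.iL hL v) ↔ ∃ x, f x = v) : IsExt f := by
  obtain ⟨z₀, hz₀⟩ : ∃ z₀, Spec.map D.jR ≫ z = z₀ := ⟨_, rfl⟩
  obtain ⟨z₁, hz₁⟩ : ∃ z₁, Spec.map D.jL ≫ wR = z₁ := ⟨_, rfl⟩
  obtain ⟨z₂, hz₂⟩ : ∃ z₂, Spec.map D.jL ≫ wL = z₂ := ⟨_, rfl⟩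
  have c0R : Spec.map D.c₀ ≫ wR = z₀ := by rw [← hR, ← Spec.map_comp_assoc, D.iR_c₀, hz₀]
  have c1R : Spec.map D.c₁ ≫ wR = z₀ := by rw [← hR, ← Spec.map_comp_assoc, D.iR_c₁, hz₀]
  have c0L : Spec.map D.c₀ ≫ wL = z₁ := by
    rw [← hL, ← Spec.map_comp_assoc, D.iL_c₀, Spec.map_comp_assoc, hR, hz₁]
  have c1L : Spec.map D.c₁ ≫ wL = z₂ := by
    rw [← hL, ← Spec.map_comp_assoc, D.iL_c₁, Spec.map_comp_assoc, hL, hz₂]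
  have h21 : z₂ ≫ p = z₁ ≫ p := by rw [← hz₂, ← hz₁, Category.assoc, Category.assoc, hLR]
  have h10 : z₁ ≫ p = z₀ ≫ p := by rw [← c0L, ← c0R, Category.assoc, Category.assoc, hLR]
  have h20 := h21.trans h10
  have hinj : Function.Injective (res M D.iR hR) := by
    have h5 : Spec.map D.μ ≫ wR = z := by
      rw [← hR, ← Spec.map_comp_assoc, D.iR_μ, Spec.map_id, Category.id_comp]
    have h6 : Spec.map (𝟙 R') ≫ z = z := by rw [Spec.map_id, Category.id_comp]
    have h7 : Spec.map (D.iR ≫ D.μ) ≫ z = z := by rw [D.iR_μ]; exact h6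
    refine Function.LeftInverse.injective (g := res M D.μ h5) fun m => ?_
    have a1 := res_res M D.iR D.μ hR h5 h7 m
    have a2 := res_congr M D.iR_μ h7 h6 m
    exact a1.trans (a2.trans (res_id M h6 m))
  let d₁ : (sectionsAt z).obj M →ₛₗ[D.iL.hom] (sectionsAt wR).obj M :=
    (φ.iso wL wR hLR).toLinearMap.comp (res M D.iL hL)
  let k₁₂ : (sectionsAt wR).obj M →ₛₗ[D.jL.hom] (sectionsAt z₀).obj M :=
    (φ.iso z₁ z₀ h10).toLinearMap.comp (res M D.jL hz₁)
  have hd₁ : IsExt d₁ := (hM.res_isExt D.iL hL).comp_linearEquiv (φ.iso wL wR hLR) _ fun _ => rfl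
  have hk₁₂ : IsExt k₁₂ := (hM.res_isExt D.jL hz₁).comp_linearEquiv (φ.iso z₁ z₀ h10) _ fun _ => rfl
  have e01 (v : (sectionsAt z).obj M) : res M D.c₀ c0R (d₁ v) = k₁₂ (res M D.iR hR v) := by
    have a1 := φ.natural D.c₀ hLR c0L c0R h10 (res M D.iL hL v)
    have a2 := res_comm M D.iL D.c₀ D.iR D.jL hL c0L hR hz₁ D.iL_c₀ v
    exact a1.symm.trans (congrArg (φ.iso z₁ z₀ h10) a2)
  have e02 (v : (sectionsAt z).obj M) : res M D.c₁ c1R (d₁ v) = k₁₂ (d₁ v) := by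
    have a1 := φ.natural D.c₁ hLR c1L c1R h20 (res M D.iL hL v)
    have a2 := res_comm M D.iL D.c₁ D.iL D.jL hL c1L hL hz₂ D.iL_c₁ v
    have a3 := φ.natural D.jL hLR hz₂ hz₁ h21 (res M D.iL hL v)
    have a4 := φ.cocycle z₂ z₁ z₀ h21 h10 h20 (res M D.jL hz₂ (res M D.iL hL v))
    exact a1.symm.trans ((congrArg (φ.iso z₂ z₀ h20) a2).trans
      (a4.symm.trans (congrArg (φ.iso z₁ z₀ h10) a3)))
  have e00 (v : (sectionsAt z).obj M) : res M D.c₀ c0R (res M D.iR hR v) = res M D.c₁ c1R (res M D.iR hR v) :=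
    res_comm M D.iR D.c₀ D.iR D.c₁ hR c0R hR c1R (D.iR_c₀.trans D.iR_c₁.symm) v
  exact D.descent (res M D.iR hR) d₁ hinj hd₁ (res M D.c₀ c0R) (res M D.c₁ c1R) k₁₂ hk₁₂ e00 e01 e02 f hf hr

variable {ι}

theorem isExt_val_of_isPullback
    (hι : ∀ U (t : Γ(E, U)), φ.Compatible U (ι.app U t))
    (hE : ∀ U (s : Γ(M, p ⁻¹ᵁ U)), φ.Compatible U s → ∃! t : Γ(E, U), ι.app U t = s)
    (hM : IsVectorBundle M) {W : Y.Opens} (hW : IsAffineOpen W) {R' : CommRingCat.{u}}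
    {σ : Γ(Y, W) ⟶ R'} {z : Spec R' ⟶ Z} (h : IsPullback z (Spec.map σ) p hW.fromSpec)
    (hσ : σ.hom.FaithfullyFlat) (hz : ⊤ ≤ (z ≫ p) ⁻¹ᵁ W) : IsExt (val ι z W hz) := by
  obtain ⟨D⟩ := DescentRings.nonempty σ hσ
  obtain ⟨wL, hL⟩ : ∃ wL, Spec.map D.iL ≫ z = wL := ⟨_, rfl⟩
  obtain ⟨wR, hR⟩ : ∃ wR, Spec.map D.iR ≫ z = wR := ⟨_, rfl⟩
  have hLR : wL ≫ p = wR ≫ p := by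
    rw [← hL, ← hR, Category.assoc, Category.assoc, h.w, ← Spec.map_comp_assoc, ← Spec.map_comp_assoc,
      D.σ_i]
  have hval : evFun (z ≫ p) W hz = σ := evFun_of_fromSpec hW σ h.w.symm hz
  obtain ⟨_, hr⟩ := isOpenImmersion_of_isPullback_fromSpec hW h
  have hb : Function.Bijective (ev (M := M) z (p ⁻¹ᵁ W) hz) := ev_bijective z M _ hr hz
  let f : Γ(E, W) →ₛₗ[σ.hom] (sectionsAt z).obj M :=
    { toFun := val ι z W hz
      map_add' := map_add _
      map_smul' := fun r m => (map_smulₛₗ (val ι z W hz) r m).trans congr($hval r • _) }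
  suffices hf : IsExt f from hf.congr_hom (fun r => congr($hval r)) fun _ => rfl
  have hwL : ⊤ ≤ wL ⁻¹ᵁ (p ⁻¹ᵁ W) := by
    rw [← hL]; exact fun r _ => hz (Set.mem_univ ((Spec.map D.iL) r))
  have hwR : ⊤ ≤ wR ⁻¹ᵁ (p ⁻¹ᵁ W) := by
    rw [← hR]; exact fun r _ => hz (Set.mem_univ ((Spec.map D.iR) r))
  refine φ.isExt_of_range D hM hL hR hLR f (fun t t' ht => ?_) fun v => ⟨fun hv => ?_, ?_⟩
  · have h1 : ι.app W t = ι.app W t' := hb.1 ht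
    exact (hE W _ (hι W t')).unique h1 rfl
  · obtain ⟨s, rfl⟩ := hb.2 v
    have hs : φ.Compatible W s := by
      intro A w w' hw hz hz'
      obtain ⟨a, ha⟩ := exists_lift_fromSpec hW (w ≫ p) hz
      obtain ⟨τ, hτ, hστ⟩ := exists_Spec_lift h w a ha.symm
      obtain ⟨τ', hτ', hστ'⟩ := exists_Spec_lift h w' a (hw.symm.trans ha.symm)
      obtain ⟨c, hc, hc'⟩ := D.exists_desc τ τ' (hστ.trans hστ'.symm)
      have hcw : Spec.map c ≫ wL = w := by rw [← hL, ← Spec.map_comp_assoc, hc, hτ]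
      have hcw' : Spec.map c ≫ wR = w' := by rw [← hR, ← Spec.map_comp_assoc, hc', hτ']
      have e1 := res_ev (M := M) D.iL hL (p ⁻¹ᵁ W) ‹_› s
      have e2 := res_ev (M := M) c hcw (p ⁻¹ᵁ W) hwL s
      have e3 := res_ev (M := M) D.iR hR (p ⁻¹ᵁ W) ‹_› s
      have e4 := res_ev (M := M) c hcw' (p ⁻¹ᵁ W) hwR s
      have e5 := φ.natural c hLR hcw hcw' hw (ev wL (p ⁻¹ᵁ W) hwL s)
      refine (congrArg (φ.iso w w' hw) e2.symm).trans (e5.trans (Eq.trans ?_ e4))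
      refine congrArg (res M c hcw') ?_
      exact (congrArg (φ.iso wL wR hLR) e1.symm).trans (hv.symm.trans e3)
    obtain ⟨t, ht, -⟩ := hE W s hs
    exact ⟨t, congrArg (ev z (p ⁻¹ᵁ W) hz) ht⟩
  · rintro ⟨t, rfl⟩
    have e1 := res_ev (M := M) D.iL hL (p ⁻¹ᵁ W) hz (ι.app W t)
    have e3 := res_ev (M := M) D.iR hR (p ⁻¹ᵁ W) hz (ι.app W t)
    exact e3.trans ((hι W t wL wR hLR hwL hwR).symm.trans (congrArg (φ.iso wL wR hLR) e1.symm))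

end DescentDatum

end AlgebraicGeometry.Scheme.Modules
end

noncomputable section

namespace AlgebraicGeometry.Scheme.Modules
variable {X Y Z T : Scheme.{u}} {R S : CommRingCat.{u}}
open Limits

theorem top_le_comp {U : Y.Opens} {x : Spec R ⟶ Y} (a : R ⟶ S) (y : Spec S ⟶ Y)
    (h : Spec.map a ≫ x = y) (hx : ⊤ ≤ x ⁻¹ᵁ U) : ⊤ ≤ y ⁻¹ᵁ U := by
  subst h; exact fun r _ => hx (Set.mem_univ ((Spec.map a) r))

theorem exists_affine_cover (y : Spec R ⟶ Y) :
    ∃ (ι : Type u) (S : ι → CommRingCat.{u}) (σ : ∀ i, R ⟶ S i), IsFlatCover (fun i => (σ i).hom) ∧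
      ∀ i, ∃ U, IsAffineOpen U ∧ ⊤ ≤ (Spec.map (σ i) ≫ y) ⁻¹ᵁ U := by
  refine exists_zariski_cover y _ fun r => ?_
  obtain ⟨_, ⟨W, hW', rfl⟩, hW, -⟩ := Y.isBasis_affineOpens.exists_subset_of_mem_open
    (Set.mem_univ (y r)) isOpen_univ
  exact ⟨W, hW, hW'⟩

namespace DescentDatum

variable {p : Z ⟶ Y} {M : Z.Modules} (φ : DescentDatum p M) {E : Y.Modules}
  {ι : E ⟶ (pushforward p).obj M} [IsAffineHom p] [Flat p] [Surjective p]

theorem isExt_val (hι : ∀ U (t : Γ(E, U)), φ.Compatible U (ι.app U t))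
    (hE : ∀ U (s : Γ(M, p ⁻¹ᵁ U)), φ.Compatible U s → ∃! t : Γ(E, U), ι.app U t = s)
    (hM : IsVectorBundle M) {W : Y.Opens} (hW : IsAffineOpen W) (z : Spec R ⟶ Z)
    (hz : ⊤ ≤ (z ≫ p) ⁻¹ᵁ W) : IsExt (val ι z W hz) := by
  obtain ⟨R', σ, z₀, h, hσ⟩ := exists_isPullback_Spec p hW.fromSpec
  obtain ⟨a, ha⟩ := exists_lift_fromSpec hW (z ≫ p) hz
  obtain ⟨τ, hτ, hστ⟩ := exists_Spec_lift h z a ha.symm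
  have hz₀ : ⊤ ≤ (z₀ ≫ p) ⁻¹ᵁ W := by
    rw [h.w]; exact top_le_comp σ _ rfl (top_le_fromSpec_preimage hW)
  have h₀ := isExt_val_of_isPullback φ hι hE hM hW h hσ hz₀
  refine h₀.comp (hM.res_isExt τ hτ) _ (fun r => ?_) fun t => (val_res ι τ hτ W hz₀ hz t).symm
  rw [evFun_of_fromSpec hW a ha hz, evFun_of_fromSpec hW σ h.w.symm hz₀, ← hστ]
  rfl

theorem isExt_rest (hι : ∀ U (t : Γ(E, U)), φ.Compatible U (ι.app U t))
    (hE : ∀ U (s : Γ(M, p ⁻¹ᵁ U)), φ.Compatible U s → ∃! t : Γ(E, U), ι.app U t = s)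
    (hM : IsVectorBundle M) (W W' : Y.affineOpens) (hW : W'.1 ≤ W.1) : IsExt (rest E hW) := by
  obtain ⟨R', σ, z, h, hσ⟩ := exists_isPullback_Spec p W'.2.fromSpec
  have hz : ⊤ ≤ (z ≫ p) ⁻¹ᵁ W'.1 := by
    rw [h.w]; exact top_le_comp σ _ rfl (top_le_fromSpec_preimage W'.2)
  have hz' : ⊤ ≤ (z ≫ p) ⁻¹ᵁ W.1 := fun r hr => hW (hz hr)
  have h1 := φ.isExt_val hι hE hM W'.2 z hz
  have h2 := φ.isExt_val hι hE hM W.2 z hz'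
  refine h1.of_comp_faithfullyFlat ?_ h2 (fun r => ?_) fun t => ?_
  · rw [evFun_of_fromSpec W'.2 σ h.w.symm hz]; exact hσ
  · have e1 : evFun (z ≫ p) W.1 hz' = Y.presheaf.map (homOfLE hW).op ≫ evFun (z ≫ p) W'.1 hz := by
      have e2 := Scheme.Hom.map_appLE (z ≫ p) hz (homOfLE hW).op
      exact (congrArg (· ≫ (Scheme.ΓSpecIso R').hom) e2.symm).trans (Category.assoc _ _ _)
    exact congr($e1 r)
  · have e1 : ι.app W'.1 (E.presheaf.map (homOfLE hW).op t) =
        M.presheaf.map ((TopologicalSpace.Opens.map p.base).map (homOfLE hW)).op (ι.app W.1 t) :=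
      congr($(ι.mapPresheaf.naturality (homOfLE hW).op) t)
    have e2 := ev_map (M := M) z ((TopologicalSpace.Opens.map p.base).map (homOfLE hW)) hz (ι.app W.1 t)
    exact e2.symm.trans (congrArg (ev z (p ⁻¹ᵁ W'.1) hz) e1.symm)

theorem isVectorBundle_descent (hι : ∀ U (t : Γ(E, U)), φ.Compatible U (ι.app U t))
    (hE : ∀ U (s : Γ(M, p ⁻¹ᵁ U)), φ.Compatible U s → ∃! t : Γ(E, U), ι.app U t = s)
    (hM : IsVectorBundle M) : IsVectorBundle E := by
  refine isVectorBundle_of_isExt E (φ.isExt_rest hι hE hM) fun W => ?_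
  obtain ⟨R', σ, z, h, hσ⟩ := exists_isPullback_Spec p W.2.fromSpec
  have hz : ⊤ ≤ (z ≫ p) ⁻¹ᵁ W.1 := by
    rw [h.w]; exact top_le_comp σ _ rfl (top_le_fromSpec_preimage W.2)
  refine (isFlatCover_of_faithfullyFlat (σ := (evFun (z ≫ p) W.1 hz).hom) ?_).finite_projective
    (fun _ => φ.isExt_val hι hE hM W.2 z hz) fun _ => hM.finite_projective z
  rw [evFun_of_fromSpec W.2 σ h.w.symm hz]; exact hσ

/-- The comparison of the descended module with the given one, at an affine point. -/
def compar (ι : E ⟶ (pushforward p).obj M) (z : Spec R ⟶ Z) :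
    (sectionsAt (z ≫ p)).obj E →ₗ[R] (sectionsAt z).obj M :=
  ((sectionsAt z).map (((pullbackPushforwardAdjunction p).homEquiv E M).symm ι)).hom ∘ₗ
    (sectionsPullback z p E).toLinearEquiv.symm.toLinearMap

theorem compar_ev (z : Spec R ⟶ Z) (U : Y.Opens) (h : ⊤ ≤ (z ≫ p) ⁻¹ᵁ U) (t : Γ(E, U)) :
    compar ι z (ev (z ≫ p) U h t) = ev z (p ⁻¹ᵁ U) h (ι.app U t) := by
  have e1 := sectionsPullback_ev p z U h h t
  have e2 : (sectionsPullback z p E).toLinearEquiv.symm (ev (z ≫ p) U h t) =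
      ev z (p ⁻¹ᵁ U) h (pullSection p t) :=
    (LinearEquiv.symm_apply_eq _).2 e1.symm
  have e3 := ev_naturality (((pullbackPushforwardAdjunction p).homEquiv E M).symm ι) z (p ⁻¹ᵁ U) h
    (pullSection p t)
  have e4 : (pullbackPushforwardAdjunction p).unit.app E ≫
      (pushforward p).map (((pullbackPushforwardAdjunction p).homEquiv E M).symm ι) = ι := by
    exact ((pullbackPushforwardAdjunction p).homEquiv_unit _ _ _).symm.trans (Equiv.apply_symm_apply _ ι)
  have e5 := congr(Hom.app $e4 U t)
  refine (congrArg (fun m => (sectionsAt z).map (((pullbackPushforwardAdjunction p).homEquiv E M).symm ι) m)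
    e2).trans (e3.trans (congrArg (ev z (p ⁻¹ᵁ U) h) e5))

theorem compar_res (ι : E ⟶ (pushforward p).obj M) {z : Spec R ⟶ Z} {w : Spec S ⟶ Z} (σ : R ⟶ S)
    (h : Spec.map σ ≫ z = w) (h' : Spec.map σ ≫ z ≫ p = w ≫ p) (m : (sectionsAt (z ≫ p)).obj E) :
    compar ι w (res E σ h' m) = res M σ h (compar ι z m) := by
  obtain ⟨n, rfl⟩ := (sectionsPullback z p E).toLinearEquiv.surjective m
  have e1 := res_sectionsPullback p E σ h n
  have e2 : (sectionsPullback w p E).toLinearEquiv.symm (res E σ h' ((sectionsPullback z p E).hom n)) =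
      res _ σ h n := (LinearEquiv.symm_apply_eq _).2 e1.symm
  have e3 := res_naturality (((pullbackPushforwardAdjunction p).homEquiv E M).symm ι) σ h n
  have e4 : (sectionsPullback z p E).toLinearEquiv.symm ((sectionsPullback z p E).toLinearEquiv n) = n :=
    LinearEquiv.symm_apply_apply _ _
  exact (congrArg (fun m => (sectionsAt w).map (((pullbackPushforwardAdjunction p).homEquiv E M).symm ι) m)
    e2).trans (e3.trans (congrArg (fun n => res M σ h ((sectionsAt z).map
      (((pullbackPushforwardAdjunction p).homEquiv E M).symm ι) n)) e4.symm))

theorem compar_bijective (hι : ∀ U (t : Γ(E, U)), φ.Compatible U (ι.app U t))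
    (hE : ∀ U (s : Γ(M, p ⁻¹ᵁ U)), φ.Compatible U s → ∃! t : Γ(E, U), ι.app U t = s)
    (hM : IsVectorBundle M) (z : Spec R ⟶ Z) : Function.Bijective (compar ι z) := by
  have hEV := φ.isVectorBundle_descent hι hE hM
  have key {A : CommRingCat.{u}} (z : Spec A ⟶ Z) {W : Y.Opens} (hW : IsAffineOpen W)
      (hz : ⊤ ≤ (z ≫ p) ⁻¹ᵁ W) : Function.Bijective (compar ι z) := by
    have h1 := hEV.isExt_evLin (z ≫ p) hW hz
    have h2 := φ.isExt_val hι hE hM hW z hz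
    have h3 : IsExt (compar ι z) := h1.of_comp (compar ι z) h2 (fun r => rfl)
      fun t => (compar_ev z W hz t).symm
    exact h3.bijective Function.bijective_id
  obtain ⟨κ, A, σ, hσ, hA⟩ := exists_affine_cover (z ≫ p)
  choose U hU hU' using hA
  refine hσ.bijective (fun i => hEV.res_isExt (σ i) (Category.assoc _ _ _).symm)
    (fun i => hM.res_isExt (σ i) rfl) _ (fun i => compar ι (Spec.map (σ i) ≫ z))
    (fun i m => (compar_res ι (σ i) rfl _ m).symm) fun i => key _ (hU i) ?_
  rw [Category.assoc]; exact hU' i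

/-- `compar` with a name for the point of the base. -/
def comparAt (ι : E ⟶ (pushforward p).obj M) (z : Spec R ⟶ Z) {y : Spec R ⟶ Y} (h : z ≫ p = y) :
    (sectionsAt y).obj E →ₗ[R] (sectionsAt z).obj M :=
  h ▸ compar ι z

theorem comparAt_res (ι : E ⟶ (pushforward p).obj M) {z : Spec R ⟶ Z} {w : Spec S ⟶ Z} {y : Spec R ⟶ Y}
    {x : Spec S ⟶ Y} (σ : R ⟶ S) (hw : Spec.map σ ≫ z = w) (hx : Spec.map σ ≫ y = x)
    (h : z ≫ p = y) (h' : w ≫ p = x) (m : (sectionsAt y).obj E) :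
    comparAt ι w h' (res E σ hx m) = res M σ hw (comparAt ι z h m) := by
  subst h h'
  exact compar_res ι σ hw hx m

theorem comparAt_ev {z : Spec R ⟶ Z} {y : Spec R ⟶ Y} (h : z ≫ p = y) (U : Y.Opens)
    (hy : ⊤ ≤ y ⁻¹ᵁ U) (hz : ⊤ ≤ z ⁻¹ᵁ (p ⁻¹ᵁ U)) (t : Γ(E, U)) :
    comparAt ι z h (ev y U hy t) = ev z (p ⁻¹ᵁ U) hz (ι.app U t) := by
  subst h
  exact compar_ev z U hy t

theorem iso_comparAt (hι : ∀ U (t : Γ(E, U)), φ.Compatible U (ι.app U t))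
    (hEV : IsVectorBundle E) (hM : IsVectorBundle M) {z z' : Spec R ⟶ Z} {y : Spec R ⟶ Y}
    (h : z ≫ p = y) (h' : z' ≫ p = y) (hz : z ≫ p = z' ≫ p) (m : (sectionsAt y).obj E) :
    φ.iso z z' hz (comparAt ι z h m) = comparAt ι z' h' m := by
  have key {A : CommRingCat.{u}} {z z' : Spec A ⟶ Z} {y : Spec A ⟶ Y} (h : z ≫ p = y)
      (h' : z' ≫ p = y) (hz : z ≫ p = z' ≫ p) (m : (sectionsAt y).obj E) {W : Y.Opens}
      (hW : IsAffineOpen W) (hy : ⊤ ≤ y ⁻¹ᵁ W) :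
      φ.iso z z' hz (comparAt ι z h m) = comparAt ι z' h' m := by
    have hzW : ⊤ ≤ z ⁻¹ᵁ (p ⁻¹ᵁ W) := by subst h; exact hy
    have hzW' : ⊤ ≤ z' ⁻¹ᵁ (p ⁻¹ᵁ W) := by subst h'; exact hy
    have e1 : (φ.iso z z' hz).toLinearMap ∘ₗ comparAt ι z h = comparAt ι z' h' :=
      (hEV.isExt_evLin y hW hy).ext fun t =>
        (congrArg (φ.iso z z' hz) (comparAt_ev h W hy hzW t)).trans
          ((hι W t z z' hz hzW hzW').trans (comparAt_ev h' W hy hzW' t).symm)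
    exact LinearMap.congr_fun e1 m
  obtain ⟨κ, A, σ, hσ, hA⟩ := exists_affine_cover y
  refine hM.ext_of_cover hσ (y' := fun i => Spec.map (σ i) ≫ z') (fun i => rfl) fun i => ?_
  obtain ⟨U, hU, hU'⟩ := hA i
  have e0 : (Spec.map (σ i) ≫ z) ≫ p = Spec.map (σ i) ≫ y := by rw [Category.assoc, h]
  have e0' : (Spec.map (σ i) ≫ z') ≫ p = Spec.map (σ i) ≫ y := by rw [Category.assoc, h']
  have e1 := key e0 e0' (e0.trans e0'.symm) (res E (σ i) rfl m) hU hU'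
  have e2 := φ.natural (σ i) hz rfl rfl (e0.trans e0'.symm) (comparAt ι z h m)
  have e3 := comparAt_res ι (σ i) rfl rfl h e0 m
  have e4 := comparAt_res ι (σ i) rfl rfl h' e0' m
  exact e2.symm.trans ((congrArg (φ.iso _ _ _) e3.symm).trans (e1.trans e4))

/-- Vector bundles descend along affine faithfully flat morphisms. -/
theorem exists_descent (hM : IsVectorBundle M) : ∃ (E : Y.Modules) (v : ∀ {R : CommRingCat.{u}}
      (z : Spec R ⟶ Z) (y : Spec R ⟶ Y) (_ : z ≫ p = y), (sectionsAt y).obj E ≃ₗ[R] (sectionsAt z).obj M),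
    IsVectorBundle E ∧
    (∀ {R S : CommRingCat.{u}} {z : Spec R ⟶ Z} {w : Spec S ⟶ Z} {y : Spec R ⟶ Y} {x : Spec S ⟶ Y}
      (σ : R ⟶ S) (hw : Spec.map σ ≫ z = w) (hx : Spec.map σ ≫ y = x) (h : z ≫ p = y) (h' : w ≫ p = x)
      (m : (sectionsAt y).obj E), v w x h' (res E σ hx m) = res M σ hw (v z y h m)) ∧
    ∀ {R : CommRingCat.{u}} {z z' : Spec R ⟶ Z} {y : Spec R ⟶ Y} (h : z ≫ p = y) (h' : z' ≫ p = y)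
      (hz : z ≫ p = z' ≫ p) (m : (sectionsAt y).obj E), φ.iso z z' hz (v z y h m) = v z' y h' m := by
  obtain ⟨E, ι, hι, hE⟩ := φ.exists_module hM
  have hEV := φ.isVectorBundle_descent hι hE hM
  have hb {R : CommRingCat.{u}} (z : Spec R ⟶ Z) (y : Spec R ⟶ Y) (h : z ≫ p = y) :
      Function.Bijective (comparAt ι z h) := by
    subst h; exact φ.compar_bijective hι hE hM z
  exact ⟨E, fun z y h => .ofBijective (comparAt ι z h) (hb z y h), hEV,
    fun σ hw hx h h' m => comparAt_res ι σ hw hx h h' m,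
    fun h h' hz m => φ.iso_comparAt hι hEV hM h h' hz m⟩

end DescentDatum

end AlgebraicGeometry.Scheme.Modules
end

noncomputable section
open AlgebraicGeometry.Scheme AlgebraicGeometry.Scheme.Modules

section

theorem span_image_span {R S M N : Type u} [CommRing R] [CommRing S] {σ : R →+* S} [AddCommGroup M]
    [AddCommGroup N] [Module R M] [Module S N] (f : M →ₛₗ[σ] N) (s : Set M) :
    Submodule.span S (f '' (Submodule.span R s)) = Submodule.span S (f '' s) := by
  refine le_antisymm (Submodule.span_le.2 ?_) (Submodule.span_mono (Set.image_mono Submodule.subset_span))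
  rintro _ ⟨m, hm, rfl⟩
  induction hm using Submodule.span_induction with
  | mem x hx => exact Submodule.subset_span ⟨x, hx, rfl⟩
  | zero => rw [map_zero]; exact zero_mem _
  | add x y _ _ hx hy => rw [map_add]; exact add_mem hx hy
  | smul r x _ hx => rw [map_smulₛₗ]; exact Submodule.smul_mem _ _ hx

section SpansLine

variable {R S A : Type u} [CommRing R] [CommRing S] [CommRing A] {σ : R →+* S} {τ : S →+* A}
  {ρ : R →+* A} {t : TensorialConstruction} {M : ModuleCat.{u} R} {N : ModuleCat.{u} S}
  {P : ModuleCat.{u} A} {K : Submodule R (t.obj M)} {L : Submodule S (t.obj N)}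
  {Q : Submodule A (t.obj P)}

/-- The submodule `L ⊆ t(N)` is generated by the image of `K ⊆ t(M)` under the map induced by `f`. -/
def SpansLine (f : M →ₛₗ[σ] N) (K : Submodule R (t.obj M)) (L : Submodule S (t.obj N)) : Prop :=
  L = Submodule.span S (t.map f '' K)

namespace SpansLine

theorem span_comp [Module.Finite R M] [Module.Projective R M] {f : M →ₛₗ[σ] N} (hf : IsExt f)
    {g : N →ₛₗ[τ] P} (hg : IsExt g) {k : M →ₛₗ[ρ] P} (hρ : ∀ r, ρ r = τ (σ r)) (hk : ∀ m, k m = g (f m))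
    (h : SpansLine f K L) : Submodule.span A (t.map g '' L) = Submodule.span A (t.map k '' K) := by
  rw [h, span_image_span, Set.image_image]
  congr 1
  ext x
  simp only [Set.mem_image, t.map_comp hf hg k hρ hk]

theorem comp [Module.Finite R M] [Module.Projective R M] {f : M →ₛₗ[σ] N} (hf : IsExt f)
    {g : N →ₛₗ[τ] P} (hg : IsExt g) {k : M →ₛₗ[ρ] P} (hρ : ∀ r, ρ r = τ (σ r)) (hk : ∀ m, k m = g (f m))
    (h : SpansLine f K L) (h' : SpansLine g L Q) : SpansLine k K Q :=
  h'.trans (span_comp hf hg hρ hk h)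

theorem linearEquiv_trans [Module.Finite R M] [Module.Projective R M] {N P : ModuleCat.{u} R}
    {L : Submodule R (t.obj N)} {Q : Submodule R (t.obj P)} {v : M ≃ₗ[R] N} {w : N ≃ₗ[R] P}
    (h : SpansLine v.toLinearMap K L) (h' : SpansLine w.toLinearMap L Q) : SpansLine (v.trans w).toLinearMap K Q :=
  comp (.of_linearEquiv v) (.of_linearEquiv w) (fun _ => rfl) (fun _ => rfl) h h'

theorem of_comp [Module.Finite R M] [Module.Projective R M] {f : M →ₛₗ[σ] N} (hf : IsExt f)
    {g : N →ₛₗ[τ] P} (hg : IsExt g) {k : M →ₛₗ[ρ] P} (hρ : ∀ r, ρ r = τ (σ r)) (hk : ∀ m, k m = g (f m))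
    (h : SpansLine f K L) (h' : SpansLine k K Q) : SpansLine g L Q :=
  h'.trans (span_comp hf hg hρ hk h).symm

theorem isSplitLine [Module.Finite R M] [Module.Projective R M] {f : M →ₛₗ[σ] N} (hf : IsExt f)
    (h : SpansLine f K L) (hK : IsSplitLine K) : IsSplitLine L :=
  (hK.baseChange (t.map_isExt hf) L h).1

theorem mem {f : M →ₛₗ[σ] N} (h : SpansLine f K L) {a : t.obj M} (ha : a ∈ K) : t.map f a ∈ L := by
  rw [h]; exact Submodule.subset_span ⟨a, ha, rfl⟩

theorem linearEquiv_iff {N : ModuleCat.{u} R} {L : Submodule R (t.obj N)} (e : M ≃ₗ[R] N) :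
    SpansLine e.toLinearMap K L ↔ K.map (t.map e.toLinearMap) = L := by
  rw [SpansLine, ← Submodule.map_coe, Submodule.span_eq, eq_comm]

theorem symm {N : ModuleCat.{u} R} {L : Submodule R (t.obj N)} {e : M ≃ₗ[R] N}
    (h : SpansLine e.toLinearMap K L) : SpansLine e.symm.toLinearMap L K := by
  rw [linearEquiv_iff] at h ⊢
  rw [← h, ← Submodule.map_comp]
  have h1 := t.map_functorial.2 e e.symm
  rw [← h1, show e.symm.toLinearMap ∘ₗ e.toLinearMap = LinearMap.id by ext; simp, t.map_functorial.1,
    Submodule.map_id]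

/-- Generation of lines can be checked on a flat cover. -/
theorem of_cover {ι : Type u} {B : ι → Type u} [∀ i, CommRing (B i)] {σ : ∀ i, R →+* B i}
    (hσ : IsFlatCover σ) {N : ModuleCat.{u} R} {L : Submodule R (t.obj N)} [Module.Finite R M]
    [Module.Projective R M] {N' : ∀ i, ModuleCat.{u} (B i)} {e : M ≃ₗ[R] N}
    {g : ∀ i, N →ₛₗ[σ i] N' i} (hg : ∀ i, IsExt (g i))
    {L' : ∀ i, Submodule (B i) (t.obj (N' i))} (hL : ∀ i, SpansLine (g i) L (L' i))
    {k : ∀ i, M →ₛₗ[σ i] N' i} (hk : ∀ i m, k i m = g i (e m)) (hK : ∀ i, SpansLine (k i) K (L' i)) :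
    SpansLine e.toLinearMap K L := by
  have := Module.Finite.equiv e
  have := Module.Projective.of_equiv e
  refine hσ.eq_of_span_eq (fun i => t.map_isExt (hg i)) fun i => ?_
  have h1 : L' i = Submodule.span (B i) (t.map (g i) '' L) := hL i
  have h2 : L' i = Submodule.span (B i) (t.map (k i) '' K) := hK i
  have h3 := span_comp (L := Submodule.span R (t.map e.toLinearMap '' K)) (IsExt.of_linearEquiv e) (hg i)
    (fun _ => rfl) (hk i) rfl
  exact h1.symm.trans (h2.trans h3.symm)

theorem of_faithfullyFlat (hτ : τ.FaithfullyFlat) [Module.Finite R M] [Module.Projective R M]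
    {f : M →ₛₗ[σ] N} (hf : IsExt f) {g : N →ₛₗ[τ] P} (hg : IsExt g) {k : M →ₛₗ[ρ] P}
    (hρ : ∀ r, ρ r = τ (σ r)) (hk : ∀ m, k m = g (f m)) (h : SpansLine g L Q) (h' : SpansLine k K Q) :
    SpansLine f K L := by
  have := hf.finite
  have := hf.projective
  refine (isFlatCover_of_faithfullyFlat hτ).eq_of_span_eq (fun _ => t.map_isExt hg) fun _ => ?_
  have h1 : Q = Submodule.span A (t.map g '' L) := h
  have h2 : Q = Submodule.span A (t.map k '' K) := h'
  have h3 := span_comp (L := Submodule.span S (t.map f '' K)) hf hg hρ hk rfl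
  exact h1.symm.trans (h2.trans h3.symm)

theorem isSplitLine_of_faithfullyFlat (hσ : σ.FaithfullyFlat) [Module.Finite R M] [Module.Projective R M]
    {f : M →ₛₗ[σ] N} (hf : IsExt f) (h : SpansLine f K L) (hL : IsSplitLine L) : IsSplitLine K := by
  have := (t.finite_projective M).1
  have h1 : L = Submodule.span S (t.map f '' K) := h
  exact (isFlatCover_of_faithfullyFlat hσ).isSplitLine (fun _ => t.map_isExt hf) fun _ => h1 ▸ hL

end SpansLine

end SpansLine

namespace LinePair

variable {X Y Z : Scheme.{u}} {R S : CommRingCat.{u}} {t : TensorialConstruction}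

theorem spansLine_res (D : LinePair t Y) {y : Spec R ⟶ Y} {y' : Spec S ⟶ Y} (σ : R ⟶ S)
    (h : Spec.map σ ≫ y = y') : SpansLine (res D.bundle σ h) (D.line R y) (D.line S y') := by
  subst h
  exact D.baseChange y σ

theorem isSplitLine (D : LinePair t Y) (y : Spec R ⟶ Y) : IsSplitLine (D.line R y) := by
  have hV := D.isVectorBundle
  have hfin {A : CommRingCat.{u}} (y : Spec A ⟶ Y) := hV.finite_projective y
  have key {A : CommRingCat.{u}} (y : Spec A ⟶ Y) (U : Y.affineOpens)
      (hU : Module.Invertible Γ(Y, U) (D.line Γ(Y, U) U.2.fromSpec) ∧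
        ∃ C, IsCompl (D.line Γ(Y, U) U.2.fromSpec) C) (hy : ⊤ ≤ y ⁻¹ᵁ U.1) :
      IsSplitLine (D.line A y) := by
    obtain ⟨hi, C, hC⟩ := hU
    obtain ⟨a, ha⟩ := exists_lift_fromSpec U.2 y hy
    have := (hfin U.2.fromSpec).1
    have := (hfin U.2.fromSpec).2
    have := (t.finite_projective ((sectionsAt U.2.fromSpec).obj D.bundle)).2
    exact (D.spansLine_res a ha).isSplitLine (hV.res_isExt a ha) (.of_isCompl hi hC)
  obtain ⟨ι, S, σ, hσ, h⟩ := exists_zariski_cover y (fun U => ∃ hU : IsAffineOpen U,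
    Module.Invertible Γ(Y, U) (D.line Γ(Y, U) hU.fromSpec) ∧
      ∃ C, IsCompl (D.line Γ(Y, U) hU.fromSpec) C) fun r => by
        obtain ⟨U, h1, h2⟩ := D.locallySplit (y r)
        exact ⟨U.1, h1, U.2, h2⟩
  have := (hfin y).1
  have := (hfin y).2
  have := (t.finite_projective ((sectionsAt y).obj D.bundle)).1
  refine hσ.isSplitLine (fun i => t.map_isExt (hV.res_isExt (σ i) rfl)) fun i => ?_
  obtain ⟨U, ⟨hU, h1⟩, h2⟩ := h i
  rw [← D.spansLine_res (σ i) rfl]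
  exact key _ ⟨U, hU⟩ h1 h2

/-- A family of split lines compatible with base change. -/
def ofIsSplitLine (E : Y.Modules) (hE : IsVectorBundle E) (K : SubFamily t E)
    (hK : ∀ {R S : CommRingCat.{u}} (y : Spec R ⟶ Y) (y' : Spec S ⟶ Y) (σ : R ⟶ S)
      (h : Spec.map σ ≫ y = y'), SpansLine (res E σ h) (K R y) (K S y'))
    (hK' : ∀ {R : CommRingCat.{u}} (y : Spec R ⟶ Y), IsSplitLine (K R y)) : LinePair t Y where
  bundle := E
  isVectorBundle := hE
  line := K
  baseChange x σ := hK x _ σ rfl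
  locallySplit y := by
    obtain ⟨_, ⟨W, hW', rfl⟩, hW, -⟩ := Y.isBasis_affineOpens.exists_subset_of_mem_open
      (Set.mem_univ y) isOpen_univ
    exact ⟨⟨W, hW'⟩, hW, (hK' _).invertible, (hK' _).exists_isCompl⟩

theorem exists_line_descent {p : Z ⟶ Y} [IsAffineHom p] [Flat p] [Surjective p] {M : Z.Modules}
    (hM : IsVectorBundle M) (φ : DescentDatum p M) (L : SubFamily t M)
    (hL : ∀ {R S : CommRingCat.{u}} (z : Spec R ⟶ Z) (z' : Spec S ⟶ Z) (σ : R ⟶ S)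
      (h : Spec.map σ ≫ z = z'), SpansLine (res M σ h) (L R z) (L S z'))
    (hL' : ∀ {R : CommRingCat.{u}} (z : Spec R ⟶ Z), IsSplitLine (L R z))
    (hφ : ∀ {R : CommRingCat.{u}} (z z' : Spec R ⟶ Z) (h : z ≫ p = z' ≫ p),
      SpansLine (φ.iso z z' h).toLinearMap (L R z) (L R z')) {E : Y.Modules} (hE : IsVectorBundle E)
    (w : ∀ {R S : CommRingCat.{u}} (σ : R ⟶ S) (y : Spec R ⟶ Y) (z : Spec S ⟶ Z)
      (_ : z ≫ p = Spec.map σ ≫ y), (sectionsAt y).obj E →ₛₗ[σ.hom] (sectionsAt z).obj M)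
    (hw : ∀ {R S : CommRingCat.{u}} (σ : R ⟶ S) (y : Spec R ⟶ Y) (z : Spec S ⟶ Z)
      (h : z ≫ p = Spec.map σ ≫ y), IsExt (w σ y z h))
    (hwres : ∀ {R S A : CommRingCat.{u}} (σ : R ⟶ S) (y : Spec R ⟶ Y) (z : Spec S ⟶ Z)
      (h : z ≫ p = Spec.map σ ≫ y) (τ : S ⟶ A) (z' : Spec A ⟶ Z) (hz : Spec.map τ ≫ z = z')
      (ρ : R ⟶ A) (h' : z' ≫ p = Spec.map ρ ≫ y) (_ : ρ = σ ≫ τ) (m : (sectionsAt y).obj E),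
      w ρ y z' h' m = res M τ hz (w σ y z h m))
    (hwE : ∀ {R S A : CommRingCat.{u}} (σ : R ⟶ S) (y : Spec R ⟶ Y) (y' : Spec S ⟶ Y)
      (hy : Spec.map σ ≫ y = y') (τ : S ⟶ A) (z : Spec A ⟶ Z) (h : z ≫ p = Spec.map τ ≫ y')
      (h' : z ≫ p = Spec.map (σ ≫ τ) ≫ y) (m : (sectionsAt y).obj E),
      w (σ ≫ τ) y z h' m = w τ y' z h (res E σ hy m))
    (hwφ : ∀ {R S : CommRingCat.{u}} (σ : R ⟶ S) (y : Spec R ⟶ Y) (z z' : Spec S ⟶ Z)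
      (h : z ≫ p = Spec.map σ ≫ y) (h' : z' ≫ p = Spec.map σ ≫ y) (hz : z ≫ p = z' ≫ p)
      (m : (sectionsAt y).obj E), φ.iso z z' hz (w σ y z h m) = w σ y z' h' m) :
    ∃ K : SubFamily t E,
      (∀ {R S : CommRingCat.{u}} (y : Spec R ⟶ Y) (σ : R ⟶ S) (z : Spec S ⟶ Z)
        (h : z ≫ p = Spec.map σ ≫ y), SpansLine (w σ y z h) (K R y) (L S z)) ∧
      (∀ {R S : CommRingCat.{u}} (y : Spec R ⟶ Y) (y' : Spec S ⟶ Y) (σ : R ⟶ S)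
        (h : Spec.map σ ≫ y = y'), SpansLine (res E σ h) (K R y) (K S y')) ∧
      ∀ {R : CommRingCat.{u}} (y : Spec R ⟶ Y), IsSplitLine (K R y) := by
  have hfE {R : CommRingCat.{u}} (y : Spec R ⟶ Y) : Module.Finite R ((sectionsAt y).obj E) :=
    (hE.finite_projective y).1
  have hpE {R : CommRingCat.{u}} (y : Spec R ⟶ Y) : Module.Projective R ((sectionsAt y).obj E) :=
    (hE.finite_projective y).2
  have hfM {R : CommRingCat.{u}} (y : Spec R ⟶ Z) : Module.Finite R ((sectionsAt y).obj M) :=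
    (hM.finite_projective y).1
  have hpM {R : CommRingCat.{u}} (y : Spec R ⟶ Z) : Module.Projective R ((sectionsAt y).obj M) :=
    (hM.finite_projective y).2
  let K : SubFamily t E := fun R y =>
    { carrier := {a | ∀ {S : CommRingCat.{u}} (σ : R ⟶ S) (z : Spec S ⟶ Z) (h : z ≫ p = Spec.map σ ≫ y),
        t.map (w σ y z h) a ∈ L S z}
      add_mem' := fun ha hb S σ z h => by rw [map_add]; exact add_mem (ha σ z h) (hb σ z h)
      zero_mem' := fun σ z h => by rw [map_zero]; exact zero_mem _
      smul_mem' := fun r a ha S σ z h => by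
        rw [map_smulₛₗ]; exact Submodule.smul_mem _ _ (ha σ z h) }
  have hK₀ {R S : CommRingCat.{u}} (y : Spec R ⟶ Y) (σ : R ⟶ S) (z : Spec S ⟶ Z)
      (h : IsPullback z (Spec.map σ) p y) (hσ : σ.hom.FaithfullyFlat) :
      SpansLine (w σ y z h.w) (K R y) (L S z) := by
    obtain ⟨D⟩ := DescentRings.nonempty σ hσ
    have hcomap : K R y = (L S z).comap (t.map (w σ y z h.w)) := by
      refine le_antisymm (fun a ha => ha σ z h.w) fun a ha {A} σ' z' h' => ?_
      obtain ⟨τ, hτ, hστ⟩ := exists_Spec_lift h z' σ' h'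
      have e1 := t.map_comp (hw σ y z h.w) (hM.res_isExt τ hτ) (w σ' y z' h')
        (fun r => by rw [← hστ]; rfl) (hwres σ y z h.w τ z' hτ σ' h' hστ.symm) a
      rw [e1]
      exact (hL z z' τ hτ).mem ha
    obtain ⟨wL, hwL⟩ : ∃ wL, Spec.map D.iL ≫ z = wL := ⟨_, rfl⟩
    obtain ⟨wR, hwR⟩ : ∃ wR, Spec.map D.iR ≫ z = wR := ⟨_, rfl⟩
    have hL₁ : wL ≫ p = Spec.map (σ ≫ D.iL) ≫ y := by
      rw [← hwL, Category.assoc, h.w, Spec.map_comp_assoc]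
    have hR₁ : wR ≫ p = Spec.map (σ ≫ D.iL) ≫ y := by
      rw [← hwR, Category.assoc, h.w, D.σ_i, Spec.map_comp_assoc]
    have hLR := hL₁.trans hR₁.symm
    let d₁ : (sectionsAt z).obj M →ₛₗ[D.iL.hom] (sectionsAt wR).obj M :=
      (φ.iso wL wR hLR).toLinearMap.comp (res M D.iL hwL)
    have hd₁ : IsExt d₁ := (hM.res_isExt D.iL hwL).comp_linearEquiv (φ.iso wL wR hLR) _ fun _ => rfl
    have hR₀ := hM.res_isExt D.iR hwR
    refine (D.span_comap (t.map_isExt (hw σ y z h.w)) (t.map (res M D.iR hwR)) (t.map d₁)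
      (t.map_isExt hd₁) (fun a => ?_) (L S z) ?_).symm.trans (by rw [hcomap])
    · have e1 := t.map_comp (hw σ y z h.w) hR₀ (w (σ ≫ D.iL) y wR hR₁)
        (fun r => congr($D.σ_i r)) (hwres σ y z h.w D.iR wR hwR _ hR₁ D.σ_i) a
      have e2 := t.map_comp (hw σ y z h.w) hd₁ (w (σ ≫ D.iL) y wR hR₁)
        (fun r => rfl) (fun m => (hwφ _ y wL wR hL₁ hR₁ hLR m).symm.trans
          (congrArg (φ.iso wL wR hLR) (hwres σ y z h.w D.iL wL hwL _ hL₁ rfl m))) a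
      exact e1.symm.trans e2
    · have e1 : L D.A₂ wR = Submodule.span D.A₂ (t.map (res M D.iR hwR) '' L S z) := hL z wR D.iR hwR
      have e2 : SpansLine d₁ (L S z) (L _ wR) := (hL z wL D.iL hwL).comp (hM.res_isExt D.iL hwL)
        (.of_linearEquiv (φ.iso wL wR hLR)) (fun _ => rfl) (fun _ => rfl) (hφ wL wR hLR)
      have e3 : L D.A₂ wR = Submodule.span D.A₂ (t.map d₁ '' L S z) := e2
      exact e1.symm.trans e3
  have hKw {R S : CommRingCat.{u}} (y : Spec R ⟶ Y) (σ : R ⟶ S) (z : Spec S ⟶ Z)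
      (h : z ≫ p = Spec.map σ ≫ y) : SpansLine (w σ y z h) (K R y) (L S z) := by
    obtain ⟨R', σ₀, z₀, h₀, hσ₀⟩ := exists_isPullback_Spec p y
    obtain ⟨τ, hτ, hστ⟩ := exists_Spec_lift h₀ z σ h
    exact (hK₀ y σ₀ z₀ h₀ hσ₀).comp (hw _ _ _ _) (hM.res_isExt τ hτ) (fun r => congr($hστ.symm r))
      (hwres σ₀ y z₀ h₀.w τ z hτ σ h hστ.symm) (hL _ _ τ hτ)
  have hK {R S : CommRingCat.{u}} (y : Spec R ⟶ Y) (y' : Spec S ⟶ Y) (σ : R ⟶ S)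
      (h : Spec.map σ ≫ y = y') : SpansLine (res E σ h) (K R y) (K S y') := by
    obtain ⟨R', σ₀, z₀, h₀, hσ₀⟩ := exists_isPullback_Spec p y'
    have h1 : z₀ ≫ p = Spec.map (σ ≫ σ₀) ≫ y := by rw [h₀.w, Spec.map_comp_assoc, h]
    exact SpansLine.of_faithfullyFlat hσ₀ (hE.res_isExt σ h) (hw σ₀ y' z₀ h₀.w) (fun r => rfl)
      (hwE σ y y' h σ₀ z₀ h₀.w h1) (hKw y' σ₀ z₀ h₀.w) (hKw y (σ ≫ σ₀) z₀ h1)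
  have hK' {R : CommRingCat.{u}} (y : Spec R ⟶ Y) : IsSplitLine (K R y) := by
    obtain ⟨R', σ₀, z₀, h₀, hσ₀⟩ := exists_isPullback_Spec p y
    exact (hKw y σ₀ z₀ h₀.w).isSplitLine_of_faithfullyFlat hσ₀ (hw σ₀ y z₀ h₀.w) (hL' z₀)
  exact ⟨K, hKw, hK, hK'⟩

/-- Pairs of a vector bundle and a locally split line bundle descend along affine faithfully flat
morphisms. -/
theorem exists_descent {p : Z ⟶ Y} [IsAffineHom p] [Flat p] [Surjective p] {M : Z.Modules}
    (hM : IsVectorBundle M) (φ : DescentDatum p M) (L : SubFamily t M)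
    (hL : ∀ {R S : CommRingCat.{u}} (z : Spec R ⟶ Z) (z' : Spec S ⟶ Z) (σ : R ⟶ S)
      (h : Spec.map σ ≫ z = z'), SpansLine (res M σ h) (L R z) (L S z'))
    (hL' : ∀ {R : CommRingCat.{u}} (z : Spec R ⟶ Z), IsSplitLine (L R z))
    (hφ : ∀ {R : CommRingCat.{u}} (z z' : Spec R ⟶ Z) (h : z ≫ p = z' ≫ p),
      SpansLine (φ.iso z z' h).toLinearMap (L R z) (L R z')) :
    ∃ (D : LinePair t Y) (v : ∀ {R : CommRingCat.{u}} (z : Spec R ⟶ Z) (y : Spec R ⟶ Y) (_ : z ≫ p = y),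
      (sectionsAt y).obj D.bundle ≃ₗ[R] (sectionsAt z).obj M),
    (∀ {R S : CommRingCat.{u}} {z : Spec R ⟶ Z} {w : Spec S ⟶ Z} {y : Spec R ⟶ Y} {x : Spec S ⟶ Y}
      (σ : R ⟶ S) (hw : Spec.map σ ≫ z = w) (hx : Spec.map σ ≫ y = x) (h : z ≫ p = y) (h' : w ≫ p = x)
      (m : (sectionsAt y).obj D.bundle), v w x h' (res _ σ hx m) = res M σ hw (v z y h m)) ∧
    (∀ {R : CommRingCat.{u}} {z z' : Spec R ⟶ Z} {y : Spec R ⟶ Y} (h : z ≫ p = y) (h' : z' ≫ p = y)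
      (hz : z ≫ p = z' ≫ p) (m : (sectionsAt y).obj D.bundle),
      φ.iso z z' hz (v z y h m) = v z' y h' m) ∧
    ∀ {R : CommRingCat.{u}} (z : Spec R ⟶ Z) (y : Spec R ⟶ Y) (h : z ≫ p = y),
      SpansLine (v z y h).toLinearMap (D.line R y) (L R z) := by
  obtain ⟨E, v, hE, hv, hφv⟩ := φ.exists_descent hM
  let w {R S : CommRingCat.{u}} (σ : R ⟶ S) (y : Spec R ⟶ Y) (z : Spec S ⟶ Z)
    (h : z ≫ p = Spec.map σ ≫ y) : (sectionsAt y).obj E →ₛₗ[σ.hom] (sectionsAt z).obj M :=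
    (v z _ h).toLinearMap.comp (res E σ rfl)
  have hw {R S : CommRingCat.{u}} (σ : R ⟶ S) (y : Spec R ⟶ Y) (z : Spec S ⟶ Z)
      (h : z ≫ p = Spec.map σ ≫ y) : IsExt (w σ y z h) :=
    (hE.res_isExt σ rfl).comp_linearEquiv (v z _ h) _ fun _ => rfl
  have hwres {R S A : CommRingCat.{u}} (σ : R ⟶ S) (y : Spec R ⟶ Y) (z : Spec S ⟶ Z)
      (h : z ≫ p = Spec.map σ ≫ y) (τ : S ⟶ A) (z' : Spec A ⟶ Z) (hz : Spec.map τ ≫ z = z')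
      (ρ : R ⟶ A) (h' : z' ≫ p = Spec.map ρ ≫ y) (hρ : ρ = σ ≫ τ) (m) :
      w ρ y z' h' m = res M τ hz (w σ y z h m) := by
    subst hρ
    have e1 := hv τ hz (by rw [Spec.map_comp_assoc]) h h' (res E σ rfl m)
    have e2 := res_res E σ τ rfl (by rw [Spec.map_comp_assoc]) rfl m
    exact (congrArg (v z' _ h') e2).symm.trans e1
  have hwE {R S A : CommRingCat.{u}} (σ : R ⟶ S) (y : Spec R ⟶ Y) (y' : Spec S ⟶ Y)
      (hy : Spec.map σ ≫ y = y') (τ : S ⟶ A) (z : Spec A ⟶ Z) (h : z ≫ p = Spec.map τ ≫ y')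
      (h' : z ≫ p = Spec.map (σ ≫ τ) ≫ y) (m : (sectionsAt y).obj E) :
      w (σ ≫ τ) y z h' m = w τ y' z h (res E σ hy m) := by
    subst hy
    have e0 : Spec.map (σ ≫ τ) ≫ y = Spec.map τ ≫ Spec.map σ ≫ y := Spec.map_comp_assoc _ _ _
    have e2 := res_res E σ τ rfl (rfl : Spec.map τ ≫ Spec.map σ ≫ y = _) e0 m
    have e3 : ∀ {x x' : Spec A ⟶ Y} (hx : Spec.map (σ ≫ τ) ≫ y = x) (hx' : Spec.map (σ ≫ τ) ≫ y = x')
        (h : z ≫ p = x) (h' : z ≫ p = x'), v z x h (res E _ hx m) = v z x' h' (res E _ hx' m) := by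
      intro x x' hx hx' h h'; subst hx hx'; rfl
    exact (e3 rfl e0 h' h).trans (congrArg (v z _ h) e2.symm)
  obtain ⟨K, hKw, hK, hK'⟩ := exists_line_descent hM φ L hL hL' hφ hE w hw hwres hwE
    fun σ y z z' h h' hz m => hφv h h' hz (res E σ rfl m)
  refine ⟨ofIsSplitLine E hE K hK hK', v, hv, hφv, fun {R} z y h => ?_⟩
  have h1 : z ≫ p = Spec.map (𝟙 R) ≫ y := by rw [Spec.map_id, Category.id_comp, h]
  have h2 : Spec.map (𝟙 R) ≫ y = y := by rw [Spec.map_id, Category.id_comp]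
  have h3 := hKw y (𝟙 R) z h1
  have h4 : w (𝟙 R) y z h1 = (v z y h).toLinearMap := by
    ext m
    have e1 := hv (𝟙 R) (by rw [Spec.map_id, Category.id_comp] : Spec.map (𝟙 _) ≫ z = z)
      (rfl : Spec.map (𝟙 R) ≫ y = _) h h1 m
    have e2 := res_id M (by rw [Spec.map_id, Category.id_comp] : Spec.map (𝟙 _) ≫ z = z) (v z y h m)
    exact e1.trans e2
  exact h4 ▸ h3

end LinePair
end

section

namespace AlgebraicGeometry.Scheme.Modules
variable {X Y Z T : Scheme.{u}} {R S : CommRingCat.{u}}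

/-- The module of `g^* M` at a point `w` is the module of `M` at the image `x` of `w`. -/
def pullAt (g : T ⟶ Y) (M : Y.Modules) (w : Spec R ⟶ T) {x : Spec R ⟶ Y} (h : w ≫ g = x) :
    (sectionsAt w).obj ((pullback g).obj M) ≃ₗ[R] (sectionsAt x).obj M :=
  h ▸ (sectionsPullback w g M).toLinearEquiv

theorem pullAt_res (g : T ⟶ Y) (M : Y.Modules) {w : Spec R ⟶ T} {w' : Spec S ⟶ T} {x : Spec R ⟶ Y}
    {x' : Spec S ⟶ Y} (h : w ≫ g = x) (h' : w' ≫ g = x') (σ : R ⟶ S) (hw : Spec.map σ ≫ w = w')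
    (hx : Spec.map σ ≫ x = x') (m : (sectionsAt w).obj ((pullback g).obj M)) :
    pullAt g M w' h' (res _ σ hw m) = res M σ hx (pullAt g M w h m) := by
  subst h h'
  exact res_sectionsPullback g M σ hw m

theorem pullAt_map (g : T ⟶ Y) {M N : Y.Modules} (φ : M ⟶ N) (w : Spec R ⟶ T) {x : Spec R ⟶ Y}
    (h : w ≫ g = x) (m : (sectionsAt w).obj ((pullback g).obj M)) :
    pullAt g N w h ((sectionsAt w).map ((pullback g).map φ) m) = (sectionsAt x).map φ (pullAt g M w h m) := by
  subst h
  have h1 := congrArg (moduleSpecΓFunctor (R := R)).map ((pullbackComp w g).hom.naturality φ)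
  rw [Functor.map_comp, Functor.map_comp] at h1
  exact congr($h1 m)

theorem pullAt_comp (f : T ⟶ Y) (g : Y ⟶ Z) (M : Z.Modules) (w : Spec R ⟶ T) {x : Spec R ⟶ Y}
    {y : Spec R ⟶ Z} (h : w ≫ f = x) (h' : x ≫ g = y) (h'' : w ≫ f ≫ g = y)
    (m : (sectionsAt w).obj ((pullback f).obj ((pullback g).obj M))) :
    pullAt (f ≫ g) M w h'' ((sectionsAt w).map ((pullbackComp f g).hom.app M) m) =
      pullAt g M x h' (pullAt f _ w h m) := by
  subst h
  have h1 := congrArg (moduleSpecΓFunctor (R := R)).map (pullbackComp_assoc w f g M)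
  rw [Functor.map_comp, Functor.map_comp, Functor.map_comp] at h1
  subst h'
  have h2 (x x' : Spec R ⟶ Z) (e : x = x') (he : (pullback x).obj M = (pullback x').obj M)
      (h1 : w ≫ f ≫ g = x) (h2 : w ≫ f ≫ g = x') (m : (sectionsAt w).obj ((pullback (f ≫ g)).obj M)) :
      (moduleSpecΓFunctor (R := R)).map (eqToHom he) (pullAt (f ≫ g) M w h1 m) = pullAt (f ≫ g) M w h2 m := by
    subst e
    rw [eqToHom_refl]
    exact congr($(CategoryTheory.Functor.map_id (moduleSpecΓFunctor (R := R)) ((pullback x).obj M)) _)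
  have h3 := congr($h1 m)
  have h4 := h2 (w ≫ f ≫ g) ((w ≫ f) ≫ g) (Category.assoc _ _ _).symm (by rw [Category.assoc]) rfl h''
    ((sectionsAt w).map ((pullbackComp f g).hom.app M) m)
  have h5 (n : (sectionsAt ((w ≫ f) ≫ g)).obj M) :
      (moduleSpecΓFunctor (R := R)).map (eqToHom (by rw [Category.assoc] : (pullback (w ≫ f ≫ g)).obj M = _))
      ((moduleSpecΓFunctor (R := R)).map (eqToHom (by rw [Category.assoc] : _ =
        (pullback (w ≫ f ≫ g)).obj M)) n) = n := by
    have h6 : (moduleSpecΓFunctor (R := R)).map (eqToHom (by rw [Category.assoc] :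
        (pullback ((w ≫ f) ≫ g)).obj M = (pullback (w ≫ f ≫ g)).obj M)) ≫
        (moduleSpecΓFunctor (R := R)).map (eqToHom (by rw [Category.assoc] : _ =
        (pullback ((w ≫ f) ≫ g)).obj M)) = 𝟙 _ := by
      rw [← Functor.map_comp, eqToHom_trans, eqToHom_refl, CategoryTheory.Functor.map_id]
    exact congr($h6 n)
  refine h4.symm.trans ?_
  refine (congrArg _ h3.symm).trans ?_
  exact h5 _

theorem pullAt_id (M : Y.Modules) (w : Spec R ⟶ Y) (h : w ≫ 𝟙 Y = w)
    (m : (sectionsAt w).obj ((pullback (𝟙 Y)).obj M)) :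
    pullAt (𝟙 Y) M w h m = (sectionsAt w).map ((pullbackId Y).hom.app M) m := by
  obtain ⟨n, rfl⟩ : ∃ n, (sectionsAt w).map ((pullbackId Y).inv.app M) n = m :=
    ⟨(sectionsAt w).map ((pullbackId Y).hom.app M) m, by
      have h1 : (sectionsAt w).map ((pullbackId Y).hom.app M) ≫ (sectionsAt w).map ((pullbackId Y).inv.app M) = 𝟙 _ := by
        rw [← Functor.map_comp, Iso.hom_inv_id_app, CategoryTheory.Functor.map_id]
      exact congr($h1 m)⟩
  have h1 := congrArg (moduleSpecΓFunctor (R := R)).map (map_pullbackId_inv_comp w M)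
  rw [Functor.map_comp, Functor.map_comp] at h1
  have h1' := h1.trans (CategoryTheory.Functor.map_id (moduleSpecΓFunctor (R := R)) ((pullback w).obj M))
  have h2 (x x' : Spec R ⟶ Y) (e : x = x') (he : (pullback x).obj M = (pullback x').obj M)
      (h1 : w ≫ 𝟙 Y = x) (h2 : w ≫ 𝟙 Y = x') (m : (sectionsAt w).obj ((pullback (𝟙 Y)).obj M)) :
      (moduleSpecΓFunctor (R := R)).map (eqToHom he) (pullAt (𝟙 Y) M w h1 m) = pullAt (𝟙 Y) M w h2 m := by
    subst e
    rw [eqToHom_refl]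
    exact congr($(CategoryTheory.Functor.map_id (moduleSpecΓFunctor (R := R)) ((pullback x).obj M)) _)
  have h3 := congr($h1' n)
  have h4 := h2 (w ≫ 𝟙 Y) w h (by rw [h]) rfl h ((sectionsAt w).map ((pullbackId Y).inv.app M) n)
  have h5 : (sectionsAt w).map ((pullbackId Y).inv.app M) ≫ (sectionsAt w).map ((pullbackId Y).hom.app M) = 𝟙 _ := by
    rw [← Functor.map_comp, Iso.inv_hom_id_app, CategoryTheory.Functor.map_id]
  exact h4.symm.trans (h3.trans congr($h5 n).symm)

theorem pullAt_congr {g g' : T ⟶ Y} (e : g = g') (M : Y.Modules) (w : Spec R ⟶ T) {x : Spec R ⟶ Y}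
    (h : w ≫ g = x) (h' : w ≫ g' = x) (m : (sectionsAt w).obj ((pullback g).obj M)) :
    pullAt g' M w h' ((sectionsAt w).map ((pullbackCongr e).hom.app M) m) = pullAt g M w h m := by
  subst e
  have : (pullbackCongr (rfl : g = g)).hom.app M = 𝟙 _ := by simp [pullbackCongr]
  rw [this, CategoryTheory.Functor.map_id]; rfl

theorem pullAt_spansLine {t : TensorialConstruction} (g : T ⟶ Y) {M : Y.Modules} (K : SubFamily t M)
    (w : Spec R ⟶ T) {x : Spec R ⟶ Y} (h : w ≫ g = x) :
    SpansLine (pullAt g M w h).toLinearMap (K.pullback g R w) (K R x) := by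
  subst h
  have h1 : (K R (w ≫ g)).map (t.map (sectionsPullback w g M).toLinearEquiv.symm.toLinearMap) =
    K.pullback g R w := rfl
  have h2 := ((SpansLine.linearEquiv_iff (sectionsPullback w g M).toLinearEquiv.symm).2 h1).symm
  exact h2

/-- A morphism of vector bundles which is bijective on the modules at affine points is an
isomorphism. -/
theorem IsVectorBundle.isIso_of_bijective {M N : Y.Modules} (hM : IsVectorBundle M)
    (hN : IsVectorBundle N) (φ : M ⟶ N) (h : ∀ {R : CommRingCat.{u}} (x : Spec R ⟶ Y),
      Function.Bijective ((sectionsAt x).map φ)) : IsIso φ := by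
  let l {R : CommRingCat.{u}} (x : Spec R ⟶ Y) : (sectionsAt x).obj M ≃ₗ[R] (sectionsAt x).obj N :=
    LinearEquiv.ofBijective ((sectionsAt x).map φ).hom (h x)
  obtain ⟨ψ, hψ⟩ := hN.exists_hom hM (fun x => (l x).symm.toLinearMap) (by
    intro R S x y σ hσ m
    obtain ⟨n, rfl⟩ := (l x).surjective m
    have e1 := res_naturality φ σ hσ n
    refine (l y).injective ?_
    refine ((l y).apply_symm_apply _).trans ?_
    refine e1.symm.trans (congrArg (fun n => l y (res M σ hσ n)) ?_)
    exact ((l x).symm_apply_apply n).symm)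
  refine ⟨ψ, hom_ext_sectionsAt fun x => ?_, hom_ext_sectionsAt fun x => ?_⟩
  · rw [CategoryTheory.Functor.map_comp, CategoryTheory.Functor.map_id]
    ext m
    exact (LinearMap.congr_fun (hψ x) (l x m)).trans ((l x).symm_apply_apply m)
  · rw [CategoryTheory.Functor.map_comp, CategoryTheory.Functor.map_id]
    ext m
    refine (congrArg (l x) (LinearMap.congr_fun (hψ x) m)).trans ((l x).apply_symm_apply m)

end AlgebraicGeometry.Scheme.Modules

end

section

variable {X : Scheme.{u}} {t : TensorialConstruction} {R S : CommRingCat.{u}}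

namespace LinePair
variable (V : LinePair t X)

/-- The action of an automorphism of `V_T` on the module of `V` at the image of a point of `T`. -/
def autAt {T : Over X} (φ : Aut ((Modules.pullback T.hom).obj V.bundle)) (w : Spec R ⟶ T.left)
    {x : Spec R ⟶ X} (h : w ≫ T.hom = x) :
    (sectionsAt x).obj V.bundle ≃ₗ[R] (sectionsAt x).obj V.bundle :=
  ((pullAt T.hom V.bundle w h).symm.trans ((sectionsAt w).mapIso φ).toLinearEquiv).trans
    (pullAt T.hom V.bundle w h)

theorem autAt_pullAt {T : Over X} (φ : Aut ((Modules.pullback T.hom).obj V.bundle)) (w : Spec R ⟶ T.left)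
    {x : Spec R ⟶ X} (h : w ≫ T.hom = x) (m) : V.autAt φ w h (pullAt T.hom V.bundle w h m) =
      pullAt T.hom V.bundle w h ((sectionsAt w).map φ.hom m) :=
  congrArg (fun m => pullAt T.hom V.bundle w h ((sectionsAt w).map φ.hom m))
    ((pullAt T.hom V.bundle w h).symm_apply_apply m)

theorem autAt_res {T : Over X} (φ : Aut ((Modules.pullback T.hom).obj V.bundle)) (w : Spec R ⟶ T.left)
    (w' : Spec S ⟶ T.left) {x : Spec R ⟶ X} {x' : Spec S ⟶ X} (h : w ≫ T.hom = x)
    (h' : w' ≫ T.hom = x') (σ : R ⟶ S) (hw : Spec.map σ ≫ w = w') (hx : Spec.map σ ≫ x = x') (m) :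
    V.autAt φ w' h' (res _ σ hx m) = res _ σ hx (V.autAt φ w h m) := by
  obtain ⟨n, rfl⟩ := (pullAt T.hom V.bundle w h).surjective m
  have e1 := pullAt_res T.hom V.bundle h h' σ hw hx n
  have e2 := pullAt_res T.hom V.bundle h h' σ hw hx ((sectionsAt w).map φ.hom n)
  have e3 := res_naturality φ.hom σ hw n
  have e4 := V.autAt_pullAt φ w h n
  have e5 := V.autAt_pullAt φ w' h' (res _ σ hw n)
  exact (congrArg (V.autAt φ w' h') e1.symm).trans (e5.trans ((congrArg (pullAt _ _ w' h') e3).trans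
    (e2.trans (congrArg (res _ σ hx) e4.symm))))

theorem autAt_mul {T : Over X} (φ ψ : Aut ((Modules.pullback T.hom).obj V.bundle)) (w : Spec R ⟶ T.left)
    {x : Spec R ⟶ X} (h : w ≫ T.hom = x) (m) :
    V.autAt (φ * ψ) w h m = V.autAt φ w h (V.autAt ψ w h m) := by
  obtain ⟨n, rfl⟩ := (pullAt T.hom V.bundle w h).surjective m
  have e1 := V.autAt_pullAt ψ w h n
  have e2 := V.autAt_pullAt φ w h ((sectionsAt w).map ψ.hom n)
  have e3 := V.autAt_pullAt (φ * ψ) w h n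
  have e4 : (sectionsAt w).map (φ * ψ).hom = (sectionsAt w).map ψ.hom ≫ (sectionsAt w).map φ.hom :=
    CategoryTheory.Functor.map_comp _ _ _
  exact e3.trans ((congrArg (pullAt _ _ w h) congr($e4 n)).trans
    (e2.symm.trans (congrArg (V.autAt φ w h) e1.symm)))

theorem finite_projective_at (x : Spec R ⟶ X) : Module.Finite R ((sectionsAt x).obj V.bundle) ∧
    Module.Projective R ((sectionsAt x).obj V.bundle) := V.isVectorBundle.finite_projective x

instance (x : Spec R ⟶ X) : Module.Finite R ((sectionsAt x).obj V.bundle) := (V.finite_projective_at x).1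
instance (x : Spec R ⟶ X) : Module.Projective R ((sectionsAt x).obj V.bundle) :=
  (V.finite_projective_at x).2

theorem autAt_spansLine {T : Over X} {φ : Aut ((Modules.pullback T.hom).obj V.bundle)}
    (hφ : φ ∈ V.autGroup T) (w : Spec R ⟶ T.left) {x : Spec R ⟶ X} (h : w ≫ T.hom = x) :
    SpansLine (V.autAt φ w h).toLinearMap (V.line R x) (V.line R x) := by
  have h1 := pullAt_spansLine T.hom V.line w h
  have h2 : SpansLine ((sectionsAt w).mapIso φ).toLinearEquiv.toLinearMap
      (V.line.pullback T.hom R w) (V.line.pullback T.hom R w) :=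
    (SpansLine.linearEquiv_iff _).2 (hφ R w)
  have hp := (V.isVectorBundle.pullback T.hom).finite_projective w
  have := hp.1
  have := hp.2
  exact (h1.symm.linearEquiv_trans h2).linearEquiv_trans h1

theorem autAt_pullbackAut {T' T : Over X} (f : T' ⟶ T) (φ : Aut ((Modules.pullback T.hom).obj V.bundle))
    (w : Spec R ⟶ T'.left) (w' : Spec R ⟶ T.left) (hw : w ≫ f.left = w') {x : Spec R ⟶ X}
    (h : w ≫ T'.hom = x) (h' : w' ≫ T.hom = x) (m) :
    V.autAt (V.pullbackAut f φ) w h m = V.autAt φ w' h' m := by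
  let α : (Modules.pullback f.left).obj ((Modules.pullback T.hom).obj V.bundle) ≅
      (Modules.pullback T'.hom).obj V.bundle :=
    (pullbackComp f.left T.hom).app V.bundle ≪≫ (pullbackCongr (Over.w f)).app V.bundle
  have h'' : w ≫ f.left ≫ T.hom = x := by rw [Over.w, h]
  have hα (n : (sectionsAt w).obj ((Modules.pullback f.left).obj ((Modules.pullback T.hom).obj V.bundle))) :
      pullAt T'.hom V.bundle w h ((sectionsAt w).map α.hom n) =
        pullAt T.hom V.bundle w' h' (pullAt f.left _ w hw n) := by
    have e0 : (sectionsAt w).map α.hom = (sectionsAt w).map ((pullbackComp f.left T.hom).hom.app V.bundle) ≫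
      (sectionsAt w).map ((pullbackCongr (Over.w f)).hom.app V.bundle) := CategoryTheory.Functor.map_comp _ _ _
    have e1 := pullAt_congr (Over.w f) V.bundle w h'' h
      ((sectionsAt w).map ((pullbackComp f.left T.hom).hom.app V.bundle) n)
    have e2 := pullAt_comp f.left T.hom V.bundle w hw h' h'' n
    exact (congrArg (pullAt _ _ w h) congr($e0 n)).trans (e1.trans e2)
  obtain ⟨n, rfl⟩ := ((pullAt f.left _ w hw).trans (pullAt T.hom V.bundle w' h')).surjective m
  have e1 := V.autAt_pullAt φ w' h' (pullAt f.left _ w hw n)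
  have e2 := pullAt_map f.left φ.hom w hw n
  have e3 := hα ((sectionsAt w).map ((Modules.pullback f.left).map φ.hom) n)
  have e4 := V.autAt_pullAt (V.pullbackAut f φ) w h ((sectionsAt w).map α.hom n)
  have e5 : (sectionsAt w).map (V.pullbackAut f φ).hom ((sectionsAt w).map α.hom n) =
      (sectionsAt w).map α.hom ((sectionsAt w).map ((Modules.pullback f.left).map φ.hom) n) := by
    have e6 : α.hom ≫ (V.pullbackAut f φ).hom = (Modules.pullback f.left).map φ.hom ≫ α.hom :=
      α.hom_inv_id_assoc _
    have e7 := congrArg (sectionsAt w).map e6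
    rw [CategoryTheory.Functor.map_comp, CategoryTheory.Functor.map_comp] at e7
    exact congr($e7 n)
  exact (congrArg (V.autAt (V.pullbackAut f φ) w h) (hα n).symm).trans (e4.trans
    ((congrArg (pullAt _ _ w h) e5).trans (e3.trans ((congrArg (pullAt _ _ w' h') e2).trans e1.symm))))

/-- Morphisms of vector bundles on `Spec R` are determined by their global sections. -/
theorem _root_.AlgebraicGeometry.Scheme.Modules.IsVectorBundle.hom_ext_of_id {M N : (Spec R).Modules}
    (hM : IsVectorBundle M) {φ ψ : M ⟶ N}
    (h : (sectionsAt (𝟙 (Spec R))).map φ = (sectionsAt (𝟙 (Spec R))).map ψ) : φ = ψ := by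
  refine hom_ext_sectionsAt fun {S} x => ?_
  obtain ⟨σ, rfl⟩ : ∃ σ : R ⟶ S, Spec.map σ = x := ⟨Spec.preimage x, Spec.map_preimage x⟩
  have hx : Spec.map σ ≫ 𝟙 (Spec R) = Spec.map σ := Category.comp_id _
  ext1
  refine (hM.res_isExt σ hx).ext fun m => ?_
  have e1 := res_naturality φ σ hx m
  have e2 := res_naturality ψ σ hx m
  exact e1.trans ((congrArg (res N σ hx) congr($h m)).trans e2.symm)

theorem autAt_injective (x : Spec R ⟶ X) {φ ψ : Aut ((Modules.pullback (Over.mk x).hom).obj V.bundle)}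
    (h : V.autAt φ (𝟙 (Spec R)) (Category.id_comp x) = V.autAt ψ (𝟙 (Spec R)) (Category.id_comp x)) :
    φ = ψ := by
  refine Iso.ext ((V.isVectorBundle.pullback x).hom_ext_of_id ?_)
  ext n
  have e1 := V.autAt_pullAt (T := Over.mk x) φ (𝟙 (Spec R)) (Category.id_comp x) n
  have e2 := V.autAt_pullAt (T := Over.mk x) ψ (𝟙 (Spec R)) (Category.id_comp x) n
  rw [h] at e1
  exact (pullAt (Over.mk x).hom V.bundle (𝟙 (Spec R)) (Category.id_comp x)).injective (e1.symm.trans e2)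

theorem exists_autAt (x : Spec R ⟶ X) (u : (sectionsAt x).obj V.bundle ≃ₗ[R] (sectionsAt x).obj V.bundle)
    (hu : SpansLine u.toLinearMap (V.line R x) (V.line R x)) :
    ∃ φ ∈ V.autGroup (Over.mk x), V.autAt φ (𝟙 (Spec R)) (Category.id_comp x) = u := by
  have hV := V.isVectorBundle
  have key {S : CommRingCat.{u}} (w : Spec S ⟶ Spec R) : ∃ u' : (sectionsAt (w ≫ x)).obj V.bundle ≃ₗ[S]
      (sectionsAt (w ≫ x)).obj V.bundle, ∀ (σ : R ⟶ S) (hσ : Spec.map σ = w)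
      (hx : Spec.map σ ≫ x = w ≫ x) (m), u' (res _ σ hx m) = res _ σ hx (u m) := by
    obtain ⟨σ, rfl⟩ : ∃ σ : R ⟶ S, Spec.map σ = w := ⟨Spec.preimage w, Spec.map_preimage w⟩
    have h1 := hV.res_isExt σ (rfl : Spec.map σ ≫ x = _)
    let k : (sectionsAt x).obj V.bundle →ₛₗ[σ.hom] (sectionsAt (Spec.map σ ≫ x)).obj V.bundle :=
      (res V.bundle σ rfl).comp u.toLinearMap
    have h2 : IsExt k := (IsExt.of_linearEquiv u).comp h1 k (fun _ => rfl) fun _ => rfl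
    refine ⟨h1.equiv h2, fun σ' hσ' hx m => ?_⟩
    obtain rfl := Spec.map_injective hσ'
    exact h1.equiv_apply h2 m
  choose u' hu' using @key
  have hures {S A : CommRingCat.{u}} (w : Spec S ⟶ Spec R) (w' : Spec A ⟶ Spec R) (τ : S ⟶ A)
      (hw : Spec.map τ ≫ w = w') (hx : Spec.map τ ≫ w ≫ x = w' ≫ x) (m) :
      u' w' (res _ τ hx m) = res _ τ hx (u' w m) := by
    obtain ⟨σ, rfl⟩ : ∃ σ : R ⟶ S, Spec.map σ = w := ⟨Spec.preimage w, Spec.map_preimage w⟩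
    have hw' : Spec.map (σ ≫ τ) = w' := by rw [Spec.map_comp, hw]
    have h1 := hV.res_isExt σ (rfl : Spec.map σ ≫ x = _)
    have hx' : Spec.map (σ ≫ τ) ≫ x = w' ≫ x := by rw [hw']
    have e3 := h1.induction (p := fun m => u' w' (res _ τ hx m) = res _ τ hx (u' (Spec.map σ) m)) m
      (by rw [map_zero, map_zero, map_zero, map_zero])
      (fun a b ha hb => by rw [map_add, map_add, map_add, map_add, ha, hb]) fun s m => by
        have e1 := hu' (Spec.map σ) σ rfl rfl m
        have e2 := hu' w' (σ ≫ τ) hw' hx' m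
        have e3 := res_res V.bundle σ τ rfl hx hx' m
        have e4 := res_res V.bundle σ τ rfl hx hx' (u m)
        rw [map_smulₛₗ, _root_.map_smul, _root_.map_smul, map_smulₛₗ]
        refine congrArg (τ.hom s • ·) ?_
        exact (congrArg (u' w') e3).trans (e2.trans (e4.symm.trans (congrArg (res _ τ hx) e1.symm)))
    exact e3
  have huline {S : CommRingCat.{u}} (w : Spec S ⟶ Spec R) :
      SpansLine (u' w).toLinearMap (V.line S (w ≫ x)) (V.line S (w ≫ x)) := by
    obtain ⟨σ, rfl⟩ : ∃ σ : R ⟶ S, Spec.map σ = w := ⟨Spec.preimage w, Spec.map_preimage w⟩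
    have h1 := hV.res_isExt σ (rfl : Spec.map σ ≫ x = _)
    have h2 := V.spansLine_res σ (rfl : Spec.map σ ≫ x = _)
    have h3 : SpansLine ((res V.bundle σ (rfl : Spec.map σ ≫ x = _)).comp u.toLinearMap)
      (V.line R x) (V.line S (Spec.map σ ≫ x)) := hu.comp (.of_linearEquiv u) h1 (fun _ => rfl) (fun _ => rfl) h2
    exact h2.of_comp h1 (.of_linearEquiv (u' (Spec.map σ))) (fun _ => rfl)
      (fun m => (hu' (Spec.map σ) σ rfl rfl m).symm) h3
  have hxV := hV.pullback x
  let θ {S : CommRingCat.{u}} (w : Spec S ⟶ Spec R) : (sectionsAt w).obj ((Modules.pullback x).obj V.bundle) ≃ₗ[S]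
      (sectionsAt w).obj ((Modules.pullback x).obj V.bundle) :=
    ((pullAt x V.bundle w rfl).trans (u' w)).trans (pullAt x V.bundle w rfl).symm
  have hθ' {S : CommRingCat.{u}} (w : Spec S ⟶ Spec R) (m) :
      pullAt x V.bundle w rfl (θ w m) = u' w (pullAt x V.bundle w rfl m) :=
    (pullAt x V.bundle w rfl).apply_symm_apply _
  obtain ⟨ψ, hψ⟩ := hxV.exists_hom hxV (fun w => (θ w).toLinearMap) (by
    intro S A w w' τ hw m
    have hx : Spec.map τ ≫ w ≫ x = w' ≫ x := by rw [← hw, Category.assoc]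
    have e1 := pullAt_res x V.bundle rfl rfl τ hw hx m
    have e2 := pullAt_res x V.bundle rfl rfl τ hw hx (θ w m)
    refine (pullAt x V.bundle w' rfl).injective ?_
    exact (hθ' w' _).trans ((congrArg (u' w') e1).trans ((hures w w' τ hw hx _).trans
      ((congrArg (res _ τ hx) (hθ' w m).symm).trans e2.symm))))
  have : IsIso ψ := hxV.isIso_of_bijective hxV ψ fun w => by
    have := (θ w).bijective
    rwa [← LinearEquiv.coe_toLinearMap, ← hψ w] at this
  refine ⟨asIso ψ, fun S w => ?_, ?_⟩
  · have h1 := pullAt_spansLine x V.line w rfl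
    have hp := hxV.finite_projective w
    have := hp.1
    have := hp.2
    have h2 : SpansLine (θ w).toLinearMap (V.line.pullback x S w) (V.line.pullback x S w) :=
      (h1.linearEquiv_trans (huline w)).linearEquiv_trans h1.symm
    rw [SpansLine.linearEquiv_iff, ← hψ w] at h2
    exact h2
  · ext m
    obtain ⟨n, rfl⟩ := (pullAt x V.bundle (𝟙 (Spec R)) (Category.id_comp x)).surjective m
    have e1 := V.autAt_pullAt (T := Over.mk x) (asIso ψ) (𝟙 (Spec R)) (Category.id_comp x) n
    refine e1.trans ?_
    have e2 : (sectionsAt (𝟙 (Spec R))).map ψ n = θ (𝟙 _) n := LinearMap.congr_fun (hψ (𝟙 (Spec R))) n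
    refine (congrArg (pullAt x V.bundle (𝟙 (Spec R)) (Category.id_comp x)) e2).trans ?_
    have h : 𝟙 (Spec R) ≫ x = x := Category.id_comp x
    have hx₁ : Spec.map (𝟙 R) ≫ x = 𝟙 (Spec R) ≫ x := by rw [Spec.map_id]
    have hx₂ : Spec.map (𝟙 R) ≫ (𝟙 (Spec R) ≫ x) = x := by rw [Spec.map_id, Category.id_comp, Category.id_comp]
    have hx₃ : Spec.map (𝟙 R) ≫ x = x := by rw [Spec.map_id, Category.id_comp]
    have hw : Spec.map (𝟙 R) ≫ 𝟙 (Spec R) = 𝟙 (Spec R) := by rw [Spec.map_id, Category.id_comp]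
    have a1 (m) := pullAt_res x V.bundle (rfl : 𝟙 (Spec R) ≫ x = _) h (𝟙 R) hw hx₂ m
    have a2 := res_id ((Modules.pullback x).obj V.bundle) hw
    have a3 (m) : pullAt x V.bundle (𝟙 (Spec R)) h m = res _ (𝟙 R) hx₂ (pullAt x V.bundle (𝟙 (Spec R)) rfl m) :=
      (congrArg (pullAt x V.bundle (𝟙 (Spec R)) h) (a2 m).symm).trans (a1 m)
    obtain ⟨q, hq⟩ : ∃ q, res V.bundle (𝟙 R) hx₁ q = pullAt x V.bundle (𝟙 (Spec R)) rfl n :=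
      ((hV.res_isExt (𝟙 R) hx₁).bijective Function.bijective_id).2 _
    have hx₄ : Spec.map (𝟙 R ≫ 𝟙 R) ≫ x = x := by rw [Category.comp_id]; exact hx₃
    have a4 (q) : res V.bundle (𝟙 R) hx₂ (res V.bundle (𝟙 R) hx₁ q) = q :=
      (res_res V.bundle (𝟙 R) (𝟙 R) hx₁ hx₂ hx₄ q).trans ((res_congr V.bundle (Category.comp_id _) hx₄ hx₃ q).trans
        (res_id V.bundle hx₃ q))
    have a5 := hu' (𝟙 (Spec R)) (𝟙 R) (Spec.map_id R) hx₁ q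
    refine (a3 _).trans ((congrArg (res _ (𝟙 R) hx₂) (hθ' (𝟙 _) n)).trans ?_)
    refine (congrArg (fun q => res _ (𝟙 R) hx₂ (u' (𝟙 _) q)) hq.symm).trans ?_
    refine (congrArg (res _ (𝟙 R) hx₂) a5).trans ((a4 (u q)).trans (congrArg u ?_))
    exact ((a3 n).trans ((congrArg (res _ (𝟙 R) hx₂) hq.symm).trans (a4 q))).symm

end LinePair

end

section
open MonoidalCategory CartesianMonoidalCategory MonObj

namespace AlgebraicGeometry.Scheme

/-! ### Morphisms of schemes in terms of affine points -/

theorem hom_ext_points {Z Z' : Scheme.{u}} {f g : Z ⟶ Z'}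
    (h : ∀ {R : CommRingCat.{u}} (p : Spec R ⟶ Z), p ≫ f = p ≫ g) : f = g :=
  Z.affineOpenCover.openCover.hom_ext _ _ fun i => h (Z.affineOpenCover.f i)

theorem exists_hom_of_points {Z Z' : Scheme.{u}} (Φ : ∀ {R : CommRingCat.{u}}, (Spec R ⟶ Z) → (Spec R ⟶ Z'))
    (hΦ : ∀ {R S : CommRingCat.{u}} (σ : R ⟶ S) (p : Spec R ⟶ Z), Φ (Spec.map σ ≫ p) = Spec.map σ ≫ Φ p) :
    ∃ f : Z ⟶ Z', ∀ {R : CommRingCat.{u}} (p : Spec R ⟶ Z), p ≫ f = Φ p := by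
  have hΦ' {R S : CommRingCat.{u}} (q : Spec S ⟶ Spec R) (p : Spec R ⟶ Z) : Φ (q ≫ p) = q ≫ Φ p := by
    rw [← Spec.map_preimage q, hΦ]
  let 𝒰 := Z.affineOpenCover.openCover
  let φ (i : 𝒰.I₀) : 𝒰.X i ⟶ Z' := Φ (Z.affineOpenCover.f i)
  let f : Z ⟶ Z' := 𝒰.glueMorphisms φ fun i j => hom_ext_points fun q => by
    have e1 := hΦ' (q ≫ Limits.pullback.fst (𝒰.f i) (𝒰.f j)) (Z.affineOpenCover.f i)
    have e2 := hΦ' (q ≫ Limits.pullback.snd (𝒰.f i) (𝒰.f j)) (Z.affineOpenCover.f j)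
    have e3 : (q ≫ Limits.pullback.fst (𝒰.f i) (𝒰.f j)) ≫ Z.affineOpenCover.f i =
      (q ≫ Limits.pullback.snd (𝒰.f i) (𝒰.f j)) ≫ Z.affineOpenCover.f j := by
      exact (Category.assoc _ _ _).trans ((congrArg (q ≫ ·) Limits.pullback.condition).trans
        (Category.assoc _ _ _).symm)
    exact (Category.assoc _ _ _).symm.trans (e1.symm.trans ((congrArg Φ e3).trans
      (e2.trans (Category.assoc _ _ _))))
  have hf (i : 𝒰.I₀) : 𝒰.f i ≫ f = φ i := 𝒰.ι_glueMorphisms _ _ i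
  refine ⟨f, fun {R} p => Scheme.Cover.hom_ext (𝒰.pullback₁ p) _ _ fun i => hom_ext_points fun q => ?_⟩
  have e1 := hΦ' (q ≫ Limits.pullback.snd p (𝒰.f i)) (Z.affineOpenCover.f i)
  have e2 := hΦ' (q ≫ Limits.pullback.fst p (𝒰.f i)) p
  have e3 : (q ≫ Limits.pullback.fst p (𝒰.f i)) ≫ p = (q ≫ Limits.pullback.snd p (𝒰.f i)) ≫ 𝒰.f i :=
    (Category.assoc _ _ _).trans ((congrArg (q ≫ ·) Limits.pullback.condition).trans
      (Category.assoc _ _ _).symm)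
  have e4 : (q ≫ Limits.pullback.fst p (𝒰.f i)) ≫ p ≫ f = (q ≫ Limits.pullback.snd p (𝒰.f i)) ≫ φ i :=
    (Category.assoc _ _ _).symm.trans ((congrArg (· ≫ f) e3).trans ((Category.assoc _ _ _).trans
      (congrArg ((q ≫ Limits.pullback.snd p (𝒰.f i)) ≫ ·) (hf i))))
  exact (Category.assoc _ _ _).symm.trans (e4.trans (e1.symm.trans ((congrArg Φ e3.symm).trans
    (e2.trans (Category.assoc _ _ _)))))

theorem isIso_of_points {Z Z' : Scheme.{u}} (f : Z ⟶ Z')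
    (hf : ∀ R : CommRingCat.{u}, Function.Bijective fun p : Spec R ⟶ Z => p ≫ f) : IsIso f := by
  obtain ⟨g, hg⟩ := exists_hom_of_points (fun {R} (p : Spec R ⟶ Z') => ((hf R).2 p).choose)
    (fun {R S} σ p => (hf S).1 (((hf S).2 _).choose_spec.trans
      ((congrArg (Spec.map σ ≫ ·) ((hf R).2 p).choose_spec.symm).trans (Category.assoc _ _ _).symm)))
  have hg' {R : CommRingCat.{u}} (p : Spec R ⟶ Z') : (p ≫ g) ≫ f = p := by
    rw [hg]; exact ((hf R).2 p).choose_spec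
  refine ⟨g, hom_ext_points fun p => (hf _).1 ?_, hom_ext_points fun p => ?_⟩
  · have := hg' (p ≫ f)
    simpa using this
  · simpa using hg' p

end AlgebraicGeometry.Scheme

variable {X : Scheme.{u}} {t : TensorialConstruction} {R S : CommRingCat.{u}}

namespace LinePair.AutIso
variable {G : Over X} [GrpObj G] {V : LinePair t X} (e : V.AutIso G)

/-- The action of a point of `G` on the module of `V` at the underlying point of `X`. -/
def rho (x : Spec R ⟶ X) (g : Over.mk x ⟶ G) :
    (sectionsAt x).obj V.bundle ≃ₗ[R] (sectionsAt x).obj V.bundle :=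
  V.autAt (e.equiv (Over.mk x) g).1 (𝟙 (Spec R)) (Category.id_comp x)

theorem rho_mul (x : Spec R ⟶ X) (g h : Over.mk x ⟶ G) (m) : e.rho x (g * h) m = e.rho x g (e.rho x h m) := by
  have h1 : (e.equiv (Over.mk x) (g * h)).1 = (e.equiv (Over.mk x) g).1 * (e.equiv (Over.mk x) h).1 := by
    rw [map_mul]; rfl
  have h2 := V.autAt_mul (T := Over.mk x) (e.equiv (Over.mk x) g).1 (e.equiv (Over.mk x) h).1 (𝟙 (Spec R))
    (Category.id_comp x) m
  rw [← h1] at h2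
  exact h2

theorem rho_one (x : Spec R ⟶ X) (m) : e.rho x 1 m = m := by
  have h1 := e.rho_mul x 1 1 m
  rw [_root_.mul_one] at h1
  exact (e.rho x 1).injective h1.symm

theorem rho_spansLine (x : Spec R ⟶ X) (g : Over.mk x ⟶ G) :
    SpansLine (e.rho x g).toLinearMap (V.line R x) (V.line R x) :=
  V.autAt_spansLine (e.equiv (Over.mk x) g).2 _ _

theorem rho_injective (x : Spec R ⟶ X) {g h : Over.mk x ⟶ G} (H : e.rho x g = e.rho x h) : g = h :=
  (e.equiv (Over.mk x)).injective (Subtype.ext (V.autAt_injective x H))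

theorem exists_rho (x : Spec R ⟶ X) (u : (sectionsAt x).obj V.bundle ≃ₗ[R] (sectionsAt x).obj V.bundle)
    (hu : SpansLine u.toLinearMap (V.line R x) (V.line R x)) : ∃ g : Over.mk x ⟶ G, e.rho x g = u := by
  obtain ⟨φ, hφ, h⟩ := V.exists_autAt x u hu
  obtain ⟨g, hg⟩ := (e.equiv (Over.mk x)).surjective ⟨φ, hφ⟩
  refine ⟨g, ?_⟩
  rw [rho, hg, h]

theorem rho_res {x : Spec R ⟶ X} {x' : Spec S ⟶ X} (σ : R ⟶ S) (h : Spec.map σ ≫ x = x')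
    (g : Over.mk x ⟶ G) (m) :
    e.rho x' ((Over.homMk (Spec.map σ) h : Over.mk x' ⟶ Over.mk x) ≫ g) (res _ σ h m) =
      res _ σ h (e.rho x g m) := by
  let f : Over.mk x' ⟶ Over.mk x := Over.homMk (Spec.map σ) h
  have e1 := e.natural f g
  have e2 := V.autAt_pullbackAut f (e.equiv (Over.mk x) g).1 (𝟙 (Spec S)) (Spec.map σ) (Category.id_comp _)
    (Category.id_comp x') h (res _ σ h m)
  rw [← e1] at e2
  have e3 := V.autAt_res (e.equiv (Over.mk x) g).1 (𝟙 (Spec R)) (Spec.map σ) (Category.id_comp x) h σ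
    (Category.comp_id _) h m
  exact e2.trans e3

end LinePair.AutIso

namespace GTorsor
variable {G : Over X} [GrpObj G] (P : GTorsor G) {T T' : Over X}

/-- The action of `G` on the points of a torsor. -/
def smul (p : T ⟶ P.total) (g : T ⟶ G) : T ⟶ P.total := lift p g ≫ P.act

theorem comp_smul (f : T' ⟶ T) (p : T ⟶ P.total) (g : T ⟶ G) : f ≫ P.smul p g = P.smul (f ≫ p) (f ≫ g) := by
  rw [smul, smul, comp_lift_assoc]

theorem smul_one (p : T ⟶ P.total) : P.smul p 1 = p := by
  have h := congrArg (lift p (toUnit T) ≫ ·) P.act_one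
  beta_reduce at h
  rw [lift_whiskerLeft_assoc, lift_rightUnitor_hom] at h
  exact h

theorem smul_mul (p : T ⟶ P.total) (g h : T ⟶ G) : P.smul p (g * h) = P.smul (P.smul p g) h := by
  have h1 := congrArg (lift (lift p g) h ≫ ·) P.act_mul
  beta_reduce at h1
  rw [lift_lift_associator_hom_assoc, lift_whiskerLeft_assoc, lift_whiskerRight_assoc] at h1
  exact h1

theorem smul_proj (p : T ⟶ P.total) (g : T ⟶ G) : P.smul p g ≫ P.proj = p ≫ P.proj := by
  rw [smul, Category.assoc, ← P.isPullback.w, lift_fst_assoc]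

theorem existsUnique_smul {p p' : T ⟶ P.total} (h : p ≫ P.proj = p' ≫ P.proj) : ∃! g, P.smul p g = p' := by
  refine ⟨P.isPullback.lift p p' h ≫ snd _ _, ?_, fun g hg => ?_⟩
  · have h1 : lift p (P.isPullback.lift p p' h ≫ snd _ _) = P.isPullback.lift p p' h := by
      refine CartesianMonoidalCategory.hom_ext _ _ ?_ ?_
      · rw [lift_fst, P.isPullback.lift_fst]
      · rw [lift_snd]
    exact (congrArg (· ≫ P.act) h1).trans (P.isPullback.lift_snd _ _ _)
  · have h1 : lift p g = P.isPullback.lift p p' h := by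
      apply P.isPullback.hom_ext
      · rw [lift_fst, P.isPullback.lift_fst]
      · rw [P.isPullback.lift_snd]; exact hg
    rw [← h1, lift_snd]

theorem Hom.smul_map {P P' : GTorsor G} (f : P ⟶ P') (p : T ⟶ P.total) (g : T ⟶ G) :
    P.smul p g ≫ f.map = P'.smul (p ≫ f.map) g := by
  rw [smul, smul, Category.assoc, f.equivariant, lift_whiskerRight_assoc]

end GTorsor

end

section
open MonoidalCategory CartesianMonoidalCategory MonObj

variable {X : Scheme.{u}} {t : TensorialConstruction} {R S : CommRingCat.{u}}

namespace GTorsor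
variable {G : Over X} [GrpObj G] {V : LinePair t X} (e : V.AutIso G) (P : GTorsor G)

/-- A trivialization of the pair `D` over the torsor `P`: for every point `p` of `P`, an isomorphism
`u p` from `V` to `D`, with `u (p g) = u p ∘ g`. -/
structure Triv (D : LinePair t P.base.left) where
  u {R : CommRingCat.{u}} (x : Spec R ⟶ X) (p : Over.mk x ⟶ P.total) (y : Spec R ⟶ P.base.left)
    (h : p.left ≫ P.proj.left = y) : (sectionsAt x).obj V.bundle ≃ₗ[R] (sectionsAt y).obj D.bundle
  natural {R S : CommRingCat.{u}} (σ : R ⟶ S) {x : Spec R ⟶ X} {x' : Spec S ⟶ X} (hx : Spec.map σ ≫ x = x')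
    (p : Over.mk x ⟶ P.total) (p' : Over.mk x' ⟶ P.total) (hp : Spec.map σ ≫ p.left = p'.left)
    {y : Spec R ⟶ P.base.left} {y' : Spec S ⟶ P.base.left} (h : p.left ≫ P.proj.left = y)
    (h' : p'.left ≫ P.proj.left = y') (hy : Spec.map σ ≫ y = y') (m : (sectionsAt x).obj V.bundle) :
    u x' p' y' h' (res _ σ hx m) = res _ σ hy (u x p y h m)
  smul {R : CommRingCat.{u}} (x : Spec R ⟶ X) (p : Over.mk x ⟶ P.total) (g : Over.mk x ⟶ G)
    (y : Spec R ⟶ P.base.left) (h : p.left ≫ P.proj.left = y) (h' : (P.smul p g).left ≫ P.proj.left = y)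
    (m : (sectionsAt x).obj V.bundle) : u x (P.smul p g) y h' m = u x p y h (e.rho x g m)
  spansLine {R : CommRingCat.{u}} (x : Spec R ⟶ X) (p : Over.mk x ⟶ P.total) (y : Spec R ⟶ P.base.left)
    (h : p.left ≫ P.proj.left = y) : SpansLine (u x p y h).toLinearMap (V.line R x) (D.line R y)

instance : Flat P.proj.left := P.flat
instance : Surjective P.proj.left := P.surjective
instance : IsAffineHom P.proj.left := P.affine

/-- The translation from one point to another one in the same fiber. -/
def transl (x : Spec R ⟶ X) (p p' : Over.mk x ⟶ P.total) (h : p.left ≫ P.proj.left = p'.left ≫ P.proj.left) :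
    Over.mk x ⟶ G :=
  (P.existsUnique_smul (Over.OverMorphism.ext h : p ≫ P.proj = p' ≫ P.proj)).choose

theorem smul_transl (x : Spec R ⟶ X) (p p' : Over.mk x ⟶ P.total)
    (h : p.left ≫ P.proj.left = p'.left ≫ P.proj.left) : P.smul p (P.transl x p p' h) = p' :=
  (P.existsUnique_smul (Over.OverMorphism.ext h : p ≫ P.proj = p' ≫ P.proj)).choose_spec.1

theorem transl_unique {x : Spec R ⟶ X} {p p' : Over.mk x ⟶ P.total}
    (h : p.left ≫ P.proj.left = p'.left ≫ P.proj.left) {g : Over.mk x ⟶ G} (hg : P.smul p g = p') :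
    g = P.transl x p p' h :=
  (P.existsUnique_smul (Over.OverMorphism.ext h : p ≫ P.proj = p' ≫ P.proj)).unique hg (P.smul_transl x p p' h)

/-- The point of the total space over `X` given by a point of the underlying scheme. -/
def pt (z : Spec R ⟶ P.total.left) {x : Spec R ⟶ X} (h : z ≫ P.total.hom = x) : Over.mk x ⟶ P.total :=
  Over.homMk z h

/-- The isomorphism of the modules of `a^* V` at two points in the same fiber, where `a` is the
structure morphism of the total space. -/
def fiberIso (x : Spec R ⟶ X) (z z' : Spec R ⟶ P.total.left) (hz : z ≫ P.total.hom = x)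
    (hz' : z' ≫ P.total.hom = x) (h : z ≫ P.proj.left = z' ≫ P.proj.left) :
    (sectionsAt z).obj ((Modules.pullback P.total.hom).obj V.bundle) ≃ₗ[R]
      (sectionsAt z').obj ((Modules.pullback P.total.hom).obj V.bundle) :=
  ((pullAt P.total.hom V.bundle z hz).trans (e.rho x (P.transl x (P.pt z hz) (P.pt z' hz') h)).symm).trans
    (pullAt P.total.hom V.bundle z' hz').symm

theorem fiberIso_spec (x : Spec R ⟶ X) (z z' : Spec R ⟶ P.total.left) (hz : z ≫ P.total.hom = x)
    (hz' : z' ≫ P.total.hom = x) (h : z ≫ P.proj.left = z' ≫ P.proj.left) (m) :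
    e.rho x (P.transl x (P.pt z hz) (P.pt z' hz') h)
      (pullAt P.total.hom V.bundle z' hz' (P.fiberIso e x z z' hz hz' h m)) =
      pullAt P.total.hom V.bundle z hz m := by
  have h1 : pullAt P.total.hom V.bundle z' hz' (P.fiberIso e x z z' hz hz' h m) =
      (e.rho x (P.transl x (P.pt z hz) (P.pt z' hz') h)).symm (pullAt P.total.hom V.bundle z hz m) :=
    (pullAt P.total.hom V.bundle z' hz').apply_symm_apply _
  rw [h1]
  exact LinearEquiv.apply_symm_apply _ _

theorem fiberIso_eq {x : Spec R ⟶ X} {z z' : Spec R ⟶ P.total.left} {hz : z ≫ P.total.hom = x}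
    {hz' : z' ≫ P.total.hom = x} (h : z ≫ P.proj.left = z' ≫ P.proj.left) {g : Over.mk x ⟶ G}
    (hg : P.smul (P.pt z hz) g = P.pt z' hz') {m} {n}
    (hn : e.rho x g (pullAt P.total.hom V.bundle z' hz' n) = pullAt P.total.hom V.bundle z hz m) :
    P.fiberIso e x z z' hz hz' h m = n := by
  apply (pullAt P.total.hom V.bundle z' hz').injective
  apply (e.rho x g).injective
  rw [hn]
  have := P.fiberIso_spec e x z z' hz hz' h m
  rwa [← P.transl_unique h hg] at this

theorem fiberIso_res {x : Spec R ⟶ X} {x' : Spec S ⟶ X} {z z' : Spec R ⟶ P.total.left}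
    {w w' : Spec S ⟶ P.total.left} (hz : z ≫ P.total.hom = x)
    (hz' : z' ≫ P.total.hom = x) (h : z ≫ P.proj.left = z' ≫ P.proj.left)
    (hw : w ≫ P.total.hom = x') (hw' : w' ≫ P.total.hom = x') (h' : w ≫ P.proj.left = w' ≫ P.proj.left)
    (σ : R ⟶ S) (hx : Spec.map σ ≫ x = x') (hσ : Spec.map σ ≫ z = w) (hσ' : Spec.map σ ≫ z' = w') (m) :
    P.fiberIso e x' w w' hw hw' h' (res _ σ hσ m) = res _ σ hσ' (P.fiberIso e x z z' hz hz' h m) := by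
  let f : Over.mk x' ⟶ Over.mk x := Over.homMk (Spec.map σ) hx
  let g := P.transl x (P.pt z hz) (P.pt z' hz') h
  have hg : P.smul (P.pt z hz) g = P.pt z' hz' := P.smul_transl x _ _ h
  have hfz : f ≫ P.pt z hz = P.pt w hw := Over.OverMorphism.ext hσ
  have hfz' : f ≫ P.pt z' hz' = P.pt w' hw' := Over.OverMorphism.ext hσ'
  have hfg : P.smul (P.pt w hw) (f ≫ g) = P.pt w' hw' := by rw [← hfz, ← comp_smul, hg, hfz']
  refine P.fiberIso_eq e h' hfg ?_
  have e1 := pullAt_res P.total.hom V.bundle hz' hw' σ hσ' hx (P.fiberIso e x z z' hz hz' h m)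
  have e2 := pullAt_res P.total.hom V.bundle hz hw σ hσ hx m
  have e3 := e.rho_res σ hx g (pullAt P.total.hom V.bundle z' hz' (P.fiberIso e x z z' hz hz' h m))
  have e4 := P.fiberIso_spec e x z z' hz hz' h m
  exact (congrArg (e.rho x' (f ≫ g)) e1).trans (e3.trans ((congrArg (res _ σ hx) e4).trans e2.symm))

theorem fiberIso_trans {x : Spec R ⟶ X} {z z' z'' : Spec R ⟶ P.total.left} (hz : z ≫ P.total.hom = x)
    (hz' : z' ≫ P.total.hom = x) (hz'' : z'' ≫ P.total.hom = x) (h : z ≫ P.proj.left = z' ≫ P.proj.left)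
    (h' : z' ≫ P.proj.left = z'' ≫ P.proj.left) (h'' : z ≫ P.proj.left = z'' ≫ P.proj.left) (m) :
    P.fiberIso e x z' z'' hz' hz'' h' (P.fiberIso e x z z' hz hz' h m) = P.fiberIso e x z z'' hz hz'' h'' m := by
  have hg := P.smul_transl x (P.pt z hz) (P.pt z' hz') h
  have hg' := P.smul_transl x (P.pt z' hz') (P.pt z'' hz'') h'
  symm
  refine P.fiberIso_eq e h'' (g := P.transl x (P.pt z hz) (P.pt z' hz') h *
    P.transl x (P.pt z' hz') (P.pt z'' hz'') h') ?_ ?_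
  · rw [smul_mul, hg, hg']
  · rw [e.rho_mul, fiberIso_spec, fiberIso_spec]

theorem fiberIso_congr {x x' : Spec R ⟶ X} {z z' : Spec R ⟶ P.total.left} (hz : z ≫ P.total.hom = x)
    (hz' : z' ≫ P.total.hom = x) (hw : z ≫ P.total.hom = x') (hw' : z' ≫ P.total.hom = x')
    (h : z ≫ P.proj.left = z' ≫ P.proj.left) :
    P.fiberIso e x z z' hz hz' h = P.fiberIso e x' z z' hw hw' h := by
  obtain rfl := hz.symm.trans hw
  rfl

theorem comp_hom_eq {z z' : Spec R ⟶ P.total.left} (h : z ≫ P.proj.left = z' ≫ P.proj.left) :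
    z' ≫ P.total.hom = z ≫ P.total.hom := by
  rw [← Over.w P.proj, ← Category.assoc, ← Category.assoc, h]

/-- The descent datum on `a^* V` given by the action of `G`. -/
def descentDatum : DescentDatum P.proj.left ((Modules.pullback P.total.hom).obj V.bundle) where
  iso z z' h := P.fiberIso e _ z z' rfl (P.comp_hom_eq h) h
  natural {R S} σ {z z' w w'} h hw hw' h' m :=
    P.fiberIso_res e rfl (P.comp_hom_eq h) h rfl (P.comp_hom_eq h') h' σ (by rw [← hw, Category.assoc]) hw hw' m
  cocycle z z' z'' h h' h'' m := by
    have h1 := P.fiberIso_congr e (z := z') (z' := z'') rfl (P.comp_hom_eq h') (P.comp_hom_eq h)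
      (P.comp_hom_eq h'') h'
    rw [h1]
    exact P.fiberIso_trans e rfl (P.comp_hom_eq h) (P.comp_hom_eq h'') h h' h'' m

/-- Every torsor gives rise to a pair on its base. -/
theorem exists_triv : ∃ D : LinePair t P.base.left, Nonempty (P.Triv e D) := by
  let a := P.total.hom
  have hM := V.isVectorBundle.pullback a
  have hfin {R : CommRingCat.{u}} (z : Spec R ⟶ P.total.left) := hM.finite_projective z
  have hL {R : CommRingCat.{u}} (z : Spec R ⟶ P.total.left) {x : Spec R ⟶ X} (h : z ≫ a = x) :
    SpansLine (pullAt a V.bundle z h).toLinearMap (V.line.pullback a R z) (V.line R x) :=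
      pullAt_spansLine a V.line z h
  obtain ⟨D, v, hv, hφv, hvL⟩ := LinePair.exists_descent hM (P.descentDatum e) (V.line.pullback a)
    (fun {R S} z z' σ h => by
      have := (hfin z').1
      have := (hfin z').2
      have := (hfin z).1
      have := (hfin z).2
      have hx : Spec.map σ ≫ z ≫ a = z' ≫ a := by rw [← h, Category.assoc]
      have h1 := (hL z rfl).comp (.of_linearEquiv _) (V.isVectorBundle.res_isExt σ hx)
        (k := (res V.bundle σ hx).comp (pullAt a V.bundle z rfl).toLinearMap) (fun _ => rfl)
        (fun _ => rfl) (V.spansLine_res σ hx)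
      have h2 : IsExt ((res V.bundle σ hx).comp (pullAt a V.bundle z rfl).toLinearMap) :=
        (IsExt.of_linearEquiv (pullAt a V.bundle z rfl)).comp (V.isVectorBundle.res_isExt σ hx) _
          (fun _ => rfl) (fun _ => rfl)
      refine h1.comp h2 (.of_linearEquiv (pullAt a V.bundle z' rfl).symm) (fun _ => rfl) (fun m => ?_)
        (hL z' rfl).symm
      refine ((LinearEquiv.symm_apply_eq _).2 ?_).symm
      exact (pullAt_res a V.bundle rfl rfl σ h hx m).symm)
    (fun {R} z => by
      have := (hfin z).1
      have := (hfin z).2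
      exact (hL z rfl).symm.isSplitLine (.of_linearEquiv (pullAt a V.bundle z rfl).symm)
        (V.isSplitLine (z ≫ a)))
    (fun {R} z z' h => by
      have := (hfin z).1
      have := (hfin z).2
      exact ((hL z rfl).linearEquiv_trans (e.rho_spansLine (z ≫ a)
        (P.transl _ (P.pt z rfl) (P.pt z' (P.comp_hom_eq h)) h)).symm).linearEquiv_trans
        (hL z' (P.comp_hom_eq h)).symm)
  let w {R : CommRingCat.{u}} (x : Spec R ⟶ X) (p : Over.mk x ⟶ P.total) (y : Spec R ⟶ P.base.left)
    (h : p.left ≫ P.proj.left = y) : (sectionsAt y).obj D.bundle ≃ₗ[R] (sectionsAt x).obj V.bundle :=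
    (v p.left y h).trans (pullAt a V.bundle p.left (Over.w p))
  refine ⟨D, ⟨{ u := fun x p y h => (w x p y h).symm
                natural := fun {R S} σ {x x'} hx p p' hp {y y'} h h' hy m => ?_
                smul := fun {R} x p g y h h' m => ?_
                spansLine := fun {R} x p y h => ?_ }⟩⟩
  · rw [LinearEquiv.symm_apply_eq]
    obtain ⟨n, rfl⟩ := (w x p y h).surjective m
    rw [LinearEquiv.symm_apply_apply]
    have e1 := hv σ hp hy h h' n
    have e2 := pullAt_res a V.bundle (Over.w p) (Over.w p') σ hp hx (v p.left y h n)
    exact e2.symm.trans (congrArg _ e1.symm)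
  · rw [LinearEquiv.symm_apply_eq]
    obtain ⟨n, hn⟩ := (w x p y h).surjective (e.rho x g m)
    rw [← hn, LinearEquiv.symm_apply_apply]
    have hpp : p.left ≫ P.proj.left = (P.smul p g).left ≫ P.proj.left := h.trans h'.symm
    have e1 := hφv h h' hpp n
    have e3 : (P.descentDatum e).iso p.left (P.smul p g).left hpp =
        P.fiberIso e x p.left (P.smul p g).left (Over.w p) (Over.w (P.smul p g)) hpp :=
      P.fiberIso_congr e _ _ _ _ hpp
    rw [e3] at e1
    have e4 := P.fiberIso_spec e x p.left (P.smul p g).left (Over.w p) (Over.w (P.smul p g)) hpp (v p.left y h n)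
    have e5 : g = P.transl x (P.pt p.left (Over.w p)) (P.pt (P.smul p g).left (Over.w (P.smul p g))) hpp :=
      P.transl_unique hpp rfl
    rw [← e5, e1] at e4
    apply (e.rho x g).injective
    exact hn.symm.trans e4.symm
  · have := (D.isVectorBundle.finite_projective y).1
    have := (D.isVectorBundle.finite_projective y).2
    have h1 : SpansLine (w x p y h).toLinearMap (D.line R y) (V.line R x) :=
      (hvL p.left y h).linearEquiv_trans (hL p.left (Over.w p))
    exact h1.symm

end GTorsor

end

section
open MonoidalCategory CartesianMonoidalCategory MonObj

variable {X Y Z : Scheme.{u}} {t : TensorialConstruction} {R S : CommRingCat.{u}}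

namespace LinePair

/-- The pullback of a pair. -/
def pullback (D : LinePair t Z) (g : Y ⟶ Z) : LinePair t Y :=
  ofIsSplitLine ((Modules.pullback g).obj D.bundle) (D.isVectorBundle.pullback g) (D.line.pullback g)
    (fun {R S} y y' σ h => by
      have h1 := pullAt_spansLine g D.line y rfl
      have hfin := (D.isVectorBundle.pullback g).finite_projective y
      have := hfin.1
      have := hfin.2
      have hx : Spec.map σ ≫ y ≫ g = y' ≫ g := by rw [← h, Category.assoc]
      have hr := D.isVectorBundle.res_isExt σ hx
      have h2 := h1.comp (.of_linearEquiv _) hr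
        (k := (res D.bundle σ hx).comp (pullAt g D.bundle y rfl).toLinearMap) (fun _ => rfl)
        (fun _ => rfl) (D.spansLine_res σ hx)
      refine h2.comp ((IsExt.of_linearEquiv _).comp hr _ (fun _ => rfl) (fun _ => rfl))
        (.of_linearEquiv (pullAt g D.bundle y' rfl).symm) (fun _ => rfl) (fun m => ?_)
        (pullAt_spansLine g D.line y' rfl).symm
      refine ((LinearEquiv.symm_apply_eq _).2 ?_).symm
      exact (pullAt_res g D.bundle rfl rfl σ h hx m).symm)
    (fun y => by
      have h1 := (pullAt_spansLine g D.line y rfl).symm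
      have hfin := D.isVectorBundle.finite_projective (y ≫ g)
      have := hfin.1
      have := hfin.2
      exact h1.isSplitLine (.of_linearEquiv _) (D.isSplitLine _))

theorem exists_baseChange (D : LinePair t Y) (D' : LinePair t Z) {y : Spec R ⟶ Y} {y' : Spec S ⟶ Y}
    {z : Spec R ⟶ Z} {z' : Spec S ⟶ Z} (σ : R ⟶ S) (hy : Spec.map σ ≫ y = y') (hz : Spec.map σ ≫ z = z')
    (w : (sectionsAt y).obj D.bundle ≃ₗ[R] (sectionsAt z).obj D'.bundle)
    (hw : SpansLine w.toLinearMap (D.line R y) (D'.line R z)) :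
    ∃ w' : (sectionsAt y').obj D.bundle ≃ₗ[S] (sectionsAt z').obj D'.bundle,
      SpansLine w'.toLinearMap (D.line S y') (D'.line S z') ∧ ∀ m, w' (res _ σ hy m) = res _ σ hz (w m) := by
  have h1 := D.isVectorBundle.res_isExt σ hy
  have h2 := D'.isVectorBundle.res_isExt σ hz
  have h3 := (IsExt.of_linearEquiv w).comp h2 ((res D'.bundle σ hz).comp w.toLinearMap) (fun _ => rfl)
    (fun _ => rfl)
  have h4 (m) : h1.equiv h3 (res _ σ hy m) = res _ σ hz (w m) := h1.equiv_apply h3 m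
  refine ⟨h1.equiv h3, ?_, h4⟩
  exact (D.spansLine_res σ hy).of_comp h1 (.of_linearEquiv (h1.equiv h3)) (fun _ => rfl)
    (fun m => (h4 m).symm) (hw.comp (.of_linearEquiv w) h2
      (k := (res D'.bundle σ hz).comp w.toLinearMap) (fun _ => rfl) (fun _ => rfl)
      (D'.spansLine_res σ hz))

/-- Descent of isomorphisms of pairs. -/
theorem exists_iso_of_cover (D D' : LinePair t Y)
    (Θ : ∀ {R : CommRingCat.{u}} (y : Spec R ⟶ Y),
      ((sectionsAt y).obj D.bundle ≃ₗ[R] (sectionsAt y).obj D'.bundle) → Prop)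
    (huniq : ∀ {R : CommRingCat.{u}} (y : Spec R ⟶ Y) (w w'), Θ y w → Θ y w' → w = w')
    (hres : ∀ {R S : CommRingCat.{u}} (y : Spec R ⟶ Y) (y' : Spec S ⟶ Y) (σ : R ⟶ S)
      (h : Spec.map σ ≫ y = y') (w), Θ y w → ∃ w', Θ y' w' ∧ ∀ m, w' (res _ σ h m) = res _ σ h (w m))
    (hline : ∀ {R : CommRingCat.{u}} (y : Spec R ⟶ Y) (w), Θ y w →
      SpansLine w.toLinearMap (D.line R y) (D'.line R y))
    (hcov : ∀ {R : CommRingCat.{u}} (y : Spec R ⟶ Y), ∃ (J : Type u) (S : J → CommRingCat.{u})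
      (σ : ∀ i, R ⟶ S i), IsFlatCover (fun i => (σ i).hom) ∧ ∀ i, ∃ w, Θ (Spec.map (σ i) ≫ y) w) :
    ∃ φ : D.bundle ≅ D'.bundle, SubFamily.Preserves φ D.line D'.line ∧
      ∀ {R : CommRingCat.{u}} (y : Spec R ⟶ Y) (w), Θ y w → ∀ m, (sectionsAt y).map φ.hom m = w m := by
  obtain ⟨ψ, hψ⟩ := D.isVectorBundle.exists_hom_of_cover D'.isVectorBundle
    (fun y f => ∃ w, Θ y w ∧ f = w.toLinearMap)
    (fun y f f' ⟨w, hw, hf⟩ ⟨w', hw', hf'⟩ => by rw [hf, hf', huniq y w w' hw hw'])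
    (fun {R S} y y' σ h f ⟨w, hw, hf⟩ => by
      obtain ⟨w', hw', h'⟩ := hres y y' σ h w hw
      exact ⟨_, ⟨w', hw', rfl⟩, fun m => by rw [hf]; exact h' m⟩)
    (fun {R} y => by
      obtain ⟨J, S, σ, hσ, h⟩ := hcov y
      exact ⟨J, S, σ, hσ, fun i => ⟨_, (h i).choose, (h i).choose_spec, rfl⟩⟩)
  have hψ' {R : CommRingCat.{u}} (y : Spec R ⟶ Y) (w) (hw : Θ y w) (m) : (sectionsAt y).map ψ m = w m :=
    LinearMap.congr_fun (hψ y _ ⟨w, hw, rfl⟩) m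
  have hbij {R : CommRingCat.{u}} (y : Spec R ⟶ Y) : Function.Bijective ((sectionsAt y).map ψ) := by
    obtain ⟨J, S, σ, hσ, h⟩ := hcov y
    choose w hw using h
    refine hσ.bijective (fun i => D.isVectorBundle.res_isExt (σ i) rfl)
      (fun i => D'.isVectorBundle.res_isExt (σ i) rfl)
      ((sectionsAt y).map ψ).hom (fun i => (w i).toLinearMap) (fun i m => ?_) (fun i => (w i).bijective)
    exact (res_naturality ψ (σ i) rfl m).symm.trans (hψ' _ (w i) (hw i) _)
  have := D.isVectorBundle.isIso_of_bijective D'.isVectorBundle ψ hbij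
  refine ⟨asIso ψ, fun R y => ?_, hψ'⟩
  obtain ⟨J, S, σ, hσ, h⟩ := hcov y
  choose w hw using h
  let l : (sectionsAt y).obj D.bundle ≃ₗ[R] (sectionsAt y).obj D'.bundle :=
    LinearEquiv.ofBijective ((sectionsAt y).map ψ).hom (hbij y)
  have h2 : SpansLine l.toLinearMap (D.line R y) (D'.line R y) := by
    refine SpansLine.of_cover hσ
      (fun i => D'.isVectorBundle.res_isExt (σ i) rfl) (fun i => D'.spansLine_res (σ i) rfl)
      (k := fun i => (w i).toLinearMap.comp (res D.bundle (σ i) rfl)) (fun i m => ?_)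
      (fun i => (D.spansLine_res (σ i) rfl).comp (D.isVectorBundle.res_isExt (σ i) rfl) (.of_linearEquiv (w i))
        (fun _ => rfl) (fun _ => rfl) (hline _ (w i) (hw i)))
    exact (hψ' _ (w i) (hw i) _).symm.trans (res_naturality ψ (σ i) rfl m)
  exact (SpansLine.linearEquiv_iff l).1 h2

end LinePair

theorem IsDedekindScheme.isLocallyNoetherian (hX : IsDedekindScheme X) : IsLocallyNoetherian X := by
  obtain ⟨S, -, hS, hX⟩ := hX
  refine isLocallyNoetherian_of_affine_cover (S := fun U : S => U.1) ?_ fun U => ?_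
  · refine top_le_iff.mp fun x _ => ?_
    obtain ⟨U, hU, hx⟩ := hX x
    exact TopologicalSpace.Opens.mem_iSup.mpr ⟨⟨U, hU⟩, hx⟩
  · have := hS U.1 U.2
    infer_instance

namespace GTorsor

theorem locallyOfFinitePresentation [IsLocallyNoetherian X] {G : Over X} [GrpObj G]
    [LocallyOfFiniteType G.hom] (P : GTorsor G) : LocallyOfFinitePresentation P.proj.left := by
  have : LocallyOfFinitePresentation G.hom :=
    LocallyOfFinitePresentation.iff_locallyOfFiniteType.2 inferInstance
  have h := P.isPullback.map (Over.forget X)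
  have h' : LocallyOfFinitePresentation (fst P.total G).left := by
    rw [Over.fst_left]
    infer_instance
  have hq : QuasiCompact P.proj.left := inferInstance
  exact MorphismProperty.of_isPullback_of_descendsAlong (P := @LocallyOfFinitePresentation)
    (Q := @Surjective ⊓ @Flat ⊓ @QuasiCompact) h ⟨⟨P.surjective, P.flat⟩, hq⟩ h'

variable {G : Over X} [GrpObj G] {V : LinePair t X} {e : V.AutIso G} {P : GTorsor G}
  {D : LinePair t P.base.left}

theorem Triv.isTwist (T : P.Triv e D) (hP : LocallyOfFinitePresentation P.proj.left) :
    V.IsTwist P.base D := by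
  have hx : P.proj.left ≫ P.base.hom = P.total.hom := Over.w P.proj
  let w {R : CommRingCat.{u}} (z : Spec R ⟶ P.total.left) :
      (sectionsAt z).obj ((Modules.pullback P.proj.left).obj D.bundle) ≃ₗ[R]
        (sectionsAt z).obj ((Modules.pullback (P.proj.left ≫ P.base.hom)).obj V.bundle) :=
    ((pullAt P.proj.left D.bundle z rfl).trans (T.u _ (P.pt z rfl) _ rfl).symm).trans
      (pullAt (P.proj.left ≫ P.base.hom) V.bundle z (congrArg (z ≫ ·) hx)).symm
  have hw {R S : CommRingCat.{u}} (z : Spec R ⟶ P.total.left) (z' : Spec S ⟶ P.total.left) (σ : R ⟶ S)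
      (h : Spec.map σ ≫ z = z') (m) : w z' (res _ σ h m) = res _ σ h (w z m) := by
    have hz : Spec.map σ ≫ z ≫ P.proj.left = z' ≫ P.proj.left := by rw [← h, Category.assoc]
    have hz' : Spec.map σ ≫ z ≫ P.total.hom = z' ≫ P.total.hom := by rw [← h, Category.assoc]
    obtain ⟨n, rfl⟩ := (w z).symm.surjective m
    rw [LinearEquiv.apply_symm_apply]
    have e1 := pullAt_res (P.proj.left ≫ P.base.hom) V.bundle (congrArg (z ≫ ·) hx) (congrArg (z' ≫ ·) hx) σ h hz' n
    have e2 := T.natural σ hz' (P.pt z rfl) (P.pt z' rfl) h rfl rfl hz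
      (pullAt (P.proj.left ≫ P.base.hom) V.bundle z (congrArg (z ≫ ·) hx) n)
    have e3 := pullAt_res P.proj.left D.bundle rfl rfl σ h hz ((w z).symm n)
    have e4 : pullAt P.proj.left D.bundle z rfl ((w z).symm n) = T.u _ (P.pt z rfl) _ rfl
        (pullAt (P.proj.left ≫ P.base.hom) V.bundle z (congrArg (z ≫ ·) hx) n) :=
      LinearEquiv.apply_symm_apply _ _
    have e5 := (e3.trans ((congrArg _ e4).trans e2.symm)).trans (congrArg _ e1.symm)
    apply (pullAt (P.proj.left ≫ P.base.hom) V.bundle z' (congrArg (z' ≫ ·) hx)).injective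
    exact (LinearEquiv.apply_symm_apply _ _).trans ((LinearEquiv.symm_apply_eq _).2 e5)
  obtain ⟨φ, hφ, -⟩ := (D.pullback P.proj.left).exists_iso_of_cover (V.pullback (P.proj.left ≫ P.base.hom))
    (fun z f => f = w z) (fun z f f' h h' => h.trans h'.symm)
    (fun z z' σ h f hf => ⟨w z', rfl, fun m => by rw [hf]; exact hw z z' σ h m⟩)
    (fun {R} z f hf => by
      rw [hf]
      have h1 := pullAt_spansLine P.proj.left D.line z rfl
      have h2 := (T.spansLine _ (P.pt z rfl) _ rfl).symm
      have h3 := (pullAt_spansLine (P.proj.left ≫ P.base.hom) V.line z (congrArg (z ≫ ·) hx)).symm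
      have hfin := (D.isVectorBundle.pullback P.proj.left).finite_projective z
      have := hfin.1
      have := hfin.2
      exact (h1.linearEquiv_trans h2).linearEquiv_trans h3)
    (fun {R} z => ⟨PUnit, fun _ => R, fun _ => 𝟙 R,
      isFlatCover_of_faithfullyFlat (.of_bijective Function.bijective_id), fun _ => ⟨_, rfl⟩⟩)
  exact ⟨_, P.proj.left, P.flat, P.surjective, hP, φ, hφ⟩

end GTorsor

end

section
open MonoidalCategory CartesianMonoidalCategory MonObj

variable {X Y Z : Scheme.{u}} {t : TensorialConstruction} {R S : CommRingCat.{u}}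

/-- Faithfully flat descent for morphisms from affine schemes. -/
theorem AlgebraicGeometry.Scheme.exists_desc_Spec {σ : R ⟶ S} (hσ : σ.hom.FaithfullyFlat) (p : Spec S ⟶ Z)
    (hp : ∀ {A : CommRingCat.{u}} (a b : Spec A ⟶ Spec S), a ≫ Spec.map σ = b ≫ Spec.map σ → a ≫ p = b ≫ p) :
    ∃ q : Spec R ⟶ Z, Spec.map σ ≫ q = p := by
  obtain ⟨hf, hs⟩ := RingHom.FaithfullyFlat.iff_flat_and_comap_surjective.1 hσ
  have : Flat (Spec.map σ) := HasRingHomProperty.Spec_iff.2 hf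
  have : Surjective (Spec.map σ) := ⟨hs⟩
  have := isRegularEpi_of_flat_of_surjective_of_isAffine (Spec.map σ)
  exact IsRegularEpi.exists_of_isKernelPair (Spec.map σ) (IsPullback.of_hasPullback _ _) p
    (hom_ext_points fun q => by
      have := hp (q ≫ Limits.pullback.fst _ _) (q ≫ Limits.pullback.snd _ _)
        (by rw [Category.assoc, Category.assoc, Limits.pullback.condition])
      rwa [Category.assoc, Category.assoc] at this)

theorem AlgebraicGeometry.Scheme.hom_ext_of_faithfullyFlat {σ : R ⟶ S} (hσ : σ.hom.FaithfullyFlat)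
    {p q : Spec R ⟶ Z} (h : Spec.map σ ≫ p = Spec.map σ ≫ q) : p = q := by
  obtain ⟨hf, hs⟩ := RingHom.FaithfullyFlat.iff_flat_and_comap_surjective.1 hσ
  have : Flat (Spec.map σ) := HasRingHomProperty.Spec_iff.2 hf
  have : Surjective (Spec.map σ) := ⟨hs⟩
  have := Flat.epi_of_flat_of_surjective (Spec.map σ)
  exact (cancel_epi _).1 h

namespace GTorsor.Triv
variable {G : Over X} [GrpObj G] {V : LinePair t X} {e : V.AutIso G} {P : GTorsor G}
  {D : LinePair t P.base.left} (T : P.Triv e D)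

theorem injective (x : Spec R ⟶ X) (p p' : Over.mk x ⟶ P.total) (y : Spec R ⟶ P.base.left)
    (h : p.left ≫ P.proj.left = y) (h' : p'.left ≫ P.proj.left = y) (H : T.u x p y h = T.u x p' y h') :
    p = p' := by
  have h1 := P.smul_transl x p p' (h.trans h'.symm)
  generalize P.transl x p p' (h.trans h'.symm) = g at h1
  subst h1
  have h2 : g = 1 := by
    refine e.rho_injective x (LinearEquiv.ext fun m => ?_)
    rw [e.rho_one]
    apply (T.u x p y h).injective
    rw [← T.smul x p g y h h', H]
  rw [h2, smul_one]

theorem exists_of_point (x : Spec R ⟶ X) (p : Over.mk x ⟶ P.total) (y : Spec R ⟶ P.base.left)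
    (h : p.left ≫ P.proj.left = y) (w : (sectionsAt x).obj V.bundle ≃ₗ[R] (sectionsAt y).obj D.bundle)
    (hw : SpansLine w.toLinearMap (V.line R x) (D.line R y)) :
    ∃ (p' : Over.mk x ⟶ P.total) (h' : p'.left ≫ P.proj.left = y), T.u x p' y h' = w := by
  have h1 := T.spansLine x p y h
  obtain ⟨g, hg⟩ := e.exists_rho x (w.trans (T.u x p y h).symm)
    (hw.linearEquiv_trans h1.symm)
  have h2 : (P.smul p g).left ≫ P.proj.left = y := by
    rw [← h]
    exact congrArg CommaMorphism.left (P.smul_proj p g)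
  refine ⟨P.smul p g, h2, LinearEquiv.ext fun m => ?_⟩
  rw [T.smul x p g y h h2, hg]
  exact (T.u x p y h).apply_symm_apply _

/-- The points of a torsor are the isomorphisms from `V` to the associated pair. -/
theorem surjective (y : Spec R ⟶ P.base.left) {x : Spec R ⟶ X} (hx : y ≫ P.base.hom = x)
    (w : (sectionsAt x).obj V.bundle ≃ₗ[R] (sectionsAt y).obj D.bundle)
    (hw : SpansLine w.toLinearMap (V.line R x) (D.line R y)) :
    ∃ (p : Over.mk x ⟶ P.total) (h : p.left ≫ P.proj.left = y), T.u x p y h = w := by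
  obtain ⟨S, σ, z, hz, hσ⟩ := exists_isPullback_Spec P.proj.left y
  have hxz : z ≫ P.total.hom = Spec.map σ ≫ x := by
    rw [← Over.w P.proj, ← Category.assoc, hz.w, Category.assoc, hx]
  obtain ⟨w', hw', hww'⟩ := V.exists_baseChange D σ rfl rfl w hw
  obtain ⟨p', hp', hpw'⟩ := T.exists_of_point _ (P.pt z hxz) _ hz.w w' hw'
  obtain ⟨q, hq⟩ := exists_desc_Spec hσ p'.left fun {A} a b hab => by
    obtain ⟨α, rfl⟩ := Spec.map_surjective a
    obtain ⟨β, rfl⟩ := Spec.map_surjective b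
    have hαβ : σ ≫ α = σ ≫ β := Spec.map_injective (by rw [Spec.map_comp, Spec.map_comp, hab])
    let x₂ := Spec.map (σ ≫ α) ≫ x
    have hα : Spec.map α ≫ Spec.map σ ≫ x = x₂ := (Spec.map_comp_assoc _ _ _).symm
    have hβ : Spec.map β ≫ Spec.map σ ≫ x = x₂ := by rw [← Spec.map_comp_assoc, ← hαβ]
    have hα' : Spec.map α ≫ Spec.map σ ≫ y = Spec.map (σ ≫ α) ≫ y := (Spec.map_comp_assoc _ _ _).symm
    have hβ' : Spec.map β ≫ Spec.map σ ≫ y = Spec.map (σ ≫ α) ≫ y := by rw [← Spec.map_comp_assoc, ← hαβ]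
    let pα : Over.mk x₂ ⟶ P.total := P.pt (Spec.map α ≫ p'.left) (by rw [Category.assoc, Over.w p']; exact hα)
    let pβ : Over.mk x₂ ⟶ P.total := P.pt (Spec.map β ≫ p'.left) (by rw [Category.assoc, Over.w p']; exact hβ)
    have ha : pα.left ≫ P.proj.left = Spec.map (σ ≫ α) ≫ y := by
      refine (Category.assoc _ _ _).trans ?_
      rw [hp']; exact hα'
    have hb : pβ.left ≫ P.proj.left = Spec.map (σ ≫ α) ≫ y := by
      refine (Category.assoc _ _ _).trans ?_
      rw [hp']; exact hβ'
    have key := T.injective x₂ pα pβ _ ha hb ?_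
    · exact congrArg CommaMorphism.left key
    apply LinearEquiv.toLinearMap_injective
    refine (V.isVectorBundle.res_isExt (σ ≫ α) rfl).ext fun m => ?_
    have e1 := T.natural α hα p' pα rfl hp' ha hα' (res V.bundle σ rfl m)
    have e2 := T.natural β hβ p' pβ rfl hp' hb hβ' (res V.bundle σ rfl m)
    have e3 := res_res V.bundle σ α rfl hα (rfl : _ = x₂) m
    have e4 := res_comm V.bundle σ α σ β rfl hα rfl hβ hαβ m
    have e5 := res_comm D.bundle σ α σ β rfl hα' rfl hβ' hαβ (w m)
    rw [hpw', hww'] at e1 e2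
    refine (congrArg _ e3.symm).trans (e1.trans (e5.trans (e2.symm.trans ?_)))
    exact congrArg _ (e4.symm.trans e3)
  have hqx : q ≫ P.total.hom = x := hom_ext_of_faithfullyFlat hσ (by
    rw [← Category.assoc, hq]; exact Over.w p')
  have hqy : q ≫ P.proj.left = y := hom_ext_of_faithfullyFlat hσ (by
    rw [← Category.assoc, hq]; exact hp')
  refine ⟨P.pt q hqx, hqy, LinearEquiv.ext fun m => ?_⟩
  refine D.isVectorBundle.ext_of_cover (isFlatCover_of_faithfullyFlat hσ) (fun _ => rfl) fun _ => ?_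
  have e1 := T.natural σ rfl (P.pt q hqx) p' hq hqy hp' rfl m
  rw [hpw', hww'] at e1
  exact e1.symm

end GTorsor.Triv

end

section
open MonoidalCategory CartesianMonoidalCategory MonObj

variable {X : Scheme.{u}} {t : TensorialConstruction} {R S : CommRingCat.{u}}

theorem CategoryTheory.Over.hom_ext_points {T T' : Over X} {f g : T ⟶ T'}
    (h : ∀ {R : CommRingCat.{u}} (x : Spec R ⟶ X) (p : Over.mk x ⟶ T), p ≫ f = p ≫ g) : f = g :=
  Over.OverMorphism.ext (AlgebraicGeometry.Scheme.hom_ext_points fun z =>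
    congrArg CommaMorphism.left (h (z ≫ T.hom) (Over.homMk z rfl)))

theorem CategoryTheory.Over.exists_hom_of_points {T T' : Over X}
    (Φ : ∀ {R : CommRingCat.{u}} (x : Spec R ⟶ X), (Over.mk x ⟶ T) → (Over.mk x ⟶ T'))
    (hΦ : ∀ {R S : CommRingCat.{u}} (σ : R ⟶ S) {x : Spec R ⟶ X} {x' : Spec S ⟶ X} (hx : Spec.map σ ≫ x = x')
      (p : Over.mk x ⟶ T), Φ x' ((Over.homMk (Spec.map σ) hx : Over.mk x' ⟶ Over.mk x) ≫ p) =
        (Over.homMk (Spec.map σ) hx : Over.mk x' ⟶ Over.mk x) ≫ Φ x p) :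
    ∃ f : T ⟶ T', ∀ {R : CommRingCat.{u}} (x : Spec R ⟶ X) (p : Over.mk x ⟶ T), p ≫ f = Φ x p := by
  obtain ⟨f, hf⟩ := AlgebraicGeometry.Scheme.exists_hom_of_points
    (fun {R} (z : Spec R ⟶ T.left) => (Φ (z ≫ T.hom) (Over.homMk z rfl)).left)
    (fun σ z => congrArg CommaMorphism.left (hΦ σ (Category.assoc _ _ _).symm (Over.homMk z rfl)))
  have h {R : CommRingCat.{u}} (x : Spec R ⟶ X) (z : Spec R ⟶ T.left) (hz : z ≫ T.hom = x) :
      z ≫ f = (Φ x (Over.homMk z hz)).left := by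
    subst hz
    exact hf z
  exact ⟨Over.homMk f (AlgebraicGeometry.Scheme.hom_ext_points fun z => by
    rw [← Category.assoc, hf]; exact Over.w (Φ _ _)), fun x p => Over.OverMorphism.ext (h x p.left (Over.w p))⟩

namespace GTorsor
variable {G : Over X} [GrpObj G] {V : LinePair t X} {e : V.AutIso G}

theorem exists_local_point (P : GTorsor G) (y : Spec R ⟶ P.base.left) : ∃ (S : CommRingCat.{u}) (σ : R ⟶ S),
    σ.hom.FaithfullyFlat ∧ ∃ (x : Spec S ⟶ X) (p : Over.mk x ⟶ P.total), p.left ≫ P.proj.left = Spec.map σ ≫ y := by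
  obtain ⟨S, σ, z, hz, hσ⟩ := exists_isPullback_Spec P.proj.left y
  exact ⟨S, σ, hσ, _, P.pt z rfl, hz.w⟩

theorem Triv.line_iso_ext {P : GTorsor G} {D : LinePair t P.base.left} (T : P.Triv e D) {E : P.base.left.Modules}
    (hE : IsVectorBundle E) {φ ψ : D.bundle ⟶ E}
    (h : ∀ {R : CommRingCat.{u}} (x : Spec R ⟶ X) (p : Over.mk x ⟶ P.total) (y : Spec R ⟶ P.base.left)
      (h : p.left ≫ P.proj.left = y) (m), (sectionsAt y).map φ (T.u x p y h m) = (sectionsAt y).map ψ (T.u x p y h m)) :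
    φ = ψ := by
  refine hE.hom_ext_of_cover fun {R} y => ?_
  obtain ⟨S, σ, hσ, x, p, hp⟩ := P.exists_local_point y
  refine ⟨PUnit, fun _ => S, fun _ => σ, isFlatCover_of_faithfullyFlat hσ, fun _ => ?_⟩
  ext n
  obtain ⟨m, rfl⟩ := (T.u x p _ hp).surjective n
  exact h x p _ hp m

namespace Triv
variable {P P' : GTorsor G} {D : LinePair t P.base.left} {D' : LinePair t P'.base.left}
  (T : P.Triv e D) (T' : P'.Triv e D')

/-- A morphism `φ : D ⟶ b^* D'` is compatible with a morphism `q : P ⟶ P'` of total spaces. -/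
structure Compat (b : P.base ⟶ P'.base) (q : P.total ⟶ P'.total)
    (φ : D.bundle ⟶ (Modules.pullback b.left).obj D'.bundle) : Prop where
  comm : ∀ {R : CommRingCat.{u}} (x : Spec R ⟶ X) (p : Over.mk x ⟶ P.total) (y : Spec R ⟶ P.base.left)
    (h : p.left ≫ P.proj.left = y) (y' : Spec R ⟶ P'.base.left) (hy : y ≫ b.left = y')
    (h' : (p ≫ q).left ≫ P'.proj.left = y') (m),
    pullAt b.left D'.bundle y hy ((sectionsAt y).map φ (T.u x p y h m)) = T'.u x (p ≫ q) y' h' m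

variable {T T'}

theorem proj_comp {b : P.base ⟶ P'.base} {q : P.total ⟶ P'.total} (hq : q ≫ P'.proj = P.proj ≫ b) {x : Spec R ⟶ X}
    (p : Over.mk x ⟶ P.total) {y : Spec R ⟶ P.base.left} (h : p.left ≫ P.proj.left = y)
    {y' : Spec R ⟶ P'.base.left} (hy : y ≫ b.left = y') : (p ≫ q).left ≫ P'.proj.left = y' := by
  rw [← hy, ← h, Over.comp_left, Category.assoc, Category.assoc]
  exact congrArg (p.left ≫ ·) (congrArg CommaMorphism.left hq)

theorem Compat.hom_ext {b : P.base ⟶ P'.base} {q : P.total ⟶ P'.total} (hq : q ≫ P'.proj = P.proj ≫ b)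
    {φ ψ : D.bundle ⟶ (Modules.pullback b.left).obj D'.bundle} (hφ : Compat T T' b q φ) (hψ : Compat T T' b q ψ) :
    φ = ψ :=
  T.line_iso_ext (D'.isVectorBundle.pullback b.left) fun x p y h m =>
    (pullAt b.left D'.bundle y rfl).injective ((hφ.comm x p y h _ rfl (proj_comp hq p h rfl) m).trans
      (hψ.comm x p y h _ rfl (proj_comp hq p h rfl) m).symm)

theorem Compat.map_ext {b : P.base ⟶ P'.base} {q q' : P.total ⟶ P'.total} (hq : q ≫ P'.proj = P.proj ≫ b)
    (hq' : q' ≫ P'.proj = P.proj ≫ b)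
    {φ : D.bundle ⟶ (Modules.pullback b.left).obj D'.bundle} (h : Compat T T' b q φ) (h' : Compat T T' b q' φ) :
    q = q' :=
  Over.hom_ext_points fun x p => T'.injective x _ _ _ (proj_comp hq p rfl rfl) (proj_comp hq' p rfl rfl)
    (LinearEquiv.ext fun m => (h.comm x p _ rfl _ rfl (proj_comp hq p rfl rfl) m).symm.trans
      (h'.comm x p _ rfl _ rfl (proj_comp hq' p rfl rfl) m))

variable (T T')

/-- The isomorphism of modules induced by a morphism of torsors at a point of the total space. -/
def isoAt (f : P ⟶ P') (x : Spec R ⟶ X) (p : Over.mk x ⟶ P.total) (y : Spec R ⟶ P.base.left)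
    (h : p.left ≫ P.proj.left = y) :
    (sectionsAt y).obj D.bundle ≃ₗ[R] (sectionsAt y).obj (D'.pullback f.base.left).bundle :=
  ((T.u x p y h).symm.trans (T'.u x (p ≫ f.map) _ (proj_comp f.w p h rfl))).trans
    (pullAt f.base.left D'.bundle y rfl).symm

theorem isoAt_u (f : P ⟶ P') (x : Spec R ⟶ X) (p : Over.mk x ⟶ P.total) (y : Spec R ⟶ P.base.left)
    (h : p.left ≫ P.proj.left = y) (m) : pullAt f.base.left D'.bundle y rfl (isoAt T T' f x p y h (T.u x p y h m)) =
      T'.u x (p ≫ f.map) _ (proj_comp f.w p h rfl) m := by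
  refine (LinearEquiv.apply_symm_apply _ _).trans ?_
  exact congrArg _ ((T.u x p y h).symm_apply_apply m)

theorem isoAt_eq (f : P ⟶ P') (x x' : Spec R ⟶ X) (p : Over.mk x ⟶ P.total) (p' : Over.mk x' ⟶ P.total)
    (y : Spec R ⟶ P.base.left) (h : p.left ≫ P.proj.left = y) (h' : p'.left ≫ P.proj.left = y) :
    isoAt T T' f x p y h = isoAt T T' f x' p' y h' := by
  obtain rfl : x = x' := by
    have h1 := Over.w p
    have h2 := Over.w p'
    rw [← Over.w P.proj, ← Category.assoc] at h1 h2
    exact h1.symm.trans ((congrArg (· ≫ P.base.hom) (h.trans h'.symm)).trans h2)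
  have h1 := P.smul_transl x p p' (h.trans h'.symm)
  generalize P.transl x p p' (h.trans h'.symm) = g at h1
  subst h1
  refine LinearEquiv.ext fun n => ?_
  obtain ⟨m, rfl⟩ := (T.u x (P.smul p g) y h').surjective n
  apply (pullAt f.base.left D'.bundle y rfl).injective
  have e1 := isoAt_u T T' f x (P.smul p g) y h' m
  have e2 := isoAt_u T T' f x p y h (e.rho x g m)
  rw [← T.smul x p g y h h'] at e2
  refine e2.trans (Eq.trans ?_ e1.symm)
  have h3 := proj_comp f.w (P.smul p g) h' (rfl : y ≫ f.base.left = _)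
  generalize_proofs at h3 ⊢
  revert h3
  rw [GTorsor.Hom.smul_map]
  exact fun h3 => (T'.smul x (p ≫ f.map) g _ _ h3 m).symm

/-- A morphism of torsors induces an isomorphism of the associated pairs. -/
theorem exists_compat_iso (f : P ⟶ P') : ∃ φ : D.bundle ≅ (Modules.pullback f.base.left).obj D'.bundle,
    SubFamily.Preserves φ D.line (D'.line.pullback f.base.left) ∧ Compat T T' f.base f.map φ.hom := by
  obtain ⟨φ, hφ, h⟩ := D.exists_iso_of_cover (D'.pullback f.base.left)
    (fun {R} y w => ∃ (x : Spec R ⟶ X) (p : Over.mk x ⟶ P.total) (h : p.left ≫ P.proj.left = y),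
      w = isoAt T T' f x p y h)
    (fun y w w' ⟨x, p, h, hw⟩ ⟨x', p', h', hw'⟩ => by rw [hw, hw', isoAt_eq])
    (fun {R S} y y' σ hy w ⟨x, p, h, hw⟩ => by
      have hx : (Spec.map σ ≫ p.left) ≫ P.total.hom = Spec.map σ ≫ x := by
        rw [Category.assoc]; exact congrArg (Spec.map σ ≫ ·) (Over.w p)
      have h' : (P.pt (Spec.map σ ≫ p.left) hx).left ≫ P.proj.left = y' := by
        rw [← hy, ← h]; exact Category.assoc _ _ _
      refine ⟨_, ⟨_, P.pt (Spec.map σ ≫ p.left) hx, h', rfl⟩, fun n => ?_⟩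
      rw [hw]
      obtain ⟨m, rfl⟩ := (T.u x p y h).surjective n
      apply (pullAt f.base.left D'.bundle y' rfl).injective
      have hyb : Spec.map σ ≫ y ≫ f.base.left = y' ≫ f.base.left := by rw [← hy, Category.assoc]
      have e1 := T.natural σ rfl p (P.pt (Spec.map σ ≫ p.left) hx) rfl h h' hy m
      have e2 := isoAt_u T T' f _ (P.pt (Spec.map σ ≫ p.left) hx) y' h' (res _ σ rfl m)
      have e3 := T'.natural σ rfl (p ≫ f.map) (P.pt (Spec.map σ ≫ p.left) hx ≫ f.map)
        (Category.assoc _ _ _).symm (proj_comp f.w p h rfl) (proj_comp f.w _ h' rfl) hyb m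
      have e4 := pullAt_res f.base.left D'.bundle rfl rfl σ hy hyb (isoAt T T' f x p y h (T.u x p y h m))
      rw [e1] at e2
      exact e2.trans (e3.trans ((congrArg _ (isoAt_u T T' f x p y h m).symm).trans e4.symm)))
    (fun {R} y w ⟨x, p, h, hw⟩ => by
      rw [hw]
      have h1 := (T.spansLine x p y h).symm
      have h2 := T'.spansLine x (p ≫ f.map) _ (proj_comp f.w p h rfl)
      have h3 := (pullAt_spansLine f.base.left D'.line y rfl).symm
      exact (h1.linearEquiv_trans h2).linearEquiv_trans h3)
    (fun {R} y => by
      obtain ⟨S, σ, hσ, x, p, h⟩ := P.exists_local_point y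
      exact ⟨PUnit, fun _ => S, fun _ => σ, isFlatCover_of_faithfullyFlat hσ, fun _ => ⟨_, x, p, h, rfl⟩⟩)
  refine ⟨φ, hφ, ⟨fun x p y hp y' hy h' m => ?_⟩⟩
  subst hy
  have := h y _ ⟨x, p, hp, rfl⟩ (T.u x p y hp m)
  exact (congrArg (pullAt f.base.left D'.bundle y rfl) this).trans (isoAt_u T T' f x p y hp m)

/-- An isomorphism of the associated pairs comes from a morphism of torsors. -/
theorem exists_compat_map (b : P.base ⟶ P'.base) (φ : D.bundle ≅ (Modules.pullback b.left).obj D'.bundle)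
    (hφ : SubFamily.Preserves φ D.line (D'.line.pullback b.left)) :
    ∃ f : P ⟶ P', f.base = b ∧ Compat T T' b f.map φ.hom := by
  have key {R : CommRingCat.{u}} (x : Spec R ⟶ X) (p : Over.mk x ⟶ P.total) :
      ∃ (p' : Over.mk x ⟶ P'.total) (h : p'.left ≫ P'.proj.left = (p.left ≫ P.proj.left) ≫ b.left),
      ∀ m, pullAt b.left D'.bundle (p.left ≫ P.proj.left) rfl ((sectionsAt _).map φ.hom (T.u x p _ rfl m)) =
        T'.u x p' _ h m := by
    have h1 := T.spansLine x p _ rfl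
    have h2 : SpansLine ((sectionsAt (p.left ≫ P.proj.left)).mapIso φ).toLinearEquiv.toLinearMap
      (D.line R (p.left ≫ P.proj.left)) (D'.line.pullback b.left R (p.left ≫ P.proj.left)) :=
      (SpansLine.linearEquiv_iff _).2 (hφ R _)
    have h3 := pullAt_spansLine b.left D'.line (p.left ≫ P.proj.left) rfl
    have h5 := (h1.linearEquiv_trans h2).linearEquiv_trans h3
    have hx : ((p.left ≫ P.proj.left) ≫ b.left) ≫ P'.base.hom = x := by
      rw [Category.assoc, Category.assoc, Over.w b, Over.w P.proj]; exact Over.w p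
    obtain ⟨p', h, hu⟩ := T'.surjective _ hx _ h5
    exact ⟨p', h, fun m => (LinearEquiv.congr_fun hu m).symm⟩
  choose Φ hΦ hΦu using @key
  have hnat {R S : CommRingCat.{u}} (σ : R ⟶ S) {x : Spec R ⟶ X} {x' : Spec S ⟶ X} (hx : Spec.map σ ≫ x = x')
      (p : Over.mk x ⟶ P.total) (p' : Over.mk x' ⟶ P.total) (hp : Spec.map σ ≫ p.left = p'.left) :
      (Φ x' p').left = Spec.map σ ≫ (Φ x p).left := by
    have h1 : (Spec.map σ ≫ (Φ x p).left) ≫ P'.total.hom = x' := by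
      rw [Category.assoc, Over.w (Φ x p)]; exact hx
    have hy : Spec.map σ ≫ p.left ≫ P.proj.left = p'.left ≫ P.proj.left := by rw [← hp, Category.assoc]
    have hyb : Spec.map σ ≫ (p.left ≫ P.proj.left) ≫ b.left = (p'.left ≫ P.proj.left) ≫ b.left := by
      rw [← hy, Category.assoc (Spec.map σ)]
    have h2 : (P'.pt _ h1).left ≫ P'.proj.left = (p'.left ≫ P.proj.left) ≫ b.left := by
      refine (Category.assoc _ _ _).trans ?_
      rw [hΦ]; exact hyb
    refine congrArg CommaMorphism.left (T'.injective x' (Φ x' p') (P'.pt _ h1) _ (hΦ _ _) h2 ?_)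
    apply LinearEquiv.toLinearMap_injective
    refine (V.isVectorBundle.res_isExt σ hx).ext fun m => ?_
    have e1 := T'.natural σ hx (Φ x p) (P'.pt _ h1) rfl (hΦ _ _) h2 hyb m
    have e2 := T.natural σ hx p p' hp rfl rfl hy m
    have e3 := res_naturality φ.hom σ hy (T.u x p _ rfl m)
    have e4 := pullAt_res b.left D'.bundle rfl rfl σ hy hyb ((sectionsAt _).map φ.hom (T.u x p _ rfl m))
    have e5 := hΦu x' p' (res _ σ hx m)
    rw [hΦu x p m] at e4
    refine e5.symm.trans (Eq.trans (congrArg _ ?_) (e4.trans e1.symm))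
    exact (congrArg _ e2).trans e3
  obtain ⟨q, hq⟩ := Over.exists_hom_of_points (fun x p => Φ x p)
    fun {R S} σ {x x'} hx p => Over.OverMorphism.ext (hnat σ hx p _ rfl)
  have hw : q ≫ P'.proj = P.proj ≫ b := Over.hom_ext_points fun x p => Over.OverMorphism.ext (by
    rw [← Category.assoc, hq, ← Category.assoc]; exact hΦ x p)
  have hc : Compat T T' b q φ.hom := ⟨fun x p y h y' hy h' m => by
    subst h hy
    refine (hΦu x p m).trans ?_
    revert h'
    rw [hq]
    exact fun h' => rfl⟩
  refine ⟨⟨b, q, hw, Over.hom_ext_points fun x z => ?_⟩, rfl, hc⟩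
  have hz : z = lift (z ≫ fst _ _) (z ≫ snd _ _) := by rw [← comp_lift, lift_fst_snd, Category.comp_id]
  rw [hz]
  generalize z ≫ fst _ _ = p
  generalize z ≫ snd _ _ = g
  rw [lift_whiskerRight_assoc, ← Category.assoc]
  have h1 : (P.smul p g).left ≫ P.proj.left = p.left ≫ P.proj.left := congrArg CommaMorphism.left (P.smul_proj p g)
  have h2 := proj_comp hw (P.smul p g) h1 rfl
  have h3 := proj_comp hw p rfl rfl
  have h4 : (P'.smul (p ≫ q) g).left ≫ P'.proj.left = _ :=
    (congrArg CommaMorphism.left (P'.smul_proj (p ≫ q) g)).trans h3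
  refine T'.injective x (P.smul p g ≫ q) (P'.smul (p ≫ q) g) _ h2 h4 (LinearEquiv.ext fun m => ?_)
  have e1 := hc.comm x (P.smul p g) _ h1 _ rfl h2 m
  have e2 := hc.comm x p _ rfl _ rfl h3 (e.rho x g m)
  rw [T.smul x p g _ rfl h1] at e1
  exact e1.symm.trans (e2.trans (T'.smul x (p ≫ q) g _ h3 h4 m).symm)

end Triv
end GTorsor

end

section
open MonoidalCategory CartesianMonoidalCategory MonObj

variable {X : Scheme.{u}} {t : TensorialConstruction} {R S : CommRingCat.{u}}

namespace GTorsor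
variable {G : Over X} [GrpObj G] {V : LinePair t X} {e : V.AutIso G}

namespace Triv

theorem compat_id {P : GTorsor G} {D : LinePair t P.base.left} (T : P.Triv e D) :
    Compat T T (𝟙 P.base) (𝟙 P.total) ((pullbackId P.base.left).inv.app D.bundle) := by
  refine ⟨fun x p y h y' hy h' m => ?_⟩
  obtain rfl : y = y' := by rw [← hy]; exact (Category.comp_id y).symm
  refine (pullAt_id D.bundle y hy _).trans ?_
  have h1 : (sectionsAt y).map ((pullbackId P.base.left).inv.app D.bundle) ≫
      (sectionsAt y).map ((pullbackId P.base.left).hom.app D.bundle) = 𝟙 _ := by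
    rw [← CategoryTheory.Functor.map_comp, Iso.inv_hom_id_app]
    exact CategoryTheory.Functor.map_id _ _
  refine (congr($h1 (T.u x p y h m)) : _).trans ?_
  revert h'
  rw [Category.comp_id]
  exact fun _ => rfl

theorem Compat.comp {P P' P'' : GTorsor G} {D : LinePair t P.base.left} {D' : LinePair t P'.base.left}
    {D'' : LinePair t P''.base.left} {T : P.Triv e D} {T' : P'.Triv e D'} {T'' : P''.Triv e D''}
    {f : P ⟶ P'} {f' : P' ⟶ P''} {φ : D.bundle ⟶ (Modules.pullback f.base.left).obj D'.bundle}
    {φ' : D'.bundle ⟶ (Modules.pullback f'.base.left).obj D''.bundle}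
    (h : Compat T T' f.base f.map φ) (h' : Compat T' T'' f'.base f'.map φ') :
    Compat T T'' (f.base ≫ f'.base) (f.map ≫ f'.map) (φ ≫ (Modules.pullback f.base.left).map φ' ≫
      (pullbackComp f.base.left f'.base.left).hom.app D''.bundle) := by
  refine ⟨fun x p y hp y' hy hp' m => ?_⟩
  have h1 := proj_comp f.w p hp rfl
  have hy' : (y ≫ f.base.left) ≫ f'.base.left = y' := (Category.assoc _ _ _).trans hy
  have h2 := proj_comp f'.w (p ≫ f.map) h1 hy'
  have e1 := h.comm x p y hp _ rfl h1 m
  have e2 := h'.comm x (p ≫ f.map) _ h1 y' hy' h2 m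
  have e3 := pullAt_map f.base.left φ' y rfl ((sectionsAt y).map φ (T.u x p y hp m))
  have e4 := pullAt_comp f.base.left f'.base.left D''.bundle y rfl hy' hy
    ((sectionsAt y).map ((Modules.pullback f.base.left).map φ') ((sectionsAt y).map φ (T.u x p y hp m)))
  have e5 : (sectionsAt y).map (φ ≫ (Modules.pullback f.base.left).map φ' ≫
      (pullbackComp f.base.left f'.base.left).hom.app D''.bundle) = (sectionsAt y).map φ ≫
        (sectionsAt y).map ((Modules.pullback f.base.left).map φ') ≫
        (sectionsAt y).map ((pullbackComp f.base.left f'.base.left).hom.app D''.bundle) := by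
    rw [CategoryTheory.Functor.map_comp, CategoryTheory.Functor.map_comp]
  rw [← e1, ← e3] at e2
  refine ((congrArg (pullAt (f.base.left ≫ f'.base.left) D''.bundle y hy)
    (congr($e5 (T.u x p y hp m)) : _)).trans e4).trans (e2.trans ?_)
  revert hp'
  rw [← Category.assoc]
  exact fun _ => rfl

end Triv

variable (e)

/-- The pair associated with a torsor. -/
def assocPair (P : GTorsor G) : LinePair t P.base.left := (P.exists_triv e).choose

/-- The tautological trivialization of the pair associated with a torsor. -/
def assocTriv (P : GTorsor G) : P.Triv e (P.assocPair e) := (P.exists_triv e).choose_spec.some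

/-- The isomorphism of pairs induced by a morphism of torsors. -/
def assocIso {P P' : GTorsor G} (f : P ⟶ P') :
    (P.assocPair e).bundle ≅ (Modules.pullback f.base.left).obj (P'.assocPair e).bundle :=
  (Triv.exists_compat_iso (P.assocTriv e) (P'.assocTriv e) f).choose

theorem assocIso_preserves {P P' : GTorsor G} (f : P ⟶ P') :
    SubFamily.Preserves (assocIso e f) (P.assocPair e).line ((P'.assocPair e).line.pullback f.base.left) :=
  (Triv.exists_compat_iso (P.assocTriv e) (P'.assocTriv e) f).choose_spec.1

theorem assocIso_compat {P P' : GTorsor G} (f : P ⟶ P') :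
    Triv.Compat (P.assocTriv e) (P'.assocTriv e) f.base f.map (assocIso e f).hom :=
  (Triv.exists_compat_iso (P.assocTriv e) (P'.assocTriv e) f).choose_spec.2

/-- The functor from torsors to twists. -/
def toTwist (hG : ∀ P : GTorsor G, LocallyOfFinitePresentation P.proj.left) : GTorsor G ⥤ Twist V where
  obj P := ⟨P.base, P.assocPair e, (P.assocTriv e).isTwist (hG P)⟩
  map f := ⟨f.base, assocIso e f, assocIso_preserves e f⟩
  map_id P := Twist.Hom.ext' rfl ((Category.comp_id _).trans
    ((assocIso_compat e (𝟙 P)).hom_ext (GTorsor.Hom.w (𝟙 P)) (P.assocTriv e).compat_id))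
  map_comp f f' := Twist.Hom.ext' rfl ((Category.comp_id _).trans
    ((assocIso_compat e (f ≫ f')).hom_ext (GTorsor.Hom.w (f ≫ f'))
      ((assocIso_compat e f).comp (assocIso_compat e f'))))

theorem exists_toTwist_iso (hG : ∀ P : GTorsor G, LocallyOfFinitePresentation P.proj.left) (P : GTorsor G)
    (D : LinePair t P.base.left) (hD : V.IsTwist P.base D) (T : P.Triv e D) :
    ∃ i : (toTwist e hG).obj P ≅ (⟨P.base, D, hD⟩ : Twist V), i.hom.base = 𝟙 P.base := by
  obtain ⟨φ, hφ, hc⟩ := Triv.exists_compat_iso (P.assocTriv e) T (𝟙 P)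
  obtain ⟨ψ, hψ, hc'⟩ := Triv.exists_compat_iso T (P.assocTriv e) (𝟙 P)
  let f : (toTwist e hG).obj P ⟶ (⟨P.base, D, hD⟩ : Twist V) := Twist.Hom.mk (𝟙 P.base) φ hφ
  let g : (⟨P.base, D, hD⟩ : Twist V) ⟶ (toTwist e hG).obj P := Twist.Hom.mk (𝟙 P.base) ψ hψ
  have hw : (𝟙 P.total ≫ 𝟙 P.total) ≫ P.proj = P.proj ≫ 𝟙 P.base ≫ 𝟙 P.base := by simp
  have key {D₁ : LinePair t P.base.left} (hD₁ : V.IsTwist P.base D₁) (T₁ : P.Triv e D₁)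
      (k : (⟨P.base, D₁, hD₁⟩ : Twist V) ⟶ ⟨P.base, D₁, hD₁⟩) (hk : k.base = 𝟙 P.base)
      (h : Triv.Compat T₁ T₁ k.base (𝟙 P.total) k.iso.hom) : k = 𝟙 _ := by
    obtain ⟨b, κ, hκ⟩ := k
    obtain rfl : b = 𝟙 P.base := hk
    exact Twist.Hom.ext' rfl ((Category.comp_id _).trans (h.hom_ext (GTorsor.Hom.w (𝟙 P)) T₁.compat_id))
  have h1 := hc.comp hc'
  have h2 := hc'.comp hc
  have h3 : (𝟙 P : P ⟶ P).map ≫ (𝟙 P : P ⟶ P).map = 𝟙 P.total := Category.comp_id (𝟙 P.total)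
  rw [h3] at h1 h2
  exact ⟨⟨f, g, key _ (P.assocTriv e) (f ≫ g) (Category.comp_id (𝟙 P.base)) h1,
    key hD T (g ≫ f) (Category.comp_id (𝟙 P.base)) h2⟩, rfl⟩

theorem toTwist_injective (hG : ∀ P : GTorsor G, LocallyOfFinitePresentation P.proj.left) {P P' : GTorsor G}
    {f f' : P ⟶ P'} (h : (toTwist e hG).map f = (toTwist e hG).map f') : f = f' := by
  have hb : f.base = f'.base := congrArg Twist.Hom.base h
  obtain ⟨b, q, hw, hq⟩ := f
  obtain ⟨b', q', hw', hq'⟩ := f'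
  obtain rfl : b = b' := hb
  have hc := assocIso_compat e (⟨b, q, hw, hq⟩ : P ⟶ P')
  have hc' := assocIso_compat e (⟨b, q', hw', hq'⟩ : P ⟶ P')
  have hi : assocIso e (⟨b, q, hw, hq⟩ : P ⟶ P') = assocIso e (⟨b, q', hw', hq'⟩ : P ⟶ P') :=
    eq_of_heq (Twist.Hom.mk.inj h).2
  rw [← hi] at hc'
  obtain rfl : q = q' := hc.map_ext hw hw' hc'
  rfl

theorem toTwist_surjective (hG : ∀ P : GTorsor G, LocallyOfFinitePresentation P.proj.left) {P P' : GTorsor G}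
    (g : (toTwist e hG).obj P ⟶ (toTwist e hG).obj P') : ∃ f : P ⟶ P', (toTwist e hG).map f = g := by
  obtain ⟨b, φ, hφ⟩ := g
  obtain ⟨f, rfl, hc⟩ := Triv.exists_compat_map (P.assocTriv e) (P'.assocTriv e) b φ hφ
  exact ⟨f, Twist.Hom.ext' rfl ((Category.comp_id _).trans ((assocIso_compat e f).hom_ext f.w hc))⟩

end GTorsor

open GTorsor in
theorem exists_basedFunctor {G : Over X} [GrpObj G] {V : LinePair t X} (e : V.AutIso G)
    (hG : ∀ P : GTorsor G, LocallyOfFinitePresentation P.proj.left)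
    (hV : ∀ (Y : Over X) (D : LinePair t Y.left) (hD : V.IsTwist Y D), ∃ (P : GTorsor G)
      (D' : LinePair t P.base.left) (hD' : V.IsTwist P.base D'), Nonempty (P.Triv e D') ∧
      (⟨P.base, D', hD'⟩ : Twist V) = ⟨Y, D, hD⟩) :
    ∃ F : BasedFunctor (BasedCategory.ofFunctor (GTorsor.forget G)) (BasedCategory.ofFunctor (Twist.forget V)),
      ∀ Y : Over X, (F.onFiber Y).IsEquivalence := by
  let F : BasedFunctor (BasedCategory.ofFunctor (GTorsor.forget G)) (BasedCategory.ofFunctor (Twist.forget V)) :=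
    { toFunctor := toTwist e hG, w := rfl }
  refine ⟨F, fun Y => ?_⟩
  have h1 : (F.onFiber Y).Faithful := ⟨fun {a b} f f' h => Subtype.ext
    (toTwist_injective e hG (congrArg Subtype.val h))⟩
  have h2 : (F.onFiber Y).Full := ⟨fun {a b} g => by
    obtain ⟨f, hf⟩ := toTwist_surjective e hG g.1
    have h3 := g.2
    have h4 : (BasedCategory.ofFunctor (Twist.forget V)).p.IsHomLift (𝟙 Y) (F.map f) := by
      have : F.map f = g.1 := hf
      rw [this]
      exact h3
    have h5 := BasedFunctor.isHomLift_map F (𝟙 Y) f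
    exact ⟨⟨f, h5⟩, Subtype.ext hf⟩⟩
  have h3 : (F.onFiber Y).EssSurj := ⟨fun ⟨D, hY⟩ => by
    obtain ⟨Y', D, hD⟩ := D
    obtain rfl : Y' = Y := hY
    obtain ⟨P, D', hD', ⟨T⟩, h⟩ := hV Y' D hD
    obtain rfl : P.base = Y' := congrArg Twist.base h
    obtain rfl : D' = D := eq_of_heq (Twist.mk.inj h).2
    obtain ⟨i, hi⟩ := exists_toTwist_iso e hG P D' hD T
    have h5 : (Twist.forget V).IsHomLift (𝟙 P.base) i.hom := by
      have := IsHomLift.map (Twist.forget V) i.hom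
      have h6 : (Twist.forget V).map i.hom = 𝟙 P.base := hi
      rw [h6] at this
      exact this
    have h7 : (Twist.forget V).IsHomLift (𝟙 P.base) i.inv := inferInstance
    exact ⟨⟨P, rfl⟩, ⟨⟨i.hom, h5⟩, ⟨i.inv, h7⟩, Subtype.ext i.hom_inv_id, Subtype.ext i.inv_hom_id⟩⟩⟩
  exact { }

end

section
open MonoidalCategory CartesianMonoidalCategory MonObj

section
variable {R : Type u} [CommRing R] {M N : Type u} [AddCommGroup M] [AddCommGroup N] [Module R M] [Module R N]

theorem Module.exists_dual_basis [Module.Finite R N] [Module.Projective R N] : ∃ (n : ℕ) (x : Fin n → N)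
    (d : Fin n → N →ₗ[R] R), ∀ y, ∑ j, d j y • x j = y := by
  obtain ⟨n, f, g, -, -, h⟩ := Module.Finite.exists_comp_eq_id_of_projective R N
  refine ⟨n, fun j => f (Pi.single j 1), fun j => LinearMap.proj j ∘ₗ g, fun y => ?_⟩
  conv_rhs => rw [show y = f (g y) from (LinearMap.congr_fun h y).symm, pi_eq_sum_univ' (g y), map_sum]
  refine Finset.sum_congr rfl fun j _ => ?_
  rw [_root_.map_smul]
  rfl

theorem IsExt.exists_semilinear {S T M' M'' : Type u} [CommRing S] [CommRing T] {σ : R →+* S} {τ : S →+* T}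
    {ρ : R →+* T} [AddCommGroup M'] [Module S M'] [AddCommGroup M''] [Module T M''] {f : M →ₛₗ[σ] M'}
    (hf : IsExt f) (k : M →ₛₗ[ρ] M'') (hρ : ∀ r, ρ r = τ (σ r)) : ∃ l : M' →ₛₗ[τ] M'', ∀ m, l (f m) = k m := by
  letI : Module S M'' := Module.compHom M'' τ
  let k' : M →ₛₗ[σ] M'' := {
    toFun := k
    map_add' := by simp
    map_smul' := fun r m => by rw [map_smulₛₗ, hρ]; rfl }
  exact ⟨{ hf.lift k' with map_smul' := fun s n => (hf.lift k').map_smul s n }, hf.lift_apply k'⟩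

/-- The extension of a linear form along a base change. -/
theorem IsExt.exists_form {S : Type u} [CommRing S] {a : R →+* S} {N' : Type u} [AddCommGroup N'] [Module S N']
    {g : N →ₛₗ[a] N'} (hg : IsExt g) (ξ : N →ₗ[R] R) : ∃ ξ' : N' →ₗ[S] S, ∀ n, ξ' (g n) = a (ξ n) :=
  ⟨hg.lift { toFun := fun n => a (ξ n), map_add' := by simp, map_smul' := by simp }, hg.lift_apply _⟩

theorem IsExt.sum_smul {S : Type u} [CommRing S] {a : R →+* S} {N' : Type u} [AddCommGroup N'] [Module S N']
    {g : N →ₛₗ[a] N'} (hg : IsExt g) {n : ℕ} {x : Fin n → N} {d : Fin n → N →ₗ[R] R}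
    (h : ∀ y, ∑ j, d j y • x j = y) {d' : Fin n → N' →ₗ[S] S} (hd' : ∀ j n, d' j (g n) = a (d j n)) (y : N') :
    ∑ j, d' j y • g (x j) = y := by
  refine hg.induction (p := fun y => ∑ j, d' j y • g (x j) = y) y (by simp) (fun y y' hy hy' => ?_) fun s m => ?_
  · simp only [map_add, add_smul, Finset.sum_add_distrib, hy, hy']
  · simp only [_root_.map_smul, hd', smul_eq_mul, mul_smul, ← Finset.smul_sum]
    conv_rhs => rw [← h m, map_sum]
    simp

/-- The vanishing of sections of a projective module is a closed condition. -/
theorem Module.exists_vanishing_ideal [Module.Finite R N] [Module.Projective R N] (s : Set N) : ∃ I : Ideal R,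
    ∀ (S : Type u) [CommRing S] (a : R →+* S) (N' : Type u) [AddCommGroup N'] [Module S N'] (g : N →ₛₗ[a] N'),
    IsExt g → ((∀ y ∈ s, g y = 0) ↔ I ≤ RingHom.ker a) := by
  obtain ⟨n, x, d, h⟩ := Module.exists_dual_basis (R := R) (N := N)
  refine ⟨Ideal.span {c | ∃ y ∈ s, ∃ j, c = d j y}, fun S _ a N' _ _ g hg => ?_⟩
  choose d' hd' using fun j => hg.exists_form (d j)
  rw [Ideal.span_le]
  constructor
  · rintro H _ ⟨y, hy, j, rfl⟩
    exact (hd' j y).symm.trans (by rw [H y hy, map_zero])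
  · intro H y hy
    rw [← hg.sum_smul h hd' (g y)]
    refine Finset.sum_eq_zero fun j _ => ?_
    rw [hd', show a (d j y) = 0 from H ⟨y, hy, j, rfl⟩, zero_smul]

open TensorProduct in
/-- The functor of homomorphisms from a module to a projective module is representable. -/
theorem Module.exists_hom_ring (R : CommRingCat.{u}) (M N : Type u) [AddCommGroup M] [AddCommGroup N] [Module R M]
    [Module R N] [Module.Finite R N] [Module.Projective R N] : ∃ (B : CommRingCat.{u}) (b : R ⟶ B),
    ∀ (NB : Type u) [AddCommGroup NB] [Module B NB] (g : N →ₛₗ[b.hom] NB), IsExt g → ∃ φ : M →ₛₗ[b.hom] NB,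
    ∀ (S : CommRingCat.{u}) (a : R ⟶ S) (N' : Type u) [AddCommGroup N'] [Module S N'] (g' : N →ₛₗ[a.hom] N'),
      IsExt g' → ∀ φ' : M →ₛₗ[a.hom] N', ∃! τ : B ⟶ S, b ≫ τ = a ∧
        ∀ l : NB →ₛₗ[τ.hom] N', (∀ n, l (g n) = g' n) → ∀ m, l (φ m) = φ' m := by
  obtain ⟨n, x, d, h⟩ := Module.exists_dual_basis (R := R) (N := N)
  let Q := M ⊗[R] (N →ₗ[R] R)
  let i := SymmetricAlgebra.ι R Q
  let b := CommRingCat.ofHom (algebraMap R (SymmetricAlgebra R Q))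
  have hb (r : R) (z : SymmetricAlgebra R Q) : b.hom r * z = r • z := (Algebra.smul_def r z).symm
  refine ⟨.of (SymmetricAlgebra R Q), b, fun NB _ _ g hg => ?_⟩
  refine ⟨{ toFun := fun m => ∑ j, i (m ⊗ₜ d j) • g (x j)
            map_add' := fun m m' => by simp [TensorProduct.add_tmul, add_smul, Finset.sum_add_distrib]
            map_smul' := fun r m => by
              rw [Finset.smul_sum]
              refine Finset.sum_congr rfl fun j _ => ?_
              rw [← TensorProduct.smul_tmul', _root_.map_smul, smul_smul]
              exact congrArg (· • g (x j)) (hb r _).symm }, fun S a N' _ _ g' hg' φ' => ?_⟩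
  letI : Algebra R S := a.hom.toAlgebra
  have hsm (r : R) (s : S) : r • s = a.hom r * s := rfl
  let β : M →ₗ[R] (N →ₗ[R] R) →ₗ[R] S := LinearMap.mk₂ R (fun m ξ => (hg'.exists_form ξ).choose (φ' m))
    (fun m m' ξ => by simp) (fun r m ξ => by rw [map_smulₛₗ, _root_.map_smul, hsm, smul_eq_mul])
    (fun m ξ ξ' => by
      rw [← LinearMap.add_apply]
      refine LinearMap.congr_fun (hg'.ext fun n => ?_) (φ' m)
      rw [LinearMap.add_apply, (hg'.exists_form _).choose_spec, (hg'.exists_form _).choose_spec,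
        (hg'.exists_form _).choose_spec, LinearMap.add_apply, map_add])
    (fun r m ξ => by
      rw [hsm, ← smul_eq_mul, ← LinearMap.smul_apply]
      refine LinearMap.congr_fun (hg'.ext fun n => ?_) (φ' m)
      rw [LinearMap.smul_apply, (hg'.exists_form _).choose_spec, (hg'.exists_form _).choose_spec,
        LinearMap.smul_apply, smul_eq_mul, map_mul, smul_eq_mul])
  have hβ (m ξ) (ξ' : N' →ₗ[S] S) (hξ' : ∀ n, ξ' (g' n) = a.hom (ξ n)) : ξ' (φ' m) = β m ξ := by
    refine LinearMap.congr_fun (hg'.ext fun n => ?_) (φ' m)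
    rw [hξ', (hg'.exists_form _).choose_spec]
  choose d' hd' using fun j => hg'.exists_form (d j)
  refine ⟨CommRingCat.ofHom (SymmetricAlgebra.lift (TensorProduct.lift β)).toRingHom, ⟨?_, fun l hl m => ?_⟩, ?_⟩
  · ext r
    exact AlgHom.commutes (SymmetricAlgebra.lift (TensorProduct.lift β)) r
  · change l (∑ j, i (m ⊗ₜ d j) • g (x j)) = _
    rw [map_sum, ← hg'.sum_smul h hd' (φ' m)]
    refine Finset.sum_congr rfl fun j _ => ?_
    rw [map_smulₛₗ, hl, hβ m (d j) _ (hd' j)]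
    exact congrArg (· • g' (x j)) ((SymmetricAlgebra.lift_ι_apply _ _).trans (TensorProduct.lift.tmul _ _))
  · rintro τ ⟨hτ, H⟩
    have hτ' (r : R) : a.hom r = τ.hom (b.hom r) := by rw [← hτ]; rfl
    obtain ⟨l, hl⟩ := hg.exists_semilinear g' hτ'
    let F : SymmetricAlgebra R Q →ₐ[R] S := { τ.hom with commutes' := fun r => (hτ' r).symm }
    have hF : F = SymmetricAlgebra.lift (TensorProduct.lift β) := by
      refine SymmetricAlgebra.algHom_ext (TensorProduct.ext' fun m ξ => ?_)
      obtain ⟨ξ', hξ'⟩ := hg'.exists_form ξ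
      refine Eq.trans ?_ ((hβ m ξ ξ' hξ').trans
        ((SymmetricAlgebra.lift_ι_apply _ _).trans (TensorProduct.lift.tmul _ _)).symm)
      have hξ : ξ = ∑ j, ξ (x j) • d j := by
        ext y
        conv_lhs => rw [← h y, map_sum]
        simp [mul_comm]
      have h1 := H l hl m
      change l (∑ j, i (m ⊗ₜ d j) • g (x j)) = _ at h1
      rw [← h1, map_sum, map_sum]
      conv_lhs => rw [hξ, TensorProduct.tmul_sum]
      rw [LinearMap.comp_apply, map_sum, map_sum]
      refine Finset.sum_congr rfl fun j _ => ?_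
      rw [TensorProduct.tmul_smul, _root_.map_smul, map_smulₛₗ l, hl]
      refine Eq.trans ?_ (ξ'.map_smul _ _).symm
      rw [hξ', smul_eq_mul, mul_comm]
      exact map_smul F _ _
    ext z
    exact congr($hF z)

end

end

section

theorem IsExt.ext_semilinear {R S T M N P : Type u} [CommRing R] [CommRing S] [CommRing T] {σ : R →+* S}
    {τ : S →+* T} [AddCommGroup M] [AddCommGroup N] [AddCommGroup P] [Module R M] [Module S N] [Module T P]
    {f : M →ₛₗ[σ] N} (hf : IsExt f) {k k' : N →ₛₗ[τ] P} (h : ∀ m, k (f m) = k' (f m)) : k = k' :=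
  LinearMap.ext fun n => hf.induction (p := fun n => k n = k' n) n (by simp)
    (fun a b ha hb => by rw [map_add, map_add, ha, hb]) fun s m => by rw [map_smulₛₗ, map_smulₛₗ, h]

namespace AlgebraicGeometry.Scheme.Modules
variable {X Y : Scheme.{u}} {R S T : CommRingCat.{u}} {M : X.Modules} {N : Y.Modules}
  {x : Spec R ⟶ X} {y : Spec R ⟶ Y} {x' : Spec S ⟶ X} {y' : Spec S ⟶ Y} {x'' : Spec T ⟶ X} {y'' : Spec T ⟶ Y}

/-- The linear map `φ'` is the base change of `φ` along `σ`. -/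
def Extends (σ : R ⟶ S) (hx : Spec.map σ ≫ x = x') (hy : Spec.map σ ≫ y = y')
    (φ : (sectionsAt x).obj M →ₗ[R] (sectionsAt y).obj N)
    (φ' : (sectionsAt x').obj M →ₗ[S] (sectionsAt y').obj N) : Prop :=
  ∀ m, φ' (res M σ hx m) = res N σ hy (φ m)

variable {φ : (sectionsAt x).obj M →ₗ[R] (sectionsAt y).obj N}
  {φ' : (sectionsAt x').obj M →ₗ[S] (sectionsAt y').obj N}
  {φ'' : (sectionsAt x'').obj M →ₗ[T] (sectionsAt y'').obj N}
  {σ : R ⟶ S} {τ : S ⟶ T} {hx : Spec.map σ ≫ x = x'} {hy : Spec.map σ ≫ y = y'}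
  {hx' : Spec.map τ ≫ x' = x''} {hy' : Spec.map τ ≫ y' = y''}

theorem Extends.comp (h : Extends σ hx hy φ φ') (h' : Extends τ hx' hy' φ' φ'')
    (hx'' : Spec.map (σ ≫ τ) ≫ x = x'') (hy'' : Spec.map (σ ≫ τ) ≫ y = y'') :
    Extends (σ ≫ τ) hx'' hy'' φ φ'' := fun m =>
  (congrArg φ'' (res_res M σ τ hx hx' hx'' m).symm).trans ((h' _).trans
    ((congrArg (res N τ hy') (h m)).trans (res_res N σ τ hy hy' hy'' (φ m))))

theorem Extends.of_comp (hM : IsVectorBundle M) (h : Extends σ hx hy φ φ')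
    {hx'' : Spec.map (σ ≫ τ) ≫ x = x''} {hy'' : Spec.map (σ ≫ τ) ≫ y = y''}
    (h' : Extends (σ ≫ τ) hx'' hy'' φ φ'') : Extends τ hx' hy' φ' φ'' := by
  have h1 : φ''.comp (res M τ hx') = (res N τ hy').comp φ' := (hM.res_isExt σ hx).ext_semilinear fun m =>
    (congrArg φ'' (res_res M σ τ hx hx' hx'' m)).trans ((h' m).trans
      ((res_res N σ τ hy hy' hy'' (φ m)).symm.trans (congrArg (res N τ hy') (h m).symm)))
  exact fun m => LinearMap.congr_fun h1 m

theorem Extends.unique (hM : IsVectorBundle M) {ψ : (sectionsAt x').obj M →ₗ[S] (sectionsAt y').obj N}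
    (h : Extends σ hx hy φ φ') (h' : Extends σ hx hy φ ψ) : φ' = ψ :=
  (hM.res_isExt σ hx).ext fun m => (h m).trans (h' m).symm

theorem exists_extends (hM : IsVectorBundle M) (φ : (sectionsAt x).obj M →ₗ[R] (sectionsAt y).obj N)
    (hx : Spec.map σ ≫ x = x') (hy : Spec.map σ ≫ y = y') :
    ∃ φ' : (sectionsAt x').obj M →ₗ[S] (sectionsAt y').obj N, Extends σ hx hy φ φ' :=
  ⟨(hM.res_isExt σ hx).lift ((res N σ hy).comp φ), (hM.res_isExt σ hx).lift_apply _⟩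

/-- The functor of homomorphisms of vector bundles is representable over an affine scheme. -/
theorem IsVectorBundle.exists_hom_ring (hM : IsVectorBundle M) (hN : IsVectorBundle N) (x : Spec R ⟶ X)
    (y : Spec R ⟶ Y) : ∃ (B : CommRingCat.{u}) (b : R ⟶ B)
    (xB : Spec B ⟶ X) (yB : Spec B ⟶ Y) (_ : Spec.map b ≫ x = xB) (_ : Spec.map b ≫ y = yB)
    (φ : (sectionsAt xB).obj M →ₗ[B] (sectionsAt yB).obj N),
    ∀ (S : CommRingCat.{u}) (a : R ⟶ S) {x' : Spec S ⟶ X} {y' : Spec S ⟶ Y} (_ : Spec.map a ≫ x = x')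
      (_ : Spec.map a ≫ y = y') (φ' : (sectionsAt x').obj M →ₗ[S] (sectionsAt y').obj N),
      ∃! τ : B ⟶ S, b ≫ τ = a ∧ ∀ h h', Extends τ h h' φ φ' := by
  have hfin := hN.finite_projective y
  have := hfin.1
  have := hfin.2
  obtain ⟨B, b, H⟩ := Module.exists_hom_ring R ((sectionsAt x).obj M) ((sectionsAt y).obj N)
  have h1 := hM.res_isExt b (rfl : Spec.map b ≫ x = _)
  have h2 := hN.res_isExt b (rfl : Spec.map b ≫ y = _)
  obtain ⟨φ₀, hφ₀⟩ := H _ (res N b rfl) h2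
  refine ⟨B, b, _, _, rfl, rfl, h1.lift φ₀, fun S a x' y' hx hy φ' => ?_⟩
  have key (τ : B ⟶ S) (hτ : b ≫ τ = a) :
      (∀ l : (sectionsAt (Spec.map b ≫ y)).obj N →ₛₗ[τ.hom] (sectionsAt y').obj N,
        (∀ n, l (res N b rfl n) = res N a hy n) → ∀ m, l (φ₀ m) = φ' (res M a hx m)) ↔
      ∀ h h', Extends τ h h' (h1.lift φ₀) φ' := by
    subst hτ
    constructor
    · intro H h h'
      have h3 : φ'.comp (res M τ h) = (res N τ h').comp (h1.lift φ₀) := h1.ext_semilinear fun m => by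
        have e1 := H (res N τ h') (fun n => res_res N b τ rfl h' hy n) m
        refine (congrArg φ' (res_res M b τ rfl h hx m)).trans (e1.symm.trans ?_)
        exact congrArg (res N τ h') (h1.lift_apply φ₀ m).symm
      exact fun m => LinearMap.congr_fun h3 m
    · intro H l hl m
      have h : Spec.map τ ≫ Spec.map b ≫ x = x' := by rw [← Spec.map_comp_assoc, hx]
      have h' : Spec.map τ ≫ Spec.map b ≫ y = y' := by rw [← Spec.map_comp_assoc, hy]
      have h3 : l = res N τ h' := h2.ext_semilinear fun n => (hl n).trans (res_res N b τ rfl h' hy n).symm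
      have e1 := H h h' (res M b rfl m)
      rw [h1.lift_apply φ₀ m] at e1
      rw [h3]
      exact e1.symm.trans (congrArg φ' (res_res M b τ rfl h hx m))
  obtain ⟨τ, ⟨h3, h4⟩, h5⟩ := hφ₀ S a _ (res N a hy) (hN.res_isExt a hy) (φ'.comp (res M a hx))
  exact ⟨τ, ⟨h3, (key τ h3).1 h4⟩, fun τ' ⟨h6, h7⟩ => h5 τ' ⟨h6, (key τ' h6).2 h7⟩⟩

theorem _root_.CommRingCat.exists_quotient (I : Ideal R) : ∃ (B : CommRingCat.{u}) (q : R ⟶ B),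
    (∀ r ∈ I, q.hom r = 0) ∧ ∀ {S : CommRingCat.{u}} (a : R ⟶ S), I ≤ RingHom.ker a.hom → ∃! τ : B ⟶ S, q ≫ τ = a := by
  refine ⟨.of (R ⧸ I), CommRingCat.ofHom (Ideal.Quotient.mk I), fun r hr => Ideal.Quotient.eq_zero_iff_mem.2 hr,
    fun a ha => ⟨CommRingCat.ofHom (Ideal.Quotient.lift I a.hom ha), ?_, fun τ hτ => ?_⟩⟩
  · ext r
    exact Ideal.Quotient.lift_mk I a.hom ha
  · ext r
    exact (congr($hτ r) : _)

/-- The condition that two homomorphisms are inverse to each other is closed. -/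
theorem IsVectorBundle.exists_inverse_ring (hM : IsVectorBundle M) (hN : IsVectorBundle N)
    (φ : (sectionsAt x).obj M →ₗ[R] (sectionsAt y).obj N) (ψ : (sectionsAt y).obj N →ₗ[R] (sectionsAt x).obj M) :
    ∃ (B : CommRingCat.{u}) (q : R ⟶ B) (xB : Spec B ⟶ X) (yB : Spec B ⟶ Y) (hx : Spec.map q ≫ x = xB)
      (hy : Spec.map q ≫ y = yB) (u : (sectionsAt xB).obj M ≃ₗ[B] (sectionsAt yB).obj N),
      Extends q hx hy φ u.toLinearMap ∧ Extends q hy hx ψ u.symm.toLinearMap ∧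
      ∀ {S : CommRingCat.{u}} (τ : R ⟶ S) {x' : Spec S ⟶ X} {y' : Spec S ⟶ Y} (hx : Spec.map τ ≫ x = x')
        (hy : Spec.map τ ≫ y = y') (u' : (sectionsAt x').obj M ≃ₗ[S] (sectionsAt y').obj N),
        Extends τ hx hy φ u'.toLinearMap → Extends τ hy hx ψ u'.symm.toLinearMap → ∃! σ : B ⟶ S, q ≫ σ = τ := by
  have hf := hM.finite_projective x
  have hg := hN.finite_projective y
  have := hf.1
  have := hf.2
  have := hg.1
  have := hg.2
  obtain ⟨I, hI⟩ := Module.exists_vanishing_ideal (R := R) (Set.range fun m => ψ (φ m) - m)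
  obtain ⟨J, hJ⟩ := Module.exists_vanishing_ideal (R := R) (Set.range fun n => φ (ψ n) - n)
  obtain ⟨B, q, hq, hB⟩ := CommRingCat.exists_quotient (I ⊔ J)
  have hqI : I ≤ RingHom.ker q.hom := fun r hr => hq r (le_sup_left (a := I) hr)
  have hqJ : J ≤ RingHom.ker q.hom := fun r hr => hq r (le_sup_right (a := I) hr)
  obtain ⟨xB, hx⟩ : ∃ xB, Spec.map q ≫ x = xB := ⟨_, rfl⟩
  obtain ⟨yB, hy⟩ : ∃ yB, Spec.map q ≫ y = yB := ⟨_, rfl⟩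
  have hMq := hM.res_isExt q hx
  have hNq := hN.res_isExt q hy
  obtain ⟨φ₃, hφ₃⟩ := exists_extends hM φ hx hy
  obtain ⟨ψ₃, hψ₃⟩ := exists_extends hN ψ hy hx
  have h1 : ψ₃ ∘ₗ φ₃ = LinearMap.id := hMq.ext fun m => by
    have e1 := (hI B q.hom _ _ hMq).2 hqI _ ⟨m, rfl⟩
    rw [map_sub, sub_eq_zero] at e1
    exact (congrArg ψ₃ (hφ₃ m)).trans ((hψ₃ _).trans e1)
  have h2 : φ₃ ∘ₗ ψ₃ = LinearMap.id := hNq.ext fun n => by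
    have e1 := (hJ B q.hom _ _ hNq).2 hqJ _ ⟨n, rfl⟩
    rw [map_sub, sub_eq_zero] at e1
    exact (congrArg φ₃ (hψ₃ n)).trans ((hφ₃ _).trans e1)
  obtain ⟨u, rfl, rfl⟩ : ∃ u : (sectionsAt xB).obj M ≃ₗ[B] (sectionsAt yB).obj N,
    u.toLinearMap = φ₃ ∧ u.symm.toLinearMap = ψ₃ := ⟨LinearEquiv.ofLinear φ₃ ψ₃ h2 h1, rfl, rfl⟩
  refine ⟨B, q, xB, yB, hx, hy, u, hφ₃, hψ₃, fun {S} τ x' y' hx hy u' h h' => hB τ (sup_le ?_ ?_)⟩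
  · refine (hI S τ.hom _ _ (hM.res_isExt τ hx)).1 ?_
    rintro _ ⟨m, rfl⟩
    rw [map_sub, sub_eq_zero]
    have e1 := h' (φ m)
    rw [← h m] at e1
    exact e1.symm.trans (u'.symm_apply_apply _)
  · refine (hJ S τ.hom _ _ (hN.res_isExt τ hy)).1 ?_
    rintro _ ⟨n, rfl⟩
    rw [map_sub, sub_eq_zero]
    have e1 := h (ψ n)
    rw [← h' n] at e1
    exact e1.symm.trans (u'.apply_symm_apply _)

theorem Extends.symm {u : (sectionsAt x).obj M ≃ₗ[R] (sectionsAt y).obj N}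
    {u' : (sectionsAt x').obj M ≃ₗ[S] (sectionsAt y').obj N} (h : Extends σ hx hy u.toLinearMap u'.toLinearMap) :
    Extends σ hy hx u.symm.toLinearMap u'.symm.toLinearMap := fun n => by
  have e1 := h (u.symm n)
  rw [LinearEquiv.coe_coe, LinearEquiv.coe_coe, LinearEquiv.apply_symm_apply] at e1
  exact (LinearEquiv.symm_apply_eq u').2 e1.symm

/-- The functor of isomorphisms of vector bundles is representable over an affine scheme. -/
theorem IsVectorBundle.exists_iso_ring (hM : IsVectorBundle M) (hN : IsVectorBundle N) (x : Spec R ⟶ X)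
    (y : Spec R ⟶ Y) : ∃ (B : CommRingCat.{u}) (b : R ⟶ B)
    (xB : Spec B ⟶ X) (yB : Spec B ⟶ Y) (_ : Spec.map b ≫ x = xB) (_ : Spec.map b ≫ y = yB)
    (u : (sectionsAt xB).obj M ≃ₗ[B] (sectionsAt yB).obj N),
    ∀ (S : CommRingCat.{u}) (a : R ⟶ S) {x' : Spec S ⟶ X} {y' : Spec S ⟶ Y} (_ : Spec.map a ≫ x = x')
      (_ : Spec.map a ≫ y = y') (u' : (sectionsAt x').obj M ≃ₗ[S] (sectionsAt y').obj N),
      ∃! τ : B ⟶ S, b ≫ τ = a ∧ ∀ h h', Extends τ h h' u.toLinearMap u'.toLinearMap := by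
  obtain ⟨B₁, b₁, x₁, y₁, hx₁, hy₁, φ, hφ⟩ := hM.exists_hom_ring hN x y
  obtain ⟨B₂, b₂, y₂, x₂, hy₂, hx₂, ψ, hψ⟩ := hN.exists_hom_ring hM y₁ x₁
  obtain ⟨φ₂, hφ₂⟩ := exists_extends hM φ hx₂ hy₂
  obtain ⟨B, q, xB, yB, hxB, hyB, u, hu, hu', hq⟩ := hM.exists_inverse_ring hN φ₂ ψ
  refine ⟨B, b₁ ≫ b₂ ≫ q, xB, yB, ?_, ?_, u, fun S a x' y' hx hy u' => ?_⟩
  · rw [Spec.map_comp_assoc, Spec.map_comp_assoc, hx₁, hx₂, hxB]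
  · rw [Spec.map_comp_assoc, Spec.map_comp_assoc, hy₁, hy₂, hyB]
  obtain ⟨τ₁, ⟨rfl, hφ₁⟩, huniq₁⟩ := hφ S a hx hy u'.toLinearMap
  have hx' : Spec.map τ₁ ≫ x₁ = x' := by rw [← hx₁, ← Spec.map_comp_assoc, hx]
  have hy' : Spec.map τ₁ ≫ y₁ = y' := by rw [← hy₁, ← Spec.map_comp_assoc, hy]
  obtain ⟨τ₂, ⟨rfl, hψ₂⟩, huniq₂⟩ := hψ S τ₁ hy' hx' u'.symm.toLinearMap
  have hx₂' : Spec.map τ₂ ≫ x₂ = x' := by rw [← hx₂, ← Spec.map_comp_assoc, hx']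
  have hy₂' : Spec.map τ₂ ≫ y₂ = y' := by rw [← hy₂, ← Spec.map_comp_assoc, hy']
  have hφ₂' : Extends τ₂ hx₂' hy₂' φ₂ u'.toLinearMap := hφ₂.of_comp hM (hφ₁ hx' hy')
  obtain ⟨τ, rfl, huniq⟩ := hq τ₂ hx₂' hy₂' u' hφ₂' (hψ₂ _ _)
  refine ⟨τ, ⟨by simp, fun h h' => hu.of_comp hM hφ₂'⟩, fun τ' ⟨hτ', h₁⟩ => ?_⟩
  have hx₄ : Spec.map τ' ≫ xB = x' := by
    rw [← hxB, ← hx₂, ← hx₁, ← Spec.map_comp_assoc, ← Spec.map_comp_assoc, ← Spec.map_comp_assoc, ← hx, ← hτ']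
    simp only [Category.assoc]
  have hy₄ : Spec.map τ' ≫ yB = y' := by
    rw [← hyB, ← hy₂, ← hy₁, ← Spec.map_comp_assoc, ← Spec.map_comp_assoc, ← Spec.map_comp_assoc, ← hy, ← hτ']
    simp only [Category.assoc]
  have hx₅ : Spec.map (q ≫ τ') ≫ x₂ = x' := by rw [Spec.map_comp_assoc, hxB, hx₄]
  have hy₅ : Spec.map (q ≫ τ') ≫ y₂ = y' := by rw [Spec.map_comp_assoc, hyB, hy₄]
  have h5 : b₂ ≫ q ≫ τ' = b₂ ≫ q ≫ τ := huniq₁ _ ⟨by simpa using hτ', fun h h' =>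
    hφ₂.comp (hu.comp (h₁ hx₄ hy₄) hx₅ hy₅) h h'⟩
  exact huniq _ (huniq₂ _ ⟨h5, fun h h' => hu'.comp (h₁ hx₄ hy₄).symm h h'⟩)

end AlgebraicGeometry.Scheme.Modules

end

section

/-- The condition that elements lie in a direct summand is closed. -/
theorem IsSplitLine.exists_mem_ideal {R P : Type u} [CommRing R] [AddCommGroup P] [Module R P] [Module.Finite R P]
    [Module.Projective R P] {L : Submodule R P} (hL : IsSplitLine L) (s : Set P) : ∃ I : Ideal R,
    ∀ (S : Type u) [CommRing S] (a : R →+* S) (P' : Type u) [AddCommGroup P'] [Module S P'] (g : P →ₛₗ[a] P'),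
    IsExt g → ((∀ n ∈ s, g n ∈ Submodule.span S (g '' L)) ↔ I ≤ RingHom.ker a) := by
  obtain ⟨C, hC⟩ := hL.exists_isCompl
  let π : P →ₗ[R] P := C.subtype ∘ₗ C.projectionOnto L hC.symm
  have hπL (n) (hn : n ∈ L) : π n = 0 := by
    have : C.projectionOnto L hC.symm n = 0 := (Submodule.projectionOnto_apply_eq_zero_iff hC.symm).2 hn
    simp [π, this]
  have hπ (n) : n - π n ∈ L := by
    rw [← Submodule.projectionOnto_apply_eq_zero_iff hC.symm, map_sub, sub_eq_zero]
    exact (Submodule.projectionOnto_apply_left hC.symm _).symm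
  obtain ⟨I, hI⟩ := Module.exists_vanishing_ideal (R := R) (π '' s)
  refine ⟨I, fun S _ a P' _ _ g hg => ?_⟩
  rw [← hI S a P' g hg]
  constructor
  · rintro h _ ⟨n, hn, rfl⟩
    have h1 := hg.lift_apply (g.comp π)
    have h2 : Submodule.span S (g '' L) ≤ LinearMap.ker (hg.lift (g.comp π)) := by
      rw [Submodule.span_le]
      rintro _ ⟨l, hl, rfl⟩
      refine (h1 l).trans ?_
      rw [LinearMap.comp_apply, hπL l hl, map_zero]
    exact (h1 n).symm.trans (h2 (h n hn))
  · intro h n hn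
    have h1 := h _ ⟨n, hn, rfl⟩
    rw [← sub_add_cancel n (π n), map_add, h1, add_zero]
    exact Submodule.subset_span ⟨_, hπ n, rfl⟩

theorem SpansLine.exists_ideal {t : TensorialConstruction} {R : Type u} [CommRing R] {M N : ModuleCat.{u} R}
    [Module.Finite R M] [Module.Projective R M] [Module.Finite R N] [Module.Projective R N] (u : M ≃ₗ[R] N)
    {K : Submodule R (t.obj M)} {L : Submodule R (t.obj N)} (hK : IsSplitLine K) (hL : IsSplitLine L) :
    ∃ I : Ideal R, ∀ (S : Type u) [CommRing S] (a : R →+* S) (M' N' : ModuleCat.{u} S) (f : M →ₛₗ[a] M')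
      (g : N →ₛₗ[a] N') (K' : Submodule S (t.obj M')) (L' : Submodule S (t.obj N')) (u' : M' ≃ₗ[S] N'),
      IsExt f → IsExt g → SpansLine f K K' → SpansLine g L L' → (∀ m, u' (f m) = g (u m)) →
      (SpansLine u'.toLinearMap K' L' ↔ I ≤ RingHom.ker a) := by
  have := (t.finite_projective M).1
  have := (t.finite_projective M).2
  have := (t.finite_projective N).1
  have := (t.finite_projective N).2
  obtain ⟨I, hI⟩ := hL.exists_mem_ideal (t.map u.toLinearMap '' K)
  obtain ⟨J, hJ⟩ := hK.exists_mem_ideal (t.map u.symm.toLinearMap '' L)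
  refine ⟨I ⊔ J, fun S _ a M' N' f g K' L' u' hf hg hK' hL' h => ?_⟩
  have e1 (k) : t.map u'.toLinearMap (t.map f k) = t.map g (t.map u.toLinearMap k) :=
    (t.map_comp hf (.of_linearEquiv u') (g.comp u.toLinearMap) (fun _ => rfl) (fun m => (h m).symm) k).symm.trans
      (t.map_comp (.of_linearEquiv u) hg (g.comp u.toLinearMap) (fun _ => rfl) (fun _ => rfl) k)
  have h' (n) : u'.symm (g n) = f (u.symm n) := by
    rw [LinearEquiv.symm_apply_eq, h, LinearEquiv.apply_symm_apply]
  have e2 (l) : t.map u'.symm.toLinearMap (t.map g l) = t.map f (t.map u.symm.toLinearMap l) :=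
    (t.map_comp hg (.of_linearEquiv u'.symm) (f.comp u.symm.toLinearMap) (fun _ => rfl)
      (fun m => (h' m).symm) l).symm.trans
      (t.map_comp (.of_linearEquiv u.symm) hf (f.comp u.symm.toLinearMap) (fun _ => rfl) (fun _ => rfl) l)
  have hK'' : K' = Submodule.span S (t.map f '' K) := hK'
  have hL'' : L' = Submodule.span S (t.map g '' L) := hL'
  have h1 := hI S a _ _ (t.map_isExt hg)
  have h2 := hJ S a _ _ (t.map_isExt hf)
  rw [sup_le_iff, ← h1, ← h2, ← hK'', ← hL'']
  constructor
  · intro H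
    constructor
    · rintro _ ⟨k, hk, rfl⟩
      rw [← e1]
      exact H.mem (hK'.mem hk)
    · rintro _ ⟨l, hl, rfl⟩
      rw [← e2]
      exact H.symm.mem (hL'.mem hl)
  · rintro ⟨H1, H2⟩
    have h3 : K' ≤ L'.comap (t.map u'.toLinearMap) := by
      conv_lhs => rw [hK'']
      rw [Submodule.span_le]
      rintro _ ⟨k, hk, rfl⟩
      exact Submodule.mem_comap.2 ((e1 k).symm ▸ H1 _ ⟨k, hk, rfl⟩)
    have h4 : L' ≤ K'.comap (t.map u'.symm.toLinearMap) := by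
      conv_lhs => rw [hL'']
      rw [Submodule.span_le]
      rintro _ ⟨l, hl, rfl⟩
      exact Submodule.mem_comap.2 ((e2 l).symm ▸ H2 _ ⟨l, hl, rfl⟩)
    rw [SpansLine.linearEquiv_iff]
    refine le_antisymm (Submodule.map_le_iff_le_comap.2 h3) fun l hl => ⟨_, h4 hl, ?_⟩
    have h5 := t.map_functorial.2 u'.symm u'
    have h6 : u'.toLinearMap ∘ₗ u'.symm.toLinearMap = LinearMap.id := by ext; simp
    rw [h6, t.map_functorial.1] at h5
    exact (LinearMap.congr_fun h5 l).symm

namespace LinePair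
variable {X Y : Scheme.{u}} {t : TensorialConstruction} {R S : CommRingCat.{u}}

/-- The functor of isomorphisms of pairs is representable over an affine scheme. -/
theorem exists_iso_ring (V : LinePair t X) (D : LinePair t Y) (x : Spec R ⟶ X) (y : Spec R ⟶ Y) :
    ∃ (B : CommRingCat.{u}) (b : R ⟶ B) (xB : Spec B ⟶ X) (yB : Spec B ⟶ Y) (_ : Spec.map b ≫ x = xB)
    (_ : Spec.map b ≫ y = yB) (u : (sectionsAt xB).obj V.bundle ≃ₗ[B] (sectionsAt yB).obj D.bundle),
    SpansLine u.toLinearMap (V.line B xB) (D.line B yB) ∧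
    ∀ (S : CommRingCat.{u}) (a : R ⟶ S) {x' : Spec S ⟶ X} {y' : Spec S ⟶ Y} (_ : Spec.map a ≫ x = x')
      (_ : Spec.map a ≫ y = y') (u' : (sectionsAt x').obj V.bundle ≃ₗ[S] (sectionsAt y').obj D.bundle),
      SpansLine u'.toLinearMap (V.line S x') (D.line S y') →
      ∃! τ : B ⟶ S, b ≫ τ = a ∧ ∀ h h', Extends τ h h' u.toLinearMap u'.toLinearMap := by
  have hV := V.isVectorBundle
  have hD := D.isVectorBundle
  obtain ⟨B₁, b, x₁, y₁, hx₁, hy₁, u₁, H⟩ := hV.exists_iso_ring hD x y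
  obtain ⟨I, hI⟩ := SpansLine.exists_ideal u₁ (V.isSplitLine x₁) (D.isSplitLine y₁)
  obtain ⟨B, q, hq, hB⟩ := CommRingCat.exists_quotient I
  have hI' {S : CommRingCat.{u}} (τ : B₁ ⟶ S) {x' : Spec S ⟶ X} {y' : Spec S ⟶ Y} (hx : Spec.map τ ≫ x₁ = x')
      (hy : Spec.map τ ≫ y₁ = y') (u' : (sectionsAt x').obj V.bundle ≃ₗ[S] (sectionsAt y').obj D.bundle)
      (hu' : Extends τ hx hy u₁.toLinearMap u'.toLinearMap) :
      SpansLine u'.toLinearMap (V.line S x') (D.line S y') ↔ I ≤ RingHom.ker τ.hom :=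
    hI S τ.hom _ _ _ _ _ _ u' (hV.res_isExt τ hx) (hD.res_isExt τ hy) (V.spansLine_res τ hx) (D.spansLine_res τ hy) hu'
  obtain ⟨xB, hxB⟩ : ∃ xB, Spec.map q ≫ x₁ = xB := ⟨_, rfl⟩
  obtain ⟨yB, hyB⟩ : ∃ yB, Spec.map q ≫ y₁ = yB := ⟨_, rfl⟩
  have h1 := hV.res_isExt q hxB
  have h3 : IsExt ((res D.bundle q hyB).comp u₁.toLinearMap) :=
    (IsExt.of_linearEquiv u₁).comp (hD.res_isExt q hyB) _ (fun _ => rfl) (fun _ => rfl)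
  obtain ⟨u, hu⟩ : ∃ u : (sectionsAt xB).obj V.bundle ≃ₗ[B] (sectionsAt yB).obj D.bundle,
    Extends q hxB hyB u₁.toLinearMap u.toLinearMap := ⟨h1.equiv h3, h1.equiv_apply h3⟩
  refine ⟨B, b ≫ q, xB, yB, ?_, ?_, u, (hI' q hxB hyB u hu).2 hq, fun S a x' y' hx hy u' hu' => ?_⟩
  · rw [Spec.map_comp_assoc, hx₁, hxB]
  · rw [Spec.map_comp_assoc, hy₁, hyB]
  obtain ⟨τ₁, ⟨rfl, h₁⟩, huniq₁⟩ := H S a hx hy u'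
  have hx' : Spec.map τ₁ ≫ x₁ = x' := by rw [← hx₁, ← Spec.map_comp_assoc, hx]
  have hy' : Spec.map τ₁ ≫ y₁ = y' := by rw [← hy₁, ← Spec.map_comp_assoc, hy]
  obtain ⟨τ, rfl, huniq⟩ := hB τ₁ ((hI' τ₁ hx' hy' u' (h₁ _ _)).1 hu')
  refine ⟨τ, ⟨Category.assoc _ _ _, fun h h' => hu.of_comp hV (h₁ hx' hy')⟩, fun τ' ⟨hτ', h₂⟩ => huniq _ ?_⟩
  refine huniq₁ _ ⟨(Category.assoc _ _ _).symm.trans hτ', fun h h' => hu.comp (h₂ ?_ ?_) h h'⟩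
  · rw [← hxB, ← Spec.map_comp_assoc, h]
  · rw [← hyB, ← Spec.map_comp_assoc, h']

end LinePair

end

section

theorem AlgebraicGeometry.Scheme.isPullback_of_points {P Y Z T : Scheme.{u}} {p : P ⟶ Y} {q : P ⟶ Z} {f : Y ⟶ T}
    {g : Z ⟶ T} (w : p ≫ f = q ≫ g) (h : ∀ {R : CommRingCat.{u}} (y : Spec R ⟶ Y) (z : Spec R ⟶ Z),
      y ≫ f = z ≫ g → ∃! c : Spec R ⟶ P, c ≫ p = y ∧ c ≫ q = z) : IsPullback p q f g := by
  have : IsIso (Limits.pullback.lift p q w) := isIso_of_points _ fun R => by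
    have h1 (c : Spec R ⟶ P) : (c ≫ Limits.pullback.lift p q w) ≫ Limits.pullback.fst f g = c ≫ p := by
      rw [Category.assoc, Limits.pullback.lift_fst]
    have h2 (c : Spec R ⟶ P) : (c ≫ Limits.pullback.lift p q w) ≫ Limits.pullback.snd f g = c ≫ q := by
      rw [Category.assoc, Limits.pullback.lift_snd]
    refine ⟨fun c c' hc => ?_, fun c => ?_⟩
    · have hc : c ≫ Limits.pullback.lift p q w = c' ≫ Limits.pullback.lift p q w := hc
      refine (h (c' ≫ p) (c' ≫ q) (by rw [Category.assoc, w, Category.assoc])).unique ⟨?_, ?_⟩ ⟨rfl, rfl⟩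
      · rw [← h1, hc, h1]
      · rw [← h2, hc, h2]
    · obtain ⟨c', ⟨h3, h4⟩, -⟩ := h (c ≫ Limits.pullback.fst f g) (c ≫ Limits.pullback.snd f g)
        (by rw [Category.assoc, Limits.pullback.condition, Category.assoc])
      exact ⟨c', Limits.pullback.hom_ext ((h1 c').trans h3) ((h2 c').trans h4)⟩
  exact IsPullback.of_iso_pullback ⟨w⟩ (asIso (Limits.pullback.lift p q w))
    (Limits.pullback.lift_fst _ _ _) (Limits.pullback.lift_snd _ _ _)

namespace LinePair
variable {X Y T Z Z' : Scheme.{u}} {t : TensorialConstruction} {R S : CommRingCat.{u}}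

/-- An isomorphism from the pullback of `V` along `a` to the pullback of `D` along `d`, given by its values
at all points. -/
structure IsoFamily (V : LinePair t X) (D : LinePair t Y) {Z : Scheme.{u}} (a : Z ⟶ X) (d : Z ⟶ Y) where
  u {R : CommRingCat.{u}} (z : Spec R ⟶ Z) (x : Spec R ⟶ X) (y : Spec R ⟶ Y) (hx : z ≫ a = x) (hy : z ≫ d = y) :
    (sectionsAt x).obj V.bundle ≃ₗ[R] (sectionsAt y).obj D.bundle
  natural {R S : CommRingCat.{u}} (σ : R ⟶ S) {z : Spec R ⟶ Z} {x : Spec R ⟶ X} {y : Spec R ⟶ Y} (hx : z ≫ a = x)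
    (hy : z ≫ d = y) {z' : Spec S ⟶ Z} {x' : Spec S ⟶ X} {y' : Spec S ⟶ Y} (hx' : z' ≫ a = x') (hy' : z' ≫ d = y')
    (hz : Spec.map σ ≫ z = z') (hxx : Spec.map σ ≫ x = x') (hyy : Spec.map σ ≫ y = y') :
    Extends σ hxx hyy (u z x y hx hy).toLinearMap (u z' x' y' hx' hy').toLinearMap
  spansLine {R : CommRingCat.{u}} (z : Spec R ⟶ Z) (x : Spec R ⟶ X) (y : Spec R ⟶ Y) (hx : z ≫ a = x)
    (hy : z ≫ d = y) : SpansLine (u z x y hx hy).toLinearMap (V.line R x) (D.line R y)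

variable {V : LinePair t X} {D : LinePair t Y}

/-- The pullback of a family of isomorphisms. -/
def IsoFamily.comp {a : Z ⟶ X} {d : Z ⟶ Y} (F : IsoFamily V D a d) (m : Z' ⟶ Z) {a' : Z' ⟶ X} {d' : Z' ⟶ Y}
    (ha : m ≫ a = a') (hd : m ≫ d = d') : IsoFamily V D a' d' where
  u z x y hx hy := F.u (z ≫ m) x y (by rw [Category.assoc, ha, hx]) (by rw [Category.assoc, hd, hy])
  natural {R S} σ {z x y} hx hy {z' x' y'} hx' hy' hz hxx hyy :=
    F.natural σ _ _ _ _ (by rw [← Category.assoc, hz]) hxx hyy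
  spansLine z x y hx hy := F.spansLine _ _ _ _ _

theorem exists_isoFamily {x : Spec R ⟶ X} {y : Spec R ⟶ Y}
    (w : (sectionsAt x).obj V.bundle ≃ₗ[R] (sectionsAt y).obj D.bundle)
    (hw : SpansLine w.toLinearMap (V.line R x) (D.line R y)) :
    ∃ F : IsoFamily V D x y, ∀ {S : CommRingCat.{u}} (σ : R ⟶ S) {x' : Spec S ⟶ X} {y' : Spec S ⟶ Y}
      (hx : Spec.map σ ≫ x = x') (hy : Spec.map σ ≫ y = y'),
      Extends σ hx hy w.toLinearMap (F.u (Spec.map σ) x' y' hx hy).toLinearMap := by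
  have key {S : CommRingCat.{u}} (z : Spec S ⟶ Spec R) (x' : Spec S ⟶ X) (y' : Spec S ⟶ Y) (hx : z ≫ x = x')
      (hy : z ≫ y = y') : ∃ w' : (sectionsAt x').obj V.bundle ≃ₗ[S] (sectionsAt y').obj D.bundle,
      SpansLine w'.toLinearMap (V.line S x') (D.line S y') ∧ ∀ σ hx hy, Spec.map σ = z →
        Extends σ hx hy w.toLinearMap w'.toLinearMap := by
    obtain ⟨σ, rfl⟩ := Spec.map_surjective z
    obtain ⟨w', h1, h2⟩ := V.exists_baseChange D σ hx hy w hw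
    refine ⟨w', h1, fun σ' hx hy hσ => ?_⟩
    obtain rfl := Spec.map_injective hσ
    exact h2
  choose u hu hu' using @key
  refine ⟨⟨u, fun {R' S} σ {z x₁ y₁} hx hy {z' x' y'} hx' hy' hz hxx hyy => ?_, hu⟩,
    fun σ x' y' hx hy => hu' _ _ _ _ _ σ hx hy rfl⟩
  obtain ⟨α, rfl⟩ := Spec.map_surjective z
  have hz' : Spec.map (α ≫ σ) = z' := by rw [Spec.map_comp, hz]
  exact (hu' _ _ _ hx hy α hx hy rfl).of_comp V.isVectorBundle
    (hu' _ _ _ hx' hy' (α ≫ σ) (by rw [hz', hx']) (by rw [hz', hy']) hz')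

/-- The scheme of isomorphisms from the pullback of `V` along `a` to the pullback of `D` along `d`. -/
structure IsoSpace (V : LinePair t X) (D : LinePair t Y) {T : Scheme.{u}} (a : T ⟶ X) (d : T ⟶ Y) where
  total : Scheme.{u}
  proj : total ⟶ T
  fam : IsoFamily V D (proj ≫ a) (proj ≫ d)
  universal {R : CommRingCat.{u}} (s : Spec R ⟶ T) {x : Spec R ⟶ X} {y : Spec R ⟶ Y} (hx : s ≫ a = x)
    (hy : s ≫ d = y) (w : (sectionsAt x).obj V.bundle ≃ₗ[R] (sectionsAt y).obj D.bundle)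
    (hw : SpansLine w.toLinearMap (V.line R x) (D.line R y)) :
    ∃! z : Spec R ⟶ total, z ≫ proj = s ∧ ∀ hx hy, fam.u z x y hx hy = w

namespace IsoSpace
variable {a : T ⟶ X} {d : T ⟶ Y} (I : IsoSpace V D a d)

theorem point_ext {z z' : Spec R ⟶ I.total} {s : Spec R ⟶ T} (h : z ≫ I.proj = s) (h' : z' ≫ I.proj = s)
    {x : Spec R ⟶ X} {y : Spec R ⟶ Y} {hx : z ≫ I.proj ≫ a = x} {hy : z ≫ I.proj ≫ d = y}
    {hx' : z' ≫ I.proj ≫ a = x} {hy' : z' ≫ I.proj ≫ d = y} (H : I.fam.u z x y hx hy = I.fam.u z' x y hx' hy') :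
    z = z' :=
  (I.universal s (by rw [← h, Category.assoc, hx]) (by rw [← h, Category.assoc, hy]) (I.fam.u z x y hx hy)
    (I.fam.spansLine _ _ _ _ _)).unique ⟨h, fun _ _ => rfl⟩ ⟨h', fun _ _ => H.symm⟩

theorem hom_ext {f f' : Z ⟶ I.total} (h : f ≫ I.proj = f' ≫ I.proj)
    (H : ∀ {R : CommRingCat.{u}} (z : Spec R ⟶ Z) (x y hx hy hx' hy'),
      I.fam.u (z ≫ f) x y hx hy = I.fam.u (z ≫ f') x y hx' hy') : f = f' :=
  hom_ext_points fun z => I.point_ext (s := z ≫ f' ≫ I.proj) (by rw [Category.assoc, h]) (Category.assoc _ _ _)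
    (H z (z ≫ f' ≫ I.proj ≫ a) (z ≫ f' ≫ I.proj ≫ d)
      (by simp only [Category.assoc]; rw [← Category.assoc f, h, Category.assoc])
      (by simp only [Category.assoc]; rw [← Category.assoc f, h, Category.assoc]) (by simp) (by simp))

theorem exists_lift (f : Z ⟶ T) {a' : Z ⟶ X} {d' : Z ⟶ Y} (ha : f ≫ a = a') (hd : f ≫ d = d')
    (F : IsoFamily V D a' d') : ∃ m : Z ⟶ I.total, m ≫ I.proj = f ∧
      ∀ {R : CommRingCat.{u}} (z : Spec R ⟶ Z) (x y hx hy hx' hy'), I.fam.u (z ≫ m) x y hx hy = F.u z x y hx' hy' := by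
  have key {R : CommRingCat.{u}} (z : Spec R ⟶ Z) := I.universal (z ≫ f) (x := z ≫ a') (y := z ≫ d')
    (by rw [Category.assoc, ha]) (by rw [Category.assoc, hd]) (F.u z _ _ rfl rfl) (F.spansLine _ _ _ _ _)
  obtain ⟨m, hm⟩ := exists_hom_of_points (fun {R} (z : Spec R ⟶ Z) => (key z).choose) fun {R S} σ z => by
    have h1 := (key z).choose_spec.1
    have h2 := (key (Spec.map σ ≫ z)).choose_spec.1
    generalize (key z).choose = c at h1
    generalize (key (Spec.map σ ≫ z)).choose = c' at h2
    have hx : c ≫ I.proj ≫ a = z ≫ a' := by rw [← Category.assoc, h1.1, Category.assoc, ha]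
    have hy : c ≫ I.proj ≫ d = z ≫ d' := by rw [← Category.assoc, h1.1, Category.assoc, hd]
    have hx' : c' ≫ I.proj ≫ a = (Spec.map σ ≫ z) ≫ a' := by rw [← Category.assoc, h2.1, Category.assoc, ha]
    have hy' : c' ≫ I.proj ≫ d = (Spec.map σ ≫ z) ≫ d' := by rw [← Category.assoc, h2.1, Category.assoc, hd]
    have hx'' : (Spec.map σ ≫ c) ≫ I.proj ≫ a = (Spec.map σ ≫ z) ≫ a' := by
      rw [Category.assoc, hx, Category.assoc]
    have hy'' : (Spec.map σ ≫ c) ≫ I.proj ≫ d = (Spec.map σ ≫ z) ≫ d' := by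
      rw [Category.assoc, hy, Category.assoc]
    refine I.point_ext h2.1 (by rw [Category.assoc, h1.1, Category.assoc]) (hx := hx') (hy := hy') (hx' := hx'')
      (hy' := hy'') ?_
    rw [h2.2]
    have e1 := F.natural σ rfl rfl rfl rfl rfl (Category.assoc _ _ _).symm (Category.assoc _ _ _).symm (z := z)
    have e2 := I.fam.natural σ hx hy hx'' hy'' rfl (Category.assoc _ _ _).symm (Category.assoc _ _ _).symm
    rw [h1.2] at e2
    exact LinearEquiv.toLinearMap_injective (e1.unique V.isVectorBundle e2)
  refine ⟨m, hom_ext_points fun z => ?_, fun {R} z x y hx hy hx' hy' => ?_⟩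
  · rw [← Category.assoc, hm]
    exact (key z).choose_spec.1.1
  · subst hx' hy'
    revert hx hy
    rw [hm]
    exact (key z).choose_spec.1.2

theorem nonempty_of_isAffine [IsAffine T] (V : LinePair t X) (D : LinePair t Y) (a : T ⟶ X) (d : T ⟶ Y) :
    ∃ I : IsoSpace V D a d, IsAffine I.total := by
  obtain ⟨B, b, x₀, y₀, hx₀, hy₀, w, hw, H⟩ := V.exists_iso_ring D (T.isoSpec.inv ≫ a) (T.isoSpec.inv ≫ d)
  obtain ⟨F, hF⟩ := exists_isoFamily w hw
  let p : Spec B ⟶ T := Spec.map b ≫ T.isoSpec.inv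
  have ha : p ≫ a = x₀ := (Category.assoc _ _ _).trans hx₀
  have hd : p ≫ d = y₀ := (Category.assoc _ _ _).trans hy₀
  refine ⟨⟨Spec B, p, F.comp (𝟙 _) (by rw [Category.id_comp, ha]) (by rw [Category.id_comp, hd]),
    fun {R} s x y hx hy w' hw' => ?_⟩, isAffine_Spec B⟩
  obtain ⟨α, hα⟩ := Spec.map_surjective (s ≫ T.isoSpec.hom)
  have hs : Spec.map α ≫ T.isoSpec.inv = s := by rw [hα, Category.assoc, Iso.hom_inv_id, Category.comp_id]
  have key (τ : B ⟶ R) : Spec.map τ ≫ p = s ↔ b ≫ τ = α := by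
    rw [← hs]
    refine ⟨fun h => Spec.map_injective ((cancel_mono T.isoSpec.inv).1 ?_), fun h => ?_⟩
    · rw [Spec.map_comp, Category.assoc]; exact h
    · rw [← h, Spec.map_comp, Category.assoc]
  have hx' : Spec.map α ≫ T.isoSpec.inv ≫ a = x := by rw [← Category.assoc, hs, hx]
  have hy' : Spec.map α ≫ T.isoSpec.inv ≫ d = y := by rw [← Category.assoc, hs, hy]
  obtain ⟨τ, ⟨h1, h2⟩, h3⟩ := H R α hx' hy' w' hw'
  refine ⟨Spec.map τ, ⟨(key τ).2 h1, fun h4 h5 => ?_⟩, fun z ⟨h4, h5⟩ => ?_⟩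
  · have h6 : Spec.map τ ≫ x₀ = x := by rw [← ha]; exact h4
    have h7 : Spec.map τ ≫ y₀ = y := by rw [← hd]; exact h5
    have h8 := hF τ h6 h7
    have h9 : (F.comp (𝟙 (Spec B)) (by rw [Category.id_comp, ha]) (by rw [Category.id_comp, hd]) :
      IsoFamily V D (p ≫ a) (p ≫ d)).u (Spec.map τ) x y h4 h5 = F.u (Spec.map τ) x y h6 h7 := by
      change F.u (Spec.map τ ≫ 𝟙 _) x y _ _ = _
      simp only [Category.comp_id]
    rw [h9]
    exact LinearEquiv.toLinearMap_injective (h8.unique V.isVectorBundle (h2 h6 h7))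
  · obtain ⟨τ', rfl⟩ := Spec.map_surjective z
    refine congrArg Spec.map (h3 τ' ⟨(key τ').1 h4, fun h6 h7 => ?_⟩)
    have h8 := hF τ' h6 h7
    have h10 := h5 (by rw [ha, h6]) (by rw [hd, h7])
    change F.u (Spec.map τ' ≫ 𝟙 _) x y _ _ = _ at h10
    simp only [Category.comp_id] at h10
    rwa [h10] at h8

end IsoSpace
end LinePair

end

section

namespace LinePair.IsoFamily
variable {X Y Z Z' : Scheme.{u}} {t : TensorialConstruction} {R S : CommRingCat.{u}} {V : LinePair t X}
  {D : LinePair t Y} {a : Z ⟶ X} {d : Z ⟶ Y}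

theorem congr (F : IsoFamily V D a d) {z z' : Spec R ⟶ Z} (h : z = z') {x : Spec R ⟶ X} {y : Spec R ⟶ Y} (hx hy hx' hy') :
    F.u z x y hx hy = F.u z' x y hx' hy' := by
  subst h
  rfl

/-- The family of values of an isomorphism of bundles. -/
def ofIso (φ : (Modules.pullback a).obj V.bundle ≅ (Modules.pullback d).obj D.bundle)
    (hφ : SubFamily.Preserves φ (V.line.pullback a) (D.line.pullback d)) : IsoFamily V D a d where
  u z x y hx hy := ((pullAt a V.bundle z hx).symm.trans ((sectionsAt z).mapIso φ).toLinearEquiv).trans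
    (pullAt d D.bundle z hy)
  natural {R S} σ {z x y} hx hy {z' x' y'} hx' hy' hz hxx hyy m := by
    obtain ⟨n, rfl⟩ := (pullAt a V.bundle z hx).surjective m
    have e1 := pullAt_res a V.bundle hx hx' σ hz hxx n
    have e2 := res_naturality φ.hom σ hz n
    have e3 := pullAt_res d D.bundle hy hy' σ hz hyy ((sectionsAt z).map φ.hom n)
    have e4 : (pullAt a V.bundle z' hx').symm (res V.bundle σ hxx (pullAt a V.bundle z hx n)) = res _ σ hz n :=
      (LinearEquiv.symm_apply_eq _).2 e1.symm
    have e5 : (pullAt a V.bundle z hx).symm (pullAt a V.bundle z hx n) = n := LinearEquiv.symm_apply_apply _ _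
    refine (congrArg (fun k => pullAt d D.bundle z' hy' ((sectionsAt z').map φ.hom k)) e4).trans ?_
    refine (congrArg (pullAt d D.bundle z' hy') e2).trans (e3.trans ?_)
    exact congrArg (fun k => res D.bundle σ hyy (pullAt d D.bundle z hy ((sectionsAt z).map φ.hom k))) e5.symm
  spansLine z x y hx hy := by
    have h1 := (pullAt_spansLine a V.line z hx).symm
    have h2 : SpansLine ((sectionsAt z).mapIso φ).toLinearEquiv.toLinearMap
      (V.line.pullback a _ z) (D.line.pullback d _ z) := (SpansLine.linearEquiv_iff _).2 (hφ _ _)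
    have h3 := pullAt_spansLine d D.line z hy
    exact (h1.linearEquiv_trans h2).linearEquiv_trans h3

theorem ofIso_apply (φ : (Modules.pullback a).obj V.bundle ≅ (Modules.pullback d).obj D.bundle)
    (hφ : SubFamily.Preserves φ (V.line.pullback a) (D.line.pullback d)) (z : Spec R ⟶ Z) {x : Spec R ⟶ X}
    {y : Spec R ⟶ Y} (hx hy) (m) : (ofIso φ hφ).u z x y hx hy (pullAt a V.bundle z hx m) =
      pullAt d D.bundle z hy ((sectionsAt z).map φ.hom m) :=
  congrArg (fun k => pullAt d D.bundle z hy ((sectionsAt z).map φ.hom k)) (LinearEquiv.symm_apply_apply _ _)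

theorem ext_of_cover {a' : Z' ⟶ X} {d' : Z' ⟶ Y} (F : IsoFamily V D a d) (F' : IsoFamily V D a' d')
    (z : Spec R ⟶ Z) (z' : Spec R ⟶ Z') {x : Spec R ⟶ X} {y : Spec R ⟶ Y} (hx hy hx' hy')
    (h : ∃ (ι : Type u) (S : ι → CommRingCat.{u}) (σ : ∀ i, R ⟶ S i), IsFlatCover (fun i => (σ i).hom) ∧
      ∀ i x' y' h1 h2 h3 h4, F.u (Spec.map (σ i) ≫ z) x' y' h1 h2 = F'.u (Spec.map (σ i) ≫ z') x' y' h3 h4) :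
    F.u z x y hx hy = F'.u z' x y hx' hy' := by
  obtain ⟨ι, S, σ, hσ, h⟩ := h
  refine LinearEquiv.ext fun m => D.isVectorBundle.ext_of_cover hσ (fun _ => rfl) fun i => ?_
  have h1 : (Spec.map (σ i) ≫ z) ≫ a = Spec.map (σ i) ≫ x := by rw [Category.assoc, hx]
  have h2 : (Spec.map (σ i) ≫ z) ≫ d = Spec.map (σ i) ≫ y := by rw [Category.assoc, hy]
  have h3 : (Spec.map (σ i) ≫ z') ≫ a' = Spec.map (σ i) ≫ x := by rw [Category.assoc, hx']
  have h4 : (Spec.map (σ i) ≫ z') ≫ d' = Spec.map (σ i) ≫ y := by rw [Category.assoc, hy']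
  have e1 := F.natural (σ i) hx hy h1 h2 rfl rfl rfl m
  have e2 := F'.natural (σ i) hx' hy' h3 h4 rfl rfl rfl m
  have e3 := LinearEquiv.congr_fun (h i _ _ h1 h2 h3 h4) (res _ (σ i) rfl m)
  exact e1.symm.trans (e3.trans e2)

/-- Families of isomorphisms satisfy descent. -/
theorem exists_of_cover {J : Type*} {W : J → Scheme.{u}} (c : ∀ j, W j ⟶ Z) {a' : ∀ j, W j ⟶ X}
    {d' : ∀ j, W j ⟶ Y} (ha : ∀ j, c j ≫ a = a' j) (hd : ∀ j, c j ≫ d = d' j)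
    (F : ∀ j, IsoFamily V D (a' j) (d' j))
    (hF : ∀ {R : CommRingCat.{u}} (i j) (z : Spec R ⟶ W i) (z' : Spec R ⟶ W j), z ≫ c i = z' ≫ c j →
      ∀ x y hx hy hx' hy', (F i).u z x y hx hy = (F j).u z' x y hx' hy')
    (hcov : ∀ {R : CommRingCat.{u}} (z : Spec R ⟶ Z), ∃ (ι : Type u) (S : ι → CommRingCat.{u})
      (σ : ∀ i, R ⟶ S i), IsFlatCover (fun i => (σ i).hom) ∧ ∀ i, ∃ j z', z' ≫ c j = Spec.map (σ i) ≫ z) :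
    ∃ E : IsoFamily V D a d, ∀ {R : CommRingCat.{u}} (j) (z : Spec R ⟶ W j) (x y hx hy hx' hy'),
      E.u (z ≫ c j) x y hx hy = (F j).u z x y hx' hy' := by
  have hza {R : CommRingCat.{u}} {j} {z' : Spec R ⟶ W j} {z : Spec R ⟶ Z} (h : z' ≫ c j = z) :
      z' ≫ a' j = z ≫ a := by rw [← ha, ← h, Category.assoc]
  have hzd {R : CommRingCat.{u}} {j} {z' : Spec R ⟶ W j} {z : Spec R ⟶ Z} (h : z' ≫ c j = z) :
      z' ≫ d' j = z ≫ d := by rw [← hd, ← h, Category.assoc]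
  let w {R : CommRingCat.{u}} (j) (z' : Spec R ⟶ W j) (z : Spec R ⟶ Z) (h : z' ≫ c j = z) :
      (sectionsAt z).obj ((Modules.pullback a).obj V.bundle) ≃ₗ[R]
        (sectionsAt z).obj ((Modules.pullback d).obj D.bundle) :=
    ((pullAt a V.bundle z rfl).trans ((F j).u z' _ _ (hza h) (hzd h))).trans (pullAt d D.bundle z rfl).symm
  have hw {R : CommRingCat.{u}} (j) (z' : Spec R ⟶ W j) (z : Spec R ⟶ Z) (h : z' ≫ c j = z) (m) :
      pullAt d D.bundle z rfl (w j z' z h m) = (F j).u z' _ _ (hza h) (hzd h) (pullAt a V.bundle z rfl m) :=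
    LinearEquiv.apply_symm_apply _ _
  obtain ⟨φ, hφ, h⟩ := (V.pullback a).exists_iso_of_cover (D.pullback d)
    (fun {R} z f => ∃ j z' h, f = w j z' z h)
    (fun z f f' ⟨i, z₁, h₁, hf⟩ ⟨j, z₂, h₂, hf'⟩ => by
      rw [hf, hf']
      refine LinearEquiv.ext fun m => (pullAt d D.bundle z rfl).injective ?_
      have e1 := LinearEquiv.congr_fun (hF i j z₁ z₂ (h₁.trans h₂.symm) _ _ (hza h₁) (hzd h₁) (hza h₂) (hzd h₂))
        (pullAt a V.bundle z rfl m)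
      exact (hw i z₁ z h₁ m).trans (e1.trans (hw j z₂ z h₂ m).symm))
    (fun {R S} z z' σ hz f ⟨j, z₁, h₁, hf⟩ => by
      have h₂ : (Spec.map σ ≫ z₁) ≫ c j = z' := by rw [Category.assoc, h₁, hz]
      refine ⟨_, ⟨j, _, h₂, rfl⟩, fun m => (pullAt d D.bundle z' rfl).injective ?_⟩
      have hxx : Spec.map σ ≫ z ≫ a = z' ≫ a := by rw [← hz, Category.assoc]
      have hyy : Spec.map σ ≫ z ≫ d = z' ≫ d := by rw [← hz, Category.assoc]
      have e1 := hw j _ z' h₂ (res _ σ hz m)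
      have e2 := pullAt_res a V.bundle rfl rfl σ hz hxx m
      have e3 := (F j).natural σ (hza h₁) (hzd h₁) (hza h₂) (hzd h₂) rfl hxx hyy (pullAt a V.bundle z rfl m)
      have e4 := pullAt_res d D.bundle rfl rfl σ hz hyy (f m)
      have e5 := hw j z₁ z h₁ m
      rw [← hf] at e5
      exact e1.trans ((congrArg _ e2).trans (e3.trans ((congrArg _ e5.symm).trans e4.symm))))
    (fun {R} z f ⟨j, z₁, h₁, hf⟩ => by
      rw [hf]
      have h1 := pullAt_spansLine a V.line z rfl
      have h2 := (F j).spansLine z₁ _ _ (hza h₁) (hzd h₁)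
      have h3 := (pullAt_spansLine d D.line z rfl).symm
      have hfin := (V.isVectorBundle.pullback a).finite_projective z
      have := hfin.1
      have := hfin.2
      exact (h1.linearEquiv_trans h2).linearEquiv_trans h3)
    (fun {R} z => by
      obtain ⟨ι, S, σ, hσ, h⟩ := hcov z
      exact ⟨ι, S, σ, hσ, fun i => ⟨_, (h i).choose, (h i).choose_spec.choose, (h i).choose_spec.choose_spec, rfl⟩⟩)
  refine ⟨ofIso φ hφ, fun {R} j z x y hx hy hx' hy' => LinearEquiv.ext fun m => ?_⟩
  obtain ⟨n, rfl⟩ := (pullAt a V.bundle (z ≫ c j) hx).surjective m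
  subst hx hy
  have e1 := ofIso_apply φ hφ (z ≫ c j) rfl rfl n
  have e2 := h (z ≫ c j) _ ⟨j, z, rfl, rfl⟩ n
  exact e1.trans ((congrArg _ e2).trans (hw j z _ rfl n))

end LinePair.IsoFamily

end

section

theorem AlgebraicGeometry.Scheme.Cover.RelativeGluingData.exists_isPullback {T : Scheme.{u}} {𝒰 : T.OpenCover}
    [Category 𝒰.I₀] [𝒰.LocallyDirected] [Small.{u} 𝒰.I₀] [Quiver.IsThin 𝒰.I₀] (δ : 𝒰.RelativeGluingData) :
    ∃ (P : Scheme.{u}) (q : P ⟶ T) (c : ∀ i, δ.functor.obj i ⟶ P),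
      (∀ i, IsPullback (c i) (δ.natTrans.app i) q (𝒰.f i)) ∧ ∀ {i j} (h : i ⟶ j), δ.functor.map h ≫ c j = c i :=
  ⟨δ.glued, δ.toBase, Limits.colimit.ι δ.functor, fun i => (δ.isPullback_natTrans_ι_toBase i).flip,
    fun h => Limits.colimit.w δ.functor h⟩

namespace LinePair.IsoSpace
variable {X Y T T' Z : Scheme.{u}} {t : TensorialConstruction} {R S : CommRingCat.{u}} {V : LinePair t X}
  {D : LinePair t Y} {a : T ⟶ X} {d : T ⟶ Y}

theorem exists_map (I : IsoSpace V D a d) {a' : T' ⟶ X} {d' : T' ⟶ Y} (I' : IsoSpace V D a' d') (m : T' ⟶ T)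
    (ha : m ≫ a = a') (hd : m ≫ d = d') : ∃ f : I'.total ⟶ I.total, IsPullback f I'.proj I.proj m ∧
      ∀ {R : CommRingCat.{u}} (z : Spec R ⟶ I'.total) (x y hx hy hx' hy'),
        I.fam.u (z ≫ f) x y hx hy = I'.fam.u z x y hx' hy' := by
  obtain ⟨f, hf, hu⟩ := I.exists_lift (I'.proj ≫ m) (by rw [Category.assoc, ha]) (by rw [Category.assoc, hd]) I'.fam
  refine ⟨f, isPullback_of_points hf fun {R} z s hzs => ?_, hu⟩
  have hx : s ≫ a' = z ≫ I.proj ≫ a := by rw [← ha, ← Category.assoc, ← hzs, Category.assoc]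
  have hy : s ≫ d' = z ≫ I.proj ≫ d := by rw [← hd, ← Category.assoc, ← hzs, Category.assoc]
  obtain ⟨c, ⟨h1, h2⟩, h3⟩ := I'.universal s hx hy (I.fam.u z _ _ rfl rfl) (I.fam.spansLine _ _ _ _ _)
  have hcx : c ≫ I'.proj ≫ a' = z ≫ I.proj ≫ a := by rw [← Category.assoc, h1, hx]
  have hcy : c ≫ I'.proj ≫ d' = z ≫ I.proj ≫ d := by rw [← Category.assoc, h1, hy]
  have hc : (c ≫ f) ≫ I.proj = z ≫ I.proj := by rw [Category.assoc, hf, ← Category.assoc, h1, hzs]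
  have hfx : (c ≫ f) ≫ I.proj ≫ a = z ≫ I.proj ≫ a := by rw [← Category.assoc, hc, Category.assoc]
  have hfy : (c ≫ f) ≫ I.proj ≫ d = z ≫ I.proj ≫ d := by rw [← Category.assoc, hc, Category.assoc]
  refine ⟨c, ⟨I.point_ext hc rfl (hx := hfx) (hy := hfy) (hx' := rfl) (hy' := rfl) ?_, h1⟩,
    fun c' ⟨h4, h5⟩ => h3 _ ⟨h5, fun h6 h7 => ?_⟩⟩
  · exact (hu c _ _ hfx hfy hcx hcy).trans (h2 hcx hcy)
  · subst h4
    exact (hu c' _ _ rfl rfl h6 h7).symm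

/-- The spaces of isomorphisms over the affine opens glue. -/
theorem exists_glued (I : ∀ U : T.affineOpens, IsoSpace V D (U.1.ι ≫ a) (U.1.ι ≫ d)) :
    ∃ (P : Scheme.{u}) (q : P ⟶ T) (c : ∀ U, (I U).total ⟶ P), (∀ U, IsPullback (c U) (I U).proj q U.1.ι) ∧
      ∀ U W : T.affineOpens, U ≤ W → ∃ f, f ≫ c W = c U ∧
        ∀ {R : CommRingCat.{u}} (z : Spec R ⟶ (I U).total) (x y hx hy hx' hy'),
          (I W).fam.u (z ≫ f) x y hx hy = (I U).fam.u z x y hx' hy' := by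
  have key (U W : T.affineOpens) (h : U ≤ W) := (I W).exists_map (I U) (T.homOfLE h)
    (by rw [← Category.assoc, Scheme.homOfLE_ι]) (by rw [← Category.assoc, Scheme.homOfLE_ι])
  choose f hf hu using key
  let 𝒰 := T.directedAffineCover
  let Φ : 𝒰.I₀ ⥤ Scheme.{u} := {
    obj U := (I U).total
    map {U W} h := f U W (leOfHom h)
    map_id U := (I U).hom_ext
      (by
        rw [(hf U U le_rfl).w, Category.id_comp]
        exact (congrArg ((I U).proj ≫ ·) (Scheme.homOfLE_rfl T U.1)).trans (Category.comp_id _))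
      fun {R} z x y hx hy hx' hy' => by
        rw [hu U U le_rfl z x y hx hy (by simpa using hx') (by simpa using hy')]
        exact (I U).fam.congr (Category.comp_id z).symm _ _ _ _
    map_comp {U W A} h h' := (I A).hom_ext
      (by
        rw [(hf U A _).w, Category.assoc, (hf W A _).w, ← Category.assoc, (hf U W _).w, Category.assoc,
          Scheme.homOfLE_homOfLE])
      fun {R} z x y hx hy hx' hy' => by
        have h1 : (z ≫ f U W (leOfHom h)) ≫ (I W).proj ≫ W.1.ι ≫ a = x := by
          rw [← hx', Category.assoc, Category.assoc, Category.assoc, ← Category.assoc (f W A _), (hf W A _).w]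
          simp
        have h2 : (z ≫ f U W (leOfHom h)) ≫ (I W).proj ≫ W.1.ι ≫ d = y := by
          rw [← hy', Category.assoc, Category.assoc, Category.assoc, ← Category.assoc (f W A _), (hf W A _).w]
          simp
        have h3 : z ≫ (I U).proj ≫ U.1.ι ≫ a = x := by
          rw [← h1, Category.assoc, ← Category.assoc (f U W _), (hf U W _).w]
          simp
        have h4 : z ≫ (I U).proj ≫ U.1.ι ≫ d = y := by
          rw [← h2, Category.assoc, ← Category.assoc (f U W _), (hf U W _).w]
          simp
        have e1 := hu U A (leOfHom (h ≫ h')) z x y hx hy h3 h4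
        have e2 := hu U W (leOfHom h) z x y h1 h2 h3 h4
        have h5 : ((z ≫ f U W (leOfHom h)) ≫ f W A (leOfHom h')) ≫ (I A).proj ≫ A.1.ι ≫ a = x := by
          rw [← hx']; simp only [Category.assoc]
        have h6 : ((z ≫ f U W (leOfHom h)) ≫ f W A (leOfHom h')) ≫ (I A).proj ≫ A.1.ι ≫ d = y := by
          rw [← hy']; simp only [Category.assoc]
        have e3 := hu W A (leOfHom h') (z ≫ f U W _) x y h5 h6 h1 h2
        exact e1.trans ((e3.trans e2).symm.trans ((I A).fam.congr (Category.assoc _ _ _) _ _ _ _)) }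
  let δ : 𝒰.RelativeGluingData := {
    functor := Φ
    natTrans := { app := fun U => (I U).proj, naturality := fun U W h => (hf U W (leOfHom h)).w }
    equifibered := fun {U W} h => hf U W (leOfHom h) }
  have : Small.{u} 𝒰.I₀ := inferInstanceAs (Small.{u} T.affineOpens)
  have : Quiver.IsThin 𝒰.I₀ := fun U W => inferInstanceAs (Subsingleton (U ⟶ W))
  obtain ⟨P, q, c, h1, h2⟩ := δ.exists_isPullback
  exact ⟨P, q, c, h1, fun U W h => ⟨f U W h, h2 (homOfLE h), hu U W h⟩⟩

end LinePair.IsoSpace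

end

section

theorem AlgebraicGeometry.Scheme.exists_affineOpens_cover {T : Scheme.{u}} {R : CommRingCat.{u}} (s : Spec R ⟶ T)
    (p : T.affineOpens → Prop)
    (hp : ∀ r : Spec R, ∃ U : T.Opens, s r ∈ U ∧ ∀ W : T.affineOpens, W.1 ≤ U → p W) :
    ∃ (ι : Type u) (S : ι → CommRingCat.{u}) (σ : ∀ i, R ⟶ S i), IsFlatCover (fun i => (σ i).hom) ∧
      ∀ i, ∃ U, p U ∧ ∃ l : Spec (S i) ⟶ U, l ≫ U.1.ι = Spec.map (σ i) ≫ s := by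
  obtain ⟨ι, S, σ, hσ, h⟩ := exists_zariski_cover s (fun U => ∃ W : T.affineOpens, W.1 = U ∧ p W) fun r => by
    obtain ⟨U, hU, h⟩ := hp r
    obtain ⟨_, ⟨W, hW, rfl⟩, hr, hWU⟩ := T.isBasis_affineOpens.exists_subset_of_mem_open hU U.2
    exact ⟨W, hr, ⟨W, hW⟩, rfl, h _ hWU⟩
  refine ⟨ι, S, σ, hσ, fun i => ?_⟩
  obtain ⟨_, ⟨W, rfl, hW⟩, hl⟩ := h i
  have hr : Set.range (Spec.map (σ i) ≫ s) ⊆ Set.range W.1.ι := by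
    rw [Scheme.Opens.range_ι]
    rintro _ ⟨r, rfl⟩
    exact hl (Set.mem_univ r)
  exact ⟨W, hW, IsOpenImmersion.lift W.1.ι _ hr, IsOpenImmersion.lift_fac _ _ _⟩

section
variable {T Z P : Scheme.{u}} (s : Z ⟶ T)

theorem AlgebraicGeometry.Scheme.hom_ext_affineOpens {f f' : Z ⟶ P} (h : ∀ U : T.affineOpens,
    Limits.pullback.fst s U.1.ι ≫ f = Limits.pullback.fst s U.1.ι ≫ f') : f = f' :=
  Scheme.Cover.hom_ext (T.directedAffineCover.pullback₁ s) _ _ h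

theorem AlgebraicGeometry.Scheme.exists_glue_affineOpens (f : ∀ U : T.affineOpens, Limits.pullback s U.1.ι ⟶ P)
    (h : ∀ (U W : T.affineOpens) {A : CommRingCat.{u}} (p : Spec A ⟶ Limits.pullback s U.1.ι)
      (p' : Spec A ⟶ Limits.pullback s W.1.ι),
      p ≫ Limits.pullback.fst s U.1.ι = p' ≫ Limits.pullback.fst s W.1.ι → p ≫ f U = p' ≫ f W) :
    ∃ g : Z ⟶ P, ∀ U : T.affineOpens, Limits.pullback.fst s U.1.ι ≫ g = f U := by
  let 𝒲 : Z.OpenCover := T.directedAffineCover.pullback₁ s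
  refine ⟨𝒲.glueMorphisms f fun U W => hom_ext_points fun p => ?_, 𝒲.ι_glueMorphisms _ _⟩
  have e := congrArg (p ≫ ·) (Limits.pullback.condition (f := 𝒲.f U) (g := 𝒲.f W))
  have e' := h U W (p ≫ Limits.pullback.fst (𝒲.f U) (𝒲.f W)) (p ≫ Limits.pullback.snd (𝒲.f U) (𝒲.f W))
    ((Category.assoc _ _ _).trans (e.trans (Category.assoc _ _ _).symm))
  exact (Category.assoc _ _ _).symm.trans (e'.trans (Category.assoc _ _ _))

end

namespace LinePair
variable {X Y T : Scheme.{u}} {t : TensorialConstruction}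

/-- The isomorphisms between the pullbacks of two pairs are represented by an affine morphism. -/
theorem exists_isoSpace (V : LinePair t X) (D : LinePair t Y) (a : T ⟶ X) (d : T ⟶ Y) :
    ∃ I : IsoSpace V D a d, IsAffineHom I.proj := by
  have hI (U : T.affineOpens) : ∃ I : IsoSpace V D (U.1.ι ≫ a) (U.1.ι ≫ d), IsAffine I.total :=
    have : IsAffine U.1 := U.2
    IsoSpace.nonempty_of_isAffine V D _ _
  choose I hI using hI
  obtain ⟨P, q, c, hc, hle⟩ := IsoSpace.exists_glued I
  have hmono (U) {A : CommRingCat.{u}} {z z' : Spec A ⟶ (I U).total} (h : z ≫ c U = z' ≫ c U) : z = z' := by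
    refine (hc U).hom_ext h ((cancel_mono U.1.ι).1 ?_)
    rw [Category.assoc, Category.assoc, ← (hc U).w, ← Category.assoc, h, Category.assoc]
  have hca (U) : c U ≫ q ≫ a = (I U).proj ≫ U.1.ι ≫ a := by rw [← Category.assoc, (hc U).w, Category.assoc]
  have hcd (U) : c U ≫ q ≫ d = (I U).proj ≫ U.1.ι ≫ d := by rw [← Category.assoc, (hc U).w, Category.assoc]
  obtain ⟨F, hF⟩ := IsoFamily.exists_of_cover c hca hcd (fun U => (I U).fam)
    (fun {R} U U' z z' h x y hx hy hx' hy' => IsoFamily.ext_of_cover _ _ _ _ _ _ _ _ <| by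
      have hq : (z ≫ c U) ≫ q = (z ≫ (I U).proj) ≫ U.1.ι := by
        rw [Category.assoc, (hc U).w, Category.assoc]
      have hq' : (z ≫ c U) ≫ q = (z' ≫ (I U').proj) ≫ U'.1.ι := by
        rw [h, Category.assoc, (hc U').w, Category.assoc]
      obtain ⟨ι, S, σ, hσ, h1⟩ := exists_affineOpens_cover ((z ≫ c U) ≫ q) (fun W => W ≤ U ∧ W ≤ U') fun r => by
        refine ⟨U.1 ⊓ U'.1, ⟨?_, ?_⟩, fun W hW => le_inf_iff.1 hW⟩
        · rw [hq]; exact ((z ≫ (I U).proj) r).2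
        · rw [hq']; exact ((z' ≫ (I U').proj) r).2
      refine ⟨ι, S, σ, hσ, fun i x' y' h2 h3 h4 h5 => ?_⟩
      obtain ⟨W, ⟨hW, hW'⟩, l, hl⟩ := h1 i
      obtain ⟨f, hf, hu⟩ := hle W U hW
      obtain ⟨f', hf', hu'⟩ := hle W U' hW'
      obtain ⟨k, hk, -⟩ := (hc W).exists_lift (Spec.map (σ i) ≫ z ≫ c U) l (by rw [hl, Category.assoc])
      have e1 : Spec.map (σ i) ≫ z = k ≫ f := hmono U (by rw [Category.assoc, Category.assoc, hf, hk])
      have e2 : Spec.map (σ i) ≫ z' = k ≫ f' := hmono U' (by rw [Category.assoc, Category.assoc, hf', hk, h])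
      have hkx : k ≫ (I W).proj ≫ W.1.ι ≫ a = x' := by
        rw [← hca, ← h2, ← hca, e1, Category.assoc, ← hf, Category.assoc]
      have hky : k ≫ (I W).proj ≫ W.1.ι ≫ d = y' := by
        rw [← hcd, ← h3, ← hcd, e1, Category.assoc, ← hf, Category.assoc]
      revert h2 h3 h4 h5
      rw [e1, e2]
      exact fun h2 h3 h4 h5 => (hu k _ _ h2 h3 hkx hky).trans (hu' k _ _ h4 h5 hkx hky).symm)
    (fun {R} z => by
      obtain ⟨ι, S, σ, hσ, h⟩ := exists_affineOpens_cover (z ≫ q) (fun _ => True)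
        fun r => ⟨⊤, trivial, fun _ _ => trivial⟩
      refine ⟨ι, S, σ, hσ, fun i => ?_⟩
      obtain ⟨U, -, l, hl⟩ := h i
      obtain ⟨k, hk, -⟩ := (hc U).exists_lift (Spec.map (σ i) ≫ z) l (by rw [hl, Category.assoc])
      exact ⟨U, k, hk⟩)
  have hext {R : CommRingCat.{u}} (z z' : Spec R ⟶ P) (x y hx hy hx' hy') (h : z ≫ q = z' ≫ q)
      (hu : F.u z x y hx hy = F.u z' x y hx' hy') : z = z' := by
    refine hom_ext_affineOpens (z ≫ q) fun U => hom_ext_points fun {A} p => ?_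
    have hp : (p ≫ Limits.pullback.fst (z ≫ q) U.1.ι) ≫ z ≫ q = (p ≫ Limits.pullback.snd (z ≫ q) U.1.ι) ≫ U.1.ι := by
      rw [Category.assoc, Limits.pullback.condition, Category.assoc]
    rw [← Category.assoc, ← Category.assoc]
    generalize p ≫ Limits.pullback.snd (z ≫ q) U.1.ι = l at hp
    generalize p ≫ Limits.pullback.fst (z ≫ q) U.1.ι = b at hp
    obtain ⟨α, rfl⟩ := Spec.map_surjective b
    obtain ⟨k, hk, hkl⟩ := (hc U).exists_lift (Spec.map α ≫ z) l (by rw [← hp, Category.assoc])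
    obtain ⟨k', hk', hkl'⟩ := (hc U).exists_lift (Spec.map α ≫ z') l (by rw [← hp, Category.assoc, h])
    have h1 : (Spec.map α ≫ z) ≫ q ≫ a = Spec.map α ≫ x := by rw [Category.assoc, hx]
    have h2 : (Spec.map α ≫ z) ≫ q ≫ d = Spec.map α ≫ y := by rw [Category.assoc, hy]
    have h3 : (Spec.map α ≫ z') ≫ q ≫ a = Spec.map α ≫ x := by rw [Category.assoc, hx']
    have h4 : (Spec.map α ≫ z') ≫ q ≫ d = Spec.map α ≫ y := by rw [Category.assoc, hy']
    have e1 := F.natural α hx hy h1 h2 rfl rfl rfl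
    have e2 := F.natural α hx' hy' h3 h4 rfl rfl rfl
    rw [← hu] at e2
    have e3 := LinearEquiv.toLinearMap_injective (e1.unique V.isVectorBundle e2)
    rw [← hk, ← hk']
    revert h1 h2 h3 h4
    rw [← hk, ← hk']
    intro h1 h2 h3 h4 _ _ e3
    have h5 : k ≫ (I U).proj ≫ U.1.ι ≫ a = Spec.map α ≫ x := by rw [← h1, Category.assoc, hca]
    have h6 : k ≫ (I U).proj ≫ U.1.ι ≫ d = Spec.map α ≫ y := by rw [← h2, Category.assoc, hcd]
    have h7 : k' ≫ (I U).proj ≫ U.1.ι ≫ a = Spec.map α ≫ x := by rw [← h3, Category.assoc, hca]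
    have h8 : k' ≫ (I U).proj ≫ U.1.ι ≫ d = Spec.map α ≫ y := by rw [← h4, Category.assoc, hcd]
    rw [(I U).point_ext hkl hkl' (hx := h5) (hy := h6) (hx' := h7) (hy' := h8)]
    exact ((hF U k _ _ h1 h2 h5 h6).symm.trans e3).trans (hF U k' _ _ h3 h4 h7 h8)
  refine ⟨⟨P, q, F, fun {R} s x y hx hy w hw => ?_⟩, ?_⟩
  · obtain ⟨F', hF'⟩ := exists_isoFamily w hw
    have hfx (U : T.affineOpens) : Limits.pullback.snd s U.1.ι ≫ U.1.ι ≫ a = Limits.pullback.fst s U.1.ι ≫ x := by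
      rw [← Category.assoc, ← Limits.pullback.condition, Category.assoc, hx]
    have hfy (U : T.affineOpens) : Limits.pullback.snd s U.1.ι ≫ U.1.ι ≫ d = Limits.pullback.fst s U.1.ι ≫ y := by
      rw [← Category.assoc, ← Limits.pullback.condition, Category.assoc, hy]
    choose m hm hmu using fun U => (I U).exists_lift (Limits.pullback.snd s U.1.ι) (hfx U) (hfy U)
      (F'.comp (Limits.pullback.fst s U.1.ι) rfl rfl)
    have hmq (U) : (m U ≫ c U) ≫ q = Limits.pullback.fst s U.1.ι ≫ s := by
      rw [Category.assoc, (hc U).w, ← Category.assoc, hm, Limits.pullback.condition]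
    have hmF {A : CommRingCat.{u}} (U) (p : Spec A ⟶ Limits.pullback s U.1.ι) (z : Spec A ⟶ P)
        (h : p ≫ m U ≫ c U = z) (x' y' h1 h2 h3 h4) :
        F.u z x' y' h1 h2 = F'.u (p ≫ Limits.pullback.fst s U.1.ι) x' y' h3 h4 := by
      have h : (p ≫ m U) ≫ c U = z := (Category.assoc _ _ _).trans h
      subst h
      have h5 : (p ≫ m U) ≫ (I U).proj ≫ U.1.ι ≫ a = x' := by rw [← hca, ← h1, Category.assoc _ (c U)]
      have h6 : (p ≫ m U) ≫ (I U).proj ≫ U.1.ι ≫ d = y' := by rw [← hcd, ← h2, Category.assoc _ (c U)]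
      exact (hF U _ _ _ h1 h2 h5 h6).trans (hmu U p _ _ h5 h6 ((Category.assoc _ _ _).symm.trans h3)
        ((Category.assoc _ _ _).symm.trans h4))
    have hbase {A : CommRingCat.{u}} (U) (p : Spec A ⟶ Limits.pullback s U.1.ι) :
        (p ≫ m U ≫ c U) ≫ q = (p ≫ Limits.pullback.fst s U.1.ι) ≫ s := by
      rw [Category.assoc, hmq, Category.assoc]
    obtain ⟨z, hz⟩ : ∃ z : Spec R ⟶ P, ∀ U : T.affineOpens, Limits.pullback.fst s U.1.ι ≫ z = m U ≫ c U := by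
      refine exists_glue_affineOpens s (fun U => m U ≫ c U) fun U W {A} b b' e1 => ?_
      have h1 : (b ≫ m U ≫ c U) ≫ q ≫ a = (b ≫ Limits.pullback.fst s U.1.ι) ≫ x := by
        rw [← Category.assoc, hbase, Category.assoc, hx]
      have h2 : (b ≫ m U ≫ c U) ≫ q ≫ d = (b ≫ Limits.pullback.fst s U.1.ι) ≫ y := by
        rw [← Category.assoc, hbase, Category.assoc, hy]
      have h3 : (b' ≫ m W ≫ c W) ≫ q ≫ a = (b ≫ Limits.pullback.fst s U.1.ι) ≫ x := by
        rw [← Category.assoc, hbase, Category.assoc, hx, e1]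
      have h4 : (b' ≫ m W ≫ c W) ≫ q ≫ d = (b ≫ Limits.pullback.fst s U.1.ι) ≫ y := by
        rw [← Category.assoc, hbase, Category.assoc, hy, e1]
      refine hext _ _ _ _ h1 h2 h3 h4 (by rw [hbase, hbase, e1]) ?_
      rw [hmF U b _ rfl _ _ h1 h2 rfl rfl, hmF W b' _ rfl _ _ h3 h4 (by rw [e1]) (by rw [e1])]
      exact F'.congr e1 _ _ _ _
    have hzq : z ≫ q = s := hom_ext_affineOpens s fun U => by
      rw [← Category.assoc, hz, hmq]
    have hw' : F'.u (𝟙 _) x y (Category.id_comp _) (Category.id_comp _) = w := by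
      have h1 : Spec.map (𝟙 R) ≫ x = x := by rw [Spec.map_id, Category.id_comp]
      have h2 : Spec.map (𝟙 R) ≫ y = y := by rw [Spec.map_id, Category.id_comp]
      rw [F'.congr (Spec.map_id R).symm _ _ h1 h2]
      refine LinearEquiv.ext fun n => ?_
      have := hF' (𝟙 R) h1 h2 n
      rwa [res_id, res_id] at this
    have hzu (h1 h2) : F.u z x y h1 h2 = w := by
      rw [← hw']
      refine IsoFamily.ext_of_cover _ _ _ _ _ _ _ _ ?_
      obtain ⟨ι, S, σ, hσ, h⟩ := exists_affineOpens_cover s (fun _ => True)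
        fun r => ⟨⊤, trivial, fun _ _ => trivial⟩
      refine ⟨ι, S, σ, hσ, fun i x' y' h3 h4 h5 h6 => ?_⟩
      obtain ⟨U, -, l, hl⟩ := h i
      have e1 : Limits.pullback.lift (Spec.map (σ i)) l hl.symm ≫ Limits.pullback.fst s U.1.ι = Spec.map (σ i) :=
        Limits.pullback.lift_fst _ _ _
      generalize Limits.pullback.lift (Spec.map (σ i)) l hl.symm = k at e1
      have e2 : k ≫ m U ≫ c U = Spec.map (σ i) ≫ z := by rw [← e1, Category.assoc, hz]
      have e3 : k ≫ Limits.pullback.fst s U.1.ι = Spec.map (σ i) ≫ 𝟙 _ := by rw [e1, Category.comp_id]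
      rw [hmF U k _ e2 _ _ h3 h4 (by rw [e3]; exact h5) (by rw [e3]; exact h6)]
      exact F'.congr e3 _ _ _ _
    have hzx : z ≫ q ≫ a = x := by rw [← Category.assoc, hzq, hx]
    have hzy : z ≫ q ≫ d = y := by rw [← Category.assoc, hzq, hy]
    refine ⟨z, ⟨hzq, hzu⟩, fun z' ⟨h1, h2⟩ => ?_⟩
    have hzx' : z' ≫ q ≫ a = x := by rw [← Category.assoc, h1, hx]
    have hzy' : z' ≫ q ≫ d = y := by rw [← Category.assoc, h1, hy]
    exact hext _ _ _ _ hzx' hzy' hzx hzy (h1.trans hzq.symm) ((h2 _ _).trans (hzu _ _).symm)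
  · refine ⟨fun U hU => ?_⟩
    have := hI ⟨U, hU⟩
    exact .of_isIso ((isPullback_morphismRestrict q U).isoIsPullback _ _ (hc ⟨U, hU⟩).flip).hom

end LinePair

end

section
open MonoidalCategory CartesianMonoidalCategory MonObj

theorem RingHom.Flat.codescendsAlong_faithfullyFlat : RingHom.CodescendsAlong RingHom.Flat RingHom.FaithfullyFlat := by
  refine .mk _ RingHom.Flat.respectsIso fun R S T _ _ _ _ _ h h' => ?_
  rw [RingHom.flat_algebraMap_iff] at h' ⊢
  rw [RingHom.faithfullyFlat_algebraMap_iff] at h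
  exact Module.Flat.of_flat_tensorProduct R T S

instance : MorphismProperty.DescendsAlong @Flat.{u}
    (@Surjective.{u} ⊓ @Flat.{u} ⊓ @LocallyOfFinitePresentation.{u}) := by
  have : MorphismProperty.DescendsAlong @Flat.{u} (@Surjective.{u} ⊓ @Flat.{u} ⊓ @QuasiCompact.{u}) :=
    HasRingHomProperty.descendsAlong_flat RingHom.Flat.codescendsAlong_faithfullyFlat
  have : IsZariskiLocalAtTarget @Flat.{u} :=
    HasRingHomProperty.instIsZariskiLocalAtTarget (P := @Flat) (Q := RingHom.Flat)
  exact instDescendsAlongSchemeMinMorphismPropertySurjectiveFlatLocallyOfFinitePresentationOfQuasiCompactOfIsZariskiLocalAtTarget _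

variable {X : Scheme.{u}} {t : TensorialConstruction} {R S : CommRingCat.{u}}

/-- A `G`-invariant morphism with an action of `G` that is simply transitive on points, with a section over a
flat cover, is a torsor. -/
theorem GTorsor.exists_of_points {G : Over X} [GrpObj G] [Flat G.hom] {Y P : Over X} (q : P ⟶ Y)
    (hq : IsAffineHom q.left)
    (sm : ∀ {R : CommRingCat.{u}} (x : Spec R ⟶ X), (Over.mk x ⟶ P) → (Over.mk x ⟶ G) → (Over.mk x ⟶ P))
    (hsm : ∀ {R S : CommRingCat.{u}} (σ : R ⟶ S) {x : Spec R ⟶ X} {x' : Spec S ⟶ X} (hx : Spec.map σ ≫ x = x')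
      (p : Over.mk x ⟶ P) (g : Over.mk x ⟶ G), sm x' ((Over.homMk (Spec.map σ) hx : Over.mk x' ⟶ Over.mk x) ≫ p)
        ((Over.homMk (Spec.map σ) hx : Over.mk x' ⟶ Over.mk x) ≫ g) =
        (Over.homMk (Spec.map σ) hx : Over.mk x' ⟶ Over.mk x) ≫ sm x p g)
    (sm_one : ∀ {R : CommRingCat.{u}} (x : Spec R ⟶ X) (p : Over.mk x ⟶ P), sm x p 1 = p)
    (sm_mul : ∀ {R : CommRingCat.{u}} (x : Spec R ⟶ X) (p : Over.mk x ⟶ P) (g h : Over.mk x ⟶ G),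
      sm x p (g * h) = sm x (sm x p g) h)
    (sm_q : ∀ {R : CommRingCat.{u}} (x : Spec R ⟶ X) (p : Over.mk x ⟶ P) (g : Over.mk x ⟶ G), sm x p g ≫ q = p ≫ q)
    (htrans : ∀ {R : CommRingCat.{u}} (x : Spec R ⟶ X) (p p' : Over.mk x ⟶ P), p ≫ q = p' ≫ q → ∃! g, sm x p g = p')
    {Z : Over X} (m : Z ⟶ P) (h1 : Flat (m ≫ q).left) (h2 : Surjective (m ≫ q).left)
    (h3 : LocallyOfFinitePresentation (m ≫ q).left) :
    ∃ (act : P ⊗ G ⟶ P) (act_one : P ◁ η[G] ≫ act = (ρ_ P).hom)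
      (act_mul : (α_ P G G).hom ≫ P ◁ μ[G] ≫ act = act ▷ G ≫ act) (isPullback : IsPullback (fst P G) act q q)
      (flat : Flat q.left) (surjective : Surjective q.left),
      ∀ {R : CommRingCat.{u}} (x : Spec R ⟶ X) (p : Over.mk x ⟶ P) (g : Over.mk x ⟶ G),
        GTorsor.smul ⟨Y, P, q, act, act_one, act_mul, isPullback, flat, surjective, hq⟩ p g = sm x p g := by
  obtain ⟨act, hact⟩ := Over.exists_hom_of_points (T := P ⊗ G) (T' := P)
    (fun x c => sm x (c ≫ fst P G) (c ≫ snd P G)) fun σ x x' hx c => by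
      rw [Category.assoc, Category.assoc, hsm]
  have hact' {R : CommRingCat.{u}} (x : Spec R ⟶ X) (p : Over.mk x ⟶ P) (g : Over.mk x ⟶ G) :
      lift p g ≫ act = sm x p g := by
    rw [hact, lift_fst, lift_snd]
  have hw : fst P G ≫ q = act ≫ q := Over.hom_ext_points fun x c => by
    rw [← Category.assoc, ← Category.assoc, hact, sm_q]
  have hl : IsPullback (fst P G).left act.left q.left q.left := by
    refine isPullback_of_points (congrArg CommaMorphism.left hw) fun {R} z z' h => ?_
    have hz : z' ≫ P.hom = z ≫ P.hom := by
      rw [← Over.w q, ← Category.assoc, ← Category.assoc]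
      exact congrArg (· ≫ Y.hom) h.symm
    let p : Over.mk (z ≫ P.hom) ⟶ P := Over.homMk z rfl
    let p' : Over.mk (z ≫ P.hom) ⟶ P := Over.homMk z' hz
    obtain ⟨g, hg, hg'⟩ := htrans _ p p' (Over.OverMorphism.ext h)
    refine ⟨(lift p g).left, ⟨?_, ?_⟩, fun c ⟨h4, h5⟩ => ?_⟩
    · exact congrArg CommaMorphism.left (lift_fst p g)
    · exact congrArg CommaMorphism.left ((hact' _ p g).trans hg)
    · have hc : c ≫ (P ⊗ G).hom = z ≫ P.hom := by
        rw [← h4, Category.assoc]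
        exact congrArg (c ≫ ·) (Over.w (fst P G)).symm
      let k : Over.mk (z ≫ P.hom) ⟶ P ⊗ G := Over.homMk c hc
      have h6 : k ≫ fst P G = p := Over.OverMorphism.ext h4
      have h7 : k ≫ act = p' := Over.OverMorphism.ext h5
      rw [hact, h6] at h7
      have h8 : k = lift p g := CartesianMonoidalCategory.hom_ext _ _ (h6.trans (lift_fst _ _).symm)
        ((hg' _ h7).trans (lift_snd _ _).symm)
      exact congrArg CommaMorphism.left h8
  have hpb : IsPullback (fst P G) act q q := IsPullback.of_map (Over.forget X) hw hl
  have hmG : IsPullback (m ▷ G) (fst Z G) (fst P G) m := by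
    refine ⟨⟨whiskerRight_fst _ _⟩, ⟨Limits.PullbackCone.IsLimit.mk _ (fun s => lift s.snd (s.fst ≫ snd P G))
      (fun s => ?_) (fun s => lift_fst _ _) fun s k hk hk' => ?_⟩⟩
    · refine CartesianMonoidalCategory.hom_ext _ _ ?_ ?_
      · rw [Category.assoc, whiskerRight_fst, lift_fst_assoc]
        exact s.condition.symm
      · rw [Category.assoc, whiskerRight_snd, lift_snd]
    · refine CartesianMonoidalCategory.hom_ext _ _ ?_ ?_
      · rw [lift_fst]; exact hk'
      · rw [lift_snd, ← hk, Category.assoc, whiskerRight_snd]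
  have hpb' := (hmG.paste_horiz hpb.flip).map (Over.forget X)
  have hfl : Flat q.left := by
    have h4 : Flat (fst Z G).left := by
      rw [Over.fst_left]
      infer_instance
    exact MorphismProperty.of_isPullback_of_descendsAlong (P := @Flat)
      (Q := @Surjective ⊓ @Flat ⊓ @LocallyOfFinitePresentation) hpb'.flip ⟨⟨h2, h1⟩, h3⟩ h4
  have hsu : Surjective q.left := by
    have : Surjective (m.left ≫ q.left) := h2
    exact .of_comp m.left q.left
  refine ⟨act, ?_, ?_, hpb, hfl, hsu, fun x p g => hact' x p g⟩
  · refine Over.hom_ext_points fun x c => ?_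
    obtain ⟨p, k, rfl⟩ : ∃ p k, c = lift p k := ⟨_, _, (lift_comp_fst_snd c).symm⟩
    rw [lift_whiskerLeft_assoc, lift_rightUnitor_hom, hact', toUnit_unique k (toUnit _)]
    exact sm_one x p
  · refine Over.hom_ext_points fun x c => ?_
    obtain ⟨c, h, rfl⟩ : ∃ c' k, c = lift c' k := ⟨_, _, (lift_comp_fst_snd c).symm⟩
    obtain ⟨p, g, rfl⟩ : ∃ p k, c = lift p k := ⟨_, _, (lift_comp_fst_snd c).symm⟩
    rw [lift_lift_associator_hom_assoc, lift_whiskerLeft_assoc, lift_whiskerRight_assoc, hact', hact', hact']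
    exact sm_mul x p g h

end

section
open MonoidalCategory CartesianMonoidalCategory MonObj

variable {X : Scheme.{u}} {t : TensorialConstruction}

/-- Every twist is the twist associated with a torsor. -/
theorem LinePair.IsTwist.exists_triv {G : Over X} [GrpObj G] [Flat G.hom] {V : LinePair t X} (e : V.AutIso G)
    {Y : Over X} {D : LinePair t Y.left} (hD : V.IsTwist Y D) : ∃ (P : GTorsor G)
      (D' : LinePair t P.base.left) (hD' : V.IsTwist P.base D'), Nonempty (P.Triv e D') ∧
      (⟨P.base, D', hD'⟩ : Twist V) = ⟨Y, D, hD⟩ := by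
  obtain ⟨I, hI⟩ := V.exists_isoSpace D Y.hom (𝟙 Y.left)
  let P : Over X := Over.mk (I.proj ≫ Y.hom)
  let q : P ⟶ Y := Over.homMk I.proj
  let u {R : CommRingCat.{u}} (x : Spec R ⟶ X) (p : Over.mk x ⟶ P) (y : Spec R ⟶ Y.left) (h : p.left ≫ I.proj = y) :
      (sectionsAt x).obj V.bundle ≃ₗ[R] (sectionsAt y).obj D.bundle :=
    I.fam.u p.left x y (Over.w p) (by rw [Category.comp_id]; exact h)
  have hu {R S : CommRingCat.{u}} (σ : R ⟶ S) {x : Spec R ⟶ X} {x' : Spec S ⟶ X} (hx : Spec.map σ ≫ x = x')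
      (p : Over.mk x ⟶ P) (p' : Over.mk x' ⟶ P) (hp : Spec.map σ ≫ p.left = p'.left) {y : Spec R ⟶ Y.left}
      {y' : Spec S ⟶ Y.left} (h : p.left ≫ I.proj = y) (h' : p'.left ≫ I.proj = y') (hy : Spec.map σ ≫ y = y') :
      Extends σ hx hy (u x p y h).toLinearMap (u x' p' y' h').toLinearMap :=
    I.fam.natural σ _ _ _ _ hp hx hy
  have hline {R : CommRingCat.{u}} (x : Spec R ⟶ X) (p : Over.mk x ⟶ P) (y : Spec R ⟶ Y.left)
      (h : p.left ≫ I.proj = y) : SpansLine (u x p y h).toLinearMap (V.line R x) (D.line R y) :=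
    I.fam.spansLine _ _ _ _ _
  have hinj {R : CommRingCat.{u}} (x : Spec R ⟶ X) (p p' : Over.mk x ⟶ P) (y : Spec R ⟶ Y.left)
      (h : p.left ≫ I.proj = y) (h' : p'.left ≫ I.proj = y) (H : u x p y h = u x p' y h') : p = p' :=
    Over.OverMorphism.ext (I.point_ext h h' H)
  have hsurj {R : CommRingCat.{u}} (x : Spec R ⟶ X) (y : Spec R ⟶ Y.left) (hy : y ≫ Y.hom = x)
      (w : (sectionsAt x).obj V.bundle ≃ₗ[R] (sectionsAt y).obj D.bundle)
      (hw : SpansLine w.toLinearMap (V.line R x) (D.line R y)) :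
      ∃ (p : Over.mk x ⟶ P) (h : p.left ≫ I.proj = y), u x p y h = w := by
    obtain ⟨z, ⟨h1, h2⟩, -⟩ := I.universal y hy (Category.comp_id y) w hw
    exact ⟨Over.homMk z (by rw [← hy, ← h1, Category.assoc]; rfl), h1, h2 _ _⟩
  have hpy {R : CommRingCat.{u}} (x : Spec R ⟶ X) (p : Over.mk x ⟶ P) : (p.left ≫ I.proj) ≫ Y.hom = x :=
    (Category.assoc _ _ _).trans (Over.w p)
  have key {R : CommRingCat.{u}} (x : Spec R ⟶ X) (p : Over.mk x ⟶ P) (g : Over.mk x ⟶ G) :=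
    hsurj x (p.left ≫ I.proj) (hpy x p) ((e.rho x g).trans (u x p _ rfl))
      ((e.rho_spansLine x g).linearEquiv_trans (hline x p _ rfl))
  choose sm hsq hsu using @key
  have hsu' {R : CommRingCat.{u}} (x : Spec R ⟶ X) (p : Over.mk x ⟶ P) (g : Over.mk x ⟶ G) (y h h') (m) :
      u x (sm x p g) y h' m = u x p y h (e.rho x g m) := by
    subst h
    exact LinearEquiv.congr_fun (hsu x p g) m
  have hq : IsAffineHom q.left := hI
  obtain ⟨Y', g, hg, hg', hg'', φ, hφ⟩ := hD
  have hφ' : SubFamily.Preserves φ.symm (V.line.pullback (g ≫ Y.hom)) (D.line.pullback g) := hφ.symm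
  obtain ⟨m, hm, -⟩ := I.exists_lift g rfl (Category.comp_id g) (IsoFamily.ofIso φ.symm hφ')
  let s₀ : Over.mk (g ≫ Y.hom) ⟶ P := Over.homMk m (by rw [← hm, Category.assoc]; rfl)
  have hs₀ : (s₀ ≫ q).left = g := hm
  obtain ⟨act, h1, h2, h3, h4, h5, hact⟩ := GTorsor.exists_of_points q hq sm
    (fun {R S} σ {x x'} hx p g => by
      have hl : Spec.map σ ≫ p.left ≫ I.proj = (Spec.map σ ≫ p.left) ≫ I.proj := (Category.assoc _ _ _).symm
      have hs : (Spec.map σ ≫ (sm x p g).left) ≫ I.proj = (Spec.map σ ≫ p.left) ≫ I.proj := by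
        rw [Category.assoc, hsq, hl]
      refine hinj x' _ _ _ (hsq x' _ _) hs (LinearEquiv.toLinearMap_injective ?_)
      refine Extends.unique V.isVectorBundle (σ := σ) (hx := hx) (hy := hl) (φ := (u x (sm x p g) _ (hsq x p g)).toLinearMap) ?_
        (hu σ hx (sm x p g) _ rfl (hsq x p g) hs hl)
      intro n
      let f : Over.mk x' ⟶ Over.mk x := Over.homMk (Spec.map σ) hx
      have e1 := hsu' x' (f ≫ p) (f ≫ g) _ rfl (hsq x' _ _) (res _ σ hx n)
      have e2 := hu σ hx p (f ≫ p) rfl rfl rfl hl (e.rho x g n)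
      have e3 := hsu' x p g _ rfl (hsq x p g) n
      exact e1.trans ((congrArg _ (e.rho_res σ hx g n)).trans (e2.trans (congrArg _ e3.symm))))
    (fun x p => hinj x _ _ _ (hsq x p 1) rfl (LinearEquiv.ext fun n =>
      (hsu' x p 1 _ rfl (hsq x p 1) n).trans (congrArg _ (e.rho_one x n))))
    (fun x p g h => hinj x _ _ _ (hsq x p _) ((hsq x _ h).trans (hsq x p g)) (LinearEquiv.ext fun n => by
      have e1 := hsu' x p (g * h) _ rfl (hsq x p _) n
      have e2 := hsu' x (sm x p g) h _ (hsq x p g) ((hsq x _ h).trans (hsq x p g)) n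
      have e3 := hsu' x p g _ rfl (hsq x p g) (e.rho x h n)
      exact e1.trans ((congrArg _ (e.rho_mul x g h n)).trans (e3.symm.trans e2.symm))))
    (fun x p g => Over.OverMorphism.ext (hsq x p g))
    (fun x p p' hpp => by
      have hpp : p'.left ≫ I.proj = p.left ≫ I.proj := (congrArg CommaMorphism.left hpp).symm
      obtain ⟨g, hg⟩ := e.exists_rho x ((u x p' _ hpp).trans (u x p _ rfl).symm)
        ((hline x p' _ hpp).linearEquiv_trans (hline x p _ rfl).symm)
      refine ⟨g, hinj x _ _ _ (hsq x p g) hpp (LinearEquiv.ext fun n => ?_), fun g' hg' => ?_⟩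
      · refine (hsu' x p g _ rfl (hsq x p g) n).trans ?_
        rw [hg]
        exact LinearEquiv.apply_symm_apply _ _
      · subst hg'
        refine e.rho_injective x (LinearEquiv.ext fun n => ?_)
        rw [hg]
        exact (LinearEquiv.eq_symm_apply _).2 (hsu' x p g' _ rfl (hsq x p g') n).symm)
    s₀ (by rw [hs₀]; exact hg) (by rw [hs₀]; exact hg') (by rw [hs₀]; exact hg'')
  refine ⟨⟨Y, P, q, act, h1, h2, h3, h4, h5, hq⟩, D, ⟨Y', g, hg, hg', hg'', φ, hφ⟩, ⟨⟨u, ?_, ?_, hline⟩⟩, rfl⟩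
  · exact fun {R S} σ {x x'} hx p p' hp {y y'} h h' hy n => hu σ hx p p' hp h h' hy n
  · intro R x p g y h h' n
    revert h'
    rw [hact x p g]
    exact fun h' => hsu' x p g y h h' n

end

end

theorem theorem1p2 {X : Scheme.{u}} (hX : IsDedekindScheme X)
    (G : Over X) [GrpObj G] [Flat G.hom] [IsAffineHom G.hom] [LocallyOfFiniteType G.hom]
    (t : TensorialConstruction) (V : LinePair t X) (e : V.AutIso G) :
    ∃ F : BasedFunctor (BasedCategory.ofFunctor (GTorsor.forget G))
        (BasedCategory.ofFunctor (Twist.forget V)),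
      ∀ Y : Over X, (F.onFiber Y).IsEquivalence :=
  have := hX.isLocallyNoetherian
  exists_basedFunctor e (fun P => P.locallyOfFinitePresentation) fun _ _ hD => hD.exists_triv e
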